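/- **Setting.** Let $K$ be a commutative ring and let $R$ be a commutative Frobenius $K$-algebra of rank $2$, with coproduct $\Delta$ and counit $\varepsilon$. This means that $R\cong K[\alpha]/(P)$ with $P=\alpha^2-s\alpha+p$; fix the generator $\alpha$. Let $u\mapsto\bar u$ be the $K$-linear involution of $R$ that fixes $1$ and sends $\alpha$ to $s-\alpha$. Let $\omega\in R^*$ be the twisting element, i.e. the unique invertible element with $\Delta(u)=u\otimes\omega\alpha-u\bar\alpha\otimes\omega$ for all $u\in R$, $\varepsilon(\omega)=0$ and $\varepsilon(\omega\alpha)=1$. Let $\Phi$ be the TQFT of $R$: $\Phi$ of a closed curve is the tensor product over $K$ of one copy of $R$ for each component, an oriented surgery that merges two components acts by the product, and one that splits a component acts by $\Delta$. Let $D$ be an (unoriented) link diagram in the plane with set of crossings $X$. For $s:X\to\{\pm1\}$ let $D_s$ be the resolved diagram: at a crossing, the value $+1$ connects each end of the upper strand with the preceding end in the counterclockwise order of the four ends, and $-1$ connects it with the following one. Let $X_s=s^{-1}(-1)$, and let $\Lambda^-(X_s)$ be the maximal exterior power of $\mathbf Z^{X_s}$, in degree $-|X_s|$. Set $$kh(D)=\bigoplus_s\Lambda^-(X_s)\otimes\Phi(D_s),\qquad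 d=\sum_{x\in X}x\otimes\gamma_x:\ u\otimes v\mapsto\sum_{x}(x\wedge u)\otimes\gamma_x(v),$$ where $\gamma_x$ is the surgery map at the crossing $x$. For a point $p$ of $D$ that is not a crossing, $T_p(a)$ is the multiplication by $a\in R$ in the tensor factor of the circle through $p$. Tensor factors $R$ below always belong to the circle created inside the modified disk, and $\gamma$ denotes surgery maps. **Maps.** To each elementary move $f:D\to D'$ associate a $K$-linear map $f^0:kh(D)\to kh(D')$ as follows. * *Surgery of index $0$* ($D'$ is $D$ plus a circle without crossings, $kh(D')=kh(D)\otimes R$) and its inverse $g$, *of index $2$*: $f^0(u)=u\otimes1$, $g^0(u\otimes a)=\varepsilon(a)u$. *Surgery of index $1$* (along a path that meets $D$ only at its ends, which are not crossings): $f^0$ is the surgery map on each resolved diagram. * *Type I*, creating a crossing $x$ of sign $e$, with inverse $g$; put $U=kh(D)$ and let $p$ be a point of the modified branch. If $e=+$, then $kh(D')=U\otimes R\oplus x\otimes U$ and $f^0(u)=u\otimes\omega\alpha-T_p(\alpha)u\otimes\omega$, $g^0(u\otimes a)=\varepsilon(a)u$, $g^0(x\otimes u)=0$. If $e=-$, then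 $kh(D')=U\oplus x\otimes U\otimes R$ and $f^0(u)=x\otimes u\otimes1$, $g^0(u)=0$, $g^0(x\otimes u\otimes a)=T_p(\bar a)u$. * *Type II*, creating crossings $x,y$, with inverse $g$. Let $U=kh(D)$ and $V=kh(D'')$, where $D''$ is obtained from $D$ by surgery along a path joining the two modified branches, and let $p$ be any point of one of these branches. When the branches are vertical and the upper one comes from the left, $x$ is the top crossing and $y$ the bottom one. Then $kh(D')=V\oplus x\otimes U\oplus y\otimes V\otimes R\oplus x\wedge y\otimes V$ and $f^0(u)=x\otimes u+y\otimes\gamma(T_p(\omega^{-1})u)\otimes\omega$, $g^0(x\otimes u)=u$, $g^0(y\otimes v\otimes a)=-\varepsilon(a)\gamma(v)$, $g^0(v)=g^0(x\wedge y\otimes v)=0$. * *Type III.* Let $x$ be the crossing of the top and bottom branches, and let $x,y,z$ be the vertices of the modified triangle in counterclockwise order, in $D$ and likewise in $D'$. The edges of the triangle on the top, middle and bottom branch are numbered $1,2,3$; the move is of type III$_+$ if this numbering is counterclockwise and III$_-$ otherwise. So the top branch passes through $x,y$ for III$_+$ and through $x,z$ for III$_-$. Let $p_1,\dots,p_6$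 be the six ends of the branches on the boundary of the disk, in counterclockwise order, such that in $D$ the ends $p_6,p_1$ are next to $x$, $p_2,p_3$ next to $y$ and $p_4,p_5$ next to $z$. Let $\gamma_i$ be the surgery along the boundary arc from $p_i$ to $p_{i-1}$ (indices mod $6$), and $T_i=T_{p_i}$. Let $V,U,A,B,C$ be the complexes of the diagrams obtained by joining, inside the disk, the ends $(16)(23)(45)$; $(12)(34)(56)$; $(16)(25)(34)$; $(56)(23)(14)$; $(12)(36)(45)$ respectively. In the formulas $u\in U$, $v\in V$, $a\in A$, $b\in B$, $c\in C$, $r\in R$. For III$_+$: $f^0(v)=0$; $f^0(x\otimes v\otimes r)=\varepsilon(r\omega)\bigl(x\otimes T_1(\omega^{-1})\gamma_2\gamma_6(v)\otimes1+y\otimes T_1(\omega^{-1})\gamma_2(v)+z\otimes T_1(\omega^{-1})\gamma_6(v)\bigr)$; $f^0(y\otimes c)=-x\otimes\gamma_4(c)\otimes1-y\otimes c$; $f^0(z\otimes b)=-z\otimes b$; $f^0(x\wedge y\otimes v)=y\wedge z\otimes v$; $f^0(x\wedge z\otimes v)=-y\wedge z\otimes v$; $f^0(y\wedge z\otimes u)=-x\wedge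 z\otimes u$; $f^0(x\wedge y\wedge z\otimes a)=x\wedge y\wedge z\otimes a$. For III$_-$: $f^0(a)=a$; $f^0(x\otimes u)=(y+z)\otimes u$; $f^0(y\otimes v)=x\otimes v$; $f^0(z\otimes v)=0$; $f^0(y\wedge z\otimes v\otimes r)=\varepsilon(r)\bigl(x\wedge z\otimes\gamma_2(v)+y\wedge z\otimes T_4(\omega^{-1})\gamma_4\gamma_2(v)\otimes\omega\bigr)$; $f^0(x\wedge y\otimes b)=-x\wedge y\otimes b+y\wedge z\otimes T_4(\omega^{-1})\gamma_4(b)\otimes\omega$; $f^0(x\wedge z\otimes c)=-x\wedge z\otimes c-y\wedge z\otimes T_4(\omega^{-1})\gamma_4(c)\otimes\omega$; $f^0(x\wedge y\wedge z\otimes v)=0$. The inverse of a type III$_\pm$ move is of type III$_\pm$, with $p_i$ replaced by $p_{i+3}$. **Proposition.** Each $kh(D)$ is a complex: $d$ has degree $-1$ and $d^2=0$. For every elementary move $f:D\to D'$ (Reidemeister moves and surgery moves of index $0,1,2$), the map $f^0:kh(D)\to kh(D')$ is a morphism of complexes of degree $n$, i.e. it is homogeneous of degree $n$ and $d\,f^0=(-1)^nf^0d$.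 Here $n=-1$ if $f$ is a type I move creating a negative crossing or a type II move creating two crossings, $n=1$ if $f$ is the inverse of such a move, and $n=0$ in all other cases. If $f$ is a Reidemeister move with inverse $g$, then $f^0$ is a homotopy equivalence with homotopy inverse $g^0$: both $g^0f^0-\mathrm{id}$ and $f^0g^0-\mathrm{id}$ have the form $dh+hd$ with $h$ of degree $1$. -/

import Mathlib

open scoped TensorProduct

noncomputable section

namespace Khovanov

/-! ### Frobenius algebras of rank two -/

section FrobeniusAlgebra

/-- A commutative `K`-algebra with a coalgebra structure is a (commutative) Frobenius algebra when
the coproduct is a map of bimodules. -/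
class IsFrobenius (K R : Type*) [CommRing K] [CommRing R] [Algebra K R] [Coalgebra K R] :
    Prop where
  comul_mul_left : ∀ a b : R,
    Coalgebra.comul (R := K) (a * b) = (a ⊗ₜ[K] 1) * Coalgebra.comul (R := K) b
  comul_mul_right : ∀ a b : R,
    Coalgebra.comul (R := K) (a * b) = Coalgebra.comul (R := K) a * (1 ⊗ₜ[K] b)

variable (K : Type*) {R : Type*} [CommRing K] [CommRing R] [Algebra K R]

/-- `R` is a `K`-algebra of rank two with `K`-generator `α`: it is `K[α]/(P)` for a monic
polynomial `P` of degree two. -/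
def IsGenerator (α : R) : Prop :=
  ∃ P : Polynomial K, P.Monic ∧ P.natDegree = 2 ∧
    ∃ φ : AdjoinRoot P ≃ₐ[K] R, φ (AdjoinRoot.root P) = α

/-- The involution `u ↦ ū = Tr(u) - u` of an algebra of rank two: it is the identity on `K`, and it
sends the generator `α` with equation `α² = s α - p` to `s - α` (see `IsGenerator.exists_conj`). -/
def conj : R →ₗ[K] R :=
  Algebra.linearMap K R ∘ₗ Algebra.trace K R - LinearMap.id

variable {K}

theorem IsGenerator.exists_conj {α : R} (hα : IsGenerator K α) :
    ∃ (s p : K) (φ₀ φ₁ : R →ₗ[K] K),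
      α * α = s • α - p • (1 : R) ∧ conj K α = s • (1 : R) - α ∧
      (∀ r, r = φ₀ r • (1 : R) + φ₁ r • α) ∧
      φ₀ 1 = 1 ∧ φ₁ 1 = 0 ∧ φ₀ α = 0 ∧ φ₁ α = 1 := by
  obtain ⟨P, hP, hdeg, φ, rfl⟩ := hα
  set pb := (AdjoinRoot.powerBasis' hP).map φ with hpb
  have hdim : pb.dim = 2 := by simpa [hpb] using hdeg
  have hgen : pb.gen = φ (AdjoinRoot.root P) := by simp [hpb]
  set α := φ (AdjoinRoot.root P)
  set b := pb.basis.reindex (finCongr hdim) with hb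
  have h0 : b 0 = 1 := by simp [hb]
  have h1 : b 1 = α := by simp [hb, hgen]
  have hrepr : ∀ r, r = b.coord 0 r • (1 : R) + b.coord 1 r • α := by
    intro r
    have := b.sum_repr r
    rw [Fin.sum_univ_two, h0, h1] at this
    simpa using this.symm
  have e00 : b.coord 0 1 = 1 := by rw [← h0]; simp
  have e10 : b.coord 1 1 = 0 := by rw [← h0]; simp
  have e01 : b.coord 0 α = 0 := by rw [← h1]; simp
  have e11 : b.coord 1 α = 1 := by rw [← h1]; simp
  refine ⟨b.coord 1 (α * α), - b.coord 0 (α * α), b.coord 0, b.coord 1, ?_, ?_, hrepr,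
    e00, e10, e01, e11⟩
  · conv_lhs => rw [hrepr (α * α)]
    rw [neg_smul]; ring
  · have htr : Algebra.trace K R α = b.coord 1 (α * α) := by
      rw [Algebra.trace_eq_matrix_trace b, Matrix.trace, Fin.sum_univ_two]
      simp only [Matrix.diag_apply, Algebra.leftMulMatrix_eq_repr_mul, h0, h1, mul_one]
      simpa using e01
    simp [conj, htr, Algebra.algebraMap_eq_smul_one]

/-- `ω` is the twisting element of the Frobenius algebra `R` with respect to the generator `α`. -/
structure IsTwisting [Coalgebra K R] (α : R) (ω : Rˣ) : Prop where
  comul_eq : ∀ u : R, Coalgebra.comul (R := K) u =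
    u ⊗ₜ[K] ((ω : R) * α) - (u * conj K α) ⊗ₜ[K] (ω : R)
  counit_omega : Coalgebra.counit (R := K) (ω : R) = 0
  counit_omega_mul : Coalgebra.counit (R := K) ((ω : R) * α) = 1

theorem existsUnique_isTwisting [Coalgebra K R] [IsFrobenius K R] {α : R}
    (hα : IsGenerator K α) : ∃! ω : Rˣ, IsTwisting (K := K) α ω := by
  obtain ⟨s, p, φ₀, φ₁, hmul, hconj, hφ, h00, h10, h01, h11⟩ := hα.exists_conj
  have hc : α + conj K α = s • (1 : R) := by rw [hconj]; ring
  have hn : α * conj K α = p • (1 : R) := by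
    rw [hconj, mul_sub, hmul]; simp
  set β := conj K α
  let F (φ : R →ₗ[K] K) : R ⊗[K] R →ₗ[K] R :=
    TensorProduct.lift ((LinearMap.lsmul K R).flip.compl₂ φ)
  have hF : ∀ φ a b, F φ (a ⊗ₜ b) = φ b • a := by intros; simp [F]
  have key : ∀ t : R ⊗[K] R, t = F φ₀ t ⊗ₜ 1 + F φ₁ t ⊗ₜ α := by
    intro t
    induction t with
    | zero => simp
    | add x y hx hy =>
      conv_lhs => rw [hx, hy]
      simp only [map_add, TensorProduct.add_tmul]; abel
    | tmul a b =>
      conv_lhs => rw [hφ b]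
      simp [hF, TensorProduct.tmul_add, TensorProduct.tmul_smul, TensorProduct.smul_tmul']
  set t : R ⊗[K] R := Coalgebra.comul (R := K) (1 : R) with ht
  set g := F φ₁ t
  have hcomm : (α ⊗ₜ[K] (1 : R)) * t = ((1 : R) ⊗ₜ[K] α) * t := by
    rw [ht, ← IsFrobenius.comul_mul_left, mul_one, mul_comm _ (Coalgebra.comul (R := K) (1 : R)),
      ← IsFrobenius.comul_mul_right, one_mul]
  have hFl : ∀ φ (t : R ⊗[K] R), F φ ((α ⊗ₜ[K] (1 : R)) * t) = α * F φ t := by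
    intro φ t
    induction t with
    | zero => simp
    | add x y hx hy => simp only [mul_add, map_add, hx, hy]
    | tmul a b => simp [hF]
  have hFr : ∀ t : R ⊗[K] R, F φ₁ (((1 : R) ⊗ₜ[K] α) * t) = F φ₀ t + s • F φ₁ t := by
    intro t
    induction t with
    | zero => simp
    | add x y hx hy => simp only [mul_add, map_add, hx, hy, smul_add]; abel
    | tmul a b =>
      have : φ₁ (α * b) = φ₀ b + s * φ₁ b := by
        conv_lhs => rw [hφ b]
        rw [mul_add, mul_smul_comm, mul_smul_comm, mul_one, hmul]
        simp [h10, h11, mul_comm]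
      simp [hF, this, add_smul, mul_smul]
  have hf : F φ₀ t = -(β * g) := by
    have h := congrArg (F φ₁) hcomm
    rw [hFl, hFr] at h
    have : α * g - s • g = F φ₀ t := by rw [h]; abel
    rw [← this, hconj]
    simp [sub_mul]
  have ht' : t = g ⊗ₜ[K] α - (β * g) ⊗ₜ[K] (1 : R) := by
    conv_lhs => rw [key t, hf]
    rw [TensorProduct.neg_tmul]; abel
  set ε : R →ₗ[K] K := Coalgebra.counit (R := K)
  have hr : ε α • g - ε 1 • (β * g) = 1 := by
    have h := Coalgebra.lTensor_counit_comul (R := K) (1 : R)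
    rw [← ht, ht'] at h
    have h' := congrArg (TensorProduct.rid K R) h
    simpa using h'
  have hl : ε g • α - ε (β * g) • (1 : R) = 1 := by
    have h := Coalgebra.rTensor_counit_comul (R := K) (1 : R)
    rw [← ht, ht'] at h
    have h' := congrArg (TensorProduct.lid K R) h
    simpa using h'
  have hg0 : ε g = 0 := by
    have := congrArg φ₁ hl
    simpa [h10, h11] using this
  have hg1 : ε (β * g) = -1 := by
    have := congrArg φ₀ hl
    simp [h00, h01] at this
    rw [← this, neg_neg]
  have hu : g * (ε α • 1 - ε 1 • β) = 1 := by
    rw [mul_sub, mul_smul_comm, mul_smul_comm, mul_one, mul_comm g β, hr]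
  let ω : Rˣ := ⟨g, ε α • 1 - ε 1 • β, hu, by rw [mul_comm]; exact hu⟩
  -- the two expressions of the coproduct of the unit agree
  have hsym : t = (1 : R) ⊗ₜ[K] (g * α) - β ⊗ₜ[K] g := by
    have hz : ((g ⊗ₜ[K] (1 : R)) - (1 : R) ⊗ₜ[K] g) *
        ((1 : R) ⊗ₜ[K] α - β ⊗ₜ[K] (1 : R)) = 0 := by
      have h1 : ((α ⊗ₜ[K] (1 : R)) - (1 : R) ⊗ₜ[K] α) *
          ((1 : R) ⊗ₜ[K] α - β ⊗ₜ[K] (1 : R)) = 0 := by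
        have e1 : β = s • (1 : R) - α := hconj
        simp only [sub_mul, mul_sub, Algebra.TensorProduct.tmul_mul_tmul, one_mul, mul_one, hn,
          hmul]
        rw [e1]
        simp only [TensorProduct.tmul_sub, TensorProduct.sub_tmul, TensorProduct.tmul_smul,
          TensorProduct.smul_tmul']
        abel
      have h2 : (g ⊗ₜ[K] (1 : R)) - (1 : R) ⊗ₜ[K] g =
          φ₁ g • ((α ⊗ₜ[K] (1 : R)) - (1 : R) ⊗ₜ[K] α) := by
        conv_lhs => rw [hφ g]
        simp only [TensorProduct.add_tmul, TensorProduct.tmul_add, TensorProduct.tmul_smul,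
          TensorProduct.smul_tmul', smul_sub]
        abel
      rw [h2, smul_mul_assoc, h1, smul_zero]
    simp only [sub_mul, mul_sub, Algebra.TensorProduct.tmul_mul_tmul, one_mul, mul_one] at hz
    rw [ht', mul_comm β g, ← sub_eq_zero]
    rw [← hz]; abel
  refine ⟨ω, ⟨?_, hg0, ?_⟩, ?_⟩
  · intro u
    have := IsFrobenius.comul_mul_left (K := K) u (1 : R)
    rw [mul_one] at this
    rw [this, ← ht, hsym]
    simp [mul_sub, ω, β]
  · have : g * α = s • g - β * g := by
      have : α = s • (1 : R) - β := by rw [← hc]; ring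
      rw [this, mul_comm]; simp [sub_mul]
    change ε (g * α) = 1
    rw [this, map_sub, map_smul, hg0, hg1]; simp
  · intro ω' h'
    ext
    have h1 := h'.comul_eq 1
    rw [← ht, hsym] at h1
    let G : R ⊗[K] R →ₗ[K] R := TensorProduct.lift ((LinearMap.lsmul K R).comp φ₁)
    have hG : ∀ a b, G (a ⊗ₜ b) = φ₁ a • b := by intros; simp [G]
    have hβ : φ₁ β = -1 := by simp [hconj, h10, h11]
    have h2 := congrArg G h1
    simp only [map_sub, hG, one_mul, h10, zero_smul, zero_sub] at h2
    change _ = g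
    have h3 : φ₁ β = -1 := hβ
    rw [h3] at h2
    simpa using h2.symm

/-- The twisting element of a Frobenius algebra of rank two with generator `α`. -/
def twist [Coalgebra K R] [IsFrobenius K R] {α : R} (hα : IsGenerator K α) : Rˣ :=
  (existsUnique_isTwisting hα).choose

end FrobeniusAlgebra

/-! ### Link diagrams

A link diagram is cut into arcs at its crossings and at finitely many marked regular points.
Crossings and arcs are labelled by natural numbers, so that two diagrams which differ only inside a
disk can share their labels outside of the disk. The plane minus the diagram is shaded like a
checkerboard, and each arc is oriented as a part of the boundary of the shaded region. -/

/-- The combinatorial data of a shaded diagram.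

* `slot x` lists the four arcs around the crossing `x`, in counterclockwise order, in such a way
  that the upper strand at `x` consists of the slots `0` and `2`;
* `overIn x` tells whether the two arcs of the upper strand at `x` point towards `x`
  (and those of the lower strand away from `x`) or conversely;
* `(e, f) ∈ joins` means that there is a marked regular point at which `e` ends and `f` starts. -/
structure DiagramCode where
  crossings : Finset ℕ
  arcs : Finset ℕ
  slot : ℕ → Fin 4 → ℕ
  overIn : ℕ → Bool
  joins : Finset (ℕ × ℕ)

namespace DiagramCode

/-- The arc end in slot `i` at the crossing `x` points towards `x`. -/
def Inward (D : DiagramCode) (x : ℕ) (i : Fin 4) : Prop :=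
  (D.overIn x = true ↔ i = 0 ∨ i = 2)

instance (D : DiagramCode) (x : ℕ) (i : Fin 4) : Decidable (D.Inward x i) := by
  unfold Inward; infer_instance

/-- The arcs `e` and `f` are glued at a marked point, or at a crossing after resolution. A state is
given by the set `S` of crossings where it takes the value `-1`. The resolution of value `+1`
connects each end of the upper strand with the preceding end in the counterclockwise order, and the
resolution of value `-1` connects it with the following end. -/
def Glued (D : DiagramCode) (S : Finset ℕ) (e f : ℕ) : Prop :=
  (e, f) ∈ D.joins ∨ ∃ x ∈ D.crossings,
    if x ∈ S then
      (e = D.slot x 0 ∧ f = D.slot x 1) ∨ (e = D.slot x 2 ∧ f = D.slot x 3)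
    else
      (e = D.slot x 0 ∧ f = D.slot x 3) ∨ (e = D.slot x 2 ∧ f = D.slot x 1)

/-- Two arcs are equivalent when they lie in the same circle of the resolved diagram `D_S`. -/
def circleSetoid (D : DiagramCode) (S : Finset ℕ) : Setoid D.arcs :=
  Relation.EqvGen.setoid fun e f => D.Glued S e f

/-- The components of the resolved diagram `D_S`. -/
abbrev Circle (D : DiagramCode) (S : Finset ℕ) : Type := Quotient (D.circleSetoid S)

instance (D : DiagramCode) (S : Finset ℕ) : Fintype (D.Circle S) := Fintype.ofFinite _

instance (D : DiagramCode) (S : Finset ℕ) : DecidableEq (D.Circle S) := Classical.decEq _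

/-- The arcs `e` and `f` lie in the same circle of `D_S`. -/
def SameCircle (D : DiagramCode) (S : Finset ℕ) (e f : ℕ) : Prop :=
  ∃ (he : e ∈ D.arcs) (hf : f ∈ D.arcs), (D.circleSetoid S).r ⟨e, he⟩ ⟨f, hf⟩

/-- The connected components of the plane graph underlying the diagram. -/
abbrev Component (D : DiagramCode) : Type :=
  Quotient (Relation.EqvGen.setoid fun e f : D.arcs =>
    ((e : ℕ), (f : ℕ)) ∈ D.joins ∨ ∃ x ∈ D.crossings, ∃ i j, e = D.slot x i ∧ f = D.slot x j)

/-- The number of faces. Following the arcs and turning left (resp. right) at every crossing, one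
runs along the faces on the left (resp. right) of the arcs. An arc arriving at `x` in the upper
strand turns left in the resolution of value `+1`, and in the lower strand in the other one. -/
def faceCount (D : DiagramCode) : ℕ :=
  Nat.card (D.Circle {x ∈ D.crossings | D.overIn x = false}) +
    Nat.card (D.Circle {x ∈ D.crossings | D.overIn x = true})

end DiagramCode

/-- A link diagram: every arc has exactly one head and one tail, and the underlying graph is plane:
`V - E + F = 2 C` (each component being drawn on its own sphere). -/
structure LinkDiagram extends DiagramCode where
  slot_mem : ∀ x ∈ crossings, ∀ i, slot x i ∈ arcs
  join_mem : ∀ j ∈ joins, j.1 ∈ arcs ∧ j.2 ∈ arcs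
  card_heads : ∀ e ∈ arcs,
    Finset.card {c ∈ crossings ×ˢ (Finset.univ : Finset (Fin 4)) |
        slot c.1 c.2 = e ∧ toDiagramCode.Inward c.1 c.2} +
      Finset.card {j ∈ joins | j.1 = e} = 1
  card_tails : ∀ e ∈ arcs,
    Finset.card {c ∈ crossings ×ˢ (Finset.univ : Finset (Fin 4)) |
        slot c.1 c.2 = e ∧ ¬ toDiagramCode.Inward c.1 c.2} +
      Finset.card {j ∈ joins | j.2 = e} = 1
  euler : (crossings.card + joins.card) + toDiagramCode.faceCount =
    arcs.card + 2 * Nat.card toDiagramCode.Component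

/-! ### The functor `Φ` on resolved diagrams -/

section Phi

variable (K R : Type*) [CommRing K] [CommRing R] [Algebra K R]

/-- The module `Φ(D_S)`: one tensor factor `R` for each component of `D_S`. -/
abbrev Phi (D : LinkDiagram) (S : Finset ℕ) : Type _ := ⨂[K] _ : D.Circle S, R

variable {K R}

/-- The element of `Φ(D_S)` with factor `a` at the circle through the arc `e`, and factor `1` at
the other circles. -/
def pt (D : LinkDiagram) (S : Finset ℕ) (e : ℕ) : R →ₗ[K] Phi K R D S :=
  if h : e ∈ D.arcs then
    (PiTensorProduct.singleAlgHom (R := K) (A := fun _ : D.Circle S => R)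
      (Quotient.mk _ ⟨e, h⟩)).toLinearMap
  else 0

/-- The operator `T_e(a)` on `Φ(D_S)`: multiplication by `a` in the factor of the circle through
the arc `e`. -/
def T (D : LinkDiagram) (S : Finset ℕ) (e : ℕ) (a : R) : Phi K R D S →ₗ[K] Phi K R D S :=
  LinearMap.mulLeft K (pt D S e a)

open Classical in
/-- Let `O` be a set of arcs which are common to `D` and `D'`. The map `Φ(D_S) → Φ(D'_S')` sends
`⊗ r_c` to the product over the circles `c` of `D_S` of the following elements: if `c` contains an
arc of `O`, the element with factor `r_c` at the circle of `D'_S'` through this arc; if not, the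
element `g(r_c)`. -/
def slide (D : LinkDiagram) (S : Finset ℕ) (D' : LinkDiagram) (S' : Finset ℕ) (O : Finset ℕ)
    (g : R →ₗ[K] Phi K R D' S') : Phi K R D S →ₗ[K] Phi K R D' S' :=
  PiTensorProduct.lift <|
    (MultilinearMap.mkPiAlgebra K (D.Circle S) (Phi K R D' S')).compLinearMap fun c =>
      if h : ∃ e : D.arcs, (e : ℕ) ∈ O ∧ Quotient.mk _ e = c then pt D' S' (h.choose : ℕ) else g

variable [Coalgebra K R]

/-- The image in `Φ(D_S)` of the coproduct `Δ(1)`, with its two factors at the circles through the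
arcs `e` and `f`. -/
def coproductAt (D : LinkDiagram) (S : Finset ℕ) (e f : ℕ) : Phi K R D S :=
  LinearMap.mul' K (Phi K R D S)
    (TensorProduct.map (pt D S e) (pt D S f) (Coalgebra.comul (R := K) (1 : R)))

open Classical in
/-- The map induced by a surgery which transforms `D_S` into `D'_S'`. The arcs `e` and `f` are
the two sides of one of the two strands cut by the surgery. If they are in the same circle after
the surgery, two circles have been merged and the factors are multiplied. If not, the
circle through `e` and `f` has been split into the circle through `e` and the circle through `f`,
and the map is the coproduct `u ↦ (u ⊗ 1) Δ(1)`.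
(For `O` and `g`, see `slide`.) -/
def surgery (D : LinkDiagram) (S : Finset ℕ) (D' : LinkDiagram) (S' : Finset ℕ) (O : Finset ℕ)
    (g : R →ₗ[K] Phi K R D' S') (e f : ℕ) : Phi K R D S →ₗ[K] Phi K R D' S' :=
  LinearMap.mulLeft K (if D'.SameCircle S' e f then 1 else coproductAt D' S' e f) ∘ₗ
    slide D S D' S' O g

/-- The map `a ↦ ε(a r) · 1`. -/
def cap (D : LinkDiagram) (S : Finset ℕ) (r : R) : R →ₗ[K] Phi K R D S :=
  Algebra.linearMap K (Phi K R D S) ∘ₗ Coalgebra.counit (R := K) (A := R) ∘ₗ LinearMap.mulRight K r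

end Phi

/-! ### The Khovanov complex

The module `Λ(S)` has rank one; it is generated by `e_S = x₁ ∧ ⋯ ∧ x_p`, where
`S = {x₁ < ⋯ < x_p}`. So `Λ⁻(S) ⊗ Φ(D_S)` is `Φ(D_S)`, where `v` stands for `e_S ⊗ v`. -/

/-- The sign such that `l₁ ∧ ⋯ ∧ l_q ∧ e_S = wedgeSign l S • e_{l ∪ S}`. -/
def wedgeSign : List ℕ → Finset ℕ → ℤ
  | [], _ => 1
  | x :: l, S => (-1) ^ Finset.card {y ∈ l.toFinset ∪ S | y < x} * wedgeSign l S

/-- The states of `D`: sets of crossings. -/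
abbrev State (D : LinkDiagram) : Type := {S : Finset ℕ // S ⊆ D.crossings}

section Complex

variable (K R : Type*) [CommRing K] [CommRing R] [Algebra K R]

/-- The module underlying the Khovanov complex `kh(D)`. -/
abbrev Kh (D : LinkDiagram) : Type _ := DirectSum (State D) fun S => Phi K R D S.1

/-- The part of degree `n` of `kh(D)`. -/
def Kh.grade (D : LinkDiagram) (n : ℤ) : Submodule K (Kh K R D) :=
  ⨆ (S : State D) (_ : -(S.1.card : ℤ) = n),
    LinearMap.range (DirectSum.lof K (State D) (fun S => Phi K R D S.1) S)

variable {K R}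

/-- The map `v ↦ l₁ ∧ ⋯ ∧ l_q ∧ e_S ⊗ v` (zero if some label is not a crossing). -/
def wedge (D : LinkDiagram) (l : List ℕ) (S : Finset ℕ) :
    Phi K R D (l.toFinset ∪ S) →ₗ[K] Kh K R D :=
  if h : l.toFinset ∪ S ⊆ D.crossings then
    wedgeSign l S • DirectSum.lof K (State D) (fun S => Phi K R D S.1) ⟨l.toFinset ∪ S, h⟩
  else 0

/-- The linear map on `kh(D)` which sends `l ∧ e_S ⊗ v` to `φ (l ∪ S) S v`, for every state
`l ∪ S`, where `S` is disjoint from the set of the elements of `L` and `l` is a sublist of `L`. -/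
def onStates {D D' : LinkDiagram} (L : List ℕ)
    (φ : (S₁ S : Finset ℕ) → Phi K R D S₁ →ₗ[K] Kh K R D') : Kh K R D →ₗ[K] Kh K R D' :=
  DirectSum.toModule K (State D) (Kh K R D') fun S₁ =>
    wedgeSign (L.filter (· ∈ S₁.1)) (S₁.1 \ L.toFinset) • φ S₁.1 (S₁.1 \ L.toFinset)

variable [Coalgebra K R]

/-- The differential `d = ∑ x ⊗ γ_x` of `kh(D)`, the sum being over the crossings `x`. -/
def Kh.d (D : LinkDiagram) : Kh K R D →ₗ[K] Kh K R D :=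
  onStates [] fun S _ => ∑ x ∈ D.crossings \ S,
    wedge D [x] S ∘ₗ surgery D S D _ D.arcs 0 (D.slot x 0) (D.slot x 3)

/-- The linear map `f` has degree `n`. -/
def HasDegree {D D' : LinkDiagram} (f : Kh K R D →ₗ[K] Kh K R D') (n : ℤ) : Prop :=
  ∀ i, (Kh.grade K R D i).map f ≤ Kh.grade K R D' (i + n)

/-- Morphisms of complexes of degree `n`: `d f = (-1)^n f d`. -/
def IsMorphism {D D' : LinkDiagram} (f : Kh K R D →ₗ[K] Kh K R D') (n : ℤ) : Prop :=
  HasDegree f n ∧ Kh.d D' ∘ₗ f = (n.negOnePow : ℤ) • (f ∘ₗ Kh.d D)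

/-- Homotopy between morphisms of degree `0`. -/
def Homotopic {D D' : LinkDiagram} (f g : Kh K R D →ₗ[K] Kh K R D') : Prop :=
  ∃ h : Kh K R D →ₗ[K] Kh K R D', HasDegree h 1 ∧ f - g = Kh.d D' ∘ₗ h + h ∘ₗ Kh.d D

end Complex

/-! ### Elementary moves -/

/-- The two diagrams coincide at the crossings in `X`. -/
def AgreeAt (D D' : LinkDiagram) (X : Finset ℕ) : Prop :=
  ∀ x ∈ X, D'.slot x = D.slot x ∧ D'.overIn x = D.overIn x

/-- A marked point between the arcs `e` and `f`, oriented from `e` to `f` if `c` is true and from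
`f` to `e` if not. -/
def arrow (c : Bool) (e f : ℕ) : ℕ × ℕ := if c then (e, f) else (f, e)

/-- A surgery move of index `0`: `D'` is `D` with a new circle `l` without crossings. -/
structure BirthMove (D D' : LinkDiagram) where
  l : ℕ
  l_notMem : l ∉ D.arcs
  crossings_eq : D'.crossings = D.crossings
  arcs_eq : D'.arcs = insert l D.arcs
  joins_eq : D'.joins = insert (l, l) D.joins
  agree : AgreeAt D D' D.crossings

/-- A surgery move of index `1`. The surgery path joins a marked point between `a` and `b` with a
marked point between `c` and `d`. As the interior of the path is in a region of the
complement of `D`, the surgery is compatible with the orientation as a boundary. -/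
structure SaddleMove (D D' : LinkDiagram) where
  a : ℕ
  b : ℕ
  c : ℕ
  d : ℕ
  mem_ab : (a, b) ∈ D.joins
  mem_cd : (c, d) ∈ D.joins
  ne : (a, b) ≠ (c, d)
  crossings_eq : D'.crossings = D.crossings
  arcs_eq : D'.arcs = D.arcs
  joins_eq : D'.joins = insert (a, d) (insert (c, b) ((D.joins.erase (a, b)).erase (c, d)))
  agree : AgreeAt D D' D.crossings

/-- A Reidemeister move of type I creating a crossing `x` whose sign is positive or negative: the
marked point between `a` and `b` is replaced by a curl with loop `l`. -/
structure ReidemeisterI (positive : Bool) (D D' : LinkDiagram) where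
  c : Bool
  a : ℕ
  b : ℕ
  l : ℕ
  x : ℕ
  mem_ab : arrow c a b ∈ D.joins
  l_notMem : l ∉ D.arcs
  x_notMem : x ∉ D.crossings
  crossings_eq : D'.crossings = insert x D.crossings
  arcs_eq : D'.arcs = insert l D.arcs
  joins_eq : D'.joins = D.joins.erase (arrow c a b)
  slot_x : D'.slot x = if positive then ![a, l, l, b] else ![l, l, b, a]
  overIn_x : D'.overIn x = if positive then c else !c
  agree : AgreeAt D D' D.crossings

/-- A Reidemeister move of type II creating two crossings `x` and `y`. Draw the two branches
vertically, the branch which will be the upper one being on the left. The left branch goes from `a`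
(bottom) to `b` (top), with a marked point between them, and the right branch from `r` (top) to `t`
(bottom). They will cross at `y` (bottom) and `x` (top), between which the lower branch is the arc
`m` and the upper branch is the arc `n`. Moreover `base` is an arc in one of the two branches
of `D`. -/
structure ReidemeisterII (D D' : LinkDiagram) where
  c : Bool
  a : ℕ
  b : ℕ
  r : ℕ
  t : ℕ
  m : ℕ
  n : ℕ
  x : ℕ
  y : ℕ
  base : ℕ
  mem_ab : arrow c a b ∈ D.joins
  mem_rt : arrow c r t ∈ D.joins
  ne : arrow c a b ≠ arrow c r t
  base_mem : base ∈ ({a, b, r, t} : Finset ℕ)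
  m_notMem : m ∉ D.arcs
  n_notMem : n ∉ D.arcs
  m_ne_n : m ≠ n
  x_notMem : x ∉ D.crossings
  y_notMem : y ∉ D.crossings
  x_ne_y : x ≠ y
  crossings_eq : D'.crossings = insert x (insert y D.crossings)
  arcs_eq : D'.arcs = insert m (insert n D.arcs)
  joins_eq : D'.joins = (D.joins.erase (arrow c a b)).erase (arrow c r t)
  slot_x : D'.slot x = ![n, r, b, m]
  slot_y : D'.slot y = ![a, t, n, m]
  overIn_x : D'.overIn x = !c
  overIn_y : D'.overIn y = c
  agree : AgreeAt D D' D.crossings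

/-- The slots of the three crossings `x, y, z` of a triangle as in a Reidemeister move of type III.
Here `x` is the crossing of the top branch and the bottom branch, `x, y, z` are in counterclockwise
order, and `k = xy`, `m = xz`, `n = yz` are the edges of the triangle. The six ends of the branches
are the arcs `p 1, …, p 6 = p 0`, in counterclockwise order, where `p 1` and `p 6` end at
`x`, `p 2` and `p 3` at `y`, `p 4` and `p 5` at `z`. In the positive case, the top branch
is `xy`, the middle one `yz` and the bottom one `xz`; in the negative case the top branch is `xz`,
the middle one `yz` and the bottom one `xy`. -/
def triangleSlots (positive : Bool) (p : ZMod 6 → ℕ) (k m n : ℕ) : Fin 3 → Fin 4 → ℕ :=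
  if positive then ![![p 6, p 1, k, m], ![k, p 2, p 3, n], ![p 5, m, n, p 4]]
  else ![![p 1, k, m, p 6], ![p 2, p 3, n, k], ![m, n, p 4, p 5]]

/-- A Reidemeister move of type III: one of the branches is moved across the crossing of the other
two. In `D'` the triangle has the same description as in `D` after rotation by three ends. -/
structure ReidemeisterIII (positive : Bool) (D D' : LinkDiagram) where
  p : ZMod 6 → ℕ
  k : ℕ
  m : ℕ
  n : ℕ
  x : ℕ
  y : ℕ
  z : ℕ
  x_mem : x ∈ D.crossings
  y_mem : y ∈ D.crossings
  z_mem : z ∈ D.crossings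
  x_ne_y : x ≠ y
  x_ne_z : x ≠ z
  y_ne_z : y ≠ z
  crossings_eq : D'.crossings = D.crossings
  arcs_eq : D'.arcs = D.arcs
  joins_eq : D'.joins = D.joins
  slots : ![D.slot x, D.slot y, D.slot z] = triangleSlots positive p k m n
  slots' : ![D'.slot x, D'.slot y, D'.slot z] = triangleSlots positive (fun i => p (i + 3)) k m n
  overIn_eq : D'.overIn x = !D.overIn x ∧ D'.overIn y = !D.overIn y ∧ D'.overIn z = !D.overIn z
  agree : AgreeAt D D' (D.crossings \ {x, y, z})

/-- The inverse of a Reidemeister move of type III. -/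
def ReidemeisterIII.symm {positive : Bool} {D D' : LinkDiagram}
    (M : ReidemeisterIII positive D D') : ReidemeisterIII positive D' D where
  p := fun i => M.p (i + 3)
  k := M.k
  m := M.m
  n := M.n
  x := M.x
  y := M.y
  z := M.z
  x_mem := M.crossings_eq ▸ M.x_mem
  y_mem := M.crossings_eq ▸ M.y_mem
  z_mem := M.crossings_eq ▸ M.z_mem
  x_ne_y := M.x_ne_y
  x_ne_z := M.x_ne_z
  y_ne_z := M.y_ne_z
  crossings_eq := M.crossings_eq.symm
  arcs_eq := M.arcs_eq.symm
  joins_eq := M.joins_eq.symm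
  slots := M.slots'
  slots' := by
    have h : (fun i : ZMod 6 => M.p (i + 3 + 3)) = M.p := by
      funext i
      rw [add_assoc, show (3 + 3 : ZMod 6) = 0 by decide, add_zero]
    rw [h]; exact M.slots
  overIn_eq := by simp [M.overIn_eq]
  agree := fun w hw => by
    have h := M.agree w (M.crossings_eq ▸ hw)
    exact ⟨h.1.symm, h.2.symm⟩

/-- Reidemeister moves. -/
inductive ReidemeisterMove : LinkDiagram → LinkDiagram → Type
  | createI {D D' : LinkDiagram} (positive : Bool) (M : ReidemeisterI positive D D') :
      ReidemeisterMove D D'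
  | removeI {D D' : LinkDiagram} (positive : Bool) (M : ReidemeisterI positive D D') :
      ReidemeisterMove D' D
  | createII {D D' : LinkDiagram} (M : ReidemeisterII D D') : ReidemeisterMove D D'
  | removeII {D D' : LinkDiagram} (M : ReidemeisterII D D') : ReidemeisterMove D' D
  | moveIII {D D' : LinkDiagram} (positive : Bool) (M : ReidemeisterIII positive D D') :
      ReidemeisterMove D D'

/-- The inverse of a Reidemeister move. -/
def ReidemeisterMove.inverse {D D' : LinkDiagram} : ReidemeisterMove D D' → ReidemeisterMove D' D
  | createI positive M => removeI positive M
  | removeI positive M => createI positive M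
  | createII M => removeII M
  | removeII M => createII M
  | moveIII positive M => moveIII positive M.symm

/-- Elementary moves: Reidemeister moves and surgery moves of index `0`, `1` and `2`. -/
inductive ElementaryMove : LinkDiagram → LinkDiagram → Type
  | reidemeister {D D' : LinkDiagram} (f : ReidemeisterMove D D') : ElementaryMove D D'
  | surgery0 {D D' : LinkDiagram} (M : BirthMove D D') : ElementaryMove D D'
  | surgery1 {D D' : LinkDiagram} (M : SaddleMove D D') : ElementaryMove D D'
  | surgery2 {D D' : LinkDiagram} (M : BirthMove D D') : ElementaryMove D' D

/-! ### The morphisms `f⁰` -/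

section Maps

variable {K R : Type*} [CommRing K] [CommRing R] [Algebra K R] [Coalgebra K R]

/-- `f⁰(u) = u ⊗ 1` -/
def BirthMove.map {D D' : LinkDiagram} (_M : BirthMove D D') : Kh K R D →ₗ[K] Kh K R D' :=
  onStates [] fun S _ => wedge D' [] S ∘ₗ slide D S D' _ D.arcs 0

/-- `g⁰(u ⊗ a) = u ε(a)` -/
def BirthMove.inverseMap {D D' : LinkDiagram} (_M : BirthMove D D') :
    Kh K R D' →ₗ[K] Kh K R D :=
  onStates [] fun S _ => wedge D [] S ∘ₗ slide D' S D _ D.arcs (cap D _ 1)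

/-- The map induced by the surgery on each resolved diagram. -/
def SaddleMove.map {D D' : LinkDiagram} (M : SaddleMove D D') : Kh K R D →ₗ[K] Kh K R D' :=
  onStates [] fun S _ => wedge D' [] S ∘ₗ surgery D S D' _ D.arcs 0 M.a M.b

/-- Positive case: `f⁰(u) = u ⊗ ωα - T_p(α)u ⊗ ω`. Negative case: `f⁰(u) = x ⊗ u ⊗ 1`. -/
def ReidemeisterI.map (α : R) (ω : Rˣ) {positive : Bool} {D D' : LinkDiagram}
    (M : ReidemeisterI positive D D') : Kh K R D →ₗ[K] Kh K R D' :=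
  onStates [] fun S _ =>
    match positive with
    | true => wedge D' [] S ∘ₗ
        (T D' _ M.l (ω * α) ∘ₗ slide D S D' _ D.arcs 0 -
          T D' _ M.l (ω : R) ∘ₗ slide D S D' _ D.arcs 0 ∘ₗ T D S M.a α)
    | false => wedge D' [M.x] S ∘ₗ slide D S D' _ D.arcs 0

/-- Positive case: `g⁰(u ⊗ a) = u ε(a)` and `g⁰(x ⊗ u) = 0`.
Negative case: `g⁰(u) = 0` and `g⁰(x ⊗ u ⊗ a) = T_p(ā)u`. -/
def ReidemeisterI.inverseMap {positive : Bool} {D D' : LinkDiagram}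
    (M : ReidemeisterI positive D D') : Kh K R D' →ₗ[K] Kh K R D :=
  onStates [M.x] fun S₁ S =>
    match positive, decide (M.x ∈ S₁) with
    | true, false => wedge D [] S ∘ₗ slide D' S₁ D _ D.arcs (cap D _ 1)
    | true, true => 0
    | false, false => 0
    | false, true => wedge D [] S ∘ₗ slide D' S₁ D _ D.arcs (pt D _ M.a ∘ₗ conj K)

/-- `f⁰(u) = x ⊗ u + y ⊗ γ(T_p(ω⁻¹)u) ⊗ ω` -/
def ReidemeisterII.map (ω : Rˣ) {D D' : LinkDiagram} (M : ReidemeisterII D D') :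
    Kh K R D →ₗ[K] Kh K R D' :=
  onStates [] fun S _ =>
    wedge D' [M.x] S ∘ₗ slide D S D' _ D.arcs 0 +
    wedge D' [M.y] S ∘ₗ T D' _ M.m (ω : R) ∘ₗ surgery D S D' _ D.arcs 0 M.a M.b ∘ₗ
      T D S M.base (↑ω⁻¹ : R)

/-- `g⁰(x ⊗ u) = u`, `g⁰(y ⊗ v ⊗ a) = -ε(a)γ(v)`, `g⁰(v) = g⁰(x ∧ y ⊗ v) = 0` -/
def ReidemeisterII.inverseMap {D D' : LinkDiagram} (M : ReidemeisterII D D') :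
    Kh K R D' →ₗ[K] Kh K R D :=
  onStates [M.x, M.y] fun S₁ S =>
    match decide (M.x ∈ S₁), decide (M.y ∈ S₁) with
    | false, false => 0
    | true, false => wedge D [] S ∘ₗ slide D' S₁ D _ D.arcs 0
    | false, true => -(wedge D [] S ∘ₗ surgery D' S₁ D _ D.arcs (cap D _ 1) M.a M.t)
    | true, true => 0

/-- The arcs outside of the triangle. -/
def ReidemeisterIII.outer {positive : Bool} {D D' : LinkDiagram}
    (M : ReidemeisterIII positive D D') : Finset ℕ :=
  D.arcs \ {M.k, M.m, M.n}

/-- The morphism induced by a positive move of type III. Let `V` and `U` be the complexes of the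
diagrams obtained by joining the ends `(1 6)(2 3)(4 5)` and `(1 2)(3 4)(5 6)` respectively,
and `A`, `B`, `C` those obtained from `(1 6)(2 5)(3 4)`, `(5 6)(2 3)(1 4)`, `(1 2)(3 6)(4 5)`.
Then `f⁰` is:

* `v ↦ 0`
* `x ⊗ v ⊗ r ↦
    ε(rω)(x ⊗ T₁(ω⁻¹)γ₂γ₆(v) ⊗ 1 + y ⊗ T₁(ω⁻¹)γ₂(v) + z ⊗ T₁(ω⁻¹)γ₆(v))`
* `y ⊗ c ↦ -x ⊗ γ₄(c) ⊗ 1 - y ⊗ c`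
* `z ⊗ b ↦ -z ⊗ b`
* `x ∧ y ⊗ v ↦ y ∧ z ⊗ v`
* `x ∧ z ⊗ v ↦ -y ∧ z ⊗ v`
* `y ∧ z ⊗ u ↦ -x ∧ z ⊗ u`
* `x ∧ y ∧ z ⊗ a ↦ x ∧ y ∧ z ⊗ a`

where `γ_i` is the surgery along an arc from the end `i` to the end `i - 1`. -/
def ReidemeisterIII.mapPos (ω : Rˣ) {D D' : LinkDiagram} (M : ReidemeisterIII true D D') :
    Kh K R D →ₗ[K] Kh K R D' :=
  onStates [M.x, M.y, M.z] fun S₁ S =>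
    match decide (M.x ∈ S₁), decide (M.y ∈ S₁), decide (M.z ∈ S₁) with
    | false, false, false => 0
    | true, false, false =>
        wedge D' [M.x] S ∘ₗ T D' _ (M.p 1) (↑ω⁻¹ : R) ∘ₗ
          surgery D' ([M.z].toFinset ∪ S) D' _ M.outer 0 (M.p 2) (M.p 3) ∘ₗ
          surgery D S₁ D' ([M.z].toFinset ∪ S) M.outer (cap D' _ (ω : R)) (M.p 6) (M.p 1) +
        wedge D' [M.y] S ∘ₗ T D' _ (M.p 1) (↑ω⁻¹ : R) ∘ₗ
          surgery D S₁ D' _ M.outer (cap D' _ (ω : R)) (M.p 2) (M.p 3) +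
        wedge D' [M.z] S ∘ₗ T D' _ (M.p 1) (↑ω⁻¹ : R) ∘ₗ
          surgery D S₁ D' _ M.outer (cap D' _ (ω : R)) (M.p 6) (M.p 1)
    | false, true, false =>
        -(wedge D' [M.x] S ∘ₗ surgery D S₁ D' _ M.outer 0 (M.p 4) (M.p 5)) -
        wedge D' [M.y] S ∘ₗ slide D S₁ D' _ M.outer 0
    | false, false, true => -(wedge D' [M.z] S ∘ₗ slide D S₁ D' _ M.outer 0)
    | true, true, false => wedge D' [M.y, M.z] S ∘ₗ slide D S₁ D' _ M.outer 0
    | true, false, true => -(wedge D' [M.y, M.z] S ∘ₗ slide D S₁ D' _ M.outer 0)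
    | false, true, true => -(wedge D' [M.x, M.z] S ∘ₗ slide D S₁ D' _ M.outer 0)
    | true, true, true => wedge D' [M.x, M.y, M.z] S ∘ₗ slide D S₁ D' _ M.outer 0

/-- The morphism induced by a negative move of type III. With the same notation, `f⁰` is:

* `a ↦ a`
* `x ⊗ u ↦ (y + z) ⊗ u`
* `y ⊗ v ↦ x ⊗ v`
* `z ⊗ v ↦ 0`
* `y ∧ z ⊗ v ⊗ r ↦ ε(r)(x ∧ z ⊗ γ₂(v) + y ∧ z ⊗ T₄(ω⁻¹)γ₄γ₂(v) ⊗ ω)`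
* `x ∧ y ⊗ b ↦ -x ∧ y ⊗ b + y ∧ z ⊗ T₄(ω⁻¹)γ₄(b) ⊗ ω`
* `x ∧ z ⊗ c ↦ -x ∧ z ⊗ c - y ∧ z ⊗ T₄(ω⁻¹)γ₄(c) ⊗ ω`
* `x ∧ y ∧ z ⊗ v ↦ 0` -/
def ReidemeisterIII.mapNeg (ω : Rˣ) {D D' : LinkDiagram} (M : ReidemeisterIII false D D') :
    Kh K R D →ₗ[K] Kh K R D' :=
  onStates [M.x, M.y, M.z] fun S₁ S =>
    match decide (M.x ∈ S₁), decide (M.y ∈ S₁), decide (M.z ∈ S₁) with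
    | false, false, false => wedge D' [] S ∘ₗ slide D S₁ D' _ M.outer 0
    | true, false, false =>
        wedge D' [M.y] S ∘ₗ slide D S₁ D' _ M.outer 0 +
        wedge D' [M.z] S ∘ₗ slide D S₁ D' _ M.outer 0
    | false, true, false => wedge D' [M.x] S ∘ₗ slide D S₁ D' _ M.outer 0
    | false, false, true => 0
    | false, true, true =>
        wedge D' [M.x, M.z] S ∘ₗ surgery D S₁ D' _ M.outer (cap D' _ 1) (M.p 2) (M.p 3) +
        wedge D' [M.y, M.z] S ∘ₗ T D' _ M.k (ω : R) ∘ₗ T D' _ (M.p 4) (↑ω⁻¹ : R) ∘ₗ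
          surgery D' ([M.x, M.z].toFinset ∪ S) D' _ M.outer 0 (M.p 4) (M.p 5) ∘ₗ
          surgery D S₁ D' ([M.x, M.z].toFinset ∪ S) M.outer (cap D' _ 1) (M.p 2) (M.p 3)
    | true, true, false =>
        -(wedge D' [M.x, M.y] S ∘ₗ slide D S₁ D' _ M.outer 0) +
        wedge D' [M.y, M.z] S ∘ₗ T D' _ M.k (ω : R) ∘ₗ T D' _ (M.p 4) (↑ω⁻¹ : R) ∘ₗ
          surgery D S₁ D' _ M.outer 0 (M.p 4) (M.p 1)
    | true, false, true =>
        -(wedge D' [M.x, M.z] S ∘ₗ slide D S₁ D' _ M.outer 0) -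
        wedge D' [M.y, M.z] S ∘ₗ T D' _ M.k (ω : R) ∘ₗ T D' _ (M.p 4) (↑ω⁻¹ : R) ∘ₗ
          surgery D S₁ D' _ M.outer 0 (M.p 4) (M.p 5)
    | true, true, true => 0

/-- The morphism `f⁰` of a Reidemeister move. -/
def ReidemeisterMove.map (α : R) (ω : Rˣ) {D D' : LinkDiagram} :
    ReidemeisterMove D D' → (Kh K R D →ₗ[K] Kh K R D')
  | createI _ M => M.map α ω
  | removeI _ M => M.inverseMap
  | createII M => M.map ω
  | removeII M => M.inverseMap
  | moveIII true M => M.mapPos ω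
  | moveIII false M => M.mapNeg ω

/-- The morphism `f⁰` of an elementary move. -/
def ElementaryMove.map (α : R) (ω : Rˣ) {D D' : LinkDiagram} :
    ElementaryMove D D' → (Kh K R D →ₗ[K] Kh K R D')
  | reidemeister f => f.map α ω
  | surgery0 M => M.map
  | surgery1 M => M.map
  | surgery2 M => M.inverseMap

/-- The degree of `f⁰`. -/
def ElementaryMove.degree {D D' : LinkDiagram} : ElementaryMove D D' → ℤ
  | reidemeister (.createI false _) => -1
  | reidemeister (.removeI false _) => 1
  | reidemeister (.createII _) => -1
  | reidemeister (.removeII _) => 1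
  | _ => 0

end Maps

end Khovanov

end

open Khovanov

noncomputable section

namespace Khovanov

open MvPolynomial (aeval)

universe u v

/-- The polynomials in the variables which belong to `O`. -/
abbrev supp (K : Type*) [CommRing K] (O : Finset ℕ) : Subalgebra K (MvPolynomial ℕ K) :=
  MvPolynomial.supported K (O : Set ℕ)

/-! ### Equivalence relations and elementary surgeries -/

section Setoids

/-- The equivalence relation generated by `a ∼ b`. -/
def pr (a b : ℕ) : Setoid ℕ := Relation.EqvGen.setoid fun x y => x = a ∧ y = b

theorem pr_le {a b : ℕ} {E : Setoid ℕ} : pr a b ≤ E ↔ E a b := by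
  constructor
  · intro h
    exact h (Relation.EqvGen.rel _ _ ⟨rfl, rfl⟩)
  · intro h x y hxy
    induction hxy with
    | rel _ _ h' => obtain ⟨rfl, rfl⟩ := h'; exact h
    | refl => exact E.refl _
    | symm _ _ _ ih => exact E.symm ih
    | trans _ _ _ _ _ ih ih' => exact E.trans ih ih'

theorem pr_comm (a b : ℕ) : pr a b = pr b a :=
  le_antisymm (pr_le.2 ((pr b a).symm (pr_le.1 le_rfl))) (pr_le.2 ((pr a b).symm (pr_le.1 le_rfl)))

theorem sup_pr_apply (E : Setoid ℕ) (a b c d : ℕ) :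
    (E ⊔ pr a b) c d ↔ E c d ∨ (E c a ∧ E b d) ∨ (E c b ∧ E a d) := by
  constructor
  · let F : Setoid ℕ :=
      { r := fun c d => E c d ∨ (E c a ∧ E b d) ∨ (E c b ∧ E a d)
        iseqv :=
          { refl := fun x => Or.inl (E.refl x)
            symm := by
              rintro x y (h | ⟨h, h'⟩ | ⟨h, h'⟩)
              · exact Or.inl (E.symm h)
              · exact Or.inr (Or.inr ⟨E.symm h', E.symm h⟩)
              · exact Or.inr (Or.inl ⟨E.symm h', E.symm h⟩)
            trans := by
              rintro x y z (h | ⟨h, h'⟩ | ⟨h, h'⟩) (k | ⟨k, k'⟩ | ⟨k, k'⟩)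
              · exact Or.inl (E.trans h k)
              · exact Or.inr (Or.inl ⟨E.trans h k, k'⟩)
              · exact Or.inr (Or.inr ⟨E.trans h k, k'⟩)
              · exact Or.inr (Or.inl ⟨h, E.trans h' k⟩)
              · exact Or.inr (Or.inl ⟨h, k'⟩)
              · exact Or.inl (E.trans h k')
              · exact Or.inr (Or.inr ⟨h, E.trans h' k⟩)
              · exact Or.inl (E.trans h k')
              · exact Or.inr (Or.inr ⟨h, k'⟩) } }
    have : E ⊔ pr a b ≤ F := sup_le (fun x y h => Or.inl h)
      (pr_le.2 (Or.inr (Or.inl ⟨E.refl _, E.refl _⟩)))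
    exact fun h => this h
  · have hE : E ≤ E ⊔ pr a b := le_sup_left
    have hab : (E ⊔ pr a b) a b := pr_le.1 le_sup_right
    rintro (h | ⟨h, h'⟩ | ⟨h, h'⟩)
    · exact hE h
    · exact (E ⊔ pr a b).trans (hE h) ((E ⊔ pr a b).trans hab (hE h'))
    · exact (E ⊔ pr a b).trans (hE h) ((E ⊔ pr a b).trans ((E ⊔ pr a b).symm hab) (hE h'))

/-- The relations `E` and `E'` differ by a surgery which cuts a strand with sides `e` and `f`; the
strand obtained on the side `e` goes to `g`. -/
structure Surg (E E' : Setoid ℕ) (e f g : ℕ) : Prop where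
  left : E e f
  right : E' e g
  sup : E ⊔ pr e g = E' ⊔ pr e f
  xor : E e g ↔ ¬ E' e f

theorem Surg.symm {E E' : Setoid ℕ} {e f g : ℕ} (h : Surg E E' e f g) : Surg E' E e g f :=
  ⟨h.right, h.left, h.sup.symm, by rw [h.xor, not_not]⟩

theorem Surg.merge {E E' : Setoid ℕ} {e f g : ℕ} (h : Surg E E' e f g) (h' : E' e f) :
    E' = E ⊔ pr e g := by
  rw [h.sup, sup_eq_left.2 (pr_le.2 h')]

theorem Surg.split {E E' : Setoid ℕ} {e f g : ℕ} (h : Surg E E' e f g) (h' : ¬ E' e f) :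
    E = E' ⊔ pr e f := by
  rw [← h.sup, sup_eq_left.2 (pr_le.2 (h.xor.2 h'))]

theorem Surg.le {E E' : Setoid ℕ} {e f g : ℕ} (h : Surg E E' e f g) : E ≤ E' ⊔ pr e f :=
  h.sup ▸ le_sup_left

theorem sup_pr_covering {E F : Setoid ℕ} {a b : ℕ} (h : E ≤ F) (hF : F ≤ E ⊔ pr a b)
    (hne : ¬ F ≤ E) : F = E ⊔ pr a b := by
  refine le_antisymm hF (sup_le h (pr_le.2 ?_))
  have : ∃ c d, F c d ∧ ¬ E c d := by
    by_contra hcon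
    push Not at hcon
    exact hne fun c d hcd => hcon c d hcd
  obtain ⟨c, d, hcd, hn⟩ := this
  rcases (sup_pr_apply E a b c d).1 (hF hcd) with h1 | ⟨h1, h2⟩ | ⟨h1, h2⟩
  · exact absurd h1 hn
  · exact F.trans (F.symm (h h1)) (F.trans hcd (F.symm (h h2)))
  · exact F.trans (h h2) (F.trans (F.symm hcd) (h h1))

theorem Surg.square_aux {E₁ E₂ E₃ E₄ : Setoid ℕ} {e f g g₂ e' f' g' g₂' : ℕ}
    (h₁₂ : Surg E₁ E₂ e f g) (h₂₄ : Surg E₂ E₄ e' f' g₂') (h₁₃ : Surg E₁ E₃ e' f' g')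
    (h₃₄ : Surg E₃ E₄ e f g₂) (hef : E₄ e f) (hef' : E₄ e' f') (h₂ : E₂ e f) : E₃ e' f' := by
  by_contra h₃
  have e₂ := h₁₂.merge h₂
  have e₁ := h₁₃.split h₃
  have e₄ := h₃₄.merge hef
  have e₄' := h₂₄.merge hef'
  have h31 : E₃ ≤ E₁ := by rw [e₁]; exact le_sup_left
  have h12 : E₁ ≤ E₂ := by rw [e₂]; exact le_sup_left
  have h24 : E₂ ≤ E₄ := by rw [e₄']; exact le_sup_left
  have hn : ¬ E₁ e g := by rw [h₁₂.xor, not_not]; exact h₂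
  have h14 : E₁ = E₄ := by
    rw [e₄]
    refine sup_pr_covering h31 ?_ fun h => h₃ (h h₁₃.left)
    rw [← e₄]; exact h12.trans h24
  have : E₂ ≤ E₁ := by rw [h14]; exact h24
  exact hn (this h₁₂.right)

end Setoids

/-! ### Polynomials in the generators of the circles -/

section Polynomials

variable (K : Type*) {R : Type*} [CommRing K] [CommRing R] [Algebra K R]

/-- The structure constants of an algebra of rank two with generator `α`. -/
structure QuadData (α : R) where
  s : K
  p : K
  φ₀ : R →ₗ[K] K
  φ₁ : R →ₗ[K] K
  mul_self : α * α = s • α - p • (1 : R)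
  conj_eq : conj K α = s • (1 : R) - α
  conj_one : conj K (1 : R) = 1
  repr : ∀ r, r = φ₀ r • (1 : R) + φ₁ r • α
  φ₀_one : φ₀ 1 = 1
  φ₁_one : φ₁ 1 = 0
  φ₀_gen : φ₀ α = 0
  φ₁_gen : φ₁ α = 1

variable {K}

theorem IsGenerator.conj_one {α : R} (hα : IsGenerator K α) : conj K (1 : R) = 1 := by
  obtain ⟨P, hP, hdeg, φ, rfl⟩ := hα
  have h := Algebra.trace_algebraMap_of_basis ((AdjoinRoot.powerBasis' hP).map φ).basis (1 : K)
  have hdim : ((AdjoinRoot.powerBasis' hP).map φ).dim = 2 := by simpa using hdeg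
  rw [map_one, Fintype.card_fin, hdim] at h
  simp only [conj, LinearMap.sub_apply, LinearMap.comp_apply, LinearMap.id_apply, h]
  simp [two_smul]

theorem IsGenerator.nonempty_quadData {α : R} (hα : IsGenerator K α) :
    Nonempty (QuadData K α) := by
  obtain ⟨s, p, φ₀, φ₁, hmul, hconj, hφ, h00, h10, h01, h11⟩ := hα.exists_conj
  exact ⟨⟨s, p, φ₀, φ₁, hmul, hconj, hα.conj_one, hφ, h00, h10, h01, h11⟩⟩

namespace QuadData

variable {α : R} (q : QuadData K α)

theorem mul_eq (r r' : R) : r * r' = (q.φ₀ r * q.φ₀ r' - q.p * (q.φ₁ r * q.φ₁ r')) • (1 : R) +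
    (q.φ₀ r * q.φ₁ r' + q.φ₁ r * q.φ₀ r' + q.s * (q.φ₁ r * q.φ₁ r')) • α := by
  conv_lhs => rw [q.repr r, q.repr r']
  have h := q.mul_self
  simp only [Algebra.smul_def, map_sub, map_add, map_mul] at h ⊢
  linear_combination (algebraMap K R (q.φ₁ r) * algebraMap K R (q.φ₁ r')) * h

theorem φ₀_mul (r r' : R) :
    q.φ₀ (r * r') = q.φ₀ r * q.φ₀ r' - q.p * (q.φ₁ r * q.φ₁ r') := by
  rw [q.mul_eq, map_add, map_smul, map_smul, q.φ₀_one, q.φ₀_gen]; simp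

theorem φ₁_mul (r r' : R) :
    q.φ₁ (r * r') = q.φ₀ r * q.φ₁ r' + q.φ₁ r * q.φ₀ r' + q.s * (q.φ₁ r * q.φ₁ r') := by
  rw [q.mul_eq, map_add, map_smul, map_smul, q.φ₁_one, q.φ₁_gen]; simp

/-- The polynomial in the variable `e` which represents `r`. -/
def el (e : ℕ) (r : R) : MvPolynomial ℕ K :=
  MvPolynomial.C (q.φ₀ r) + MvPolynomial.C (q.φ₁ r) * MvPolynomial.X e

@[simp] theorem el_one (e : ℕ) : q.el e 1 = 1 := by simp [el, q.φ₀_one, q.φ₁_one]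

@[simp] theorem el_gen (e : ℕ) : q.el e α = MvPolynomial.X e := by
  simp [el, q.φ₀_gen, q.φ₁_gen]

theorem X_mem {O : Finset ℕ} {e : ℕ} (he : e ∈ O) :
    (MvPolynomial.X e : MvPolynomial ℕ K) ∈ supp K O := by
  rw [supp, MvPolynomial.supported_eq_adjoin_X]
  exact Algebra.subset_adjoin ⟨e, he, rfl⟩

theorem el_conj (e : ℕ) (r : R) : q.el e (conj K r) =
    MvPolynomial.C (q.φ₀ r) + MvPolynomial.C (q.φ₁ r) * (MvPolynomial.C q.s - MvPolynomial.X e) := by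
  have h : conj K r = (q.φ₀ r + q.φ₁ r * q.s) • (1 : R) - q.φ₁ r • α := by
    conv_lhs => rw [q.repr r, map_add, map_smul, map_smul, q.conj_one, q.conj_eq]
    module
  rw [el, h]
  simp only [map_sub, map_smul, q.φ₀_one, q.φ₀_gen, q.φ₁_one, q.φ₁_gen, smul_eq_mul, mul_one,
    mul_zero, sub_zero, zero_sub, map_add, map_mul, map_neg]
  ring

theorem counit_mul_omega [Coalgebra K R] {ω : Rˣ} (hω : IsTwisting (K := K) α ω) (r : R) :
    Coalgebra.counit (R := K) (r * (ω : R)) = q.φ₁ r := by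
  have h1 : r * (ω : R) = q.φ₀ r • (ω : R) + q.φ₁ r • ((ω : R) * α) := by
    conv_lhs => rw [q.repr r]
    rw [add_mul, smul_mul_assoc, smul_mul_assoc, one_mul, mul_comm α]
  rw [h1, map_add, map_smul, map_smul, hω.counit_omega, hω.counit_omega_mul]
  simp

theorem el_mem {O : Finset ℕ} {e : ℕ} (he : e ∈ O) (r : R) :
    q.el e r ∈ supp K O :=
  add_mem (Subalgebra.algebraMap_mem _ _)
    (mul_mem (Subalgebra.algebraMap_mem _ _) (X_mem he))

/-- The polynomial which represents the coproduct `Δ(1)` at the arcs `e` and `f`. -/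
def cop (ω : Rˣ) (e f : ℕ) : MvPolynomial ℕ K :=
  q.el f ω * (MvPolynomial.X e + MvPolynomial.X f - MvPolynomial.C q.s)

theorem cop_mem {O : Finset ℕ} {e f : ℕ} (he : e ∈ O) (hf : f ∈ O) (ω : Rˣ) :
    q.cop ω e f ∈ supp K O :=
  mul_mem (q.el_mem hf _) (sub_mem (add_mem (X_mem he)
    (X_mem hf)) (Subalgebra.algebraMap_mem _ _))

open Classical in
/-- The polynomial by which a surgery acts: `1` for a merge and `Δ(1)` for a split. -/
def cc (ω : Rˣ) (E : Setoid ℕ) (e f : ℕ) : MvPolynomial ℕ K :=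
  if E e f then 1 else q.cop ω e f

theorem cc_mem {O : Finset ℕ} {e f : ℕ} (he : e ∈ O) (hf : f ∈ O) (ω : Rˣ) (E : Setoid ℕ) :
    q.cc ω E e f ∈ supp K O := by
  unfold cc
  split_ifs
  · exact one_mem _
  · exact q.cop_mem he hf ω

theorem cc_pos {ω : Rˣ} {E : Setoid ℕ} {e f : ℕ} (h : E e f) : q.cc ω E e f = 1 := by
  simp [cc, h]

theorem cc_neg {ω : Rˣ} {E : Setoid ℕ} {e f : ℕ} (h : ¬ E e f) :
    q.cc ω E e f = q.cop ω e f := by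
  simp [cc, h]

section Model

variable {A : Type*} [CommRing A] [Algebra K A]

/-- A model of an equivalence relation: a family of roots of the equation of `α`, constant on the
classes of `E`. -/
structure IsModel (E : Setoid ℕ) (x : ℕ → A) : Prop where
  mul_self : ∀ e, x e * x e = algebraMap K A q.s * x e - algebraMap K A q.p
  eq_of_rel : ∀ {e f}, E e f → x e = x f

variable {q}

theorem IsModel.mono {E E' : Setoid ℕ} {x : ℕ → A} (h : q.IsModel E' x) (hE : E ≤ E') :
    q.IsModel E x :=
  ⟨h.1, fun hef => h.2 (hE hef)⟩

theorem aeval_el (x : ℕ → A) (e : ℕ) (r : R) : aeval x (q.el e r) =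
    algebraMap K A (q.φ₀ r) + algebraMap K A (q.φ₁ r) * x e := by
  simp [el]

theorem IsModel.aeval_el_mul {E : Setoid ℕ} {x : ℕ → A} (h : q.IsModel E x) (e : ℕ) (r r' : R) :
    aeval x (q.el e (r * r')) =
      aeval x (q.el e r) * aeval x (q.el e r') := by
  simp only [aeval_el, q.φ₀_mul, q.φ₁_mul, map_add, map_sub, map_mul]
  linear_combination (- algebraMap K A (q.φ₁ r) * algebraMap K A (q.φ₁ r')) * h.mul_self e

theorem IsModel.el_mul_inv {E : Setoid ℕ} {x : ℕ → A} (h : q.IsModel E x) (e : ℕ) (ω : Rˣ) :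
    aeval x (q.el e ω) * aeval x (q.el e (↑ω⁻¹ : R)) = 1 := by
  rw [← h.aeval_el_mul]; simp

theorem aeval_cop (x : ℕ → A) (ω : Rˣ) (e f : ℕ) : aeval x (q.cop ω e f) =
    aeval x (q.el f ω) * (x e + x f - algebraMap K A q.s) := by
  simp [cop]

theorem IsModel.sub_mul_delta {E : Setoid ℕ} {x : ℕ → A} (h : q.IsModel E x) (e f : ℕ) :
    (x e - x f) * (x e + x f - algebraMap K A q.s) = 0 := by
  linear_combination h.mul_self e - h.mul_self f

theorem IsModel.sub_mul_cop {E : Setoid ℕ} {x : ℕ → A} (h : q.IsModel E x) (ω : Rˣ) (e f : ℕ) :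
    x e * aeval x (q.cop ω e f) = x f * aeval x (q.cop ω e f) := by
  rw [aeval_cop]
  linear_combination aeval x (q.el f ω) * h.sub_mul_delta e f

theorem IsModel.cop_comm {E : Setoid ℕ} {x : ℕ → A} (h : q.IsModel E x) (ω : Rˣ) (e f : ℕ) :
    aeval x (q.cop ω e f) = aeval x (q.cop ω f e) := by
  simp only [aeval_cop, aeval_el]
  linear_combination (-algebraMap K A (q.φ₁ ω)) * h.sub_mul_delta e f

theorem IsModel.el_congr {E : Setoid ℕ} {x : ℕ → A} (h : q.IsModel E x) {e f : ℕ} (hef : E e f)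
    (r : R) : aeval x (q.el e r) = aeval x (q.el f r) := by
  simp only [aeval_el, h.eq_of_rel hef]

theorem IsModel.cop_congr {E : Setoid ℕ} {x : ℕ → A} (h : q.IsModel E x) (ω : Rˣ)
    {e f e' f' : ℕ} (he : E e e') (hf : E f f') :
    aeval x (q.cop ω e f) = aeval x (q.cop ω e' f') := by
  simp only [aeval_cop, aeval_el, h.eq_of_rel he, h.eq_of_rel hf]

theorem IsModel.mul_cc {E : Setoid ℕ} {x : ℕ → A} (h : q.IsModel E x) (ω : Rˣ) {e f a b : ℕ}
    (hab : (E ⊔ pr e f) a b) :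
    x a * aeval x (q.cc ω E e f) = x b * aeval x (q.cc ω E e f) := by
  by_cases hef : E e f
  · rw [sup_eq_left.2 (pr_le.2 hef)] at hab
    rw [h.eq_of_rel hab]
  · rw [q.cc_neg hef]
    have := h.sub_mul_cop ω e f
    rcases (sup_pr_apply E e f a b).1 hab with h1 | ⟨h1, h2⟩ | ⟨h1, h2⟩
    · rw [h.eq_of_rel h1]
    · rw [h.eq_of_rel h1, ← h.eq_of_rel h2, this]
    · rw [h.eq_of_rel h1, ← h.eq_of_rel h2, this]

end Model

end QuadData

end Polynomials

section Congruence

variable {K : Type u} {R : Type v} [CommRing K] [CommRing R] [Algebra K R] {α : R}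
  (q : QuadData K α)

/-- The polynomials `b` and `b'` take the same value in every model of `E`. -/
def QuadData.Cong (E : Setoid ℕ) (b b' : MvPolynomial ℕ K) : Prop :=
  ∀ (A : Type (max u v)) [CommRing A] [Algebra K A] (x : ℕ → A), q.IsModel E x →
    aeval x b = aeval x b'

namespace QuadData.Cong

variable {q}

theorem refl (E : Setoid ℕ) (b : MvPolynomial ℕ K) : q.Cong E b b := fun _ _ _ _ _ => rfl

theorem of_eq {E : Setoid ℕ} {b b' : MvPolynomial ℕ K} (h : b = b') : q.Cong E b b' :=
  h ▸ refl E b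

theorem symm {E : Setoid ℕ} {b b' : MvPolynomial ℕ K} (h : q.Cong E b b') : q.Cong E b' b :=
  fun A _ _ x hx => (h A x hx).symm

theorem trans {E : Setoid ℕ} {b b' b'' : MvPolynomial ℕ K} (h : q.Cong E b b')
    (h' : q.Cong E b' b'') : q.Cong E b b'' :=
  fun A _ _ x hx => (h A x hx).trans (h' A x hx)

theorem mono {E E' : Setoid ℕ} {b b' : MvPolynomial ℕ K} (h : q.Cong E b b') (hE : E ≤ E') :
    q.Cong E' b b' :=
  fun A _ _ x hx => h A x (hx.mono hE)

theorem mul {E : Setoid ℕ} {b b' c c' : MvPolynomial ℕ K} (h : q.Cong E b b')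
    (h' : q.Cong E c c') : q.Cong E (b * c) (b' * c') :=
  fun A _ _ x hx => by rw [map_mul, map_mul, h A x hx, h' A x hx]

theorem neg {E : Setoid ℕ} {b b' : MvPolynomial ℕ K} (h : q.Cong E b b') :
    q.Cong E (-b) (-b') :=
  fun A _ _ x hx => by rw [map_neg, map_neg, h A x hx]

/-- Surgeries respect congruences. -/
theorem push (ω : Rˣ) {E E' : Setoid ℕ} {e f : ℕ} {b b' : MvPolynomial ℕ K}
    (h : q.Cong E b b') (hE : E ≤ E' ⊔ pr e f) :
    q.Cong E' (b * q.cc ω E' e f) (b' * q.cc ω E' e f) := by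
  intro A _ _ x hx
  set c := aeval x (q.cc ω E' e f) with hc
  let I : Ideal A := (Submodule.span A {c}).annihilator
  have hI : ∀ a : A, a ∈ I ↔ a * c = 0 := fun a => by
    simp [I]
  let y : ℕ → A ⧸ I := fun e => Ideal.Quotient.mk I (x e)
  have hy : q.IsModel E y := by
    refine ⟨fun e => ?_, fun {a b} hab => ?_⟩
    · have := congrArg (Ideal.Quotient.mk I) (hx.mul_self e)
      simpa [y] using this
    · rw [Ideal.Quotient.eq, hI, sub_mul, sub_eq_zero]
      exact hx.mul_cc ω (hE hab)
  have key := h (A ⧸ I) y hy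
  have hval : ∀ b : MvPolynomial ℕ K, aeval y b =
      Ideal.Quotient.mk I (aeval x b) := fun b => by
    have : aeval y = (Ideal.Quotient.mkₐ K I).comp (aeval x) :=
      MvPolynomial.algHom_ext fun e => by simp [y]
    rw [this]; rfl
  rw [hval, hval, Ideal.Quotient.eq, hI, sub_mul, sub_eq_zero] at key
  rw [map_mul, map_mul, key]

end QuadData.Cong

namespace QuadData

theorem cop_comm_cong (ω : Rˣ) (E : Setoid ℕ) (e f : ℕ) :
    q.Cong E (q.cop ω e f) (q.cop ω f e) :=
  fun _ _ _ _ hx => hx.cop_comm ω e f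

theorem cop_congr (ω : Rˣ) {E : Setoid ℕ} {e f e' f' : ℕ} (he : E e e') (hf : E f f') :
    q.Cong E (q.cop ω e f) (q.cop ω e' f') :=
  fun _ _ _ _ hx => hx.cop_congr ω he hf

theorem el_congr {E : Setoid ℕ} {e f : ℕ} (h : E e f) (r : R) : q.Cong E (q.el e r) (q.el f r) :=
  fun _ _ _ _ hx => hx.el_congr h r

theorem cc_congr (ω : Rˣ) {E F : Setoid ℕ} {e f e' f' : ℕ} (he : E e e') (hf : E f f')
    (hF : F e f ↔ E e' f') : q.Cong E (q.cc ω F e f) (q.cc ω E e' f') := by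
  by_cases h : E e' f'
  · rw [q.cc_pos h, q.cc_pos (hF.2 h)]; exact Cong.refl _ _
  · rw [q.cc_neg h, q.cc_neg (mt hF.1 h)]; exact q.cop_congr ω he hf

theorem cc_comm (ω : Rˣ) (E : Setoid ℕ) (e f : ℕ) : q.Cong E (q.cc ω E e f) (q.cc ω E f e) := by
  by_cases h : E e f
  · rw [q.cc_pos h, q.cc_pos (E.symm h)]; exact Cong.refl _ _
  · rw [q.cc_neg h, q.cc_neg (mt E.symm h)]; exact q.cop_comm_cong ω E e f

theorem cc_congr_swap (ω : Rˣ) {E F : Setoid ℕ} {e f e' f' : ℕ} (he : E e f') (hf : E f e')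
    (hF : F e f ↔ E e' f') : q.Cong E (q.cc ω F e f) (q.cc ω E e' f') :=
  (q.cc_congr ω he hf (hF.trans ⟨fun h => E.symm h, fun h => E.symm h⟩)).trans
    (q.cc_comm ω E f' e')

/-- A surgery followed by the reverse surgery is the multiplication by `Δ(1)`. -/
theorem cc_back (ω : Rˣ) {E E' : Setoid ℕ} {e f g : ℕ} (h : Surg E E' e f g) :
    q.Cong E (q.cc ω E' e f * q.cc ω E e g) (q.cop ω e g) := by
  by_cases hg : E e g
  · rw [q.cc_pos hg, q.cc_neg (h.xor.1 hg), mul_one]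
    exact q.cop_congr ω (E.refl _) (E.trans (E.symm h.left) hg)
  · have : E' e f := by by_contra h'; exact hg (h.xor.2 h')
    rw [q.cc_neg hg, q.cc_pos this, one_mul]
    exact Cong.refl _ _

/-- Surgeries commute. -/
theorem cc_square (ω : Rˣ) {E₁ E₂ E₃ E₄ : Setoid ℕ} {e f g g₂ e' f' g' g₂' : ℕ}
    (h₁₂ : Surg E₁ E₂ e f g) (h₂₄ : Surg E₂ E₄ e' f' g₂') (h₁₃ : Surg E₁ E₃ e' f' g')
    (h₃₄ : Surg E₃ E₄ e f g₂) :
    q.Cong E₄ (q.cc ω E₂ e f * q.cc ω E₄ e' f') (q.cc ω E₃ e' f' * q.cc ω E₄ e f) := by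
  by_cases hef : E₄ e f <;> by_cases hef' : E₄ e' f'
  · rw [q.cc_pos hef, q.cc_pos hef', mul_one, mul_one]
    by_cases h₂ : E₂ e f
    · rw [q.cc_pos h₂, q.cc_pos (h₁₂.square_aux h₂₄ h₁₃ h₃₄ hef hef' h₂)]; exact Cong.refl _ _
    · have h₃ : ¬ E₃ e' f' := fun h₃ => h₂ (h₁₃.square_aux h₃₄ h₁₂ h₂₄ hef' hef h₃)
      rw [q.cc_neg h₂, q.cc_neg h₃]
      have e₄ := h₂₄.merge hef'
      have h2 : E₂ ≤ E₄ := by rw [e₄]; exact le_sup_left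
      have hee : E₄ e e' := by
        have := hef
        rw [e₄] at this
        rcases (sup_pr_apply _ _ _ _ _).1 this with h | ⟨h, -⟩ | ⟨h, -⟩
        · exact absurd h h₂
        · exact h2 h
        · exact E₄.trans (h2 h) (E₄.symm h₂₄.right)
      exact q.cop_congr ω hee (E₄.trans (E₄.symm hef) (E₄.trans hee hef'))
  · have e₂ := h₂₄.split hef'
    have e₄ := h₃₄.merge hef
    have h₂ : E₂ e f := by rw [e₂]; exact (le_sup_left : E₄ ≤ _) hef
    have h₃ : ¬ E₃ e' f' := fun h => hef' (by rw [e₄]; exact (le_sup_left : E₃ ≤ _) h)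
    rw [q.cc_pos hef, q.cc_pos h₂, q.cc_neg hef', q.cc_neg h₃, mul_one, one_mul]
    exact Cong.refl _ _
  · have e₃ := h₃₄.split hef
    have e₄ := h₂₄.merge hef'
    have h₃ : E₃ e' f' := by rw [e₃]; exact (le_sup_left : E₄ ≤ _) hef'
    have h₂ : ¬ E₂ e f := fun h => hef (by rw [e₄]; exact (le_sup_left : E₂ ≤ _) h)
    rw [q.cc_pos hef', q.cc_pos h₃, q.cc_neg hef, q.cc_neg h₂, mul_one, one_mul]
    exact Cong.refl _ _
  · have e₂ := h₂₄.split hef'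
    have e₃ := h₃₄.split hef
    have i₂ : E₂ e f ↔ (E₄ e e' ∧ E₄ f' f) ∨ (E₄ e f' ∧ E₄ e' f) := by
      rw [e₂, sup_pr_apply]; simp [hef]
    have i₃ : E₃ e' f' ↔ (E₄ e' e ∧ E₄ f f') ∨ (E₄ e' f ∧ E₄ e f') := by
      rw [e₃, sup_pr_apply]; simp [hef']
    have i : E₂ e f ↔ E₃ e' f' := by
      rw [i₂, i₃, E₄.comm' (x := e) (y := e'), E₄.comm' (x := f') (y := f),
        and_comm (a := E₄ e f')]
    rw [q.cc_neg hef, q.cc_neg hef']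
    by_cases h₂ : E₂ e f
    · rw [q.cc_pos h₂, q.cc_pos (i.1 h₂), one_mul, one_mul]
      rcases i₂.1 h₂ with ⟨h, h'⟩ | ⟨h, h'⟩
      · exact q.cop_congr ω (E₄.symm h) h'
      · exact (q.cop_comm_cong ω E₄ e' f').trans (q.cop_congr ω (E₄.symm h) h')
    · rw [q.cc_neg h₂, q.cc_neg (mt i.2 h₂), mul_comm]; exact Cong.refl _ _

end QuadData

end Congruence

/-! ### Gluing relations -/

section Gluing

/-- If two permutations differ by a transposition, then the two transposed points are in the same
cycle of exactly one of them. -/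
theorem sameCycle_iff_not_sameCycle_mul_swap {T : Type*} [Finite T] [DecidableEq T]
    (σ : Equiv.Perm T) {a c : T} (hac : a ≠ c) :
    σ.SameCycle a c ↔ ¬ (σ * Equiv.swap a c).SameCycle a c := by
  have orbit : ∀ (τ : Equiv.Perm T) (n : ℕ) (x y : T), 0 < n → (τ ^ n) x = x → τ.SameCycle x y →
      ∃ i < n, (τ ^ i) x = y := by
    rintro τ n x y hn hx ⟨k, hk⟩
    have hn' : (0 : ℤ) < n := by exact_mod_cast hn
    refine ⟨(k % n).toNat, ?_, ?_⟩
    · have := Int.emod_lt_of_pos k hn'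
      have := Int.emod_nonneg k hn'.ne'
      omega
    · have h0 : (((k % n).toNat : ℕ) : ℤ) = k % n := Int.toNat_of_nonneg (Int.emod_nonneg k hn'.ne')
      have h1 : (τ ^ (k % n)) x = y := by
        conv_rhs => rw [← hk, ← Int.emod_add_mul_ediv k n, zpow_add, zpow_mul, zpow_natCast]
        rw [Equiv.Perm.mul_apply, Equiv.Perm.zpow_apply_eq_self_of_apply_eq_self hx]
      rw [← h1, ← h0, zpow_natCast, h0]
  have hex : ∃ n : ℕ, 0 < n ∧ ((σ ^ n) a = a ∨ (σ ^ n) a = c) :=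
    ⟨orderOf σ, orderOf_pos σ, Or.inl (by rw [pow_orderOf_eq_one]; rfl)⟩
  classical
  set n := Nat.find hex
  obtain ⟨hn, hna⟩ : 0 < n ∧ ((σ ^ n) a = a ∨ (σ ^ n) a = c) := Nat.find_spec hex
  have hmin : ∀ i, 0 < i → i < n → (σ ^ i) a ≠ a ∧ (σ ^ i) a ≠ c := by
    intro i hi hin
    have := Nat.find_min hex hin
    push Not at this
    exact this hi
  set τ := σ * Equiv.swap a c with hτ
  have hpow : ∀ i, 0 < i → i ≤ n → (τ ^ i) c = (σ ^ i) a := by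
    intro i hi
    induction i, hi using Nat.le_induction with
    | base => intro _; simp [hτ]
    | succ i hi ih =>
      intro hin
      obtain ⟨h1, h2⟩ := hmin i hi (by omega)
      rw [pow_succ', Equiv.Perm.mul_apply, ih (by omega), hτ, Equiv.Perm.mul_apply,
        Equiv.swap_apply_of_ne_of_ne h1 h2, pow_succ', Equiv.Perm.mul_apply]
  rcases hna with h | h
  · refine iff_of_false (fun hs => ?_) (fun hs => hs ?_)
    · obtain ⟨i, hi, hia⟩ := orbit σ n a c hn h hs
      rcases Nat.eq_zero_or_pos i with rfl | hi0
      · exact hac (by simpa using hia)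
      · exact (hmin i hi0 hi).2 hia
    · exact Equiv.Perm.SameCycle.symm ⟨n, by rw [zpow_natCast, hpow n hn le_rfl, h]⟩
  · refine iff_of_true ⟨n, by rw [zpow_natCast, h]⟩ (fun hs => ?_)
    obtain ⟨i, hi, hia⟩ := orbit τ n c a hn (by rw [hpow n hn le_rfl, h]) hs.symm
    rcases Nat.eq_zero_or_pos i with rfl | hi0
    · exact hac (by simpa using hia.symm)
    · exact (hmin i hi0 hi).1 (by rw [← hpow i hi0 hi.le, hia])

open Classical in
/-- The gluing relation at a resolved crossing. -/
def cr (s : Fin 4 → ℕ) (neg : Prop) : Setoid ℕ :=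
  if neg then pr (s 0) (s 1) ⊔ pr (s 2) (s 3) else pr (s 0) (s 3) ⊔ pr (s 2) (s 1)

theorem cr_pos (s : Fin 4 → ℕ) {neg : Prop} (h : neg) :
    cr s neg = pr (s 0) (s 1) ⊔ pr (s 2) (s 3) := if_pos h

theorem cr_neg (s : Fin 4 → ℕ) {neg : Prop} (h : ¬ neg) :
    cr s neg = pr (s 0) (s 3) ⊔ pr (s 2) (s 1) := if_neg h

/-- The gluing relation at the marked points in `J` and at the crossings in `X`. -/
def glueOn (J : Finset (ℕ × ℕ)) (slot : ℕ → Fin 4 → ℕ) (X S : Finset ℕ) : Setoid ℕ :=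
  (⨆ j ∈ J, pr j.1 j.2) ⊔ ⨆ x ∈ X, cr (slot x) (x ∈ S)

/-- The gluing relation of the resolved diagram `D_S`. -/
def glue (D : LinkDiagram) (S : Finset ℕ) : Setoid ℕ :=
  glueOn D.joins D.slot D.crossings S

theorem glueOn_insert_crossing (J : Finset (ℕ × ℕ)) (slot : ℕ → Fin 4 → ℕ) (X S : Finset ℕ)
    (x : ℕ) : glueOn J slot (insert x X) S = glueOn J slot X S ⊔ cr (slot x) (x ∈ S) := by
  rw [glueOn, glueOn, Finset.iSup_insert, sup_assoc, sup_comm (cr _ _)]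

theorem glueOn_congr {J : Finset (ℕ × ℕ)} {slot slot' : ℕ → Fin 4 → ℕ} {X S S' : Finset ℕ}
    (h : ∀ x ∈ X, slot x = slot' x ∧ (x ∈ S ↔ x ∈ S')) :
    glueOn J slot X S = glueOn J slot' X S' := by
  unfold glueOn
  congr 1
  refine iSup_congr fun x => iSup_congr fun hx => ?_
  rw [(h x hx).1, propext (h x hx).2]

theorem le_glueOn_of_mem {J : Finset (ℕ × ℕ)} {slot : ℕ → Fin 4 → ℕ} {X S : Finset ℕ} {x : ℕ}
    (hx : x ∈ X) : cr (slot x) (x ∈ S) ≤ glueOn J slot X S :=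
  (le_iSup₂_of_le (f := fun x (_ : x ∈ X) => cr (slot x) (x ∈ S)) x hx le_rfl).trans le_sup_right

theorem glueOn_le {J : Finset (ℕ × ℕ)} {slot : ℕ → Fin 4 → ℕ} {X S : Finset ℕ} {E : Setoid ℕ}
    (hJ : ∀ j ∈ J, E j.1 j.2) (hX : ∀ x ∈ X, cr (slot x) (x ∈ S) ≤ E) :
    glueOn J slot X S ≤ E :=
  sup_le (iSup₂_le fun j hj => pr_le.2 (hJ j hj)) (iSup₂_le hX)

theorem surg_of_xor {M E E' : Setoid ℕ} {a b c d : ℕ} (hE : E = M ⊔ pr a b ⊔ pr c d)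
    (hE' : E' = M ⊔ pr a d ⊔ pr c b) (hx : E a d ↔ ¬ E' a b) : Surg E E' a b d where
  left := by rw [hE]; exact pr_le.1 (le_sup_right.trans le_sup_left)
  right := by rw [hE']; exact pr_le.1 (le_sup_right.trans le_sup_left)
  sup := by
    have key : ∀ (E E' : Setoid ℕ) (b d : ℕ), E = M ⊔ pr a b ⊔ pr c d →
        E' = M ⊔ pr a d ⊔ pr c b → E' ⊔ pr a b ≤ E ⊔ pr a d := by
      rintro E E' b d rfl rfl
      have hab : (M ⊔ pr a b ⊔ pr c d ⊔ pr a d) a b :=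
        pr_le.1 ((le_sup_right.trans le_sup_left).trans le_sup_left)
      have hcd : (M ⊔ pr a b ⊔ pr c d ⊔ pr a d) c d := pr_le.1 (le_sup_right.trans le_sup_left)
      have had : (M ⊔ pr a b ⊔ pr c d ⊔ pr a d) a d := pr_le.1 le_sup_right
      refine sup_le (sup_le (sup_le ((le_sup_left.trans le_sup_left).trans le_sup_left)
        (pr_le.2 had)) (pr_le.2 ?_)) (pr_le.2 hab)
      exact Setoid.trans' _ hcd (Setoid.trans' _ (Setoid.symm' _ had) hab)
    exact le_antisymm (key E' E d b hE' hE) (key E E' b d hE hE')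
  xor := hx

end Gluing

namespace LinkDiagram

variable (D : LinkDiagram)

theorem eq_or_sameCircle_of_glue {S : Finset ℕ} {e f : ℕ} (h : glue D S e f) :
    e = f ∨ D.SameCircle S e f := by
  let F : Setoid ℕ :=
    { r := fun a b => a = b ∨ D.SameCircle S a b
      iseqv :=
        { refl := fun _ => Or.inl rfl
          symm := by
            rintro a b (rfl | ⟨ha, hb, hab⟩)
            · exact Or.inl rfl
            · exact Or.inr ⟨hb, ha, (D.circleSetoid S).symm hab⟩
          trans := by
            rintro a b c (rfl | ⟨ha, hb, hab⟩) (rfl | ⟨hb', hc, hbc⟩)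
            · exact Or.inl rfl
            · exact Or.inr ⟨hb', hc, hbc⟩
            · exact Or.inr ⟨ha, hb, hab⟩
            · exact Or.inr ⟨ha, hc, (D.circleSetoid S).trans hab hbc⟩ } }
  have hrel : ∀ a b (ha : a ∈ D.arcs) (hb : b ∈ D.arcs), D.Glued S a b → F a b :=
    fun a b ha hb hab => Or.inr ⟨ha, hb, Relation.EqvGen.rel _ _ hab⟩
  have hF : glue D S ≤ F := by
    refine glueOn_le (fun j hj => ?_) (fun x hx => ?_)
    · exact hrel _ _ (D.join_mem j hj).1 (D.join_mem j hj).2 (Or.inl hj)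
    · have hm := D.slot_mem x hx
      by_cases hS : x ∈ S
      · rw [cr_pos _ hS]
        refine sup_le (pr_le.2 ?_) (pr_le.2 ?_)
        · exact hrel _ _ (hm 0) (hm 1) (Or.inr ⟨x, hx, by simp [hS]⟩)
        · exact hrel _ _ (hm 2) (hm 3) (Or.inr ⟨x, hx, by simp [hS]⟩)
      · rw [cr_neg _ hS]
        refine sup_le (pr_le.2 ?_) (pr_le.2 ?_)
        · exact hrel _ _ (hm 0) (hm 3) (Or.inr ⟨x, hx, by simp [hS]⟩)
        · exact hrel _ _ (hm 2) (hm 1) (Or.inr ⟨x, hx, by simp [hS]⟩)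
  exact hF h

theorem sameCircle_iff (S : Finset ℕ) (e f : ℕ) :
    D.SameCircle S e f ↔ e ∈ D.arcs ∧ f ∈ D.arcs ∧ glue D S e f := by
  constructor
  · rintro ⟨he, hf, h⟩
    refine ⟨he, hf, ?_⟩
    change Relation.EqvGen _ _ _ at h
    have : ∀ u v : D.arcs, Relation.EqvGen (fun e f : D.arcs => D.Glued S e f) u v →
        glue D S u v := by
      intro u v huv
      induction huv with
      | rel u v h =>
        rcases h with h | ⟨x, hx, h⟩
        · exact pr_le.1 ((le_iSup₂_of_le (f := fun j (_ : j ∈ D.joins) => pr j.1 j.2) _ h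
            le_rfl).trans le_sup_left)
        · have hcr := le_glueOn_of_mem (J := D.joins) (slot := D.slot) (S := S) hx
          split_ifs at h with hS
          · rw [cr_pos _ hS] at hcr
            rcases h with ⟨h, h'⟩ | ⟨h, h'⟩
            · rw [h, h']; exact pr_le.1 (le_sup_left.trans hcr)
            · rw [h, h']; exact pr_le.1 (le_sup_right.trans hcr)
          · rw [cr_neg _ hS] at hcr
            rcases h with ⟨h, h'⟩ | ⟨h, h'⟩
            · rw [h, h']; exact pr_le.1 (le_sup_left.trans hcr)
            · rw [h, h']; exact pr_le.1 (le_sup_right.trans hcr)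
      | refl => exact Setoid.refl' _ _
      | symm _ _ _ ih => exact Setoid.symm' _ ih
      | trans _ _ _ _ _ ih ih' => exact Setoid.trans' _ ih ih'
    exact this _ _ h
  · rintro ⟨he, hf, h⟩
    rcases D.eq_or_sameCircle_of_glue h with rfl | h'
    · exact ⟨he, he, (D.circleSetoid S).refl _⟩
    · exact h'

/-- The end of an arc, at a crossing or at a marked point. -/
abbrev End : Type := (ℕ × Fin 4) ⊕ (ℕ × ℕ)

/-- The arc `e` arrives at the given end. -/
def Head (e : ℕ) : End → Prop
  | .inl c => c.1 ∈ D.crossings ∧ D.slot c.1 c.2 = e ∧ D.Inward c.1 c.2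
  | .inr j => j ∈ D.joins ∧ j.1 = e

/-- The arc `e` starts at the given end. -/
def Tail (e : ℕ) : End → Prop
  | .inl c => c.1 ∈ D.crossings ∧ D.slot c.1 c.2 = e ∧ ¬ D.Inward c.1 c.2
  | .inr j => j ∈ D.joins ∧ j.2 = e

variable {D}

theorem existsUnique_head {e : ℕ} (he : e ∈ D.arcs) : ∃! l, D.Head e l := by
  have h := D.card_heads e he
  rw [← Finset.card_disjSum, Finset.card_eq_one] at h
  obtain ⟨l, hl⟩ := h
  have : ∀ l', D.Head e l' ↔ l' = l := by
    intro l'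
    rw [← Finset.mem_singleton, ← hl]
    rcases l' with c | j <;> simp [Head]
  exact ⟨l, (this l).2 rfl, fun l' => (this l').1⟩

theorem existsUnique_tail {e : ℕ} (he : e ∈ D.arcs) : ∃! l, D.Tail e l := by
  have h := D.card_tails e he
  rw [← Finset.card_disjSum, Finset.card_eq_one] at h
  obtain ⟨l, hl⟩ := h
  have : ∀ l', D.Tail e l' ↔ l' = l := by
    intro l'
    rw [← Finset.mem_singleton, ← hl]
    rcases l' with c | j <;> simp [Tail]
  exact ⟨l, (this l).2 rfl, fun l' => (this l').1⟩

/-- The end which is connected with a given end in the resolved diagram. -/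
def across (S : Finset ℕ) : End → End
  | .inl c => .inl (c.1, if c.1 ∈ S then ![1, 0, 3, 2] c.2 else ![3, 2, 1, 0] c.2)
  | .inr j => .inr j

theorem across_across (S : Finset ℕ) (l : End) : across S (across S l) = l := by
  rcases l with ⟨x, i⟩ | j
  · by_cases h : x ∈ S <;> fin_cases i <;> simp [across, h]
  · rfl

variable (D) in
/-- The arc starting at the given end. -/
def arcAt : End → ℕ
  | .inl c => D.slot c.1 c.2
  | .inr j => j.2

theorem inward_across {x : ℕ} {i : Fin 4} (h : ¬ D.Inward x i) (S : Finset ℕ) :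
    D.Inward x (if x ∈ S then ![1, 0, 3, 2] i else ![3, 2, 1, 0] i) := by
  simp only [DiagramCode.Inward] at h ⊢
  by_cases hS : x ∈ S <;> fin_cases i <;> simp_all

theorem Head.tail_across {e : ℕ} {l : End} (h : D.Head e l) (S : Finset ℕ) :
    D.Tail (D.arcAt (across S l)) (across S l) := by
  rcases l with ⟨x, i⟩ | j
  · refine ⟨h.1, rfl, ?_⟩
    have h2 := h.2.2
    simp only [DiagramCode.Inward] at h2 ⊢
    by_cases hS : x ∈ S <;> fin_cases i <;> simp_all
  · exact ⟨h.1, rfl⟩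

theorem Tail.mem_arcs {e : ℕ} {l : End} (h : D.Tail e l) : e ∈ D.arcs := by
  rcases l with c | j
  · exact h.2.1 ▸ D.slot_mem _ h.1 _
  · exact h.2 ▸ (D.join_mem _ h.1).2

theorem Head.eq {e e' : ℕ} {l : End} (h : D.Head e l) (h' : D.Head e' l) : e = e' := by
  rcases l with c | j
  · exact h.2.1.symm.trans h'.2.1
  · exact h.2.symm.trans h'.2

variable (D) in
/-- The permutation of the arcs which sends each arc to the next one along its circle. -/
def next (S : Finset ℕ) : Equiv.Perm D.arcs :=
  Equiv.ofBijective
    (fun e => ⟨D.arcAt (across S (existsUnique_head e.2).choose),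
      ((existsUnique_head e.2).choose_spec.1.tail_across S).mem_arcs⟩) <| by
    rw [← Finite.injective_iff_bijective]
    intro e e' h
    have h1 := (existsUnique_head e.2).choose_spec.1
    have h1' := (existsUnique_head e'.2).choose_spec.1
    have h2 := h1.tail_across S
    have h2' := h1'.tail_across S
    rw [Subtype.mk.injEq] at h
    rw [← h] at h2'
    have h3 := (existsUnique_tail h2.mem_arcs).unique h2 h2'
    have h4 := congrArg (across S) h3
    rw [across_across, across_across] at h4
    rw [← h4] at h1'
    exact Subtype.ext (h1.eq h1')

theorem next_eq {S : Finset ℕ} {e f : D.arcs} {l : End} (h : D.Head e l)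
    (h' : D.Tail f (across S l)) : D.next S e = f := by
  have h1 := (existsUnique_head e.2).choose_spec.1
  have hl : (existsUnique_head e.2).choose = l := (existsUnique_head e.2).unique h1 h
  apply Subtype.ext
  change D.arcAt (across S (existsUnique_head e.2).choose) = f
  rw [hl]
  rcases l with c | j
  · exact h'.2.1
  · exact h'.2

theorem next_slot {S : Finset ℕ} {x : ℕ} (hx : x ∈ D.crossings) {i : Fin 4}
    (hi : D.Inward x i) : D.next S ⟨D.slot x i, D.slot_mem x hx i⟩ =
      ⟨D.slot x (if x ∈ S then ![1, 0, 3, 2] i else ![3, 2, 1, 0] i), D.slot_mem x hx _⟩ :=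
  have h : D.Head (D.slot x i) (.inl (x, i)) := ⟨hx, rfl, hi⟩
  next_eq h (h.tail_across S)

theorem next_join {S : Finset ℕ} {e f : D.arcs} (h : ((e : ℕ), (f : ℕ)) ∈ D.joins) :
    D.next S e = f :=
  have h' : D.Head e (.inr ((e : ℕ), (f : ℕ))) := ⟨h, rfl⟩
  next_eq h' (h'.tail_across S)

theorem glue_cross {S : Finset ℕ} {x : ℕ} (hx : x ∈ D.crossings) (i : Fin 4) :
    glue D S (D.slot x i)
      (D.slot x (if x ∈ S then ![1, 0, 3, 2] i else ![3, 2, 1, 0] i)) := by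
  have hcr := le_glueOn_of_mem (J := D.joins) (slot := D.slot) (S := S) hx
  change _ ≤ glue D S at hcr
  by_cases hS : x ∈ S
  · rw [cr_pos _ hS] at hcr
    have h01 := pr_le.1 (le_sup_left.trans hcr)
    have h23 := pr_le.1 (le_sup_right.trans hcr)
    fin_cases i <;> simp only [hS, if_true]
    exacts [h01, Setoid.symm' _ h01, h23, Setoid.symm' _ h23]
  · rw [cr_neg _ hS] at hcr
    have h03 := pr_le.1 (le_sup_left.trans hcr)
    have h21 := pr_le.1 (le_sup_right.trans hcr)
    fin_cases i <;> simp only [hS, if_false]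
    exacts [h03, Setoid.symm' _ h21, h21, Setoid.symm' _ h03]

theorem glue_next (S : Finset ℕ) (e : D.arcs) : glue D S e (D.next S e) := by
  obtain ⟨l, hl, -⟩ := existsUnique_head e.2
  have := hl.tail_across S
  rw [next_eq (f := ⟨_, this.mem_arcs⟩) hl this]
  rcases l with ⟨x, i⟩ | j
  · have h := glue_cross (S := S) hl.1 i
    rw [hl.2.1] at h
    exact h
  · have : pr j.1 j.2 ≤ glue D S :=
      (le_iSup₂_of_le (f := fun j (_ : j ∈ D.joins) => pr j.1 j.2) _ hl.1 le_rfl).trans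
        le_sup_left
    have h := pr_le.1 this
    rw [hl.2] at h
    exact h

theorem glue_iff_sameCycle (S : Finset ℕ) (e f : D.arcs) :
    glue D S e f ↔ (D.next S).SameCycle e f := by
  constructor
  · intro h
    obtain ⟨he, hf, h'⟩ := (D.sameCircle_iff S e f).2 ⟨e.2, f.2, h⟩
    have key : ∀ u v : D.arcs, Relation.EqvGen (fun e f : D.arcs => D.Glued S e f) u v →
        (D.next S).SameCycle u v := by
      have aux : ∀ (x : ℕ) (hx : x ∈ D.crossings) (i j : Fin 4),
          (if x ∈ S then ![1, 0, 3, 2] i else ![3, 2, 1, 0] i) = j → ∀ u v : D.arcs,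
          (u : ℕ) = D.slot x i → (v : ℕ) = D.slot x j → (D.next S).SameCycle u v := by
        rintro x hx i j hij ⟨u, hu⟩ ⟨v, hv⟩ huv hv'
        dsimp only at huv hv'
        subst huv
        subst hv'
        by_cases hi : D.Inward x i
        · have := next_slot (S := S) hx hi
          simp only [hij] at this
          rw [← this]
          exact Equiv.Perm.sameCycle_apply_right.2 (Equiv.Perm.SameCycle.refl _ _)
        · have hj : D.Inward x j := hij ▸ inward_across hi S
          have hji : (if x ∈ S then ![1, 0, 3, 2] j else ![3, 2, 1, 0] j) = i := by
            rw [← hij]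
            by_cases hS : x ∈ S <;> fin_cases i <;> simp [hS]
          have := next_slot (S := S) hx hj
          simp only [hji] at this
          rw [← this]
          exact Equiv.Perm.sameCycle_apply_left.2 (Equiv.Perm.SameCycle.refl _ _)
      intro u v huv
      induction huv with
      | rel u v h =>
        rcases h with h | ⟨x, hx, h⟩
        · rw [← next_join (S := S) h]
          exact Equiv.Perm.sameCycle_apply_right.2 (Equiv.Perm.SameCycle.refl _ _)
        · split_ifs at h with hS
          · rcases h with ⟨h, h'⟩ | ⟨h, h'⟩
            · exact aux x hx 0 1 (by simp [hS]) u v h h'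
            · exact aux x hx 2 3 (by simp [hS]) u v h h'
          · rcases h with ⟨h, h'⟩ | ⟨h, h'⟩
            · exact aux x hx 0 3 (by simp [hS]) u v h h'
            · exact aux x hx 2 1 (by simp [hS]) u v h h'
      | refl => exact Equiv.Perm.SameCycle.refl _ _
      | symm _ _ _ ih => exact ih.symm
      | trans _ _ _ _ _ ih ih' => exact ih.trans ih'
    exact key _ _ h'
  · rintro ⟨k, rfl⟩
    induction k using Int.induction_on with
    | zero => exact Setoid.refl' _ _
    | succ k ih =>
      rw [add_comm, zpow_add, zpow_one, Equiv.Perm.mul_apply]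
      exact Setoid.trans' _ ih (glue_next S _)
    | pred k ih =>
      refine Setoid.trans' _ ih (Setoid.symm' _ ?_)
      have := glue_next S ((D.next S ^ (-(k : ℤ) - 1)) e)
      rwa [← Equiv.Perm.mul_apply, ← zpow_one_add, add_sub_cancel] at this

theorem glue_crossing_xor {S : Finset ℕ} {w : ℕ} (hw : w ∈ D.crossings) (hS : w ∉ S) :
    glue D S (D.slot w 0) (D.slot w 1) ↔ ¬ glue D (insert w S) (D.slot w 0) (D.slot w 3) := by
  have key : ∀ i : Fin 4, D.Inward w i → (glue D S (D.slot w i) (D.slot w (i + 2)) ↔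
      ¬ glue D (insert w S) (D.slot w i) (D.slot w (i + 2))) := by
    intro i hi
    have hi2 : D.Inward w (i + 2) := by
      simp only [DiagramCode.Inward] at hi ⊢
      fin_cases i <;> simp_all
    set a : D.arcs := ⟨D.slot w i, D.slot_mem w hw i⟩
    set c : D.arcs := ⟨D.slot w (i + 2), D.slot_mem w hw (i + 2)⟩
    have ha : D.Head a (.inl (w, i)) := ⟨hw, rfl, hi⟩
    have hc : D.Head c (.inl (w, i + 2)) := ⟨hw, rfl, hi2⟩
    have hac : a ≠ c := by
      intro h
      rw [← h] at hc
      have := (existsUnique_head a.2).unique ha hc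
      simp at this
    have hnext : D.next (insert w S) = D.next S * Equiv.swap a c := by
      ext1 e
      rw [Equiv.Perm.mul_apply]
      by_cases hea : e = a
      · rw [hea, Equiv.swap_apply_left, next_slot hw hi, next_slot hw hi2]
        fin_cases i <;> simp [hS]
      · by_cases hec : e = c
        · rw [hec, Equiv.swap_apply_right, next_slot hw hi, next_slot hw hi2]
          fin_cases i <;> simp [hS]
        · rw [Equiv.swap_apply_of_ne_of_ne hea hec]
          obtain ⟨l, hl, -⟩ := existsUnique_head e.2
          have hl' : across (insert w S) l = across S l := by
            rcases l with ⟨x, j⟩ | j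
            · have hxw : x ≠ w := by
                rintro rfl
                have hj := hl.2.2
                have : j = i ∨ j = i + 2 := by
                  simp only [DiagramCode.Inward] at hi hj
                  by_cases ho : D.overIn x = true <;> fin_cases i <;> fin_cases j <;> simp_all
                rcases this with rfl | rfl
                · exact hea (Subtype.ext hl.2.1.symm)
                · exact hec (Subtype.ext hl.2.1.symm)
              simp [across, hxw]
            · rfl
          have ht := hl.tail_across S
          rw [next_eq (f := ⟨_, ht.mem_arcs⟩) hl ht]
          rw [← hl'] at ht
          rw [next_eq (f := ⟨_, ht.mem_arcs⟩) hl ht]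
          exact Subtype.ext (by simp only [hl'])
    have := sameCycle_iff_not_sameCycle_mul_swap (D.next S) hac
    rw [← hnext, ← glue_iff_sameCycle, ← glue_iff_sameCycle] at this
    exact this
  have g0 := glue_cross (S := S) hw 0
  have g1 := glue_cross (S := S) hw 1
  have g0' := glue_cross (S := insert w S) hw 0
  have g3' := glue_cross (S := insert w S) hw 3
  simp only [hS, if_false, Finset.mem_insert_self, if_true] at g0 g1 g0' g3'
  change glue D S (D.slot w 0) (D.slot w 3) at g0
  change glue D S (D.slot w 1) (D.slot w 2) at g1
  change glue D _ (D.slot w 0) (D.slot w 1) at g0'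
  change glue D _ (D.slot w 3) (D.slot w 2) at g3'
  by_cases h0 : D.Inward w 0
  · have := key 0 h0
    change glue D S (D.slot w 0) (D.slot w 2) ↔
      ¬ glue D (insert w S) (D.slot w 0) (D.slot w 2) at this
    have e1 : glue D S (D.slot w 0) (D.slot w 1) ↔ glue D S (D.slot w 0) (D.slot w 2) :=
      ⟨fun h => Setoid.trans' _ h g1, fun h => Setoid.trans' _ h (Setoid.symm' _ g1)⟩
    have e2 : glue D (insert w S) (D.slot w 0) (D.slot w 3) ↔
        glue D (insert w S) (D.slot w 0) (D.slot w 2) :=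
      ⟨fun h => Setoid.trans' _ h g3', fun h => Setoid.trans' _ h (Setoid.symm' _ g3')⟩
    rw [e1, e2, this]
  · have h1 : D.Inward w 1 := by
      simp only [DiagramCode.Inward] at h0 ⊢
      simp_all
    have := key 1 h1
    change glue D S (D.slot w 1) (D.slot w 3) ↔
      ¬ glue D (insert w S) (D.slot w 1) (D.slot w 3) at this
    have e1 : glue D S (D.slot w 0) (D.slot w 1) ↔ glue D S (D.slot w 1) (D.slot w 3) :=
      ⟨fun h => Setoid.trans' _ (Setoid.symm' _ h) g0,
        fun h => Setoid.trans' _ g0 (Setoid.symm' _ h)⟩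
    have e2 : glue D (insert w S) (D.slot w 0) (D.slot w 3) ↔
        glue D (insert w S) (D.slot w 1) (D.slot w 3) :=
      ⟨fun h => Setoid.trans' _ (Setoid.symm' _ g0') h, fun h => Setoid.trans' _ g0' h⟩
    rw [e1, e2, this]

theorem surg_crossing {S : Finset ℕ} {w : ℕ} (hw : w ∈ D.crossings) (hS : w ∉ S) :
    Surg (glue D S) (glue D (insert w S)) (D.slot w 0) (D.slot w 3) (D.slot w 1) := by
  have hX : D.crossings = insert w (D.crossings.erase w) := (Finset.insert_erase hw).symm
  have hM : glueOn D.joins D.slot (D.crossings.erase w) (insert w S) =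
      glueOn D.joins D.slot (D.crossings.erase w) S :=
    glueOn_congr fun x hx => ⟨rfl, by simp [(Finset.mem_erase.1 hx).1]⟩
  refine surg_of_xor (M := glueOn D.joins D.slot (D.crossings.erase w) S) (c := D.slot w 2) ?_ ?_
    (glue_crossing_xor hw hS)
  · rw [glue, hX, glueOn_insert_crossing, cr_neg _ hS, ← hX, sup_assoc]
  · rw [glue, hX, glueOn_insert_crossing, hM, cr_pos _ (Finset.mem_insert_self _ _), ← hX,
      sup_assoc]

end LinkDiagram

/-! ### Surgery maps on generators -/

section Evaluation

variable {K : Type u} {R : Type v} [CommRing K] [CommRing R] [Algebra K R]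

/-- The arc `e` if it is an arc of `D`, and some other arc of `D` if not. -/
def LinkDiagram.arc (D : LinkDiagram) (e : ℕ) : ℕ :=
  if e ∈ D.arcs then e else if h : D.arcs.Nonempty then h.choose else e

theorem LinkDiagram.arc_of_mem {D : LinkDiagram} {e : ℕ} (h : e ∈ D.arcs) : D.arc e = e :=
  if_pos h

theorem LinkDiagram.arc_mem {D : LinkDiagram} (h : D.arcs.Nonempty) (e : ℕ) :
    D.arc e ∈ D.arcs := by
  unfold LinkDiagram.arc
  split_ifs with he
  · exact he
  · exact h.choose_spec

theorem pt_of_mem {D : LinkDiagram} {S : Finset ℕ} {e : ℕ} (h : e ∈ D.arcs) (r : R) :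
    pt (K := K) D S e r = PiTensorProduct.singleAlgHom (R := K) (A := fun _ : D.Circle S => R)
      (Quotient.mk _ ⟨e, h⟩) r := by
  simp [pt, h]

theorem pt_mul {D : LinkDiagram} {S : Finset ℕ} {e : ℕ} (h : e ∈ D.arcs) (r r' : R) :
    pt (K := K) D S e (r * r') = pt (K := K) D S e r * pt (K := K) D S e r' := by
  simp only [pt_of_mem h, map_mul]

theorem pt_one {D : LinkDiagram} {S : Finset ℕ} {e : ℕ} (h : e ∈ D.arcs) :
    pt (K := K) (R := R) D S e 1 = 1 := by
  rw [pt_of_mem h, map_one]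

theorem pt_congr {D : LinkDiagram} {S : Finset ℕ} {e f : ℕ} (h : D.SameCircle S e f) :
    pt (K := K) (R := R) D S e = pt D S f := by
  obtain ⟨he, hf, h⟩ := h
  ext r
  rw [pt_of_mem he, pt_of_mem hf, Quotient.sound h]

/-- The evaluation of polynomials in `Φ(D_S)`: the variable `e` is sent to `α` in the factor of the
circle through the arc `e`. -/
def ev (α : R) (D : LinkDiagram) (S : Finset ℕ) : MvPolynomial ℕ K →ₐ[K] Phi K R D S :=
  aeval fun e => pt D S (D.arc e) α

variable {α : R} (q : QuadData K α)

theorem pt_eq_el {D : LinkDiagram} {S : Finset ℕ} {e : ℕ} (h : e ∈ D.arcs) (r : R) :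
    pt (K := K) D S e r = ev α D S (q.el e r) := by
  rw [ev, QuadData.aeval_el, LinkDiagram.arc_of_mem h]
  conv_lhs => rw [q.repr r, map_add, map_smul, map_smul, pt_one h]
  simp [Algebra.smul_def]

theorem isModel_ev {D : LinkDiagram} (S : Finset ℕ) (h : D.arcs.Nonempty) :
    q.IsModel (glue D S) fun e => pt (K := K) D S (D.arc e) α := by
  refine ⟨fun e => ?_, fun {e f} hef => ?_⟩
  · have he := LinkDiagram.arc_mem h e
    rw [← pt_mul he, q.mul_self, map_sub, map_smul, map_smul, pt_one he]
    simp [Algebra.smul_def]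
  · rcases D.eq_or_sameCircle_of_glue hef with rfl | h'
    · rfl
    · rw [LinkDiagram.arc_of_mem h'.1, LinkDiagram.arc_of_mem h'.2.1, pt_congr h']

theorem ev_congr {D : LinkDiagram} {S : Finset ℕ} (h : D.arcs.Nonempty) {b b' : MvPolynomial ℕ K}
    (hb : q.Cong (glue D S) b b') : ev α D S b = ev α D S b' :=
  hb _ _ (isModel_ev q S h)

variable [Coalgebra K R]

theorem coproductAt_eq {ω : Rˣ} (hω : IsTwisting (K := K) α ω) {D : LinkDiagram} (S : Finset ℕ)
    {e f : ℕ} (he : e ∈ D.arcs) (hf : f ∈ D.arcs) :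
    coproductAt (K := K) (R := R) D S e f = ev α D S (q.cop ω e f) := by
  have h : D.arcs.Nonempty := ⟨e, he⟩
  rw [coproductAt, hω.comul_eq, map_sub, map_sub, TensorProduct.map_tmul, TensorProduct.map_tmul,
    LinearMap.mul'_apply, LinearMap.mul'_apply, one_mul, pt_one he, one_mul, pt_mul hf, q.conj_eq,
    map_sub, map_smul, pt_one he, pt_eq_el q hf, ← map_one (ev α D S), QuadData.cop]
  rw [pt_eq_el q he, pt_eq_el q hf, q.el_gen, q.el_gen]
  simp only [map_mul, map_sub, map_add, map_one, Algebra.smul_def, mul_one]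
  rw [show MvPolynomial.C q.s = algebraMap K (MvPolynomial ℕ K) q.s from rfl, AlgHom.commutes]
  ring

theorem surgery_apply {ω : Rˣ} (hω : IsTwisting (K := K) α ω) {D : LinkDiagram} {S : Finset ℕ}
    {D' : LinkDiagram} {S' : Finset ℕ} {O : Finset ℕ} (g : R →ₗ[K] Phi K R D' S') {e f : ℕ}
    (he : e ∈ D'.arcs) (hf : f ∈ D'.arcs) (v : Phi K R D S) :
    surgery D S D' S' O g e f v =
      ev α D' S' (q.cc ω (glue D' S') e f) * slide D S D' S' O g v := by
  rw [surgery, LinearMap.comp_apply, LinearMap.mulLeft_apply]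
  congr 1
  by_cases h : glue D' S' e f
  · rw [if_pos ((D'.sameCircle_iff S' e f).2 ⟨he, hf, h⟩), q.cc_pos h, map_one]
  · rw [if_neg fun h' => h ((D'.sameCircle_iff S' e f).1 h').2.2, q.cc_neg h,
      coproductAt_eq q hω S' he hf]

end Evaluation

section Slide

variable {K : Type u} {R : Type v} [CommRing K] [CommRing R] [Algebra K R]

open Classical in
/-- The factor of `slide` at the circle `c`. -/
def slideFactor (D : LinkDiagram) (S : Finset ℕ) (D' : LinkDiagram) (S' : Finset ℕ)
    (O : Finset ℕ) (g : R →ₗ[K] Phi K R D' S') (c : D.Circle S) : R →ₗ[K] Phi K R D' S' :=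
  if h : ∃ e : D.arcs, (e : ℕ) ∈ O ∧ Quotient.mk _ e = c then pt D' S' (h.choose : ℕ) else g

theorem slide_tprod (D : LinkDiagram) (S : Finset ℕ) (D' : LinkDiagram) (S' : Finset ℕ)
    (O : Finset ℕ) (g : R →ₗ[K] Phi K R D' S') (r : D.Circle S → R) :
    slide D S D' S' O g (PiTensorProduct.tprod K r) =
      ∏ c, slideFactor D S D' S' O g c (r c) := by
  rw [slide, PiTensorProduct.lift.tprod]
  rfl

variable {D D' : LinkDiagram} {S S' O : Finset ℕ} {g : R →ₗ[K] Phi K R D' S'}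

theorem slideFactor_of_mem {e : ℕ} (he : e ∈ D.arcs) (heO : e ∈ O) :
    ∃ e' ∈ O, glue D S e e' ∧
      slideFactor D S D' S' O g (Quotient.mk _ ⟨e, he⟩) = pt D' S' e' := by
  have h : ∃ e' : D.arcs, (e' : ℕ) ∈ O ∧
      (Quotient.mk (D.circleSetoid S) e') = Quotient.mk _ ⟨e, he⟩ := ⟨⟨e, he⟩, heO, rfl⟩
  refine ⟨h.choose, h.choose_spec.1, ?_, ?_⟩
  · have := Quotient.exact h.choose_spec.2
    exact Setoid.symm' _ ((D.sameCircle_iff S _ _).1 ⟨h.choose.2, he, this⟩).2.2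
  · rw [slideFactor, dif_pos h]

theorem slideFactor_one (hO' : O ⊆ D'.arcs) {e : ℕ} (he : e ∈ D.arcs) {a : ℕ} (ha : a ∈ O)
    (hOD : O ⊆ D.arcs) (h : glue D S e a) :
    slideFactor D S D' S' O g (Quotient.mk _ ⟨e, he⟩) 1 = 1 := by
  have : (Quotient.mk (D.circleSetoid S) ⟨e, he⟩) = Quotient.mk _ ⟨a, hOD ha⟩ := by
    obtain ⟨_, _, h'⟩ := (D.sameCircle_iff S e a).2 ⟨he, hOD ha, h⟩
    exact Quotient.sound h'
  obtain ⟨e', he', -, h'⟩ := slideFactor_of_mem (S := S) (S' := S') (g := g) (hOD ha) ha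
  rw [this, h', pt_one (hO' he')]

theorem slide_pt_mul (hO' : O ⊆ D'.arcs) {e e' : ℕ} (he : e ∈ D.arcs) (he' : e' ∈ O)
    (hf : slideFactor D S D' S' O g (Quotient.mk _ ⟨e, he⟩) = pt D' S' e') (r : R)
    (v : Phi K R D S) :
    slide D S D' S' O g (pt D S e r * v) = pt D' S' e' r * slide D S D' S' O g v := by
  induction v using PiTensorProduct.induction_on with
  | smul_tprod t f =>
    rw [mul_smul_comm, map_smul, map_smul, mul_smul_comm]
    congr 1
    rw [pt_of_mem he, PiTensorProduct.singleAlgHom_apply, PiTensorProduct.tprod_mul_tprod,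
      slide_tprod, slide_tprod]
    set c₀ : D.Circle S := Quotient.mk _ ⟨e, he⟩
    rw [← Finset.mul_prod_erase _ _ (Finset.mem_univ c₀),
      ← Finset.mul_prod_erase Finset.univ (fun c => slideFactor D S D' S' O g c (f c))
        (Finset.mem_univ c₀), ← mul_assoc]
    congr 1
    · rw [hf, ← pt_mul (hO' he')]
      simp
    · refine Finset.prod_congr rfl fun c hc => ?_
      have hc' : c ≠ c₀ := (Finset.mem_erase.1 hc).1
      simp [hc']
  | add x y hx hy => rw [mul_add, map_add, hx, hy, map_add, mul_add]

variable {α : R}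

theorem mul_slide_ev_mul (q : QuadData K α) (hO : O ⊆ D.arcs) (hO' : O ⊆ D'.arcs) {t : Phi K R D' S'}
    (ht : ∀ a ∈ O, ∀ b ∈ O, glue D S a b →
      ev α D' S' (MvPolynomial.X a) * t = ev α D' S' (MvPolynomial.X b) * t)
    {b : MvPolynomial ℕ K} (hb : b ∈ supp K O) (v : Phi K R D S) :
    t * slide D S D' S' O g (ev α D S b * v) = ev α D' S' b * (t * slide D S D' S' O g v) := by
  rw [supp, MvPolynomial.supported_eq_adjoin_X] at hb
  induction hb using Algebra.adjoin_induction generalizing v with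
  | mem b hb =>
    obtain ⟨e, heO, rfl⟩ := hb
    have heO : e ∈ O := heO
    obtain ⟨e', he', hee', hf⟩ :=
      slideFactor_of_mem (S := S) (S' := S') (g := g) (hO heO) heO
    have h1 : ev (K := K) α D S (MvPolynomial.X e) = pt D S e α := by
      rw [pt_eq_el q (hO heO), q.el_gen]
    rw [h1, slide_pt_mul hO' (hO heO) he' hf, pt_eq_el q (hO' he'), q.el_gen]
    have h2 := ht e heO e' he' hee'
    rw [← mul_assoc, ← mul_assoc, mul_comm t, h2]
  | algebraMap r =>
    rw [AlgHom.commutes, AlgHom.commutes, ← Algebra.smul_def, ← Algebra.smul_def, map_smul,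
      mul_smul_comm]
  | add x y _ _ hx hy => rw [map_add, add_mul, map_add, mul_add, hx, hy, map_add, add_mul]
  | mul x y _ _ hx hy => rw [map_mul (ev α D S), mul_assoc, hx, hy, map_mul, mul_assoc]

/-- Each circle of `D_S` contains an arc in `O`. -/
def Covered (D : LinkDiagram) (S O : Finset ℕ) : Prop :=
  ∀ e ∈ D.arcs, ∃ a ∈ O, glue D S e a

/-- Each circle of `D_S` contains an arc in `O`, except the circle through `k`. -/
structure CoveredExcept (D : LinkDiagram) (S O : Finset ℕ) (k : ℕ) : Prop where
  mem : k ∈ D.arcs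
  not_glue : ∀ a ∈ O, ¬ glue D S k a
  cover : ∀ e ∈ D.arcs, glue D S e k ∨ ∃ a ∈ O, glue D S e a

theorem slide_one (hO : O ⊆ D.arcs) (hO' : O ⊆ D'.arcs) (hc : Covered D S O) :
    slide D S D' S' O g 1 = 1 := by
  rw [PiTensorProduct.one_def, slide_tprod]
  refine Finset.prod_eq_one fun c _ => ?_
  induction c using Quotient.inductionOn with
  | h e =>
    obtain ⟨a, ha, h⟩ := hc e e.2
    exact slideFactor_one hO' e.2 ha hO h

theorem slide_pt {k : ℕ} (hO : O ⊆ D.arcs) (hO' : O ⊆ D'.arcs) (hc : CoveredExcept D S O k)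
    (r : R) : slide D S D' S' O g (pt D S k r) = g r := by
  rw [pt_of_mem hc.mem, PiTensorProduct.singleAlgHom_apply, slide_tprod]
  rw [Finset.prod_eq_single (Quotient.mk _ ⟨k, hc.mem⟩)]
  · rw [slideFactor, dif_neg]
    · simp
    · rintro ⟨e, he, h⟩
      refine hc.not_glue e he (Setoid.symm' _ ?_)
      exact ((D.sameCircle_iff S _ _).1 ⟨e.2, hc.mem, Quotient.exact h⟩).2.2
  · intro c _ hck
    induction c using Quotient.inductionOn with
    | h e =>
      rcases hc.cover e e.2 with h | ⟨a, ha, h⟩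
      · refine absurd ?_ hck
        obtain ⟨_, _, h'⟩ := (D.sameCircle_iff S _ _).2 ⟨e.2, hc.mem, h⟩
        exact Quotient.sound h'
      · rw [MonoidHom.mulSingle_apply, Pi.mulSingle_eq_of_ne hck]
        exact slideFactor_one hO' e.2 ha hO h
  · intro h
    exact absurd (Finset.mem_univ _) h

/-- The elements `b β` with `b` a polynomial in the variables in `O` and `β` in `B` span
`Φ(D_S)`. -/
def Spans (α : R) (D : LinkDiagram) (S O : Finset ℕ) (B : Set (MvPolynomial ℕ K)) : Prop :=
  ⊤ ≤ Submodule.span K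
    {v : Phi K R D S | ∃ b ∈ supp K O, ∃ β ∈ B, v = ev α D S (b * β)}

theorem tprod_eq_prod (f : D.Circle S → R) : PiTensorProduct.tprod K f =
    ∏ c, PiTensorProduct.singleAlgHom (R := K) (A := fun _ : D.Circle S => R) c (f c) := by
  conv_lhs => rw [← Finset.univ_prod_mulSingle f, PiTensorProduct.tprod_prod]
  rfl

theorem Spans.of_tprod {B : Set (MvPolynomial ℕ K)} (h : ∀ f : D.Circle S → R,
    ∃ b ∈ supp K O, ∃ β ∈ B,
      PiTensorProduct.tprod K f = ev α D S (b * β)) : Spans α D S O B := by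
  intro v _
  induction v using PiTensorProduct.induction_on with
  | smul_tprod t f => exact Submodule.smul_mem _ _ (Submodule.subset_span (h f))
  | add x y hx hy => exact Submodule.add_mem _ (hx trivial) (hy trivial)

theorem exists_prod_eq_ev (q : QuadData K α) (hO : O ⊆ D.arcs) (C : Finset (D.Circle S))
    (hC : ∀ c ∈ C, ∃ (e : ℕ) (he : e ∈ D.arcs), c = Quotient.mk _ ⟨e, he⟩ ∧
      ∃ a ∈ O, glue D S e a) (f : D.Circle S → R) :
    ∃ b ∈ supp K O,
      ∏ c ∈ C, PiTensorProduct.singleAlgHom (R := K) (A := fun _ : D.Circle S => R) c (f c) =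
        ev α D S b := by
  have : ∀ c, ∃ b ∈ supp K O, c ∈ C →
      PiTensorProduct.singleAlgHom (R := K) (A := fun _ : D.Circle S => R) c (f c) =
        ev α D S b := by
    intro c
    by_cases hcC : c ∈ C
    · obtain ⟨e, he, hce, a, ha, hea⟩ := hC c hcC
      refine ⟨q.el a (f c), q.el_mem ha _, fun _ => ?_⟩
      rw [← pt_eq_el q (hO ha), ← pt_congr ((D.sameCircle_iff S e a).2 ⟨he, hO ha, hea⟩),
        pt_of_mem he, hce]
    · exact ⟨0, Subalgebra.zero_mem _, fun h => absurd h hcC⟩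
  choose b hb hbe using this
  refine ⟨∏ c ∈ C, b c, Subalgebra.prod_mem _ fun c _ => hb c, ?_⟩
  rw [map_prod]
  exact Finset.prod_congr rfl fun c hc => hbe c hc

theorem Covered.spans (q : QuadData K α) (hO : O ⊆ D.arcs) (hc : Covered D S O) :
    Spans (K := K) α D S O {1} := by
  refine Spans.of_tprod fun f => ?_
  obtain ⟨b, hb, h⟩ := exists_prod_eq_ev q (S := S) hO Finset.univ (fun c _ => by
    induction c using Quotient.inductionOn with
    | h e =>
      obtain ⟨a, ha, h⟩ := hc e e.2
      exact ⟨e, e.2, rfl, a, ha, h⟩) f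
  exact ⟨b, hb, 1, rfl, by rw [tprod_eq_prod, h, mul_one]⟩

theorem CoveredExcept.spans (q : QuadData K α) {k : ℕ} (hO : O ⊆ D.arcs) (hc : CoveredExcept D S O k) :
    Spans α D S O (Set.range (q.el k)) := by
  refine Spans.of_tprod fun f => ?_
  set c₀ : D.Circle S := Quotient.mk _ ⟨k, hc.mem⟩ with hc₀
  obtain ⟨b, hb, h⟩ := exists_prod_eq_ev q (S := S) hO (Finset.univ.erase c₀) (fun c hcc => by
    induction c using Quotient.inductionOn with
    | h e =>
      rcases hc.cover e e.2 with h | ⟨a, ha, h⟩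
      · refine absurd ?_ (Finset.mem_erase.1 hcc).1
        obtain ⟨_, _, h'⟩ := (D.sameCircle_iff S _ _).2 ⟨e.2, hc.mem, h⟩
        exact Quotient.sound h'
      · exact ⟨e, e.2, rfl, a, ha, h⟩) f
  refine ⟨b, hb, _, ⟨f c₀, rfl⟩, ?_⟩
  rw [tprod_eq_prod, ← Finset.mul_prod_erase _ _ (Finset.mem_univ c₀), h, mul_comm, map_mul,
    ← pt_eq_el q hc.mem, pt_of_mem hc.mem]

/-- A slide between resolved diagrams whose circles all meet `O`. -/
theorem slide_ev (q : QuadData K α) (hO : O ⊆ D.arcs) (hO' : O ⊆ D'.arcs) (hc : Covered D S O)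
    (h : ∀ a ∈ O, ∀ b ∈ O, glue D S a b → glue D' S' a b)
    {b : MvPolynomial ℕ K} (hb : b ∈ supp K O) :
    slide D S D' S' O g (ev α D S b) = ev α D' S' b := by
  have := mul_slide_ev_mul q (g := g) (t := 1) hO hO' (fun a ha b hb hab => by
    rw [ev_congr q ⟨a, hO' ha⟩]
    have := q.el_congr (h a ha b hb hab) α
    simpa using this) hb 1
  simpa [slide_one hO hO' hc] using this

/-- A slide which applies `g` to the factor of the circle through `k`. -/
theorem slide_ev_circle (q : QuadData K α) {k : ℕ} (hO : O ⊆ D.arcs) (hO' : O ⊆ D'.arcs)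
    (hc : CoveredExcept D S O k)
    (h : ∀ a ∈ O, ∀ b ∈ O, glue D S a b → glue D' S' a b)
    {b : MvPolynomial ℕ K} (hb : b ∈ supp K O) (r : R) :
    slide D S D' S' O g (ev α D S (b * q.el k r)) = ev α D' S' b * g r := by
  have := mul_slide_ev_mul q (g := g) (t := 1) hO hO' (fun a ha b hb hab => by
    rw [ev_congr q ⟨a, hO' ha⟩]
    have := q.el_congr (h a ha b hb hab) α
    simpa using this) hb (pt D S k r)
  rw [slide_pt hO hO' hc] at this
  rw [map_mul, ← pt_eq_el q hc.mem]
  simpa using this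

theorem ev_X_mul_cc (q : QuadData K α) {ω : Rˣ} {e f a b : ℕ} (ha : a ∈ D'.arcs)
    (h : (glue D' S' ⊔ pr e f) a b) :
    ev α D' S' (MvPolynomial.X a) * ev α D' S' (q.cc ω (glue D' S') e f) =
      ev α D' S' (MvPolynomial.X b) * ev α D' S' (q.cc ω (glue D' S') e f) := by
  have := (isModel_ev q S' ⟨a, ha⟩).mul_cc ω h
  simpa [ev] using this

variable [Coalgebra K R]

/-- A surgery between resolved diagrams whose circles all meet `O`. -/
theorem surgery_ev (q : QuadData K α) {ω : Rˣ} (hω : IsTwisting (K := K) α ω) (hO : O ⊆ D.arcs) (hO' : O ⊆ D'.arcs)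
    (hc : Covered D S O) {e f : ℕ} (he : e ∈ D'.arcs) (hf : f ∈ D'.arcs)
    (h : ∀ a ∈ O, ∀ b ∈ O, glue D S a b → (glue D' S' ⊔ pr e f) a b)
    {b : MvPolynomial ℕ K} (hb : b ∈ supp K O) :
    surgery D S D' S' O g e f (ev α D S b) = ev α D' S' (b * q.cc ω (glue D' S') e f) := by
  have := mul_slide_ev_mul q (g := g) hO hO'
    (fun a ha b hb hab => ev_X_mul_cc q (ω := ω) (hO' ha) (h a ha b hb hab)) hb 1
  rw [surgery_apply q hω _ he hf, ← mul_one (ev α D S b), this, slide_one hO hO' hc, mul_one,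
    map_mul]

/-- A surgery which applies `g` to the factor of the circle through `k`. -/
theorem surgery_ev_circle (q : QuadData K α) {ω : Rˣ} (hω : IsTwisting (K := K) α ω) {k : ℕ} (hO : O ⊆ D.arcs)
    (hO' : O ⊆ D'.arcs) (hc : CoveredExcept D S O k) {e f : ℕ} (he : e ∈ D'.arcs)
    (hf : f ∈ D'.arcs) (h : ∀ a ∈ O, ∀ b ∈ O, glue D S a b → (glue D' S' ⊔ pr e f) a b)
    {b : MvPolynomial ℕ K} (hb : b ∈ supp K O) (r : R) :
    surgery D S D' S' O g e f (ev α D S (b * q.el k r)) =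
      ev α D' S' (b * q.cc ω (glue D' S') e f) * g r := by
  have := mul_slide_ev_mul q (g := g) hO hO'
    (fun a ha b hb hab => ev_X_mul_cc q (ω := ω) (hO' ha) (h a ha b hb hab)) hb (pt D S k r)
  rw [surgery_apply q hω _ he hf, map_mul, ← pt_eq_el q hc.mem, this, slide_pt hO hO' hc, map_mul,
    mul_assoc]

theorem cap_eq (D : LinkDiagram) (S : Finset ℕ) (t r : R) : cap (K := K) D S t r =
    algebraMap K (Phi K R D S) (Coalgebra.counit (R := K) (r * t)) := by
  simp [cap]

end Slide

/-! ### Signs -/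

section Signs

theorem wedgeSign_mul_self (l : List ℕ) (S : Finset ℕ) : wedgeSign l S * wedgeSign l S = 1 := by
  induction l with
  | nil => rfl
  | cons x l ih =>
    rw [wedgeSign, mul_mul_mul_comm, ih, mul_one, ← mul_pow]
    norm_num

theorem wedgeSign_swap {x y : ℕ} {l : List ℕ} {S : Finset ℕ} (hxy : x ≠ y)
    (hx : x ∉ l.toFinset ∪ S) (hy : y ∉ l.toFinset ∪ S) :
    wedgeSign (x :: y :: l) S = -wedgeSign (y :: x :: l) S := by
  wlog h : x < y generalizing x y
  · have h' : y < x := lt_of_le_of_ne (not_lt.1 h) hxy.symm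
    rw [this hxy.symm hy hx h', neg_neg]
  have e1 : {t ∈ (y :: l).toFinset ∪ S | t < x} = {t ∈ l.toFinset ∪ S | t < x} := by
    ext t
    simp only [List.toFinset_cons, Finset.insert_union, Finset.mem_filter, Finset.mem_insert]
    constructor
    · rintro ⟨rfl | h1, h2⟩
      · omega
      · exact ⟨h1, h2⟩
    · rintro ⟨h1, h2⟩
      exact ⟨Or.inr h1, h2⟩
  have e2 : {t ∈ (x :: l).toFinset ∪ S | t < y} = insert x {t ∈ l.toFinset ∪ S | t < y} := by
    ext t
    simp only [List.toFinset_cons, Finset.insert_union, Finset.mem_filter, Finset.mem_insert]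
    constructor
    · rintro ⟨rfl | h1, h2⟩
      · exact Or.inl rfl
      · exact Or.inr ⟨h1, h2⟩
    · rintro (rfl | ⟨h1, h2⟩)
      · exact ⟨Or.inl rfl, h⟩
      · exact ⟨Or.inr h1, h2⟩
  simp only [wedgeSign]
  rw [e1, e2, Finset.card_insert_of_notMem (fun h' => hx (Finset.mem_filter.1 h').1), pow_succ]
  ring

theorem wedgeSign_cons_out {w : ℕ} {l : List ℕ} {S : Finset ℕ} (hl : l.Nodup)
    (hS : ∀ x ∈ l, x ∉ S) (hw : w ∉ l) (hwS : w ∉ S) :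
    wedgeSign (w :: l) S = (-1) ^ l.length * wedgeSign [w] S * wedgeSign l (insert w S) := by
  induction l with
  | nil => simp [wedgeSign]
  | cons x l ih =>
    rw [List.nodup_cons] at hl
    simp only [List.mem_cons, not_or, forall_eq_or_imp] at hS hw
    rw [wedgeSign_swap hw.1 (by simp [hw.2, hwS]) (by simp [hl.1, hS.1]), wedgeSign,
      ih hl.2 hS.2 hw.2, List.length_cons, pow_succ,
      show wedgeSign (x :: l) (insert w S) = (-1) ^ Finset.card
        {y ∈ l.toFinset ∪ insert w S | y < x} * wedgeSign l (insert w S) from rfl,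
      List.toFinset_cons, Finset.insert_union, Finset.union_insert]
    ring

end Signs

/-! ### Generators of the complex -/

section Generators

variable {K : Type u} {R : Type v} [CommRing K] [CommRing R] [Algebra K R]

variable (K) in
/-- The element `l ∧ e_S ⊗ b` of `kh(D)`. -/
def W (α : R) (D : LinkDiagram) (l : List ℕ) (S : Finset ℕ) : MvPolynomial ℕ K →ₗ[K] Kh K R D :=
  wedge D l S ∘ₗ (ev α D (l.toFinset ∪ S)).toLinearMap

variable {α : R} {D D' : LinkDiagram}

theorem zsmul_hom_apply {M : Type*} [AddCommGroup M] [Module K M] (n : ℤ)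
    (f : M →ₗ[K] Kh K R D) (v : M) : (n • f) v = n • f v := rfl

theorem zsmul_sum_kh {ι : Type*} (n : ℤ) (s : Finset ι) (f : ι → Kh K R D) :
    n • ∑ i ∈ s, f i = ∑ i ∈ s, n • f i := map_sum (zsmulAddGroupHom n) f s

theorem wedge_ev (l : List ℕ) (S : Finset ℕ) (b : MvPolynomial ℕ K) :
    wedge (K := K) (R := R) D l S (ev α D (l.toFinset ∪ S) b) = W K α D l S b := rfl

theorem W_eq_lof {l : List ℕ} {S : Finset ℕ} (h : l.toFinset ∪ S ⊆ D.crossings)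
    (b : MvPolynomial ℕ K) : W K α D l S b = wedgeSign l S •
      DirectSum.lof K (State D) (fun S => Phi K R D S.1) ⟨l.toFinset ∪ S, h⟩ (ev α D _ b) := by
  rw [← wedge_ev, wedge, dif_pos h]; rfl

theorem W_of_not_subset {l : List ℕ} {S : Finset ℕ} (h : ¬ l.toFinset ∪ S ⊆ D.crossings)
    (b : MvPolynomial ℕ K) : W K α D l S b = 0 := by
  rw [← wedge_ev, wedge, dif_neg h]; rfl

open Classical in
/-- The element `e_S ⊗ b` of `kh(D)`. -/
def genE (α : R) (D : LinkDiagram) (S : Finset ℕ) (b : MvPolynomial ℕ K) : Kh K R D :=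
  if h : S ⊆ D.crossings then
    DirectSum.lof K (State D) (fun S => Phi K R D S.1) ⟨S, h⟩ (ev α D S b)
  else 0

theorem W_eq_genE (l : List ℕ) (S : Finset ℕ) (b : MvPolynomial ℕ K) :
    W K α D l S b = wedgeSign l S • genE α D (l.toFinset ∪ S) b := by
  by_cases h : l.toFinset ∪ S ⊆ D.crossings
  · rw [W_eq_lof h, genE, dif_pos h]
  · rw [W_of_not_subset h, genE, dif_neg h, zsmul_zero]

theorem W_cons (w : ℕ) (l : List ℕ) (S : Finset ℕ) (b : MvPolynomial ℕ K) :
    W K α D (w :: l) S b = wedgeSign l S • W K α D [w] (l.toFinset ∪ S) b := by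
  rw [W_eq_genE, W_eq_genE, smul_smul]
  congr 1
  · simp [wedgeSign, mul_comm]
  · simp

theorem W_swap {x y : ℕ} {l : List ℕ} {S : Finset ℕ} (hxy : x ≠ y)
    (hx : x ∉ l.toFinset ∪ S) (hy : y ∉ l.toFinset ∪ S) (b : MvPolynomial ℕ K) :
    W K α D (x :: y :: l) S b = -W K α D (y :: x :: l) S b := by
  rw [W_eq_genE, W_eq_genE, wedgeSign_swap hxy hx hy, neg_smul]
  simp [Finset.insert_comm]

theorem W_cons_out {w : ℕ} {l : List ℕ} {S : Finset ℕ} (hl : l.Nodup)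
    (hS : ∀ x ∈ l, x ∉ S) (hw : w ∉ l) (hwS : w ∉ S) (b : MvPolynomial ℕ K) :
    W K α D (w :: l) S b = ((-1) ^ l.length * wedgeSign [w] S) • W K α D l (insert w S) b := by
  rw [W_eq_genE, W_eq_genE, wedgeSign_cons_out hl hS hw hwS, smul_smul]
  simp

theorem W_congr (q : QuadData K α) (h : D.arcs.Nonempty) {l : List ℕ} {S : Finset ℕ}
    {b b' : MvPolynomial ℕ K} (hb : q.Cong (glue D (l.toFinset ∪ S)) b b') :
    W K α D l S b = W K α D l S b' := by
  rw [← wedge_ev, ← wedge_ev, ev_congr q h hb]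

theorem filter_mem_union {L l : List ℕ} (hL : L.Nodup) (hl : l.Sublist L) {S : Finset ℕ}
    (hS : ∀ x ∈ L, x ∉ S) : L.filter (· ∈ l.toFinset ∪ S) = l := by
  have : ∀ L l : List ℕ, l.Sublist L → L.Nodup → L.filter (· ∈ l) = l := by
    intro L l h
    induction h with
    | slnil => intro; rfl
    | @cons l L a h ih =>
      intro hL
      rw [List.nodup_cons] at hL
      rw [List.filter_cons_of_neg (by simpa using fun ha => hL.1 (h.subset ha)), ih hL.2]
    | @cons_cons l L a h ih =>
      intro hL
      rw [List.nodup_cons] at hL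
      rw [List.filter_cons_of_pos (by simp)]
      congr 1
      conv_rhs => rw [← ih hL.2]
      refine List.filter_congr fun x hx => ?_
      have : x ≠ a := by rintro rfl; exact hL.1 hx
      simp [this]
  conv_rhs => rw [← this L l hl hL]
  refine List.filter_congr fun x hx => ?_
  simp [hS x hx]

theorem onStates_W {L l : List ℕ} (hL : L.Nodup) (hl : l.Sublist L) {S : Finset ℕ}
    (hS : ∀ x ∈ L, x ∉ S) (h : l.toFinset ∪ S ⊆ D.crossings)
    (φ : (S₁ S : Finset ℕ) → Phi K R D S₁ →ₗ[K] Kh K R D') (b : MvPolynomial ℕ K) :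
    onStates L φ (W K α D l S b) = φ (l.toFinset ∪ S) S (ev α D (l.toFinset ∪ S) b) := by
  have hS' : (l.toFinset ∪ S) \ L.toFinset = S := by
    ext x
    simp only [Finset.mem_sdiff, Finset.mem_union, List.mem_toFinset]
    constructor
    · rintro ⟨h1 | h1, h2⟩
      · exact absurd (hl.subset h1) h2
      · exact h1
    · exact fun h1 => ⟨Or.inr h1, fun h2 => hS x h2 h1⟩
  rw [W_eq_lof h, map_zsmul, onStates, DirectSum.toModule_lof, filter_mem_union hL hl hS, hS',
    zsmul_hom_apply, smul_smul, wedgeSign_mul_self, one_smul]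

/-- Linear maps on `kh(D)` are determined by their values on generators. -/
theorem kh_hom_ext {M : Type*} [AddCommGroup M] [Module K M] {F G : Kh K R D →ₗ[K] M}
    {L : List ℕ} {O : Finset ℕ}
    (h : ∀ l : List ℕ, l.Sublist L → ∀ S ⊆ D.crossings \ L.toFinset,
      l.toFinset ∪ S ⊆ D.crossings →
      ∃ B, Spans α D (l.toFinset ∪ S) O B ∧
        ∀ b ∈ supp K O, ∀ β ∈ B,
          F (W K α D l S (b * β)) = G (W K α D l S (b * β))) : F = G := by
  refine DirectSum.linearMap_ext K fun S₁ => ?_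
  have hS₁ : (L.filter (· ∈ S₁.1)).toFinset ∪ S₁.1 \ L.toFinset = S₁.1 := by
    ext x
    simp only [Finset.mem_union, List.mem_toFinset, List.mem_filter, Finset.mem_sdiff,
      decide_eq_true_eq]
    tauto
  obtain ⟨B, hB, hFG⟩ := h (L.filter (· ∈ S₁.1)) List.filter_sublist (S₁.1 \ L.toFinset)
    (Finset.sdiff_subset_sdiff S₁.2 le_rfl) (hS₁.symm ▸ S₁.2)
  rw [hS₁] at hB
  have key : ∀ b : MvPolynomial ℕ K, DirectSum.lof K (State D) (fun S => Phi K R D S.1) S₁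
      (ev α D S₁.1 b) = wedgeSign (L.filter (· ∈ S₁.1)) (S₁.1 \ L.toFinset) •
        W K α D (L.filter (· ∈ S₁.1)) (S₁.1 \ L.toFinset) b := by
    intro b
    rw [W_eq_genE, smul_smul, wedgeSign_mul_self, one_smul, hS₁, genE, dif_pos S₁.2]
  refine LinearMap.ext_on (eq_top_iff.2 hB) ?_
  rintro _ ⟨b, hb, β, hβ, rfl⟩
  rw [LinearMap.comp_apply, LinearMap.comp_apply, key, map_zsmul, map_zsmul, hFG b hb β hβ]

theorem W_mem_grade {l : List ℕ} {S : Finset ℕ} (hl : l.Nodup) (hS : ∀ x ∈ l, x ∉ S) {n : ℤ}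
    (hn : n = -((l.length : ℤ) + S.card)) (b : MvPolynomial ℕ K) :
    W K α D l S b ∈ Kh.grade K R D n := by
  by_cases h : l.toFinset ∪ S ⊆ D.crossings
  · rw [W_eq_lof h]
    refine Submodule.smul_of_tower_mem _ _ ?_
    have hcard : (l.toFinset ∪ S).card = l.length + S.card := by
      rw [Finset.card_union_of_disjoint, List.toFinset_card_of_nodup hl]
      rw [Finset.disjoint_left]
      exact fun x hx => hS x (List.mem_toFinset.1 hx)
    refine Submodule.mem_iSup_of_mem ⟨l.toFinset ∪ S, h⟩ (Submodule.mem_iSup_of_mem ?_ ⟨_, rfl⟩)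
    rw [hcard, hn]; push_cast; ring
  · rw [W_of_not_subset h]; exact Submodule.zero_mem _

theorem hasDegree_of_W {F : Kh K R D →ₗ[K] Kh K R D'} {n : ℤ} {L : List ℕ} {O : Finset ℕ}
    (hL : L.Nodup)
    (h : ∀ l : List ℕ, l.Sublist L → ∀ S ⊆ D.crossings \ L.toFinset,
      l.toFinset ∪ S ⊆ D.crossings →
      ∃ B, Spans α D (l.toFinset ∪ S) O B ∧
        ∀ b ∈ supp K O, ∀ β ∈ B,
          F (W K α D l S (b * β)) ∈ Kh.grade K R D' (-((l.length : ℤ) + S.card) + n)) :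
    HasDegree F n := by
  intro i
  rw [Kh.grade, Submodule.map_iSup]
  refine iSup_le fun S₁ => ?_
  rw [Submodule.map_iSup]
  refine iSup_le fun hi => ?_
  rintro _ ⟨_, ⟨v, rfl⟩, rfl⟩
  have hS₁ : (L.filter (· ∈ S₁.1)).toFinset ∪ S₁.1 \ L.toFinset = S₁.1 := by
    ext x
    simp only [Finset.mem_union, List.mem_toFinset, List.mem_filter, Finset.mem_sdiff,
      decide_eq_true_eq]
    tauto
  have hcard : S₁.1.card = (L.filter (· ∈ S₁.1)).length + (S₁.1 \ L.toFinset).card := by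
    conv_lhs => rw [← hS₁]
    rw [Finset.card_union_of_disjoint, List.toFinset_card_of_nodup (hL.filter _)]
    rw [Finset.disjoint_left]
    intro x hx hx'
    exact (Finset.mem_sdiff.1 hx').2 (List.mem_toFinset.2
      (List.mem_filter.1 (List.mem_toFinset.1 hx)).1)
  obtain ⟨B, hB, hF⟩ := h (L.filter (· ∈ S₁.1)) List.filter_sublist (S₁.1 \ L.toFinset)
    (Finset.sdiff_subset_sdiff S₁.2 le_rfl) (hS₁.symm ▸ S₁.2)
  rw [hS₁] at hB
  have key : ∀ b : MvPolynomial ℕ K, DirectSum.lof K (State D) (fun S => Phi K R D S.1) S₁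
      (ev α D S₁.1 b) = wedgeSign (L.filter (· ∈ S₁.1)) (S₁.1 \ L.toFinset) •
        W K α D (L.filter (· ∈ S₁.1)) (S₁.1 \ L.toFinset) b := by
    intro b
    rw [W_eq_genE, smul_smul, wedgeSign_mul_self, one_smul, hS₁, genE, dif_pos S₁.2]
  have hv : v ∈ (Kh.grade K R D' (i + n)).comap
      (F ∘ₗ DirectSum.lof K (State D) (fun S => Phi K R D S.1) S₁) := by
    refine Submodule.span_le.2 ?_ (hB (Submodule.mem_top : v ∈ ⊤))
    rintro _ ⟨b, hb, β, hβ, rfl⟩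
    rw [SetLike.mem_coe, Submodule.mem_comap, LinearMap.comp_apply, key, map_zsmul]
    refine Submodule.smul_of_tower_mem _ _ ?_
    have := hF b hb β hβ
    rw [← hi, hcard]
    exact_mod_cast this
  exact hv

end Generators

/-! ### The differential -/

section Differential

variable {K : Type u} {R : Type v} [CommRing K] [CommRing R] [Algebra K R] [Coalgebra K R]
  {α : R} {ω : Rˣ}

variable (K R) in
/-- The part of the differential corresponding to the crossings in `X`. -/
def dOn (D : LinkDiagram) (X : Finset ℕ) : Kh K R D →ₗ[K] Kh K R D :=
  onStates [] fun S _ => ∑ x ∈ X \ S,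
    wedge D [x] S ∘ₗ surgery D S D _ D.arcs 0 (D.slot x 0) (D.slot x 3)

theorem d_eq_dOn (D : LinkDiagram) : Kh.d (K := K) (R := R) D = dOn K R D D.crossings := rfl

theorem covered_arcs (D : LinkDiagram) (S : Finset ℕ) : Covered D S D.arcs :=
  fun e he => ⟨e, he, Setoid.refl' _ _⟩

theorem dOn_W (q : QuadData K α) (hω : IsTwisting (K := K) α ω) {D : LinkDiagram} {X : Finset ℕ}
    (hX : X ⊆ D.crossings) {l : List ℕ} {S : Finset ℕ} (h : l.toFinset ∪ S ⊆ D.crossings)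
    {b : MvPolynomial ℕ K} (hb : b ∈ supp K D.arcs) :
    dOn K R D X (W K α D l S b) = ∑ w ∈ X \ (l.toFinset ∪ S), W K α D (w :: l) S
      (b * q.cc ω (glue D (insert w (l.toFinset ∪ S))) (D.slot w 0) (D.slot w 3)) := by
  have h0 : ([] : List ℕ).toFinset ∪ (l.toFinset ∪ S) ⊆ D.crossings := by simpa using h
  have h1 : W K α D l S b = wedgeSign l S • W K α D [] (l.toFinset ∪ S) b := by
    rw [W_eq_genE, W_eq_genE]
    simp [wedgeSign]
  rw [h1, map_zsmul, dOn, onStates_W List.nodup_nil (List.Sublist.refl []) (by simp) h0,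
    LinearMap.sum_apply, zsmul_sum_kh]
  refine Finset.sum_congr (by simp) fun w hw => ?_
  rw [Finset.mem_sdiff] at hw
  have hwD := hX hw.1
  rw [W_cons, LinearMap.comp_apply]
  congr 1
  have hs := LinkDiagram.surg_crossing hwD (S := [].toFinset ∪ (l.toFinset ∪ S))
    (by simpa using hw.2)
  have e1 : insert w ([].toFinset ∪ (l.toFinset ∪ S)) =
      [w].toFinset ∪ ([].toFinset ∪ (l.toFinset ∪ S)) := by simp
  have e2 : [].toFinset ∪ (l.toFinset ∪ S) = l.toFinset ∪ S := by simp
  rw [surgery_ev q hω le_rfl le_rfl (covered_arcs _ _) (D.slot_mem w hwD 0) (D.slot_mem w hwD 3)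
    (fun _ _ _ _ hab => (e1 ▸ hs).le hab) hb, wedge_ev, ← e1, e2]

theorem dOn_union (D : LinkDiagram) {X Y : Finset ℕ} (h : Disjoint X Y) :
    dOn K R D (X ∪ Y) = dOn K R D X + dOn K R D Y := by
  refine DirectSum.linearMap_ext K fun S₁ => ?_
  refine LinearMap.ext fun v => ?_
  simp only [dOn, onStates, LinearMap.comp_apply, LinearMap.add_apply, DirectSum.toModule_lof,
    zsmul_hom_apply, LinearMap.sum_apply]
  rw [← zsmul_add, Finset.union_sdiff_distrib, Finset.sum_union
    (h.mono Finset.sdiff_subset Finset.sdiff_subset)]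

theorem hasDegree_d (q : QuadData K α) (hω : IsTwisting (K := K) α ω) (D : LinkDiagram) :
    HasDegree (Kh.d (K := K) (R := R) D) (-1) := by
  refine hasDegree_of_W (α := α) (L := []) (O := D.arcs) List.nodup_nil fun l hl S hS h => ?_
  obtain rfl := List.sublist_nil.1 hl
  refine ⟨_, (covered_arcs D _).spans q le_rfl, ?_⟩
  rintro b hb _ rfl
  rw [mul_one, d_eq_dOn, dOn_W q hω le_rfl h hb]
  refine Submodule.sum_mem _ fun w hw => W_mem_grade (by simp) ?_ (by simp) _
  simpa using (Finset.mem_sdiff.1 hw).2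

theorem d_comp_d (q : QuadData K α) (hω : IsTwisting (K := K) α ω) (D : LinkDiagram) :
    Kh.d (K := K) (R := R) D ∘ₗ Kh.d D = 0 := by
  refine kh_hom_ext (α := α) (L := []) (O := D.arcs) fun l hl S hS h => ?_
  obtain rfl := List.sublist_nil.1 hl
  refine ⟨_, (covered_arcs D _).spans q le_rfl, ?_⟩
  rintro b hb _ rfl
  simp only [List.toFinset_nil, Finset.empty_union] at h
  rw [mul_one, LinearMap.comp_apply, d_eq_dOn, dOn_W q hω le_rfl (by simpa using h) hb, map_sum]
  have hterm : ∀ w ∈ D.crossings \ S, dOn K R D D.crossings (W K α D [w] S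
      (b * q.cc ω (glue D (insert w S)) (D.slot w 0) (D.slot w 3))) =
      ∑ w' ∈ D.crossings \ insert w S, W K α D [w', w] S
        (b * q.cc ω (glue D (insert w S)) (D.slot w 0) (D.slot w 3) *
          q.cc ω (glue D (insert w' (insert w S))) (D.slot w' 0) (D.slot w' 3)) := by
    intro w hw
    have hwD := (Finset.mem_sdiff.1 hw).1
    rw [dOn_W q hω le_rfl]
    · simp
    · simpa using Finset.insert_subset hwD h
    · exact mul_mem hb (q.cc_mem (D.slot_mem w hwD 0) (D.slot_mem w hwD 3) _ _)
  simp only [List.toFinset_nil, Finset.empty_union, LinearMap.zero_apply]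
  rw [Finset.sum_congr rfl hterm, Finset.sum_sigma']
  refine Finset.sum_involution (fun p _ => ⟨p.2, p.1⟩) ?_ ?_ ?_ ?_
  · rintro ⟨w, w'⟩ hp
    simp only [Finset.mem_sigma, Finset.mem_sdiff, Finset.mem_insert, not_or] at hp
    obtain ⟨⟨hw, hwS⟩, hw', hne, hwS'⟩ := hp
    dsimp only
    rw [W_swap hne (by simpa using hwS') (by simpa using hwS), neg_add_eq_zero]
    have hsq := q.cc_square ω (LinkDiagram.surg_crossing hw hwS)
      (LinkDiagram.surg_crossing hw' (S := insert w S) (by simp [hne, hwS']))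
      (LinkDiagram.surg_crossing hw' hwS')
      (by rw [Finset.insert_comm w' w S]
          exact LinkDiagram.surg_crossing hw (S := insert w' S) (by simp [Ne.symm hne, hwS]))
    refine W_congr q ⟨_, D.slot_mem w hw 0⟩ ?_
    rw [mul_assoc, mul_assoc, Finset.insert_comm w w' S]
    refine (QuadData.Cong.refl _ b).mul (QuadData.Cong.mono hsq (le_of_eq ?_))
    congr 1
    ext; simp; tauto
  · rintro ⟨w, w'⟩ hp _ heq
    simp only [Finset.mem_sigma, Finset.mem_sdiff, Finset.mem_insert, not_or] at hp
    simp only [Sigma.mk.injEq, heq_eq_eq] at heq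
    exact hp.2.2.1 heq.1
  · rintro ⟨w, w'⟩ hp
    simp only [Finset.mem_sigma, Finset.mem_sdiff, Finset.mem_insert, not_or] at hp ⊢
    exact ⟨⟨hp.2.1, hp.2.2.2⟩, hp.1.1, Ne.symm hp.2.2.1, hp.1.2⟩
  · rintro ⟨w, w'⟩ _
    rfl

end Differential

/-! ### Operators which are local on the diagram -/

section Local

/-- The crossings of `D` are the local crossings in `L` and the outer crossings in `X`; the arcs
at the outer crossings are outer arcs, i.e. elements of `O`. -/
structure Frame (D : LinkDiagram) (L : List ℕ) (X O : Finset ℕ) : Prop where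
  nodup : L.Nodup
  notMem : ∀ x ∈ L, x ∉ X
  crossings_eq : D.crossings = L.toFinset ∪ X
  sub : O ⊆ D.arcs
  slot_mem : ∀ w ∈ X, ∀ i, D.slot w i ∈ O

/-- The relation induced on the outer arcs by the gluing relation of `D` in the states `l ∪ S`. -/
structure Outer (D : LinkDiagram) (l : List ℕ) (X O : Finset ℕ) (E : Finset ℕ → Setoid ℕ) :
    Prop where
  iff : ∀ S ⊆ X, ∀ a ∈ O, ∀ b ∈ O, (glue D (l.toFinset ∪ S) a b ↔ E S a b)
  le : ∀ S ⊆ X, E S ≤ glue D (l.toFinset ∪ S)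

/-- The outer crossings act by surgeries on a family of relations. -/
def OutSurg (slot : ℕ → Fin 4 → ℕ) (X : Finset ℕ) (E : Finset ℕ → Setoid ℕ) : Prop :=
  ∀ S ⊆ X, ∀ w ∈ X, w ∉ S → Surg (E S) (E (insert w S)) (slot w 0) (slot w 3) (slot w 1)

variable {D D' : LinkDiagram} {L l : List ℕ} {X O : Finset ℕ}

theorem Frame.sdiff (h : Frame D L X O) : D.crossings \ L.toFinset = X := by
  rw [h.crossings_eq, Finset.union_sdiff_left, Finset.sdiff_eq_self_iff_disjoint,
    Finset.disjoint_right]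
  exact fun x hx => h.notMem x (List.mem_toFinset.1 hx)

theorem Frame.union_subset (h : Frame D L X O) (hl : l.Sublist L) {S : Finset ℕ} (hS : S ⊆ X) :
    l.toFinset ∪ S ⊆ D.crossings := by
  rw [h.crossings_eq]
  exact Finset.union_subset_union (fun x hx => by
    rw [List.mem_toFinset] at hx ⊢; exact hl.subset hx) hS

theorem Frame.notMem_of_sublist (h : Frame D L X O) (hl : l.Sublist L) {S : Finset ℕ}
    (hS : S ⊆ X) : ∀ x ∈ l, x ∉ S :=
  fun x hx hxS => h.notMem x (hl.subset hx) (hS hxS)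

theorem Outer.outSurg (h : Frame D L X O) (hl : l.Sublist L) {J : Finset (ℕ × ℕ)}
    {slot : ℕ → Fin 4 → ℕ} {μ : Setoid ℕ} (hslot : ∀ w ∈ X, D.slot w = slot w)
    (hE : Outer D l X O fun S => glueOn J slot X S ⊔ μ) :
    OutSurg slot X fun S => glueOn J slot X S ⊔ μ := by
  intro S hS w hw hwS
  have hX : X = insert w (X.erase w) := (Finset.insert_erase hw).symm
  have hM : glueOn J slot (X.erase w) (insert w S) = glueOn J slot (X.erase w) S :=
    glueOn_congr fun x hx => ⟨rfl, by simp [(Finset.mem_erase.1 hx).1]⟩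
  have hwD : w ∈ D.crossings := by rw [h.crossings_eq]; exact Finset.mem_union_right _ hw
  have hwl : w ∉ l := fun hwl => h.notMem w (hl.subset hwl) hw
  refine surg_of_xor (M := glueOn J slot (X.erase w) S ⊔ μ) (c := slot w 2) ?_ ?_ ?_
  · change glueOn J slot X S ⊔ μ = _
    conv_lhs => rw [hX, glueOn_insert_crossing, cr_neg _ hwS]
    simp only [sup_assoc, sup_comm μ]
  · change glueOn J slot X (insert w S) ⊔ μ = _
    conv_lhs => rw [hX, glueOn_insert_crossing, hM, cr_pos _ (Finset.mem_insert_self _ _)]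
    simp only [sup_assoc, sup_comm μ]
  · have key := LinkDiagram.glue_crossing_xor (S := l.toFinset ∪ S) hwD (by simp [hwl, hwS])
    rw [← Finset.union_insert, hE.iff S hS _ (h.slot_mem w hw 0) _ (h.slot_mem w hw 1),
      hE.iff _ (Finset.insert_subset hw hS) _ (h.slot_mem w hw 0) _ (h.slot_mem w hw 3),
      hslot w hw] at key
    exact key

end Local

section Tables

variable {K : Type u} {R : Type v} [CommRing K] [CommRing R] [Algebra K R]
  {α : R} (ω : Rˣ) (q : QuadData K α)

/-- The multiplications by the polynomials `m S` commute with the surgeries at the outer crossings,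
from the family of relations `E` to the family `E'`. -/
def Natural (slot : ℕ → Fin 4 → ℕ) (X : Finset ℕ) (E E' : Finset ℕ → Setoid ℕ)
    (m : Finset ℕ → MvPolynomial ℕ K) : Prop :=
  ∀ S ⊆ X, ∀ w ∈ X, w ∉ S → q.Cong (E' (insert w S))
    (m S * q.cc ω (E' (insert w S)) (slot w 0) (slot w 3))
    (q.cc ω (E (insert w S)) (slot w 0) (slot w 3) * m (insert w S))

variable {ω q} {slot : ℕ → Fin 4 → ℕ} {X : Finset ℕ} {E E' E'' : Finset ℕ → Setoid ℕ}
  {m m' : Finset ℕ → MvPolynomial ℕ K}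

theorem natural_const (m : MvPolynomial ℕ K) : Natural ω q slot X E E fun _ => m :=
  fun _ _ _ _ _ => QuadData.Cong.of_eq (mul_comm _ _)

theorem Natural.mul_const (h : Natural ω q slot X E E' m) (c : MvPolynomial ℕ K) :
    Natural ω q slot X E E' fun S => m S * c := by
  intro S hS w hw hwS
  rw [mul_right_comm, ← mul_assoc]
  exact (h S hS w hw hwS).mul (QuadData.Cong.refl _ c)

theorem natural_surg {e f g : ℕ} (h : ∀ S ⊆ X, Surg (E S) (E' S) e f g) (hE : OutSurg slot X E)
    (hE' : OutSurg slot X E') : Natural ω q slot X E E' fun S => q.cc ω (E' S) e f :=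
  fun S hS w hw hwS => q.cc_square ω (h S hS) (hE' S hS w hw hwS) (hE S hS w hw hwS)
    (h _ (Finset.insert_subset hw hS))

theorem Natural.mul_surg {e f g : ℕ} (h' : Natural ω q slot X E E' m)
    (h : ∀ S ⊆ X, Surg (E' S) (E'' S) e f g) (hE : OutSurg slot X E')
    (hE' : OutSurg slot X E'') :
    Natural ω q slot X E E'' fun S => m S * q.cc ω (E'' S) e f := by
  intro S hS w hw hwS
  have h1 := (QuadData.Cong.refl _ (m S)).mul
    ((natural_surg (ω := ω) (q := q) h hE hE') S hS w hw hwS)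
  have h2 := (h' S hS w hw hwS).push ω (h _ (Finset.insert_subset hw hS)).le
  refine QuadData.Cong.trans (QuadData.Cong.trans (QuadData.Cong.of_eq (mul_assoc _ _ _)) h1) ?_
  rw [← mul_assoc, ← mul_assoc]
  exact h2

variable (α) in
/-- The sum of the elements `l ∧ e_S ⊗ b m(S)` for the entries `(l, m)` of a table. -/
def tab (D : LinkDiagram) (t : List (List ℕ × (Finset ℕ → MvPolynomial ℕ K))) (S : Finset ℕ)
    (b : MvPolynomial ℕ K) : Kh K R D :=
  (t.map fun c => W K α D c.1 S (b * c.2 S)).sum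

/-- The operator `F` sends `l ∧ e_S ⊗ bβ` to the element given by the table `t`. -/
def Acts {D D' : LinkDiagram} (X O : Finset ℕ) (F : Kh K R D →ₗ[K] Kh K R D') (α : R)
    (l : List ℕ) (β : MvPolynomial ℕ K)
    (t : List (List ℕ × (Finset ℕ → MvPolynomial ℕ K))) : Prop :=
  ∀ S ⊆ X, ∀ b ∈ supp K O, F (W K α D l S (b * β)) = tab α D' t S b

variable (ω q) in
/-- An entry of the table of an operator of degree `n`, for a local state with `k` elements. -/
structure IsEntry (D' : LinkDiagram) (L' : List ℕ) (X O : Finset ℕ) (E : Finset ℕ → Setoid ℕ)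
    (n k : ℤ) (c : List ℕ × (Finset ℕ → MvPolynomial ℕ K)) : Prop where
  sub : c.1.Sublist L'
  length : (c.1.length : ℤ) = k - n
  mem : ∀ S ⊆ X, c.2 S ∈ supp K D'.arcs
  nat : ∃ E', Outer D' c.1 X O E' ∧ Natural ω q D'.slot X E E' c.2

theorem cc_eq_of_iff {E E' : Setoid ℕ} {e f : ℕ} (h : E e f ↔ E' e f) :
    q.cc ω E e f = q.cc ω E' e f := by
  by_cases h' : E' e f
  · rw [q.cc_pos h', q.cc_pos (h.2 h')]
  · rw [q.cc_neg h', q.cc_neg (mt h.1 h')]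

theorem tab_mem_grade {D' : LinkDiagram} {L' : List ℕ} {O : Finset ℕ} (h' : Frame D' L' X O) {n : ℤ} {k : ℤ}
    {t : List (List ℕ × (Finset ℕ → MvPolynomial ℕ K))}
    (ht : ∀ c ∈ t, IsEntry ω q D' L' X O E n k c) {S : Finset ℕ} (hS : S ⊆ X)
    (b : MvPolynomial ℕ K) :
    tab α D' t S b ∈ Kh.grade K R D' (-(k + S.card) + n) := by
  refine list_sum_mem fun x hx => ?_
  obtain ⟨c, hc, rfl⟩ := List.mem_map.1 hx
  have := ht c hc
  refine W_mem_grade (h'.nodup.sublist this.sub) (h'.notMem_of_sublist this.sub hS) ?_ _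
  rw [this.length]; ring

/-- The data which describe an operator of degree `n` in the local state `l` by a family of
tables. -/
structure HasTables (ω : Rˣ) (q : QuadData K α) (D D' : LinkDiagram) (L' : List ℕ)
    (X O : Finset ℕ) (F : Kh K R D →ₗ[K] Kh K R D') (n : ℤ) (l : List ℕ)
    (β : R → MvPolynomial ℕ K)
    (t : R → List (List ℕ × (Finset ℕ → MvPolynomial ℕ K))) : Prop where
  spans : ∀ S ⊆ X, Spans α D (l.toFinset ∪ S) O (Set.range β)
  mem : ∀ r, β r ∈ supp K D.arcs
  acts : ∀ r, Acts X O F α l (β r) (t r)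
  entry : ∃ E, Outer D l X O E ∧ ∀ r, ∀ c ∈ t r, IsEntry ω q D' L' X O E n l.length c

theorem hasDegree_of_tables {D D' : LinkDiagram} {L L' : List ℕ} {O : Finset ℕ} (h : Frame D L X O) (h' : Frame D' L' X O)
    {F : Kh K R D →ₗ[K] Kh K R D'} {n : ℤ}
    (hF : ∀ l : List ℕ, l.Sublist L → ∃ β t, HasTables ω q D D' L' X O F n l β t) :
    HasDegree F n := by
  refine hasDegree_of_W (α := α) (O := O) h.nodup fun l hl S hS _ => ?_
  rw [h.sdiff] at hS
  obtain ⟨β, t, ht⟩ := hF l hl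
  obtain ⟨E, hE, hent⟩ := ht.entry
  refine ⟨_, ht.spans S hS, fun b hb _ hr => ?_⟩
  obtain ⟨r, rfl⟩ := hr
  rw [ht.acts r S hS b hb]
  exact tab_mem_grade h' (hent r) hS b

variable [Coalgebra K R] {D D' : LinkDiagram} {L L' l : List ℕ} {O : Finset ℕ}

theorem dOn_outer_W (hω : IsTwisting (K := K) α ω) (h : Frame D L X O) (hl : l.Sublist L)
    (hE : Outer D l X O E) {S : Finset ℕ} (hS : S ⊆ X) {b : MvPolynomial ℕ K}
    (hb : b ∈ supp K D.arcs) :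
    dOn K R D X (W K α D l S b) = ∑ w ∈ X \ S, ((-1) ^ l.length * wedgeSign [w] S) •
      W K α D l (insert w S) (b * q.cc ω (E (insert w S)) (D.slot w 0) (D.slot w 3)) := by
  rw [dOn_W q hω (by rw [h.crossings_eq]; exact Finset.subset_union_right)
    (h.union_subset hl hS) hb]
  have hX : X \ (l.toFinset ∪ S) = X \ S := by
    ext x
    simp only [Finset.mem_sdiff, Finset.mem_union, List.mem_toFinset, not_or]
    exact ⟨fun ⟨h1, h2⟩ => ⟨h1, h2.2⟩, fun ⟨h1, h2⟩ =>
      ⟨h1, fun hx => h.notMem x (hl.subset hx) h1, h2⟩⟩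
  rw [hX]
  refine Finset.sum_congr rfl fun w hw => ?_
  rw [Finset.mem_sdiff] at hw
  have hwl : w ∉ l := fun hwl => h.notMem w (hl.subset hwl) hw.1
  rw [W_cons_out (h.nodup.sublist hl) (h.notMem_of_sublist hl hS) hwl hw.2, ← Finset.union_insert,
    cc_eq_of_iff (hE.iff _ (Finset.insert_subset hw.1 hS) _ (h.slot_mem w hw.1 0) _
      (h.slot_mem w hw.1 3))]

theorem dOn_local_W (q : QuadData K α) (hω : IsTwisting (K := K) α ω) (h : Frame D L X O)
    (hl : l.Sublist L) {S : Finset ℕ} (hS : S ⊆ X) {b : MvPolynomial ℕ K}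
    (hb : b ∈ supp K D.arcs) :
    dOn K R D L.toFinset (W K α D l S b) =
      ((L.filter (· ∉ l)).map fun x => W K α D (x :: l) S
        (b * q.cc ω (glue D ((x :: l).toFinset ∪ S)) (D.slot x 0) (D.slot x 3))).sum := by
  rw [dOn_W q hω (by rw [h.crossings_eq]; exact Finset.subset_union_left)
    (h.union_subset hl hS) hb]
  have hL : L.toFinset \ (l.toFinset ∪ S) = (L.filter (· ∉ l)).toFinset := by
    ext x
    simp only [Finset.mem_sdiff, Finset.mem_union, List.mem_toFinset, not_or, List.mem_filter,
      decide_eq_true_eq]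
    exact ⟨fun ⟨h1, h2⟩ => ⟨h1, h2.1⟩, fun ⟨h1, h2⟩ =>
      ⟨h1, h2, fun hx => h.notMem x h1 (hS hx)⟩⟩
  rw [hL, List.sum_toFinset _ (h.nodup.filter _)]
  simp only [List.toFinset_cons, Finset.insert_union]

theorem d_eq_add (h : Frame D L X O) :
    Kh.d (K := K) (R := R) D = dOn K R D L.toFinset + dOn K R D X := by
  have hd : Disjoint L.toFinset X := by
    rw [Finset.disjoint_left]
    exact fun x hx => h.notMem x (List.mem_toFinset.1 hx)
  rw [d_eq_dOn, ← dOn_union _ hd, ← h.crossings_eq]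

/-- An operator given by a table commutes, up to sign, with the outer part of the differential. -/
theorem dOn_outer_comm (hω : IsTwisting (K := K) α ω) (h : Frame D L X O) (h' : Frame D' L' X O)
    (hslot : ∀ w ∈ X, D'.slot w = D.slot w) {F : Kh K R D →ₗ[K] Kh K R D'} {n : ℤ}
    (hl : l.Sublist L) (hE : Outer D l X O E) {β : MvPolynomial ℕ K}
    (hβ : β ∈ supp K D.arcs)
    {t : List (List ℕ × (Finset ℕ → MvPolynomial ℕ K))} (hF : Acts X O F α l β t)
    (ht : ∀ c ∈ t, IsEntry ω q D' L' X O E n l.length c) {S : Finset ℕ} (hS : S ⊆ X)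
    {b : MvPolynomial ℕ K} (hb : b ∈ supp K O) :
    dOn K R D' X (F (W K α D l S (b * β))) =
      (n.negOnePow : ℤ) • F (dOn K R D X (W K α D l S (b * β))) := by
  have hOD : supp K O ≤ supp K D.arcs :=
    MvPolynomial.supported_mono (by exact_mod_cast h.sub)
  have hOD' : supp K O ≤ supp K D'.arcs :=
    MvPolynomial.supported_mono (by exact_mod_cast h'.sub)
  have hright : F (dOn K R D X (W K α D l S (b * β))) =
      ∑ w ∈ X \ S, ((-1) ^ l.length * wedgeSign [w] S) •
        tab α D' t (insert w S) (b * q.cc ω (E (insert w S)) (D.slot w 0) (D.slot w 3)) := by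
    rw [dOn_outer_W (q := q) hω h hl hE hS (mul_mem (hOD hb) hβ), map_sum]
    refine Finset.sum_congr rfl fun w hw => ?_
    rw [Finset.mem_sdiff] at hw
    rw [map_zsmul, mul_right_comm, hF _ (Finset.insert_subset hw.1 hS) _ (mul_mem hb
      (q.cc_mem (h.slot_mem w hw.1 0) (h.slot_mem w hw.1 3) _ _))]
  have hleft : ∀ t : List (List ℕ × (Finset ℕ → MvPolynomial ℕ K)),
      (∀ c ∈ t, IsEntry ω q D' L' X O E n l.length c) → dOn K R D' X (tab α D' t S b) =
      (n.negOnePow : ℤ) • ∑ w ∈ X \ S, ((-1) ^ l.length * wedgeSign [w] S) •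
        tab α D' t (insert w S) (b * q.cc ω (E (insert w S)) (D.slot w 0) (D.slot w 3)) := by
    intro t
    induction t with
    | nil =>
      intro _
      rw [Finset.sum_eq_zero (fun w _ => by exact zsmul_zero _), zsmul_zero]
      exact map_zero _
    | cons c t ih =>
      intro ht
      have hc := ht c List.mem_cons_self
      obtain ⟨E', hE', hnat⟩ := hc.nat
      have hcons : ∀ S b, tab α D' (c :: t) S b =
          W K α D' c.1 S (b * c.2 S) + tab α D' t S b := fun S b => by
        rw [tab, List.map_cons, List.sum_cons]; rfl
      have hsign : ((-1 : ℤ)) ^ c.1.length = (n.negOnePow : ℤ) * (-1) ^ l.length := by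
        have e : ∀ k : ℕ, ((-1 : ℤ)) ^ k = ((k : ℤ).negOnePow : ℤ) := fun k => by
          rw [Int.negOnePow_def]; simp
        rw [e, e, hc.length, Int.negOnePow_sub]
        push_cast
        ring
      rw [hcons, map_add, ih fun c hc => ht c (List.mem_cons_of_mem _ hc),
        dOn_outer_W (q := q) hω h' hc.sub hE' hS
          (mul_mem (hOD' hb) (hc.mem S hS))]
      simp only [hcons, zsmul_add, Finset.sum_add_distrib]
      congr 1
      rw [zsmul_sum_kh]
      refine Finset.sum_congr rfl fun w hw => ?_
      rw [Finset.mem_sdiff] at hw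
      rw [hsign, smul_smul, mul_assoc]
      congr 1
      have hne : D'.arcs.Nonempty := ⟨_, h'.sub (h'.slot_mem w hw.1 0)⟩
      refine W_congr q hne ?_
      have := (hnat S hS w hw.1 hw.2).mono (hE'.le _ (Finset.insert_subset hw.1 hS))
      rw [mul_assoc, mul_assoc, hslot w hw.1] at *
      exact (QuadData.Cong.refl _ b).mul this
  rw [hF S hS b hb, hleft t ht, hright]

/-- An operator given by tables is a morphism when it commutes, up to sign, with the local part of
the differential. -/
theorem isMorphism_of_tables (hω : IsTwisting (K := K) α ω) (h : Frame D L X O)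
    (h' : Frame D' L' X O) (hslot : ∀ w ∈ X, D'.slot w = D.slot w)
    {F : Kh K R D →ₗ[K] Kh K R D'} {n : ℤ}
    (hF : ∀ l : List ℕ, l.Sublist L → ∃ β t, HasTables ω q D D' L' X O F n l β t ∧
      ∀ S ⊆ X, ∀ b ∈ supp K O, ∀ r,
        dOn K R D' L'.toFinset (tab α D' (t r) S b) =
          (n.negOnePow : ℤ) • F (dOn K R D L.toFinset (W K α D l S (b * β r)))) :
    IsMorphism F n := by
  refine ⟨hasDegree_of_tables (q := q) (ω := ω) h h' fun l hl => ?_, ?_⟩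
  · obtain ⟨β, t, ht, -⟩ := hF l hl
    exact ⟨β, t, ht⟩
  refine kh_hom_ext (α := α) (L := L) (O := O) fun l hl S hS _ => ?_
  rw [h.sdiff] at hS
  obtain ⟨β, t, ht, hloc⟩ := hF l hl
  obtain ⟨E, hE, hent⟩ := ht.entry
  refine ⟨_, ht.spans S hS, fun b hb _ hr => ?_⟩
  obtain ⟨r, rfl⟩ := hr
  have h1 := dOn_outer_comm hω h h' hslot hl hE (ht.mem r) (ht.acts r) (hent r) hS hb
  have h2 := hloc S hS b hb r
  rw [← ht.acts r S hS b hb] at h2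
  rw [LinearMap.comp_apply, d_eq_add h', LinearMap.add_apply, h1, h2, ← zsmul_add, ← map_add,
    ← LinearMap.add_apply, ← d_eq_add h]
  rfl

/-- An operator given by tables is a homotopy when it is so for the local part of the
differential. -/
theorem homotopic_of_tables (hω : IsTwisting (K := K) α ω) (h : Frame D L X O)
    {F G H : Kh K R D →ₗ[K] Kh K R D}
    (hH : ∀ l : List ℕ, l.Sublist L → ∃ β t, HasTables ω q D D L X O H 1 l β t ∧
      ∀ S ⊆ X, ∀ b ∈ supp K O, ∀ r,
        F (W K α D l S (b * β r)) - G (W K α D l S (b * β r)) =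
          dOn K R D L.toFinset (tab α D (t r) S b) +
            H (dOn K R D L.toFinset (W K α D l S (b * β r)))) :
    Homotopic F G := by
  refine ⟨H, hasDegree_of_tables (q := q) (ω := ω) h h fun l hl => ?_, ?_⟩
  · obtain ⟨β, t, ht, -⟩ := hH l hl
    exact ⟨β, t, ht⟩
  refine kh_hom_ext (α := α) (L := L) (O := O) fun l hl S hS _ => ?_
  rw [h.sdiff] at hS
  obtain ⟨β, t, ht, hloc⟩ := hH l hl
  obtain ⟨E, hE, hent⟩ := ht.entry
  refine ⟨_, ht.spans S hS, fun b hb _ hr => ?_⟩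
  obtain ⟨r, rfl⟩ := hr
  have h1 := dOn_outer_comm hω h h (fun _ _ => rfl) hl hE (ht.mem r) (ht.acts r)
    (hent r) hS hb
  have h2 := hloc S hS b hb r
  rw [← ht.acts r S hS b hb] at h2
  rw [LinearMap.sub_apply, h2, LinearMap.add_apply, LinearMap.comp_apply, LinearMap.comp_apply,
    d_eq_add h, LinearMap.add_apply, LinearMap.add_apply, h1, map_add]
  rw [show (((1 : ℤ).negOnePow : ℤˣ) : ℤ) = -1 by simp, neg_one_zsmul]
  abel

end Tables

/-! ### Local states -/

section Pairs

/-- The function `f` takes the same value on the two elements of each pair. -/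
def Compat {T : Type} (f : ℕ → T) (L : List (ℕ × ℕ)) : Prop := ∀ p ∈ L, f p.1 = f p.2

@[simp] theorem compat_nil {T : Type} (f : ℕ → T) : Compat f [] := by simp [Compat]

@[simp] theorem compat_cons {T : Type} (f : ℕ → T) (p : ℕ × ℕ) (L : List (ℕ × ℕ)) :
    Compat f (p :: L) ↔ f p.1 = f p.2 ∧ Compat f L := by simp [Compat]

/-- The equivalence relation generated by a list of pairs. -/
def prs (L : List (ℕ × ℕ)) : Setoid ℕ := ⨆ p ∈ L, pr p.1 p.2

theorem prs_le {L : List (ℕ × ℕ)} {E : Setoid ℕ} : prs L ≤ E ↔ ∀ p ∈ L, E p.1 p.2 := by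
  simp only [prs, iSup_le_iff, pr_le]

theorem prs_apply {L : List (ℕ × ℕ)} {p : ℕ × ℕ} (h : p ∈ L) : prs L p.1 p.2 :=
  prs_le.1 le_rfl p h

theorem prs_cons (p : ℕ × ℕ) (L : List (ℕ × ℕ)) : prs (p :: L) = pr p.1 p.2 ⊔ prs L :=
  eq_of_forall_ge_iff fun E => by simp [prs_le, pr_le]

theorem compat_mk {L : List (ℕ × ℕ)} {E : Setoid ℕ} (h : prs L ≤ E) :
    Compat (fun e => (Quotient.mk E e)) L :=
  fun p hp => Quotient.sound (prs_le.1 h p hp)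

/-- The pairs of slots which are connected in a resolution of a crossing. -/
def crs (s : Fin 4 → ℕ) (neg : Bool) : List (ℕ × ℕ) :=
  if neg then [(s 0, s 1), (s 2, s 3)] else [(s 0, s 3), (s 2, s 1)]

theorem cr_le {s : Fin 4 → ℕ} {P : Prop} [Decidable P] {E : Setoid ℕ} :
    cr s P ≤ E ↔ ∀ p ∈ crs s (decide P), E p.1 p.2 := by
  by_cases h : P
  · rw [cr_pos _ h]; simp [crs, h, pr_le]
  · rw [cr_neg _ h]; simp [crs, h, pr_le]

theorem glueOn_le_iff {J : Finset (ℕ × ℕ)} {slot : ℕ → Fin 4 → ℕ} {X S : Finset ℕ}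
    {E : Setoid ℕ} : glueOn J slot X S ≤ E ↔
      (∀ j ∈ J, E j.1 j.2) ∧ ∀ x ∈ X, cr (slot x) (x ∈ S) ≤ E := by
  simp only [glueOn, sup_le_iff, iSup_le_iff, pr_le]

/-- The gluing relation at the marked points in `J`, at the crossings in `X`, and at the pairs in
`μ`. -/
def fam (J : Finset (ℕ × ℕ)) (slot : ℕ → Fin 4 → ℕ) (X : Finset ℕ) (μ : List (ℕ × ℕ))
    (S : Finset ℕ) : Setoid ℕ :=
  glueOn J slot X S ⊔ prs μ

theorem fam_apply {J : Finset (ℕ × ℕ)} {slot : ℕ → Fin 4 → ℕ} {X : Finset ℕ}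
    {μ : List (ℕ × ℕ)} {S : Finset ℕ} {p : ℕ × ℕ} (h : p ∈ μ) :
    fam J slot X μ S p.1 p.2 :=
  (le_sup_right : prs μ ≤ fam J slot X μ S) (prs_apply h)

theorem fam_le {J : Finset (ℕ × ℕ)} {slot : ℕ → Fin 4 → ℕ} {X : Finset ℕ}
    {μ μ' : List (ℕ × ℕ)} (h : prs μ ≤ prs μ') (S : Finset ℕ) :
    fam J slot X μ S ≤ fam J slot X μ' S :=
  sup_le_sup le_rfl h

/-- The families of relations given by two systems of pairs `(a, b), (c, d)` and `(a, d), (c, b)`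
differ by a surgery. -/
theorem surg_fam {J : Finset (ℕ × ℕ)} {slot : ℕ → Fin 4 → ℕ} {X S : Finset ℕ}
    {a b c d : ℕ} {μ μ' ν : List (ℕ × ℕ)} (h : prs μ = prs ((a, b) :: (c, d) :: ν))
    (h' : prs μ' = prs ((a, d) :: (c, b) :: ν))
    (hx : fam J slot X μ S a d ↔ ¬ fam J slot X μ' S a b) :
    Surg (fam J slot X μ S) (fam J slot X μ' S) a b d := by
  refine surg_of_xor (M := glueOn J slot X S ⊔ prs ν) (c := c) ?_ ?_ hx
  · rw [fam, h, prs_cons, prs_cons]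
    simp only [sup_assoc, sup_comm (prs ν)]
  · rw [fam, h', prs_cons, prs_cons]
    simp only [sup_assoc, sup_comm (prs ν)]

theorem prs_congr {μ μ' : List (ℕ × ℕ)} (h : ∀ (T : Type) (f : ℕ → T), Compat f μ ↔ Compat f μ') :
    prs μ = prs μ' := by
  have key : ∀ μ μ' : List (ℕ × ℕ), (∀ (T : Type) (f : ℕ → T), Compat f μ → Compat f μ') →
      prs μ' ≤ prs μ := fun μ μ' h =>
    prs_le.2 fun p hp => Quotient.exact (h _ _ (compat_mk (E := prs μ) le_rfl) p hp)
  exact le_antisymm (key _ _ fun T f => (h T f).2) (key _ _ fun T f => (h T f).1)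

end Pairs

section States

/-- A description of `D`: its marked points are those in `J`, and the local ones in `Jl`, and its
crossings are those in `X`, where the slots are given by `slot`, and those in `L`. -/
structure Cut (D : LinkDiagram) (L : List ℕ) (X O : Finset ℕ) (J : Finset (ℕ × ℕ))
    (slot : ℕ → Fin 4 → ℕ) (Jl : List (ℕ × ℕ)) : Prop extends Frame D L X O where
  joins_iff : ∀ E : Setoid ℕ, (∀ j ∈ D.joins, E j.1 j.2) ↔
    (∀ j ∈ J, E j.1 j.2) ∧ ∀ j ∈ Jl, E j.1 j.2
  join_mem : ∀ j ∈ J, j.1 ∈ O ∧ j.2 ∈ O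
  slot_eq : ∀ w ∈ X, D.slot w = slot w

/-- In the local state `l`, the outer arcs are connected according to the pairs in `μ`. Each arc `e`
is connected with `ρ e`, which is an outer arc or a chosen arc in a circle. -/
structure IsState (D : LinkDiagram) (L : List ℕ) (O : Finset ℕ) (Jl : List (ℕ × ℕ)) (l : List ℕ)
    (μ : List (ℕ × ℕ)) (ρ : ℕ → ℕ) : Prop where
  fix : ∀ a ∈ O, ρ a = a
  mem : ∀ p ∈ μ, p.1 ∈ O ∧ p.2 ∈ O
  forth : ∀ (T : Type) (f : ℕ → T),
    Compat f (Jl ++ L.flatMap fun x => crs (D.slot x) (decide (x ∈ l))) →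
      Compat f μ ∧ ∀ e ∈ D.arcs, f (ρ e) = f e
  back : ∀ (T : Type) (f : ℕ → T), Compat f μ →
    Compat (f ∘ ρ) (Jl ++ L.flatMap fun x => crs (D.slot x) (decide (x ∈ l)))

variable {D : LinkDiagram} {L l : List ℕ} {X O : Finset ℕ} {J : Finset (ℕ × ℕ)}
  {slot : ℕ → Fin 4 → ℕ} {Jl μ : List (ℕ × ℕ)} {ρ : ℕ → ℕ}

theorem Cut.glue_eq (h : Cut D L X O J slot Jl) (hl : ∀ x ∈ l, x ∈ L) {S : Finset ℕ}
    (hS : S ⊆ X) : glue D (l.toFinset ∪ S) = glueOn J slot X S ⊔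
      prs (Jl ++ L.flatMap fun x => crs (D.slot x) (decide (x ∈ l))) := by
  refine eq_of_forall_ge_iff fun E => ?_
  rw [glue, glueOn_le_iff, h.joins_iff, h.crossings_eq, sup_le_iff, glueOn_le_iff, prs_le]
  have hX : ∀ x ∈ X, (cr (D.slot x) (x ∈ l.toFinset ∪ S) ≤ E ↔ cr (slot x) (x ∈ S) ≤ E) := by
    intro x hx
    have : x ∈ l.toFinset ∪ S ↔ x ∈ S := by
      simp only [Finset.mem_union, List.mem_toFinset, or_iff_right_iff_imp]
      exact fun hxl => absurd hx (h.notMem x (hl x hxl))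
    rw [h.slot_eq x hx, propext this]
  have hL : ∀ x ∈ L, (cr (D.slot x) (x ∈ l.toFinset ∪ S) ≤ E ↔
      ∀ p ∈ crs (D.slot x) (decide (x ∈ l)), E p.1 p.2) := by
    intro x hx
    have : x ∈ l.toFinset ∪ S ↔ x ∈ l := by
      simp only [Finset.mem_union, List.mem_toFinset, or_iff_left_iff_imp]
      exact fun hxS => absurd (hS hxS) (h.notMem x hx)
    rw [propext this, cr_le]
  constructor
  · rintro ⟨⟨h1, h2⟩, h3⟩
    refine ⟨⟨h1, fun x hx => (hX x hx).1 (h3 x (Finset.mem_union_right _ hx))⟩, ?_⟩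
    intro p hp
    rcases List.mem_append.1 hp with hp | hp
    · exact h2 p hp
    · obtain ⟨x, hx, hp⟩ := List.mem_flatMap.1 hp
      exact (hL x hx).1 (h3 x (Finset.mem_union_left _ (List.mem_toFinset.2 hx))) p hp
  · rintro ⟨⟨h1, h2⟩, h3⟩
    refine ⟨⟨h1, fun p hp => h3 p (List.mem_append_left _ hp)⟩, ?_⟩
    intro x hx
    rcases Finset.mem_union.1 hx with hx | hx
    · rw [List.mem_toFinset] at hx
      exact (hL x hx).2 fun p hp =>
        h3 p (List.mem_append_right _ (List.mem_flatMap.2 ⟨x, hx, hp⟩))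
    · exact (hX x hx).2 (h2 x hx)

theorem IsState.fam_le_glue (hst : IsState D L O Jl l μ ρ) (h : Cut D L X O J slot Jl)
    (hl : ∀ x ∈ l, x ∈ L) {S : Finset ℕ} (hS : S ⊆ X) :
    fam J slot X μ S ≤ glue D (l.toFinset ∪ S) := by
  rw [h.glue_eq hl hS]
  refine sup_le le_sup_left (prs_le.2 fun p hp => Quotient.exact ?_)
  exact (hst.forth _ _ (compat_mk le_sup_right)).1 p hp

theorem IsState.glue_rho (hst : IsState D L O Jl l μ ρ) (h : Cut D L X O J slot Jl)
    (hl : ∀ x ∈ l, x ∈ L) {S : Finset ℕ} (hS : S ⊆ X) {e : ℕ} (he : e ∈ D.arcs) :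
    glue D (l.toFinset ∪ S) (ρ e) e := by
  rw [h.glue_eq hl hS]
  exact Quotient.exact ((hst.forth _ _ (compat_mk le_sup_right)).2 e he)

theorem cr_le_comap {s : Fin 4 → ℕ} (hs : ∀ i, ρ (s i) = s i) {P : Prop} {E : Setoid ℕ}
    (hE : cr s P ≤ E) : cr s P ≤ E.comap ρ := by
  classical
  rw [cr_le] at hE ⊢
  intro p hp
  have : ρ p.1 = p.1 ∧ ρ p.2 = p.2 := by
    by_cases h : P <;> simp only [crs, h, decide_true, decide_false, if_true, if_false,
      List.mem_cons, List.not_mem_nil, or_false, Bool.false_eq_true] at hp <;>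
      rcases hp with rfl | rfl <;> exact ⟨hs _, hs _⟩
  rw [Setoid.comap_rel, this.1, this.2]
  exact hE p hp

theorem IsState.glue_iff (hst : IsState D L O Jl l μ ρ) (h : Cut D L X O J slot Jl)
    (hl : ∀ x ∈ l, x ∈ L) {S : Finset ℕ} (hS : S ⊆ X) {e f : ℕ} (he : e ∈ D.arcs)
    (hf : f ∈ D.arcs) :
    glue D (l.toFinset ∪ S) e f ↔ fam J slot X μ S (ρ e) (ρ f) := by
  constructor
  · suffices H : glue D (l.toFinset ∪ S) ≤ (fam J slot X μ S).comap ρ from fun hef => H hef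
    rw [h.glue_eq hl hS]
    refine sup_le (glueOn_le (fun j hj => ?_) fun x hx => ?_) (prs_le.2 fun p hp => ?_)
    · rw [Setoid.comap_rel, hst.fix _ (h.join_mem j hj).1, hst.fix _ (h.join_mem j hj).2]
      exact (glueOn_le_iff.1 (le_sup_left : _ ≤ fam J slot X μ S)).1 j hj
    · refine cr_le_comap (fun i => hst.fix _ ?_) ((le_glueOn_of_mem hx).trans le_sup_left)
      rw [← h.slot_eq x hx]
      exact h.slot_mem x hx i
    · rw [Setoid.comap_rel]
      exact Quotient.exact (hst.back _ _ (compat_mk (E := fam J slot X μ S) le_sup_right) p hp)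
  · intro hef
    exact Setoid.trans' _ (Setoid.symm' _ (hst.glue_rho h hl hS he))
      (Setoid.trans' _ (hst.fam_le_glue h hl hS hef) (hst.glue_rho h hl hS hf))

theorem IsState.outer (hst : IsState D L O Jl l μ ρ) (h : Cut D L X O J slot Jl)
    (hl : ∀ x ∈ l, x ∈ L) : Outer D l X O (fam J slot X μ) where
  iff S hS a ha b hb := by
    rw [hst.glue_iff h hl hS (h.sub ha) (h.sub hb), hst.fix a ha, hst.fix b hb]
  le S hS := hst.fam_le_glue h hl hS

theorem IsState.outSurg (hst : IsState D L O Jl l μ ρ) (h : Cut D L X O J slot Jl)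
    (hl : l.Sublist L) : OutSurg slot X (fam J slot X μ) :=
  Outer.outSurg h.toFrame hl h.slot_eq (hst.outer h fun _ hx => hl.subset hx)

theorem fam_isolated (h : Cut D L X O J slot Jl) (hμ : ∀ p ∈ μ, p.1 ∈ O ∧ p.2 ∈ O) {S : Finset ℕ}
    {k a : ℕ} (hk : k ∉ O) (hka : k ≠ a) : ¬ fam J slot X μ S k a := by
  intro hfam
  have hO : ∀ e ∈ O, (e = k) = False := fun e he => by
    simp only [eq_iff_iff, iff_false]; rintro rfl; exact hk he
  have H : fam J slot X μ S ≤ Setoid.ker (fun e => e = k) := by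
    refine sup_le (glueOn_le (fun j hj => ?_) fun x hx => ?_) (prs_le.2 fun p hp => ?_)
    · rw [Setoid.ker_def, hO _ (h.join_mem j hj).1, hO _ (h.join_mem j hj).2]
    · have hs : ∀ i, (slot x i = k) = False := fun i =>
        hO _ (by rw [← h.slot_eq x hx]; exact h.slot_mem x hx i)
      by_cases hxS : x ∈ S
      · rw [cr_pos _ hxS, sup_le_iff, pr_le, pr_le, Setoid.ker_def, Setoid.ker_def]
        simp only [hs, and_self]
      · rw [cr_neg _ hxS, sup_le_iff, pr_le, pr_le, Setoid.ker_def, Setoid.ker_def]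
        simp only [hs, and_self]
    · rw [Setoid.ker_def, hO _ (hμ p hp).1, hO _ (hμ p hp).2]
  have := H hfam
  rw [Setoid.ker_def] at this
  exact hka ((this.mp rfl).symm)

theorem IsState.covered (hst : IsState D L O Jl l μ ρ) (h : Cut D L X O J slot Jl)
    (hl : ∀ x ∈ l, x ∈ L) {S : Finset ℕ} (hS : S ⊆ X) (hρ : ∀ e ∈ D.arcs, ρ e ∈ O) :
    Covered D (l.toFinset ∪ S) O :=
  fun e he => ⟨ρ e, hρ e he, Setoid.symm' _ (hst.glue_rho h hl hS he)⟩

theorem IsState.coveredExcept (hst : IsState D L O Jl l μ ρ) (h : Cut D L X O J slot Jl)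
    (hl : ∀ x ∈ l, x ∈ L) {S : Finset ℕ} (hS : S ⊆ X) {k : ℕ} (hk : k ∈ D.arcs) (hkO : k ∉ O)
    (hρk : ρ k = k) (hρ : ∀ e ∈ D.arcs, ρ e = k ∨ ρ e ∈ O) :
    CoveredExcept D (l.toFinset ∪ S) O k where
  mem := hk
  not_glue a ha hka := by
    rw [hst.glue_iff h hl hS hk (h.sub ha), hρk, hst.fix a ha] at hka
    exact fam_isolated h hst.mem hkO (fun hka => hkO (hka ▸ ha)) hka
  cover e he := by
    have hg := Setoid.symm' _ (hst.glue_rho h hl hS he)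
    rcases hρ e he with h1 | h1
    · rw [h1] at hg; exact Or.inl hg
    · exact Or.inr ⟨_, h1, hg⟩

end States

section StateGenerators

variable {K : Type u} {R : Type v} [CommRing K] [CommRing R] [Algebra K R] {α : R} {ω : Rˣ}
  {D D' : LinkDiagram} {L L' l l' : List ℕ} {X O : Finset ℕ} {J : Finset (ℕ × ℕ)}
  {slot : ℕ → Fin 4 → ℕ} {Jl Jl' μ μ' : List (ℕ × ℕ)} {ρ ρ' : ℕ → ℕ} {S : Finset ℕ}

theorem cong_rename (q : QuadData K α) {E : Setoid ℕ} {A : Finset ℕ} (hρ : ∀ e ∈ A, E (ρ e) e)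
    {b : MvPolynomial ℕ K} (hb : b ∈ supp K A) :
    q.Cong E (MvPolynomial.rename ρ b) b := by
  intro B _ _ x hx
  rw [MvPolynomial.aeval_rename]
  rw [supp, MvPolynomial.supported_eq_adjoin_X] at hb
  induction hb using Algebra.adjoin_induction with
  | mem b hb =>
    obtain ⟨e, he, rfl⟩ := hb
    simpa using hx.eq_of_rel (hρ e he)
  | algebraMap r => simp
  | add x y _ _ hx hy => rw [map_add, map_add, hx, hy]
  | mul x y _ _ hx hy => rw [map_mul, map_mul, hx, hy]

theorem rename_of_supported {b : MvPolynomial ℕ K} (hfix : ∀ a ∈ O, ρ a = a)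
    (hb : b ∈ supp K O) : MvPolynomial.rename ρ b = b := by
  rw [supp, MvPolynomial.supported_eq_adjoin_X] at hb
  induction hb using Algebra.adjoin_induction with
  | mem b hb =>
    obtain ⟨e, he, rfl⟩ := hb
    rw [MvPolynomial.rename_X, hfix e he]
  | algebraMap r => simp [MvPolynomial.algebraMap_eq]
  | add x y _ _ hx hy => rw [map_add, hx, hy]
  | mul x y _ _ hx hy => rw [map_mul, hx, hy]

@[simp] theorem rename_el (q : QuadData K α) (e : ℕ) (r : R) :
    MvPolynomial.rename ρ (q.el e r) = q.el (ρ e) r := by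
  simp [QuadData.el]

/-- Equality of generators in a local state. -/
theorem IsState.W_congr (q : QuadData K α) (hst : IsState D L O Jl l μ ρ)
    (h : Cut D L X O J slot Jl) (hne : D.arcs.Nonempty) (hl : ∀ x ∈ l, x ∈ L) (hS : S ⊆ X)
    {b b' : MvPolynomial ℕ K} (hb : q.Cong (fam J slot X μ S) b b') :
    W K α D l S b = W K α D l S b' :=
  Khovanov.W_congr q hne (hb.mono (hst.fam_le_glue h hl hS))

/-- Normalization of the generators which appear in the differential. -/
theorem IsState.W_cc (q : QuadData K α) (hst : IsState D L O Jl l μ ρ)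
    (h : Cut D L X O J slot Jl) (hl : ∀ x ∈ l, x ∈ L) (hS : S ⊆ X)
    {b : MvPolynomial ℕ K} (hb : b ∈ supp K D.arcs) {e f : ℕ}
    (he : e ∈ D.arcs) (hf : f ∈ D.arcs) :
    W K α D l S (b * q.cc ω (glue D (l.toFinset ∪ S)) e f) =
      W K α D l S (MvPolynomial.rename ρ b * q.cc ω (fam J slot X μ S) (ρ e) (ρ f)) := by
  have hg := fun e he => hst.glue_rho h hl hS (e := e) he
  refine Khovanov.W_congr q ⟨e, he⟩ ((cong_rename q hg hb).symm.mul ?_)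
  have hi := hst.glue_iff h hl hS he hf
  by_cases h' : glue D (l.toFinset ∪ S) e f
  · rw [q.cc_pos h', q.cc_pos (hi.1 h')]; exact QuadData.Cong.refl _ _
  · rw [q.cc_neg h', q.cc_neg (mt hi.2 h')]
    exact (q.cop_congr ω (hg e he) (hg f hf)).symm

theorem T_ev (q : QuadData K α) {e : ℕ} (he : e ∈ D.arcs) (S₁ : Finset ℕ) (r : R)
    (b : MvPolynomial ℕ K) : T D S₁ e r (ev α D S₁ b) = ev α D S₁ (b * q.el e r) := by
  rw [T, LinearMap.mulLeft_apply, pt_eq_el q he, ← map_mul, mul_comm]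

theorem IsState.slide_ev (q : QuadData K α) (hst : IsState D L O Jl l μ ρ)
    (h : Cut D L X O J slot Jl) (hst' : IsState D' L' O Jl' l' μ' ρ')
    (h' : Cut D' L' X O J slot Jl') (hl : ∀ x ∈ l, x ∈ L) (hl' : ∀ x ∈ l', x ∈ L')
    (hρ : ∀ e ∈ D.arcs, ρ e ∈ O) (hμ : prs μ ≤ prs μ') (hS : S ⊆ X)
    {S₁ S₁' : Finset ℕ} (e₁ : S₁ = l.toFinset ∪ S) (e₁' : S₁' = l'.toFinset ∪ S)
    {g : R →ₗ[K] Phi K R D' S₁'} {b : MvPolynomial ℕ K}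
    (hb : b ∈ supp K O) :
    slide D S₁ D' S₁' O g (ev α D _ b) = ev α D' _ b := by
  subst e₁ e₁'
  refine Khovanov.slide_ev q h.sub h'.sub (hst.covered h hl hS hρ) (fun a ha b hb hab => ?_) hb
  rw [(hst'.outer h' hl').iff S hS a ha b hb]
  rw [(hst.outer h hl).iff S hS a ha b hb] at hab
  exact fam_le hμ S hab

theorem IsState.slide_ev_circle (q : QuadData K α) (hst : IsState D L O Jl l μ ρ)
    (h : Cut D L X O J slot Jl) (hst' : IsState D' L' O Jl' l' μ' ρ')
    (h' : Cut D' L' X O J slot Jl') (hl : ∀ x ∈ l, x ∈ L) (hl' : ∀ x ∈ l', x ∈ L') {k : ℕ}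
    (hk : k ∈ D.arcs) (hkO : k ∉ O) (hρk : ρ k = k)
    (hρ : ∀ e ∈ D.arcs, ρ e = k ∨ ρ e ∈ O) (hμ : prs μ ≤ prs μ') (hS : S ⊆ X)
    {S₁ S₁' : Finset ℕ} (e₁ : S₁ = l.toFinset ∪ S) (e₁' : S₁' = l'.toFinset ∪ S)
    {g : R →ₗ[K] Phi K R D' S₁'} {b : MvPolynomial ℕ K}
    (hb : b ∈ supp K O) (r : R) :
    slide D S₁ D' S₁' O g (ev α D _ (b * q.el k r)) =
      ev α D' _ b * g r := by
  subst e₁ e₁'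
  refine Khovanov.slide_ev_circle q h.sub h'.sub (hst.coveredExcept h hl hS hk hkO hρk hρ)
    (fun a ha b hb hab => ?_) hb r
  rw [(hst'.outer h' hl').iff S hS a ha b hb]
  rw [(hst.outer h hl).iff S hS a ha b hb] at hab
  exact fam_le hμ S hab

theorem IsState.isEntry {q : QuadData K α} {n k : ℤ} {m : Finset ℕ → MvPolynomial ℕ K}
    (hst' : IsState D' L' O Jl' l' μ' ρ') (h' : Cut D' L' X O J slot Jl')
    (hl' : l'.Sublist L') (hlen : (l'.length : ℤ) = k - n)
    (hm : ∀ S ⊆ X, m S ∈ supp K D'.arcs)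
    (hnat : Natural ω q slot X (fam J slot X μ) (fam J slot X μ') m) :
    IsEntry ω q D' L' X O (fam J slot X μ) n k (l', m) where
  sub := hl'
  length := hlen
  mem := hm
  nat := by
    refine ⟨_, hst'.outer h' fun _ hx => hl'.subset hx, fun S hS w hw hwS => ?_⟩
    rw [h'.slot_eq w hw]
    exact hnat S hS w hw hwS

/-- An operator in a local state where all circles meet the outer arcs. -/
theorem IsState.hasTables {q : QuadData K α} {n : ℤ} {F : Kh K R D →ₗ[K] Kh K R D'}
    (hst : IsState D L O Jl l μ ρ) (h : Cut D L X O J slot Jl) (hl : l.Sublist L)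
    (hρ : ∀ e ∈ D.arcs, ρ e ∈ O) {t : List (List ℕ × (Finset ℕ → MvPolynomial ℕ K))}
    (hF : ∀ S ⊆ X, ∀ b ∈ supp K O,
      F (W K α D l S b) = tab α D' t S b)
    (ht : ∀ c ∈ t, IsEntry ω q D' L' X O (fam J slot X μ) n l.length c) :
    HasTables ω q D D' L' X O F n l (fun _ => 1) fun _ => t where
  spans S hS := by
    rw [Set.range_const]
    exact (hst.covered h (fun _ hx => hl.subset hx) hS hρ).spans q h.sub
  mem _ := one_mem _
  acts _ S hS b hb := by rw [mul_one]; exact hF S hS b hb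
  entry := ⟨_, hst.outer h fun _ hx => hl.subset hx, fun _ => ht⟩

/-- An operator in a local state with a circle which does not meet the outer arcs. -/
theorem IsState.hasTables_circle {q : QuadData K α} {n : ℤ} {F : Kh K R D →ₗ[K] Kh K R D'}
    (hst : IsState D L O Jl l μ ρ) (h : Cut D L X O J slot Jl) (hl : l.Sublist L) {k : ℕ}
    (hk : k ∈ D.arcs) (hkO : k ∉ O) (hρk : ρ k = k)
    (hρ : ∀ e ∈ D.arcs, ρ e = k ∨ ρ e ∈ O)
    {t : R → List (List ℕ × (Finset ℕ → MvPolynomial ℕ K))}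
    (hF : ∀ S ⊆ X, ∀ b ∈ supp K O, ∀ r,
      F (W K α D l S (b * q.el k r)) = tab α D' (t r) S b)
    (ht : ∀ r, ∀ c ∈ t r, IsEntry ω q D' L' X O (fam J slot X μ) n l.length c) :
    HasTables ω q D D' L' X O F n l (q.el k) t where
  spans _ hS := (hst.coveredExcept h (fun _ hx => hl.subset hx) hS hk hkO hρk hρ).spans q h.sub
  mem r := q.el_mem hk r
  acts r S hS b hb := hF S hS b hb r
  entry := ⟨_, hst.outer h fun _ hx => hl.subset hx, ht⟩

variable [Coalgebra K R]

theorem IsState.surgery_ev (q : QuadData K α) (hω : IsTwisting (K := K) α ω)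
    (hst : IsState D L O Jl l μ ρ) (h : Cut D L X O J slot Jl)
    (hst' : IsState D' L' O Jl' l' μ' ρ') (h' : Cut D' L' X O J slot Jl')
    (hl : ∀ x ∈ l, x ∈ L) (hl' : ∀ x ∈ l', x ∈ L') (hρ : ∀ e ∈ D.arcs, ρ e ∈ O) {e f g₀ : ℕ}
    (he : e ∈ O) (hf : f ∈ O) (hS : S ⊆ X)
    (hs : Surg (fam J slot X μ S) (fam J slot X μ' S) e f g₀)
    {S₁ S₁' : Finset ℕ} (e₁ : S₁ = l.toFinset ∪ S) (e₁' : S₁' = l'.toFinset ∪ S)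
    {g : R →ₗ[K] Phi K R D' S₁'} {b : MvPolynomial ℕ K}
    (hb : b ∈ supp K O) :
    surgery D S₁ D' S₁' O g e f (ev α D _ b) =
      ev α D' _ (b * q.cc ω (fam J slot X μ' S) e f) := by
  subst e₁ e₁'
  rw [Khovanov.surgery_ev q hω h.sub h'.sub (hst.covered h hl hS hρ) (h'.sub he) (h'.sub hf)
    (fun a ha b hb hab => ?_) hb, cc_eq_of_iff ((hst'.outer h' hl').iff S hS e he f hf)]
  rw [(hst.outer h hl).iff S hS a ha b hb] at hab
  exact (sup_le_sup (hst'.fam_le_glue h' hl' hS) le_rfl) (hs.le hab)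

theorem IsState.surgery_ev_circle (q : QuadData K α) (hω : IsTwisting (K := K) α ω)
    (hst : IsState D L O Jl l μ ρ) (h : Cut D L X O J slot Jl)
    (hst' : IsState D' L' O Jl' l' μ' ρ') (h' : Cut D' L' X O J slot Jl')
    (hl : ∀ x ∈ l, x ∈ L) (hl' : ∀ x ∈ l', x ∈ L') {k : ℕ}
    (hk : k ∈ D.arcs) (hkO : k ∉ O) (hρk : ρ k = k)
    (hρ : ∀ e ∈ D.arcs, ρ e = k ∨ ρ e ∈ O) {e f g₀ : ℕ}
    (he : e ∈ O) (hf : f ∈ O) (hS : S ⊆ X)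
    (hs : Surg (fam J slot X μ S) (fam J slot X μ' S) e f g₀)
    {S₁ S₁' : Finset ℕ} (e₁ : S₁ = l.toFinset ∪ S) (e₁' : S₁' = l'.toFinset ∪ S)
    {g : R →ₗ[K] Phi K R D' S₁'} {b : MvPolynomial ℕ K}
    (hb : b ∈ supp K O) (r : R) :
    surgery D S₁ D' S₁' O g e f (ev α D _ (b * q.el k r)) =
      ev α D' _ (b * q.cc ω (fam J slot X μ' S) e f) * g r := by
  subst e₁ e₁'
  rw [Khovanov.surgery_ev_circle q hω h.sub h'.sub (hst.coveredExcept h hl hS hk hkO hρk hρ)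
    (h'.sub he) (h'.sub hf) (fun a ha b hb hab => ?_) hb,
    cc_eq_of_iff ((hst'.outer h' hl').iff S hS e he f hf)]
  rw [(hst.outer h hl).iff S hS a ha b hb] at hab
  exact (sup_le_sup (hst'.fam_le_glue h' hl' hS) le_rfl) (hs.le hab)

end StateGenerators

/-! ### Surgery moves -/

section States

/-- A local state without local crossings and with a trivial elimination of arcs. -/
theorem IsState.of_id {D : LinkDiagram} {O : Finset ℕ} {Jl μ : List (ℕ × ℕ)}
    (hμ : ∀ p ∈ μ, p.1 ∈ O ∧ p.2 ∈ O)
    (h : ∀ (T : Type) (f : ℕ → T), Compat f Jl ↔ Compat f μ) : IsState D [] O Jl [] μ id where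
  fix _ _ := rfl
  mem := hμ
  forth T f hf := ⟨(h T f).1 (by simpa using hf), fun _ _ => rfl⟩
  back T f hf := by simpa using (h T f).2 hf

theorem LinkDiagram.cut (D : LinkDiagram) {J : Finset (ℕ × ℕ)} {Jl : List (ℕ × ℕ)}
    (hJ : D.joins = J ∪ Jl.toFinset) : Cut D [] D.crossings D.arcs J D.slot Jl where
  nodup := List.nodup_nil
  notMem := by simp
  crossings_eq := by simp
  sub := le_rfl
  slot_mem := D.slot_mem
  joins_iff E := by
    simp only [hJ, Finset.mem_union, List.mem_toFinset, or_imp, forall_and]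
  join_mem j hj := D.join_mem j (hJ ▸ Finset.mem_union_left _ hj)
  slot_eq _ _ := rfl

theorem LinkDiagram.ne_heads (D : LinkDiagram) {a b c d : ℕ} (h : (a, b) ∈ D.joins)
    (h' : (c, d) ∈ D.joins) (hne : (a, b) ≠ (c, d)) : a ≠ c := by
  rintro rfl
  have := (LinkDiagram.existsUnique_head (D.join_mem _ h).1).unique
    (y₁ := .inr (a, b)) (y₂ := .inr (a, d)) ⟨h, rfl⟩ ⟨h', rfl⟩
  exact hne (Sum.inr.inj this)

theorem LinkDiagram.exists_perm (D : LinkDiagram) (S A : Finset ℕ) (hA : D.arcs = A) :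
    ∃ τ : Equiv.Perm A, (∀ e f : A, glue D S e f ↔ τ.SameCycle e f) ∧
      ∀ (e : A) (l : LinkDiagram.End), D.Head e l →
        (τ e : ℕ) = D.arcAt (LinkDiagram.across S l) := by
  subst hA
  refine ⟨D.next S, D.glue_iff_sameCycle S, fun e l hl => ?_⟩
  rw [LinkDiagram.next_eq (f := ⟨_, (hl.tail_across S).mem_arcs⟩) hl (hl.tail_across S)]

theorem SaddleMove.xor {D D' : LinkDiagram} (M : SaddleMove D D') (S : Finset ℕ) :
    glue D S M.a M.d ↔ ¬ glue D' S M.a M.b := by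
  have ha := D.join_mem _ M.mem_ab
  have hc := D.join_mem _ M.mem_cd
  have hac := D.ne_heads M.mem_ab M.mem_cd M.ne
  obtain ⟨σ, hσ, hσ'⟩ := D.exists_perm S _ rfl
  obtain ⟨τ, hτ, hτ'⟩ := D'.exists_perm S _ M.arcs_eq
  let a : D.arcs := ⟨M.a, ha.1⟩
  let b : D.arcs := ⟨M.b, ha.2⟩
  let c : D.arcs := ⟨M.c, hc.1⟩
  let d : D.arcs := ⟨M.d, hc.2⟩
  have hac' : a ≠ c := fun h => hac (congrArg Subtype.val h)
  have hsa : σ a = b := Subtype.ext (hσ' a (.inr (M.a, M.b)) ⟨M.mem_ab, rfl⟩)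
  have hsc : σ c = d := Subtype.ext (hσ' c (.inr (M.c, M.d)) ⟨M.mem_cd, rfl⟩)
  have hta : τ a = d := Subtype.ext (hτ' a (.inr (M.a, M.d)) ⟨by simp [M.joins_eq], rfl⟩)
  have htc : τ c = b := Subtype.ext (hτ' c (.inr (M.c, M.b)) ⟨by simp [M.joins_eq], rfl⟩)
  have hmul : τ = σ * Equiv.swap a c := by
    ext1 e
    rw [Equiv.Perm.mul_apply]
    by_cases hea : e = a
    · rw [hea, Equiv.swap_apply_left, hta, hsc]
    · by_cases hec : e = c
      · rw [hec, Equiv.swap_apply_right, htc, hsa]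
      · rw [Equiv.swap_apply_of_ne_of_ne hea hec]
        obtain ⟨l, hl, -⟩ := LinkDiagram.existsUnique_head e.2
        apply Subtype.ext
        rw [hσ' e l hl]
        rcases l with ⟨x, i⟩ | j
        · have hx := M.agree x hl.1
          rw [hτ' e (.inl (x, i)) ⟨M.crossings_eq ▸ hl.1, by rw [hx.1]; exact hl.2.1, by
            unfold DiagramCode.Inward; rw [hx.2]; exact hl.2.2⟩]
          simp only [LinkDiagram.across, LinkDiagram.arcAt, hx.1]
        · refine hτ' e (.inr j) ⟨?_, hl.2⟩
          rw [M.joins_eq]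
          refine Finset.mem_insert_of_mem (Finset.mem_insert_of_mem ?_)
          refine Finset.mem_erase.2 ⟨?_, Finset.mem_erase.2 ⟨?_, hl.1⟩⟩
          · rintro rfl; exact hec (Subtype.ext hl.2.symm)
          · rintro rfl; exact hea (Subtype.ext hl.2.symm)
  have key := sameCycle_iff_not_sameCycle_mul_swap σ hac'
  rw [← hmul, ← hσ, ← hτ] at key
  have g1 : glue D S M.d M.c := Setoid.symm' _ ((hσ c d).2 (hsc ▸ ⟨1, rfl⟩))
  have g2 : glue D' S M.c M.b := (hτ c b).2 (htc ▸ ⟨1, rfl⟩)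
  exact ⟨fun h => fun h' => key.1 (Setoid.trans' _ h g1)
      (Setoid.trans' _ h' (Setoid.symm' _ g2)),
    fun h => Setoid.trans' _ (key.2 fun h' => h (Setoid.trans' _ h' g2)) (Setoid.symm' _ g1)⟩

end States

section SurgeryMoves

variable {K : Type u} {R : Type v} [CommRing K] [CommRing R] [Algebra K R] {α : R}

theorem onStates_nil_W {D D' : LinkDiagram} {S : Finset ℕ} (h : S ⊆ D.crossings)
    (φ : (S₁ S : Finset ℕ) → Phi K R D S₁ →ₗ[K] Kh K R D') (b : MvPolynomial ℕ K) :
    onStates [] φ (W K α D [] S b) = φ S S (ev α D S b) := by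
  rw [onStates_W List.nodup_nil (List.Sublist.refl _) (by simp) (by simpa using h)]
  have : ∀ S₁ : Finset ℕ, S₁ = S → φ S₁ S (ev α D S₁ b) = φ S S (ev α D S b) := by
    rintro _ rfl; rfl
  exact this _ (by simp)

variable [Coalgebra K R] {ω : Rˣ} {D D' : LinkDiagram}

theorem dOn_empty (D : LinkDiagram) : dOn K R D ∅ = 0 := by
  refine DirectSum.linearMap_ext K fun S₁ => LinearMap.ext fun v => ?_
  simp only [dOn, onStates, LinearMap.comp_apply, DirectSum.toModule_lof, LinearMap.zero_apply,
    Finset.empty_sdiff, Finset.sum_empty]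
  rw [zsmul_hom_apply, LinearMap.zero_apply, zsmul_zero]

theorem isMorphism_of_tables_nil {q : QuadData K α} (hω : IsTwisting (K := K) α ω)
    {X O : Finset ℕ} (h : Frame D [] X O) (h' : Frame D' [] X O)
    (hslot : ∀ w ∈ X, D'.slot w = D.slot w) {F : Kh K R D →ₗ[K] Kh K R D'}
    (hF : ∃ β t, HasTables ω q D D' [] X O F 0 [] β t) : IsMorphism F 0 := by
  obtain ⟨β, t, ht⟩ := hF
  refine isMorphism_of_tables (q := q) hω h h' hslot fun l hl => ?_
  obtain rfl := List.sublist_nil.1 hl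
  refine ⟨β, t, ht, fun S hS b hb r => ?_⟩
  rw [List.toFinset_nil, dOn_empty, dOn_empty]
  simp

variable (M : BirthMove D D')

theorem BirthMove.cut : Cut D' [] D.crossings D.arcs D.joins D.slot [(M.l, M.l)] where
  nodup := List.nodup_nil
  notMem := by simp
  crossings_eq := by simp [M.crossings_eq]
  sub := by rw [M.arcs_eq]; exact Finset.subset_insert _ _
  slot_mem w hw i := by rw [(M.agree w hw).1]; exact D.slot_mem w hw i
  joins_iff E := by simp [M.joins_eq]
  join_mem := D.join_mem
  slot_eq w hw := (M.agree w hw).1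

theorem BirthMove.isState : IsState D' [] D.arcs [(M.l, M.l)] [] [] id :=
  IsState.of_id (by simp) (by simp)

theorem isState_self (D : LinkDiagram) : IsState D [] D.arcs [] [] [] id :=
  IsState.of_id (by simp) (by simp)

theorem BirthMove.isMorphism_map (q : QuadData K α) (hω : IsTwisting (K := K) α ω) :
    IsMorphism (M.map (K := K) (R := R)) 0 := by
  have h := D.cut (J := D.joins) (Jl := []) (by simp)
  refine isMorphism_of_tables_nil (q := q) hω h.toFrame M.cut.toFrame
    (fun w hw => (M.agree w hw).1)
    ⟨_, _, (isState_self D).hasTables h (List.Sublist.refl _) (fun _ he => he)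
      (t := [([], fun _ => 1)]) (fun S hS b hb => ?_) ?_⟩
  · rw [BirthMove.map, onStates_nil_W hS, LinearMap.comp_apply,
      (isState_self D).slide_ev q h M.isState M.cut (by simp) (by simp) (fun _ he => he) le_rfl hS
        (by simp) rfl hb]
    rw [wedge_ev]
    simp [tab]
  · simp only [List.mem_singleton]
    rintro _ rfl
    exact M.isState.isEntry M.cut (List.Sublist.refl _) (by simp)
      (fun _ _ => one_mem _) (natural_const _)

theorem BirthMove.isMorphism_inverseMap (q : QuadData K α) (hω : IsTwisting (K := K) α ω) :
    IsMorphism (M.inverseMap (K := K) (R := R)) 0 := by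
  have h := D.cut (J := D.joins) (Jl := []) (by simp)
  have hl : M.l ∈ D'.arcs := by rw [M.arcs_eq]; exact Finset.mem_insert_self _ _
  have hcov : ∀ e ∈ D'.arcs, id e = M.l ∨ id e ∈ D.arcs := fun e he => by
    rw [M.arcs_eq] at he; exact Finset.mem_insert.1 he
  refine isMorphism_of_tables_nil (q := q) hω M.cut.toFrame h.toFrame
    (fun w hw => (M.agree w hw).1.symm)
    ⟨_, _, M.isState.hasTables_circle M.cut (List.Sublist.refl _) hl M.l_notMem rfl hcov
      (t := fun r => [([], fun _ => MvPolynomial.C (Coalgebra.counit (R := K) r))])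
      (fun S hS b hb r => ?_) ?_⟩
  · rw [BirthMove.inverseMap, onStates_nil_W (by simpa [M.crossings_eq] using hS), LinearMap.comp_apply,
      M.isState.slide_ev_circle q M.cut (isState_self D) h (by simp) (by simp) hl M.l_notMem rfl
        hcov le_rfl hS (by simp) rfl hb, cap_eq, ← (ev α D _).commutes, ← map_mul, wedge_ev]
    simp [tab, MvPolynomial.algebraMap_eq]
  · intro r
    simp only [List.mem_singleton]
    rintro _ rfl
    exact (isState_self D).isEntry h (List.Sublist.refl _) (by simp)
      (fun _ _ => Subalgebra.algebraMap_mem _ _) (natural_const _)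

end SurgeryMoves

section Saddles

variable {K : Type u} {R : Type v} [CommRing K] [CommRing R] [Algebra K R] [Coalgebra K R]
  {α : R} {ω : Rˣ} {D D' : LinkDiagram} (M : SaddleMove D D')

theorem SaddleMove.isMorphism_map (q : QuadData K α) (hω : IsTwisting (K := K) α ω) :
    IsMorphism (M.map (K := K) (R := R)) 0 := by
  have ha := D.join_mem _ M.mem_ab
  have hc := D.join_mem _ M.mem_cd
  set J := (D.joins.erase (M.a, M.b)).erase (M.c, M.d) with hJ
  have hJD : D.joins = J ∪ [(M.a, M.b), (M.c, M.d)].toFinset := by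
    ext j
    have h1 := M.mem_ab
    have h2 := M.mem_cd
    simp only [hJ, Finset.mem_union, Finset.mem_erase, List.mem_toFinset, List.mem_cons,
      List.not_mem_nil, or_false]
    by_cases e1 : j = (M.a, M.b) <;> by_cases e2 : j = (M.c, M.d) <;> simp_all
  have h := D.cut hJD
  have h' : Cut D' [] D.crossings D.arcs J D.slot [(M.a, M.d), (M.c, M.b)] :=
    { nodup := List.nodup_nil
      notMem := by simp
      crossings_eq := by simp [M.crossings_eq]
      sub := M.arcs_eq.ge
      slot_mem := fun w hw i => by rw [(M.agree w hw).1]; exact D.slot_mem w hw i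
      joins_iff := fun E => by
        rw [M.joins_eq]
        simp only [Finset.mem_insert, forall_eq_or_imp, List.mem_cons, List.not_mem_nil, hJ]
        tauto
      join_mem := h.join_mem
      slot_eq := fun w hw => (M.agree w hw).1 }
  have hst : IsState D [] D.arcs [(M.a, M.b), (M.c, M.d)] [] [(M.a, M.b), (M.c, M.d)] id :=
    IsState.of_id (by simp [ha, hc]) fun _ _ => Iff.rfl
  have hst' : IsState D' [] D.arcs [(M.a, M.d), (M.c, M.b)] [] [(M.a, M.d), (M.c, M.b)] id :=
    IsState.of_id (by simp [ha, hc]) fun _ _ => Iff.rfl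
  have hs : ∀ S ⊆ D.crossings, Surg (fam J D.slot D.crossings [(M.a, M.b), (M.c, M.d)] S)
      (fam J D.slot D.crossings [(M.a, M.d), (M.c, M.b)] S) M.a M.b M.d := by
    intro S hS
    refine surg_fam (ν := []) rfl rfl ?_
    have e1 := hst.glue_iff h (by simp) hS ha.1 hc.2
    have e2 := hst'.glue_iff h' (by simp) hS (h'.sub ha.1) (h'.sub ha.2)
    have := M.xor ([].toFinset ∪ S)
    rw [e1, e2] at this
    exact this
  refine isMorphism_of_tables_nil (q := q) hω h.toFrame h'.toFrame
    (fun w hw => (M.agree w hw).1)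
    ⟨_, _, hst.hasTables h (List.Sublist.refl _) (fun _ he => he)
      (t := [([], fun S => q.cc ω (fam J D.slot D.crossings [(M.a, M.d), (M.c, M.b)] S) M.a M.b)])
      (fun S hS b hb => ?_) ?_⟩
  · rw [SaddleMove.map, onStates_nil_W hS, LinearMap.comp_apply,
      hst.surgery_ev q hω h hst' h' (by simp) (by simp) (fun _ he => he) ha.1 ha.2 hS
        (e := M.a) (f := M.b) (hs S hS) (by simp) rfl hb]
    rw [wedge_ev]
    simp [tab]
  · simp only [List.mem_singleton]
    rintro _ rfl
    exact hst'.isEntry h' (List.Sublist.refl _) (by simp)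
      (fun _ _ => q.cc_mem (h'.sub ha.1) (h'.sub ha.2) _ _)
      (natural_surg hs (hst.outSurg h (List.Sublist.refl _))
        (hst'.outSurg h' (List.Sublist.refl _)))

end Saddles

/-! ### Reidemeister moves of type I -/

section Homotopies

variable {K : Type u} {R : Type v} [CommRing K] [CommRing R] [Algebra K R] [Coalgebra K R]

theorem homotopic_of_eq {D D' : LinkDiagram} {F G : Kh K R D →ₗ[K] Kh K R D'} (h : F = G) :
    Homotopic F G := by
  refine ⟨0, fun i => ?_, ?_⟩
  · rw [Submodule.map_zero]; exact bot_le
  · refine LinearMap.ext fun v => ?_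
    rw [h, LinearMap.sub_apply, LinearMap.add_apply, LinearMap.comp_zero, LinearMap.zero_comp]
    simp only [LinearMap.zero_apply, add_zero]
    abel

end Homotopies

section TypeI

variable {K : Type u} {R : Type v} [CommRing K] [CommRing R] [Algebra K R] [Coalgebra K R]
  {α : R} {ω : Rˣ}

section OneCrossing

variable {D : LinkDiagram} {x : ℕ} {X O : Finset ℕ} {J : Finset (ℕ × ℕ)}
  {slot : ℕ → Fin 4 → ℕ} {Jl μ : List (ℕ × ℕ)} {ρ : ℕ → ℕ} {S : Finset ℕ}

theorem Cut.dOn_one_nil (q : QuadData K α) (hω : IsTwisting (K := K) α ω)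
    (h : Cut D [x] X O J slot Jl) (hst : IsState D [x] O Jl [x] μ ρ) (hS : S ⊆ X)
    {b : MvPolynomial ℕ K} (hb : b ∈ supp K D.arcs) :
    dOn K R D [x].toFinset (W K α D [] S b) = W K α D [x] S
      (MvPolynomial.rename ρ b * q.cc ω (fam J slot X μ S) (ρ (D.slot x 0)) (ρ (D.slot x 3))) := by
  have hx : x ∈ D.crossings := by rw [h.crossings_eq]; simp
  rw [dOn_local_W q hω h.toFrame (List.nil_sublist _) hS hb]
  simp only [List.not_mem_nil, not_false_eq_true, decide_true, List.filter_true, List.map_cons,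
    List.map_nil, List.sum_cons, List.sum_nil, add_zero]
  exact hst.W_cc q h (fun _ hx => hx) hS hb (D.slot_mem x hx _) (D.slot_mem x hx _)

theorem Cut.dOn_one_one (q : QuadData K α) (hω : IsTwisting (K := K) α ω)
    (h : Cut D [x] X O J slot Jl) (hS : S ⊆ X)
    {b : MvPolynomial ℕ K} (hb : b ∈ supp K D.arcs) :
    dOn K R D [x].toFinset (W K α D [x] S b) = 0 := by
  rw [dOn_local_W q hω h.toFrame (List.Sublist.refl _) hS hb]
  simp

theorem sublist_one {l : List ℕ} (h : l.Sublist [x]) : l = [] ∨ l = [x] := by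
  rcases l with _ | ⟨y, l⟩
  · exact Or.inl rfl
  · have := h.length_le
    have hl : l = [] := by
      cases l with
      | nil => rfl
      | cons _ _ => simp at this
    subst hl
    right
    simpa using h.subset

end OneCrossing

variable {positive : Bool} {D D' : LinkDiagram} (M : ReidemeisterI positive D D')

theorem mem_arrow {E : Setoid ℕ} {c : Bool} {a b : ℕ} :
    E (arrow c a b).1 (arrow c a b).2 ↔ E a b := by
  cases c
  · exact ⟨fun h => E.symm h, fun h => E.symm h⟩
  · exact Iff.rfl

theorem LinkDiagram.arrow_mem (D : LinkDiagram) {c : Bool} {a b : ℕ} (h : arrow c a b ∈ D.joins) :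
    a ∈ D.arcs ∧ b ∈ D.arcs := by
  have := D.join_mem _ h
  cases c
  · exact this.symm
  · exact this

namespace ReidemeisterI

/-- The marked points which are not modified. -/
def joins : Finset (ℕ × ℕ) := D.joins.erase (arrow M.c M.a M.b)

/-- The family of gluing relations on the outer arcs. -/
abbrev rel : Finset ℕ → Setoid ℕ := fam M.joins D.slot D.crossings [(M.a, M.b)]

theorem a_mem : M.a ∈ D.arcs := (D.arrow_mem M.mem_ab).1
theorem b_mem : M.b ∈ D.arcs := (D.arrow_mem M.mem_ab).2

theorem sub_arcs (M : ReidemeisterI positive D D') : D.arcs ⊆ D'.arcs := by rw [M.arcs_eq]; exact Finset.subset_insert _ _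
theorem l_mem : M.l ∈ D'.arcs := by rw [M.arcs_eq]; exact Finset.mem_insert_self _ _

theorem a_ne_l : M.a ≠ M.l := fun h => M.l_notMem (h ▸ M.a_mem)
theorem b_ne_l : M.b ≠ M.l := fun h => M.l_notMem (h ▸ M.b_mem)

theorem subset (M : ReidemeisterI positive D D')
    {S : Finset ℕ} (hS : S ⊆ D.crossings) : [].toFinset ∪ S ⊆ D'.crossings := by
  rw [M.crossings_eq]; simpa using hS.trans (Finset.subset_insert _ _)

theorem subset_one {S : Finset ℕ} (hS : S ⊆ D.crossings) : [M.x].toFinset ∪ S ⊆ D'.crossings := by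
  rw [M.crossings_eq]; simpa using Finset.insert_subset_insert _ hS

theorem notMem_state {S : Finset ℕ} (hS : S ⊆ D.crossings) : ∀ x ∈ [M.x], x ∉ S := by
  simpa using fun h => M.x_notMem (hS h)

theorem cut : Cut D [] D.crossings D.arcs M.joins D.slot [(M.a, M.b)] where
  nodup := List.nodup_nil
  notMem := by simp
  crossings_eq := by simp
  sub := le_rfl
  slot_mem := D.slot_mem
  joins_iff E := by
    rw [← Finset.insert_erase M.mem_ab]
    simp only [Finset.mem_insert, forall_eq_or_imp, mem_arrow, List.mem_singleton, forall_eq]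
    exact and_comm
  join_mem j hj := D.join_mem j (Finset.mem_of_mem_erase hj)
  slot_eq _ _ := rfl

theorem cut' : Cut D' [M.x] D.crossings D.arcs M.joins D.slot [] where
  nodup := List.nodup_singleton _
  notMem := by simpa using M.x_notMem
  crossings_eq := by rw [M.crossings_eq]; simp
  sub := M.sub_arcs
  slot_mem w hw i := by rw [(M.agree w hw).1]; exact D.slot_mem w hw i
  joins_iff E := by rw [M.joins_eq]; simp [joins]
  join_mem j hj := D.join_mem j (Finset.mem_of_mem_erase hj)
  slot_eq w hw := (M.agree w hw).1

theorem isState : IsState D [] D.arcs [(M.a, M.b)] [] [(M.a, M.b)] id :=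
  IsState.of_id (by simp [M.a_mem, M.b_mem]) fun _ _ => Iff.rfl

/-- The state where the loop is a circle. -/
theorem isState_circle {l : List ℕ} (hl : M.x ∈ l ↔ positive = false) :
    IsState D' [M.x] D.arcs [] l [(M.a, M.b)] id where
  fix _ _ := rfl
  mem := by simp [M.a_mem, M.b_mem]
  forth T f := by
    cases positive <;> simp +contextual [hl, crs, M.slot_x, eq_comm]
  back T f := by
    cases positive <;> simp +contextual [hl, crs, M.slot_x, eq_comm]

/-- The state where the loop is a part of the strand. -/
theorem isState_strand {l : List ℕ} (hl : M.x ∈ l ↔ positive = true) :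
    IsState D' [M.x] D.arcs [] l [(M.a, M.b)] (Function.update id M.l M.a) where
  fix a ha := Function.update_of_ne (by rintro rfl; exact M.l_notMem ha) _ _
  mem := by simp [M.a_mem, M.b_mem]
  forth T f hf := by
    have hab : f M.a = f M.b ∧ f M.a = f M.l := by
      cases positive <;> simp [hl, crs, M.slot_x] at hf <;> grind
    refine ⟨by simp [hab.1], fun e he => ?_⟩
    rcases eq_or_ne e M.l with rfl | h
    · simp [hab.2]
    · simp [Function.update_of_ne h]
  back T f := by
    have ha := M.a_ne_l
    have hb := M.b_ne_l
    cases positive <;> simp [hl, crs, M.slot_x, Function.update_of_ne ha,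
      Function.update_of_ne hb] <;> exact fun h => by simp [h]

theorem covered_circle : ∀ e ∈ D'.arcs, id e = M.l ∨ id e ∈ D.arcs := fun e he => by
  rw [M.arcs_eq] at he; exact Finset.mem_insert.1 he

theorem covered_strand : ∀ e ∈ D'.arcs, Function.update id M.l M.a e ∈ D.arcs := fun e he => by
  rw [M.arcs_eq] at he
  rcases eq_or_ne e M.l with rfl | h
  · simp [M.a_mem]
  · rw [Function.update_of_ne h]; exact (Finset.mem_insert.1 he).resolve_left h

theorem rel_ab (S : Finset ℕ) : M.rel S M.a M.b := fam_apply (p := (M.a, M.b)) (by simp)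

theorem mem_of_mem (M : ReidemeisterI positive D D')
    {b : MvPolynomial ℕ K} (hb : b ∈ supp K D.arcs) :
    b ∈ supp K D'.arcs :=
  MvPolynomial.supported_mono (by exact_mod_cast M.sub_arcs) hb

theorem rename_strand {b : MvPolynomial ℕ K}
    (hb : b ∈ supp K D.arcs) :
    MvPolynomial.rename (Function.update id M.l M.a) b = b :=
  rename_of_supported (M.isState_strand (l := if positive then [M.x] else [])
    (by cases positive <;> simp)).fix hb

end ReidemeisterI

section Positive

variable {D D' : LinkDiagram} (M : ReidemeisterI true D D')

namespace ReidemeisterI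

theorem pos_state : IsState D' [M.x] D.arcs [] [] [(M.a, M.b)] id :=
  M.isState_circle (by simp)

theorem pos_state' : IsState D' [M.x] D.arcs [] [M.x] [(M.a, M.b)]
    (Function.update id M.l M.a) :=
  M.isState_strand (by simp)

theorem pos_d {q : QuadData K α} (hω : IsTwisting (K := K) α ω) {S : Finset ℕ}
    (hS : S ⊆ D.crossings) {b : MvPolynomial ℕ K}
    (hb : b ∈ supp K D'.arcs) :
    dOn K R D' [M.x].toFinset (W K α D' [] S b) =
      W K α D' [M.x] S (MvPolynomial.rename (Function.update id M.l M.a) b) := by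
  rw [M.cut'.dOn_one_nil q hω M.pos_state' hS hb]
  congr 1
  have h0 : D'.slot M.x 0 = M.a := by simp [M.slot_x]
  have h3 : D'.slot M.x 3 = M.b := by simp [M.slot_x]
  rw [h0, h3, Function.update_of_ne M.a_ne_l, Function.update_of_ne M.b_ne_l, id, id, q.cc_pos,
    mul_one]
  exact M.rel_ab S

theorem pos_map_W (q : QuadData K α) {S : Finset ℕ}
    (hS : S ⊆ D.crossings) {b : MvPolynomial ℕ K}
    (hb : b ∈ supp K D.arcs) :
    M.map (K := K) (R := R) α ω (W K α D [] S b) = W K α D' [] S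
      (b * (q.el M.l ((ω : R) * α) - MvPolynomial.X M.a * q.el M.l (ω : R))) := by
  have key : ∀ b ∈ supp K D.arcs,
      slide D S D' ([].toFinset ∪ S) D.arcs 0 (ev α D S b) = ev (R := R) α D' _ b := fun b hb =>
    M.isState.slide_ev q M.cut M.pos_state M.cut' (by simp) (by simp) (fun _ he => he) le_rfl hS
      (by simp) rfl hb
  have hb' : b * q.el M.a α ∈ supp K D.arcs :=
    mul_mem hb (q.el_mem M.a_mem _)
  rw [ReidemeisterI.map, onStates_nil_W hS]
  simp only [LinearMap.comp_apply, LinearMap.sub_apply]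
  rw [T_ev q M.a_mem, key b hb, key _ hb', T_ev q M.l_mem, T_ev q M.l_mem, ← map_sub, wedge_ev,
    q.el_gen]
  congr 1
  ring

theorem pos_inverseMap_W (q : QuadData K α) {S : Finset ℕ}
    (hS : S ⊆ D.crossings) {b : MvPolynomial ℕ K}
    (hb : b ∈ supp K D.arcs) (r : R) :
    M.inverseMap (K := K) (R := R) (W K α D' [] S (b * q.el M.l r)) =
      W K α D [] S (b * MvPolynomial.C (Coalgebra.counit (R := K) r)) := by
  have hx : M.x ∉ [].toFinset ∪ S := by simpa using fun h => M.x_notMem (hS h)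
  rw [ReidemeisterI.inverseMap, onStates_W (List.nodup_singleton _) (List.nil_sublist _)
    (M.notMem_state hS) (M.subset hS)]
  simp only [hx, decide_false, LinearMap.comp_apply]
  rw [M.pos_state.slide_ev_circle q M.cut' M.isState M.cut (by simp) (by simp) M.l_mem M.l_notMem
    rfl M.covered_circle le_rfl hS rfl rfl hb, cap_eq, ← (ev α D _).commutes, ← map_mul, wedge_ev,
    mul_one, MvPolynomial.algebraMap_eq]

theorem pos_inverseMap_W_one {S : Finset ℕ} (hS : S ⊆ D.crossings) (b : MvPolynomial ℕ K) :
    M.inverseMap (K := K) (R := R) (W K α D' [M.x] S b) = 0 := by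
  rw [ReidemeisterI.inverseMap, onStates_W (List.nodup_singleton _) (List.Sublist.refl _)
    (M.notMem_state hS) (M.subset_one hS)]
  simp

/-- The homotopy. -/
def posHomotopy (ω : Rˣ) : Kh K R D' →ₗ[K] Kh K R D' :=
  onStates [M.x] fun S₁ S =>
    match decide (M.x ∈ S₁) with
    | false => 0
    | true => -(wedge D' [] S ∘ₗ T D' _ M.l (ω : R) ∘ₗ T D' _ M.a (↑ω⁻¹ : R) ∘ₗ
        slide D' S₁ D' _ D.arcs 0)

theorem posHomotopy_W {S : Finset ℕ} (hS : S ⊆ D.crossings) (b : MvPolynomial ℕ K) :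
    M.posHomotopy ω (K := K) (R := R) (W K α D' [] S b) = 0 := by
  have hx : M.x ∉ [].toFinset ∪ S := by simpa using fun h => M.x_notMem (hS h)
  rw [posHomotopy, onStates_W (List.nodup_singleton _) (List.nil_sublist _)
    (M.notMem_state hS) (M.subset hS)]
  simp only [hx, decide_false, LinearMap.zero_apply]

theorem posHomotopy_W_one (q : QuadData K α) {S : Finset ℕ} (hS : S ⊆ D.crossings)
    {b : MvPolynomial ℕ K} (hb : b ∈ supp K D.arcs) :
    M.posHomotopy ω (K := K) (R := R) (W K α D' [M.x] S b) =
      W K α D' [] S (b * -(q.el M.a (↑ω⁻¹ : R) * q.el M.l (ω : R))) := by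
  have hx : M.x ∈ [M.x].toFinset ∪ S := by simp
  rw [posHomotopy, onStates_W (List.nodup_singleton _) (List.Sublist.refl _)
    (M.notMem_state hS) (M.subset_one hS)]
  simp only [hx, decide_true, LinearMap.neg_apply, LinearMap.comp_apply]
  rw [M.pos_state'.slide_ev q M.cut' M.pos_state M.cut' (by simp) (by simp) M.covered_strand
    le_rfl hS rfl rfl hb, T_ev q (M.sub_arcs M.a_mem), T_ev q M.l_mem, wedge_ev, ← map_neg]
  congr 1
  ring

theorem pos_hasTables (q : QuadData K α) :
    HasTables ω q D D' [M.x] D.crossings D.arcs (M.map (K := K) α ω) 0 [] (fun _ => 1)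
      fun _ => [([], fun _ => q.el M.l ((ω : R) * α) - MvPolynomial.X M.a * q.el M.l (ω : R))] := by
  refine M.isState.hasTables M.cut (List.Sublist.refl _) (fun _ he => he) (fun S hS b hb => ?_) ?_
  · rw [M.pos_map_W q hS hb]; simp [tab]
  · simp only [List.mem_singleton]
    rintro _ rfl
    refine M.pos_state.isEntry M.cut' (List.nil_sublist _) (by simp) (fun _ _ => ?_)
      (natural_const _)
    exact sub_mem (q.el_mem M.l_mem _)
      (mul_mem (QuadData.X_mem (M.sub_arcs M.a_mem)) (q.el_mem M.l_mem _))

theorem pos_isMorphism_map (q : QuadData K α) (hω : IsTwisting (K := K) α ω) :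
    IsMorphism (M.map (K := K) α ω) 0 := by
  refine isMorphism_of_tables (q := q) hω M.cut.toFrame M.cut'.toFrame
    (fun w hw => (M.agree w hw).1) fun l hl => ?_
  obtain rfl := List.sublist_nil.1 hl
  refine ⟨_, _, M.pos_hasTables q, fun S hS b hb r => ?_⟩
  have ht := ((M.pos_hasTables (ω := ω) q).entry.choose_spec.2 r _ List.mem_cons_self).mem S hS
  rw [List.toFinset_nil, dOn_empty, LinearMap.zero_apply, map_zero, zsmul_zero]
  simp only [tab, List.map_cons, List.map_nil, List.sum_cons, List.sum_nil, add_zero]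
  rw [M.pos_d (q := q) hω hS (mul_mem (M.mem_of_mem hb) ht), ← map_zero (W K α D' _ _)]
  refine M.pos_state'.W_congr q M.cut' ⟨_, M.l_mem⟩ (by simp) hS ?_
  intro A _ _ x hx
  simp only [map_mul, map_sub, rename_el, MvPolynomial.rename_X, Function.update_self,
    Function.update_of_ne M.a_ne_l, id, hx.aeval_el_mul, MvPolynomial.aeval_X, q.el_gen, map_zero]
  ring

theorem pos_hasTables' (q : QuadData K α) :
    HasTables ω q D' D [] D.crossings D.arcs (M.inverseMap (K := K) (R := R)) 0 [] (q.el M.l)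
      fun r => [([], fun _ => MvPolynomial.C (Coalgebra.counit (R := K) r))] := by
  refine M.pos_state.hasTables_circle M.cut' (List.nil_sublist _) M.l_mem M.l_notMem rfl
    M.covered_circle (fun S hS b hb r => ?_) fun r => ?_
  · rw [M.pos_inverseMap_W q hS hb]; simp [tab]
  · simp only [List.mem_singleton]
    rintro _ rfl
    exact M.isState.isEntry M.cut (List.nil_sublist _) (by simp)
      (fun _ _ => Subalgebra.algebraMap_mem _ _) (natural_const _)

theorem pos_isMorphism_inverseMap (q : QuadData K α) (hω : IsTwisting (K := K) α ω) :
    IsMorphism (M.inverseMap (K := K) (R := R)) 0 := by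
  refine isMorphism_of_tables (q := q) hω M.cut'.toFrame M.cut.toFrame
    (fun w hw => (M.agree w hw).1.symm) fun l hl => ?_
  rcases sublist_one hl with rfl | rfl
  · refine ⟨_, _, M.pos_hasTables' q, fun S hS b hb r => ?_⟩
    rw [M.pos_d (q := q) hω hS (mul_mem (M.mem_of_mem hb) (q.el_mem M.l_mem _)),
      M.pos_inverseMap_W_one hS, List.toFinset_nil, dOn_empty, zsmul_zero]
    rfl
  · refine ⟨_, _, M.pos_state'.hasTables M.cut' (List.Sublist.refl _) M.covered_strand (t := [])
      (fun S hS b hb => by rw [M.pos_inverseMap_W_one hS]; rfl) (by simp), fun S hS b hb r => ?_⟩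
    rw [M.cut'.dOn_one_one q hω hS (by simpa using M.mem_of_mem hb), map_zero, zsmul_zero]
    simp [tab]

theorem pos_inverse_comp (q : QuadData K α) (hω : IsTwisting (K := K) α ω) :
    M.inverseMap ∘ₗ M.map α ω = (LinearMap.id : Kh K R D →ₗ[K] _) := by
  refine kh_hom_ext (α := α) (L := []) (O := D.arcs) fun l hl S hS _ => ?_
  obtain rfl := List.sublist_nil.1 hl
  rw [M.cut.sdiff] at hS
  refine ⟨_, (M.isState.covered M.cut (by simp) hS fun _ he => he).spans q le_rfl, ?_⟩
  rintro b hb _ rfl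
  have e : b * (q.el M.l ((ω : R) * α) - MvPolynomial.X M.a * q.el M.l (ω : R)) =
      b * q.el M.l ((ω : R) * α) - b * MvPolynomial.X M.a * q.el M.l (ω : R) := by ring
  rw [mul_one, LinearMap.comp_apply, M.pos_map_W q hS hb, e, map_sub, map_sub,
    M.pos_inverseMap_W q hS hb, M.pos_inverseMap_W q hS
      (mul_mem hb (QuadData.X_mem M.a_mem)), hω.counit_omega, hω.counit_omega_mul]
  simp

theorem pos_homotopic (q : QuadData K α) (hω : IsTwisting (K := K) α ω) :
    Homotopic (M.map α ω ∘ₗ M.inverseMap) (LinearMap.id : Kh K R D' →ₗ[K] _) := by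
  have hh : ∀ b ∈ supp K D.arcs,
      b * -(q.el M.a (↑ω⁻¹ : R) * q.el M.l (ω : R)) ∈
        supp K D'.arcs := fun b hb =>
    mul_mem (M.mem_of_mem hb) (neg_mem (Subalgebra.mul_mem _
      (q.el_mem (M.sub_arcs M.a_mem) _) (q.el_mem M.l_mem _)))
  refine homotopic_of_tables (q := q) (O := D.arcs) hω M.cut'.toFrame (H := M.posHomotopy ω)
    fun l hl => ?_
  rcases sublist_one hl with rfl | rfl
  · refine ⟨_, _, M.pos_state.hasTables_circle M.cut' (List.nil_sublist _) M.l_mem M.l_notMem rfl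
      M.covered_circle (t := fun _ => []) (fun S hS b hb r => by rw [M.posHomotopy_W hS]; rfl)
      (by simp), fun S hS b hb r => ?_⟩
    have hb1 : b * q.el M.a r ∈ supp K D.arcs :=
      mul_mem hb (q.el_mem M.a_mem _)
    have hb0 : b * MvPolynomial.C (Coalgebra.counit (R := K) r) ∈
        supp K D.arcs :=
      mul_mem hb (Subalgebra.algebraMap_mem _ _)
    rw [LinearMap.comp_apply, LinearMap.id_apply, M.pos_inverseMap_W q hS hb,
      M.pos_map_W q hS hb0,
      M.pos_d (q := q) hω hS (mul_mem (M.mem_of_mem hb) (q.el_mem M.l_mem _)),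
      map_mul (MvPolynomial.rename _), M.rename_strand hb, rename_el, Function.update_self, M.posHomotopy_W_one q hS hb1,
      tab, List.map_nil, List.sum_nil, map_zero, zero_add, ← map_sub]
    refine M.pos_state.W_congr q M.cut' ⟨_, M.l_mem⟩ (by simp) hS ?_
    intro A _ _ x hx
    obtain ⟨t, rfl⟩ : ∃ t, r = t * (ω : R) := ⟨r * (↑ω⁻¹ : R), by simp⟩
    simp only [map_mul, map_sub, map_neg, hx.aeval_el_mul, MvPolynomial.aeval_X, q.el_gen,
      MvPolynomial.aeval_C, q.counit_mul_omega hω]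
    have h1 := hx.el_mul_inv M.a ω
    rw [QuadData.aeval_el x M.l t, QuadData.aeval_el x M.a t]
    linear_combination (aeval x b * (algebraMap K A (q.φ₀ t) +
      algebraMap K A (q.φ₁ t) * x M.a) * aeval x (q.el M.l (ω : R))) * h1
  · refine ⟨_, _, M.pos_state'.hasTables M.cut' (List.Sublist.refl _) M.covered_strand
      (t := [([], fun _ => -(q.el M.a (↑ω⁻¹ : R) * q.el M.l (ω : R)))])
      (fun S hS b hb => by rw [M.posHomotopy_W_one q hS hb]; simp [tab]) ?_, fun S hS b hb r => ?_⟩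
    · simp only [List.mem_singleton]
      rintro _ rfl
      exact M.pos_state.isEntry M.cut' (List.nil_sublist _) (by simp)
        (fun _ _ => by simpa using hh 1 (one_mem _)) (natural_const _)
    · rw [LinearMap.comp_apply, LinearMap.id_apply, M.pos_inverseMap_W_one hS, map_zero,
        M.cut'.dOn_one_one q hω hS (by simpa using M.mem_of_mem hb), map_zero, add_zero, mul_one]
      simp only [tab, List.map_cons, List.map_nil, List.sum_cons, List.sum_nil, add_zero]
      rw [M.pos_d (q := q) hω hS (hh b hb), ← map_zero (W K α D' [M.x] S), ← map_sub]
      refine M.pos_state'.W_congr q M.cut' ⟨_, M.l_mem⟩ (by simp) hS ?_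
      rw [map_mul, M.rename_strand hb]
      intro A _ _ x hx
      simp only [map_mul, map_sub, map_neg, rename_el, Function.update_self,
        Function.update_of_ne M.a_ne_l, id, map_zero]
      linear_combination (aeval x b) * hx.el_mul_inv M.a ω

end ReidemeisterI

end Positive

section Negative

variable {D D' : LinkDiagram} (M : ReidemeisterI false D D')

namespace ReidemeisterI

theorem neg_state : IsState D' [M.x] D.arcs [] [] [(M.a, M.b)] (Function.update id M.l M.a) :=
  M.isState_strand (by simp)

theorem neg_state' : IsState D' [M.x] D.arcs [] [M.x] [(M.a, M.b)] id :=
  M.isState_circle (by simp)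

theorem neg_d {q : QuadData K α} (hω : IsTwisting (K := K) α ω) {S : Finset ℕ}
    (hS : S ⊆ D.crossings) {b : MvPolynomial ℕ K}
    (hb : b ∈ supp K D'.arcs) :
    dOn K R D' [M.x].toFinset (W K α D' [] S b) =
      W K α D' [M.x] S (b * q.el M.a (ω : R) * (MvPolynomial.X M.a - MvPolynomial.C q.s) *
        q.el M.l 1 + b * q.el M.a (ω : R) * q.el M.l α) := by
  rw [M.cut'.dOn_one_nil q hω M.neg_state' hS hb]
  congr 1
  have h0 : D'.slot M.x 0 = M.l := by simp [M.slot_x]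
  have h3 : D'.slot M.x 3 = M.a := by simp [M.slot_x]
  rw [h0, h3, MvPolynomial.rename_id_apply, id, id, q.cc_neg, QuadData.cop, q.el_one, q.el_gen]
  · ring
  · exact fam_isolated M.cut' M.neg_state'.mem M.l_notMem M.a_ne_l.symm

theorem neg_map_W (q : QuadData K α) {S : Finset ℕ}
    (hS : S ⊆ D.crossings) {b : MvPolynomial ℕ K}
    (hb : b ∈ supp K D.arcs) :
    M.map (K := K) (R := R) α ω (W K α D [] S b) = W K α D' [M.x] S b := by
  rw [ReidemeisterI.map, onStates_nil_W hS]
  simp only [LinearMap.comp_apply]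
  rw [M.isState.slide_ev q M.cut M.neg_state' M.cut' (by simp) (by simp) (fun _ he => he) le_rfl
    hS (by simp) rfl hb, wedge_ev]

theorem neg_inverseMap_W_one (q : QuadData K α) {S : Finset ℕ}
    (hS : S ⊆ D.crossings) {b : MvPolynomial ℕ K}
    (hb : b ∈ supp K D.arcs) (r : R) :
    M.inverseMap (K := K) (R := R) (W K α D' [M.x] S (b * q.el M.l r)) =
      W K α D [] S (b * q.el M.a (conj K r)) := by
  have hx : M.x ∈ [M.x].toFinset ∪ S := by simp
  rw [ReidemeisterI.inverseMap, onStates_W (List.nodup_singleton _) (List.Sublist.refl _)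
    (M.notMem_state hS) (M.subset_one hS)]
  simp only [hx, decide_true, LinearMap.comp_apply]
  rw [M.neg_state'.slide_ev_circle q M.cut' M.isState M.cut (by simp) (by simp) M.l_mem M.l_notMem
    rfl M.covered_circle le_rfl hS rfl rfl hb, LinearMap.comp_apply, pt_eq_el q M.a_mem, ← map_mul,
    wedge_ev]

theorem neg_inverseMap_W {S : Finset ℕ} (hS : S ⊆ D.crossings) (b : MvPolynomial ℕ K) :
    M.inverseMap (K := K) (R := R) (W K α D' [] S b) = 0 := by
  have hx : M.x ∉ [].toFinset ∪ S := by simpa using fun h => M.x_notMem (hS h)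
  rw [ReidemeisterI.inverseMap, onStates_W (List.nodup_singleton _) (List.nil_sublist _)
    (M.notMem_state hS) (M.subset hS)]
  simp only [hx, decide_false, LinearMap.zero_apply]

/-- The homotopy. -/
def negHomotopy (ω : Rˣ) : Kh K R D' →ₗ[K] Kh K R D' :=
  onStates [M.x] fun S₁ S =>
    match decide (M.x ∈ S₁) with
    | false => 0
    | true => -(wedge D' [] S ∘ₗ T D' _ M.a (↑ω⁻¹ : R) ∘ₗ
        slide D' S₁ D' _ D.arcs (cap D' _ (ω : R)))

theorem negHomotopy_W {S : Finset ℕ} (hS : S ⊆ D.crossings) (b : MvPolynomial ℕ K) :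
    M.negHomotopy ω (K := K) (R := R) (W K α D' [] S b) = 0 := by
  have hx : M.x ∉ [].toFinset ∪ S := by simpa using fun h => M.x_notMem (hS h)
  rw [negHomotopy, onStates_W (List.nodup_singleton _) (List.nil_sublist _)
    (M.notMem_state hS) (M.subset hS)]
  simp only [hx, decide_false, LinearMap.zero_apply]

theorem negHomotopy_W_one {q : QuadData K α} (hω : IsTwisting (K := K) α ω) {S : Finset ℕ}
    (hS : S ⊆ D.crossings) {b : MvPolynomial ℕ K}
    (hb : b ∈ supp K D.arcs) (r : R) :
    M.negHomotopy ω (K := K) (R := R) (W K α D' [M.x] S (b * q.el M.l r)) =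
      W K α D' [] S (b * (MvPolynomial.C (-q.φ₁ r) * q.el M.a (↑ω⁻¹ : R))) := by
  have hx : M.x ∈ [M.x].toFinset ∪ S := by simp
  rw [negHomotopy, onStates_W (List.nodup_singleton _) (List.Sublist.refl _)
    (M.notMem_state hS) (M.subset_one hS)]
  simp only [hx, decide_true, LinearMap.neg_apply, LinearMap.comp_apply]
  rw [M.neg_state'.slide_ev_circle q M.cut' M.neg_state M.cut' (by simp) (by simp) M.l_mem
    M.l_notMem rfl M.covered_circle le_rfl hS rfl rfl hb, cap_eq, ← (ev α D' _).commutes, ← map_mul,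
    T_ev q (M.sub_arcs M.a_mem), wedge_ev, ← map_neg, q.counit_mul_omega hω,
    MvPolynomial.algebraMap_eq]
  congr 1
  rw [map_neg]
  ring

theorem neg_hasTables (q : QuadData K α) :
    HasTables ω q D D' [M.x] D.crossings D.arcs (M.map (K := K) α ω) (-1) [] (fun _ => 1)
      fun _ => [([M.x], fun _ => 1)] := by
  refine M.isState.hasTables M.cut (List.Sublist.refl _) (fun _ he => he) (fun S hS b hb => ?_) ?_
  · rw [M.neg_map_W q hS hb]; simp [tab]
  · simp only [List.mem_singleton]
    rintro _ rfl
    exact M.neg_state'.isEntry M.cut' (List.Sublist.refl _) (by simp)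
      (fun _ _ => one_mem _) (natural_const _)

theorem neg_isMorphism_map (q : QuadData K α) (hω : IsTwisting (K := K) α ω) :
    IsMorphism (M.map (K := K) α ω) (-1) := by
  refine isMorphism_of_tables (q := q) hω M.cut.toFrame M.cut'.toFrame
    (fun w hw => (M.agree w hw).1) fun l hl => ?_
  obtain rfl := List.sublist_nil.1 hl
  refine ⟨_, _, M.neg_hasTables q, fun S hS b hb r => ?_⟩
  rw [List.toFinset_nil, dOn_empty, LinearMap.zero_apply, map_zero, zsmul_zero]
  simp only [tab, List.map_cons, List.map_nil, List.sum_cons, List.sum_nil, add_zero]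
  exact M.cut'.dOn_one_one q hω hS (by simpa using M.mem_of_mem hb)

theorem neg_isMorphism_inverseMap (q : QuadData K α) (hω : IsTwisting (K := K) α ω) :
    IsMorphism (M.inverseMap (K := K) (R := R)) 1 := by
  refine isMorphism_of_tables (q := q) hω M.cut'.toFrame M.cut.toFrame
    (fun w hw => (M.agree w hw).1.symm) fun l hl => ?_
  rcases sublist_one hl with rfl | rfl
  · refine ⟨_, _, M.neg_state.hasTables M.cut' (List.nil_sublist _) M.covered_strand (t := [])
      (fun S hS b hb => by rw [M.neg_inverseMap_W hS]; rfl) (by simp), fun S hS b hb r => ?_⟩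
    have h1 : b * q.el M.a (ω : R) ∈ supp K D.arcs :=
      mul_mem hb (q.el_mem M.a_mem _)
    have h2 : b * q.el M.a (ω : R) * (MvPolynomial.X M.a - MvPolynomial.C q.s) ∈
        supp K D.arcs :=
      mul_mem h1 (sub_mem (QuadData.X_mem M.a_mem)
        (Subalgebra.algebraMap_mem _ _))
    rw [List.toFinset_nil, dOn_empty, mul_one, M.neg_d (q := q) hω hS (M.mem_of_mem hb), map_add,
      map_add, M.neg_inverseMap_W_one q hS h2, M.neg_inverseMap_W_one q hS h1, ← map_add,
      LinearMap.zero_apply, q.el_conj, q.el_conj, q.φ₀_one, q.φ₁_one, q.φ₀_gen, q.φ₁_gen]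
    simp only [map_zero, map_one]
    ring_nf
    rw [map_zero, zsmul_zero]
  · refine ⟨_, _, M.neg_state'.hasTables_circle M.cut' (List.Sublist.refl _) M.l_mem M.l_notMem rfl
      M.covered_circle (t := fun r => [([], fun _ => q.el M.a (conj K r))])
      (fun S hS b hb r => by rw [M.neg_inverseMap_W_one q hS hb]; simp [tab]) fun r => ?_,
      fun S hS b hb r => ?_⟩
    · simp only [List.mem_singleton]
      rintro _ rfl
      exact M.isState.isEntry M.cut (List.nil_sublist _) (by simp)
        (fun _ _ => q.el_mem M.a_mem _) (natural_const _)
    · rw [M.cut'.dOn_one_one q hω hS (mul_mem (M.mem_of_mem hb) (q.el_mem M.l_mem _)),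
        map_zero, zsmul_zero, List.toFinset_nil, dOn_empty, LinearMap.zero_apply]

theorem neg_inverse_comp (q : QuadData K α) :
    M.inverseMap ∘ₗ M.map α ω = (LinearMap.id : Kh K R D →ₗ[K] _) := by
  refine kh_hom_ext (α := α) (L := []) (O := D.arcs) fun l hl S hS _ => ?_
  obtain rfl := List.sublist_nil.1 hl
  rw [M.cut.sdiff] at hS
  refine ⟨_, (M.isState.covered M.cut (by simp) hS fun _ he => he).spans q le_rfl, ?_⟩
  rintro b hb _ rfl
  have e : b = b * q.el M.l 1 := by rw [q.el_one, mul_one]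
  rw [mul_one, LinearMap.comp_apply, M.neg_map_W q hS hb]
  conv_lhs => rw [e]
  rw [M.neg_inverseMap_W_one q hS hb, q.conj_one, q.el_one, mul_one, LinearMap.id_apply]

theorem neg_homotopic (q : QuadData K α) (hω : IsTwisting (K := K) α ω) :
    Homotopic (M.map α ω ∘ₗ M.inverseMap) (LinearMap.id : Kh K R D' →ₗ[K] _) := by
  have hh : ∀ c : K, MvPolynomial.C c * q.el M.a (↑ω⁻¹ : R) ∈
      supp K D'.arcs := fun c =>
    mul_mem (Subalgebra.algebraMap_mem _ _) (q.el_mem (M.sub_arcs M.a_mem) _)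
  refine homotopic_of_tables (q := q) (O := D.arcs) hω M.cut'.toFrame (H := M.negHomotopy ω)
    fun l hl => ?_
  rcases sublist_one hl with rfl | rfl
  · refine ⟨_, _, M.neg_state.hasTables M.cut' (List.nil_sublist _) M.covered_strand (t := [])
      (fun S hS b hb => by rw [M.negHomotopy_W hS]; rfl) (by simp), fun S hS b hb r => ?_⟩
    have h1 : b * q.el M.a (ω : R) ∈ supp K D.arcs :=
      mul_mem hb (q.el_mem M.a_mem _)
    have h2 : b * q.el M.a (ω : R) * (MvPolynomial.X M.a - MvPolynomial.C q.s) ∈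
        supp K D.arcs :=
      mul_mem h1 (sub_mem (QuadData.X_mem M.a_mem)
        (Subalgebra.algebraMap_mem _ _))
    rw [LinearMap.comp_apply, LinearMap.id_apply, M.neg_inverseMap_W hS, map_zero, mul_one,
      M.neg_d (q := q) hω hS (M.mem_of_mem hb), map_add, map_add, M.negHomotopy_W_one hω hS h2,
      M.negHomotopy_W_one hω hS h1, tab, List.map_nil, List.sum_nil, map_zero, zero_add, zero_sub,
      ← map_neg, ← map_add]
    refine M.neg_state.W_congr q M.cut' ⟨_, M.l_mem⟩ (by simp) hS ?_
    intro A _ _ x hx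
    have h1 := hx.el_mul_inv M.a ω
    simp only [map_mul, map_sub, map_neg, map_add, q.φ₁_one, q.φ₁_gen, map_one, map_zero]
    linear_combination (aeval x b) * h1
  · refine ⟨_, _, M.neg_state'.hasTables_circle M.cut' (List.Sublist.refl _) M.l_mem M.l_notMem rfl
      M.covered_circle (t := fun r => [([], fun _ =>
        MvPolynomial.C (-q.φ₁ r) * q.el M.a (↑ω⁻¹ : R))])
      (fun S hS b hb r => by rw [M.negHomotopy_W_one hω hS hb]; simp [tab]) fun r => ?_,
      fun S hS b hb r => ?_⟩
    · simp only [List.mem_singleton]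
      rintro _ rfl
      exact M.neg_state.isEntry M.cut' (List.nil_sublist _) (by simp)
        (fun _ _ => hh _) (natural_const _)
    · have hb1 : b * q.el M.a (conj K r) ∈ supp K D.arcs :=
        mul_mem hb (q.el_mem M.a_mem _)
      rw [LinearMap.comp_apply, LinearMap.id_apply, M.neg_inverseMap_W_one q hS hb,
        M.neg_map_W q hS hb1, M.cut'.dOn_one_one q hω hS
          (mul_mem (M.mem_of_mem hb) (q.el_mem M.l_mem _)), map_zero, add_zero]
      simp only [tab, List.map_cons, List.map_nil, List.sum_cons, List.sum_nil, add_zero]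
      rw [M.neg_d (q := q) hω hS (mul_mem (M.mem_of_mem hb) (hh _)), ← map_sub]
      refine M.neg_state'.W_congr q M.cut' ⟨_, M.l_mem⟩ (by simp) hS ?_
      rw [q.el_conj]
      intro A _ _ x hx
      have h1 := hx.el_mul_inv M.a ω
      simp only [map_mul, map_sub, map_neg, map_add, q.el_one, q.el_gen, map_one,
        MvPolynomial.aeval_C, MvPolynomial.aeval_X, QuadData.aeval_el x M.l r]
      linear_combination (aeval x b * algebraMap K A (q.φ₁ r) *
        (x M.l + x M.a - algebraMap K A q.s)) * h1

end ReidemeisterI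

end Negative

end TypeI

/-! ### Reidemeister moves of type II -/

section TwoCrossings

variable {K : Type u} {R : Type v} [CommRing K] [CommRing R] [Algebra K R] {α : R} {ω : Rˣ}

theorem QuadData.IsModel.el_mul_cc {q : QuadData K α} {A : Type*} [CommRing A] [Algebra K A]
    {E : Setoid ℕ} {x : ℕ → A} (h : q.IsModel E x) (ω : Rˣ) {e f a b : ℕ}
    (hab : (E ⊔ pr e f) a b) (r : R) :
    aeval x (q.el a r) * aeval x (q.cc ω E e f) =
      aeval x (q.el b r) * aeval x (q.cc ω E e f) := by
  rw [QuadData.aeval_el, QuadData.aeval_el]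
  linear_combination algebraMap K A (q.φ₁ r) * h.mul_cc ω hab

theorem W_swap_nil {D : LinkDiagram} {X O : Finset ℕ} {L : List ℕ} (h : Frame D L X O) {x y : ℕ}
    (hx : x ∈ L) (hy : y ∈ L) (hxy : x ≠ y) {S : Finset ℕ} (hS : S ⊆ X) (b : MvPolynomial ℕ K) :
    W K α D [y, x] S b = -W K α D [x, y] S b :=
  W_swap hxy.symm (by simpa using fun hyS => h.notMem y hy (hS hyS))
    (by simpa using fun hxS => h.notMem x hx (hS hxS)) b

theorem sublist_two {x y : ℕ} {l : List ℕ} (h : l.Sublist [x, y]) :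
    l = [] ∨ l = [x] ∨ l = [y] ∨ l = [x, y] := by
  rcases List.sublist_cons_iff.1 h with h' | ⟨l, rfl, h'⟩
  · rcases sublist_one h' with rfl | rfl <;> simp
  · rcases sublist_one h' with rfl | rfl <;> simp

end TwoCrossings

namespace ReidemeisterII

variable {D D' : LinkDiagram}

section Relations

variable (M : ReidemeisterII D D')

/-- The marked points which are not modified. -/
def joins : Finset (ℕ × ℕ) := (D.joins.erase (arrow M.c M.a M.b)).erase (arrow M.c M.r M.t)

/-- The pairs of ends connected by the two branches. -/
def pairsU : List (ℕ × ℕ) := [(M.a, M.b), (M.r, M.t)]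

/-- The pairs of ends connected after surgery. -/
def pairsV : List (ℕ × ℕ) := [(M.a, M.t), (M.r, M.b)]

/-- The gluing relations of the two branches. -/
abbrev U : Finset ℕ → Setoid ℕ := fam M.joins D.slot D.crossings M.pairsU

/-- The gluing relations after surgery. -/
abbrev V : Finset ℕ → Setoid ℕ := fam M.joins D.slot D.crossings M.pairsV

theorem a_mem : M.a ∈ D.arcs := (D.arrow_mem M.mem_ab).1
theorem b_mem : M.b ∈ D.arcs := (D.arrow_mem M.mem_ab).2
theorem r_mem : M.r ∈ D.arcs := (D.arrow_mem M.mem_rt).1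
theorem t_mem : M.t ∈ D.arcs := (D.arrow_mem M.mem_rt).2

theorem base_mem_arcs : M.base ∈ D.arcs := by
  have h := M.base_mem
  simp only [Finset.mem_insert, Finset.mem_singleton] at h
  rcases h with h | h | h | h <;> rw [h]
  exacts [M.a_mem, M.b_mem, M.r_mem, M.t_mem]

theorem sub_arcs (M : ReidemeisterII D D') : D.arcs ⊆ D'.arcs := by
  rw [M.arcs_eq]
  exact (Finset.subset_insert _ _).trans (Finset.subset_insert _ _)

theorem m_mem : M.m ∈ D'.arcs := by rw [M.arcs_eq]; exact Finset.mem_insert_self _ _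

theorem ne_m {e : ℕ} (he : e ∈ D.arcs) : e ≠ M.m := by rintro rfl; exact M.m_notMem he
theorem ne_n {e : ℕ} (he : e ∈ D.arcs) : e ≠ M.n := by rintro rfl; exact M.n_notMem he

theorem cut : Cut D [] D.crossings D.arcs M.joins D.slot M.pairsU where
  nodup := List.nodup_nil
  notMem := by simp
  crossings_eq := by simp
  sub := le_rfl
  slot_mem := D.slot_mem
  joins_iff E := by
    have h : arrow M.c M.r M.t ∈ D.joins.erase (arrow M.c M.a M.b) :=
      Finset.mem_erase.2 ⟨M.ne.symm, M.mem_rt⟩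
    rw [joins, ← Finset.insert_erase M.mem_ab, Finset.erase_insert_eq_erase,
      Finset.erase_idem, ← Finset.insert_erase h]
    simp only [Finset.mem_insert, forall_eq_or_imp, mem_arrow, pairsU, List.mem_cons,
      List.not_mem_nil, false_imp_iff, implies_true, and_true, Finset.erase_insert_eq_erase,
      Finset.erase_idem]
    tauto
  join_mem j hj := D.join_mem j (Finset.mem_of_mem_erase (Finset.mem_of_mem_erase hj))
  slot_eq _ _ := rfl

theorem cut' : Cut D' [M.x, M.y] D.crossings D.arcs M.joins D.slot [] where
  nodup := by simpa using M.x_ne_y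
  notMem := by simpa using ⟨M.x_notMem, M.y_notMem⟩
  crossings_eq := by rw [M.crossings_eq]; ext; simp
  sub := M.sub_arcs
  slot_mem w hw i := by rw [(M.agree w hw).1]; exact D.slot_mem w hw i
  joins_iff E := by rw [M.joins_eq]; simp [joins]
  join_mem j hj := D.join_mem j (Finset.mem_of_mem_erase (Finset.mem_of_mem_erase hj))
  slot_eq w hw := (M.agree w hw).1

theorem subset {l : List ℕ} (hl : l.Sublist [M.x, M.y]) {S : Finset ℕ} (hS : S ⊆ D.crossings) :
    l.toFinset ∪ S ⊆ D'.crossings := M.cut'.union_subset hl hS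

theorem notMem_state {S : Finset ℕ} (hS : S ⊆ D.crossings) : ∀ x ∈ [M.x, M.y], x ∉ S :=
  fun x hx hxS => M.cut'.notMem x hx (hS hxS)

theorem mem_pairsU : ∀ p ∈ M.pairsU, p.1 ∈ D.arcs ∧ p.2 ∈ D.arcs := by
  simp [pairsU, M.a_mem, M.b_mem, M.r_mem, M.t_mem]

theorem mem_pairsV : ∀ p ∈ M.pairsV, p.1 ∈ D.arcs ∧ p.2 ∈ D.arcs := by
  simp [pairsV, M.a_mem, M.b_mem, M.r_mem, M.t_mem]

theorem isState : IsState D [] D.arcs M.pairsU [] M.pairsU id :=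
  IsState.of_id M.mem_pairsU fun _ _ => Iff.rfl

/-- The function which sends the arcs `m` and `n` to `e` and `f`. -/
def send (e f : ℕ) : ℕ → ℕ := Function.update (Function.update id M.m e) M.n f

@[simp] theorem send_m (e f : ℕ) : M.send e f M.m = e := by
  simp [send, Function.update_of_ne M.m_ne_n]

@[simp] theorem send_n (e f : ℕ) : M.send e f M.n = f := by simp [send]

theorem send_of_mem (e f : ℕ) {a : ℕ} (ha : a ∈ D.arcs) : M.send e f a = a := by
  rw [send, Function.update_of_ne (M.ne_n ha), Function.update_of_ne (M.ne_m ha), id]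

theorem forall_arcs {P : ℕ → Prop} (M : ReidemeisterII D D') (h : ∀ e ∈ D.arcs, P e) (hm : P M.m)
    (hn : P M.n) : ∀ e ∈ D'.arcs, P e := by
  intro e he
  rw [M.arcs_eq] at he
  simp only [Finset.mem_insert] at he
  rcases he with rfl | rfl | he
  exacts [hm, hn, h e he]

theorem isState_of {l : List ℕ} {μ : List (ℕ × ℕ)} {e f : ℕ}
    (hμ : ∀ p ∈ μ, p.1 ∈ D.arcs ∧ p.2 ∈ D.arcs)
    (h : ∀ (T : Type) (φ : ℕ → T),
      Compat φ (crs (D'.slot M.x) (decide (M.x ∈ l)) ++ crs (D'.slot M.y) (decide (M.y ∈ l))) →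
        Compat φ μ ∧ φ e = φ M.m ∧ φ f = φ M.n)
    (h' : ∀ (T : Type) (φ : ℕ → T), Compat φ μ → Compat (φ ∘ M.send e f)
      (crs (D'.slot M.x) (decide (M.x ∈ l)) ++ crs (D'.slot M.y) (decide (M.y ∈ l)))) :
    IsState D' [M.x, M.y] D.arcs [] l μ (M.send e f) where
  fix a ha := M.send_of_mem e f ha
  mem := hμ
  forth T φ hφ := by
    have := h T φ (by simpa using hφ)
    refine ⟨this.1, M.forall_arcs (fun a ha => by rw [M.send_of_mem e f ha]) ?_ ?_⟩
    · rw [M.send_m]; exact this.2.1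
    · rw [M.send_n]; exact this.2.2
  back T φ hφ := by simpa using h' T φ hφ

theorem state_nil : IsState D' [M.x, M.y] D.arcs [] [] M.pairsV (M.send M.a M.a) := by
  have := M.send_of_mem M.a M.a M.a_mem
  have := M.send_of_mem M.a M.a M.b_mem
  have := M.send_of_mem M.a M.a M.r_mem
  have := M.send_of_mem M.a M.a M.t_mem
  refine M.isState_of M.mem_pairsV (fun T φ => ?_) fun T φ => ?_ <;>
    simp [crs, M.slot_x, M.slot_y, pairsV] <;> grind

theorem state_x : IsState D' [M.x, M.y] D.arcs [] [M.x] M.pairsU (M.send M.a M.r) := by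
  have := M.send_of_mem M.a M.r M.a_mem
  have := M.send_of_mem M.a M.r M.b_mem
  have := M.send_of_mem M.a M.r M.r_mem
  have := M.send_of_mem M.a M.r M.t_mem
  refine M.isState_of M.mem_pairsU (fun T φ => ?_) fun T φ => ?_ <;>
    simp [crs, M.slot_x, M.slot_y, pairsU, M.x_ne_y.symm] <;> grind

theorem state_y : IsState D' [M.x, M.y] D.arcs [] [M.y] M.pairsV (M.send M.m M.m) := by
  have := M.send_of_mem M.m M.m M.a_mem
  have := M.send_of_mem M.m M.m M.b_mem
  have := M.send_of_mem M.m M.m M.r_mem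
  have := M.send_of_mem M.m M.m M.t_mem
  refine M.isState_of M.mem_pairsV (fun T φ => ?_) fun T φ => ?_ <;>
    simp [crs, M.slot_x, M.slot_y, pairsV, M.x_ne_y] <;> grind

theorem state_xy {l : List ℕ} (hx : M.x ∈ l) (hy : M.y ∈ l) :
    IsState D' [M.x, M.y] D.arcs [] l M.pairsV (M.send M.b M.b) := by
  have := M.send_of_mem M.b M.b M.a_mem
  have := M.send_of_mem M.b M.b M.b_mem
  have := M.send_of_mem M.b M.b M.r_mem
  have := M.send_of_mem M.b M.b M.t_mem
  refine M.isState_of M.mem_pairsV (fun T φ => ?_) fun T φ => ?_ <;>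
    simp [crs, M.slot_x, M.slot_y, pairsV, hx, hy] <;> grind

theorem covered {e f : ℕ} (he : e ∈ D.arcs) (hf : f ∈ D.arcs) :
    ∀ a ∈ D'.arcs, M.send e f a ∈ D.arcs :=
  M.forall_arcs (fun a ha => by rwa [M.send_of_mem e f ha]) (by rwa [M.send_m]) (by rwa [M.send_n])

theorem covered_circle : ∀ e ∈ D'.arcs, M.send M.m M.m e = M.m ∨ M.send M.m M.m e ∈ D.arcs :=
  M.forall_arcs (fun a ha => Or.inr (by rwa [M.send_of_mem _ _ ha]))
    (Or.inl (M.send_m _ _)) (Or.inl (M.send_n _ _))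

theorem surg {S : Finset ℕ} (hS : S ⊆ D.crossings) : Surg (M.U S) (M.V S) M.a M.b M.t := by
  refine surg_fam (ν := []) rfl rfl ?_
  have hy : M.y ∈ D'.crossings := by rw [M.crossings_eq]; simp
  have hyS : M.y ∉ [M.x].toFinset ∪ S := by
    simp only [List.toFinset_cons, List.toFinset_nil, Finset.mem_union, Finset.mem_insert,
      Finset.notMem_empty, or_false, not_or]
    exact ⟨M.x_ne_y.symm, M.notMem_state hS _ (by simp)⟩
  have key := LinkDiagram.glue_crossing_xor hy hyS
  rw [← Finset.insert_union, ← List.toFinset_cons,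
    M.state_x.glue_iff M.cut' (by simp) hS (D'.slot_mem _ hy _) (D'.slot_mem _ hy _),
    (M.state_xy (l := [M.y, M.x]) (by simp) (by simp)).glue_iff M.cut' (by simp) hS
      (D'.slot_mem _ hy _) (D'.slot_mem _ hy _)] at key
  simpa [M.slot_y, M.send_of_mem _ _ M.a_mem, M.send_of_mem _ _ M.t_mem] using key

theorem U_rt (S : Finset ℕ) : M.U S M.r M.t := fam_apply (p := (M.r, M.t)) (by simp [pairsU])

theorem V_at (S : Finset ℕ) : M.V S M.a M.t := fam_apply (p := (M.a, M.t)) (by simp [pairsV])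

theorem V_rb (S : Finset ℕ) : M.V S M.r M.b := fam_apply (p := (M.r, M.b)) (by simp [pairsV])

theorem V_base (S : Finset ℕ) : (M.V S ⊔ pr M.a M.b) M.base M.b := by
  have h1 : (M.V S ⊔ pr M.a M.b) M.a M.b := pr_le.1 le_sup_right
  have h2 : (M.V S ⊔ pr M.a M.b) M.a M.t := (le_sup_left : M.V S ≤ _) (M.V_at S)
  have h3 : (M.V S ⊔ pr M.a M.b) M.r M.b := (le_sup_left : M.V S ≤ _) (M.V_rb S)
  have h := M.base_mem
  simp only [Finset.mem_insert, Finset.mem_singleton] at h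
  rcases h with h | h | h | h <;> rw [h]
  exacts [h1, h3, Setoid.trans' _ (Setoid.symm' _ h2) h1]

theorem outSurgU : OutSurg D.slot D.crossings M.U := M.isState.outSurg M.cut (List.Sublist.refl _)

theorem outSurgV : OutSurg D.slot D.crossings M.V :=
  M.state_nil.outSurg M.cut' (List.nil_sublist _)

end Relations

section Operators

variable {K : Type u} {R : Type v} [CommRing K] [CommRing R] [Algebra K R] {α : R} {ω : Rˣ}
  {S : Finset ℕ} (M : ReidemeisterII D D')

theorem mem_of_mem (M : ReidemeisterII D D') {b : MvPolynomial ℕ K}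
    (hb : b ∈ supp K D.arcs) :
    b ∈ supp K D'.arcs :=
  MvPolynomial.supported_mono (by exact_mod_cast M.sub_arcs) hb

theorem rename_eq (e f : ℕ) {b : MvPolynomial ℕ K}
    (hb : b ∈ supp K D.arcs) :
    MvPolynomial.rename (M.send e f) b = b :=
  rename_of_supported (fun _ ha => M.send_of_mem e f ha) hb

theorem x_notMem_union {l : List ℕ} (hl : M.x ∉ l) (hS : S ⊆ D.crossings) :
    M.x ∉ l.toFinset ∪ S := by
  simpa [hl] using fun h => M.x_notMem (hS h)

theorem y_notMem_union {l : List ℕ} (hl : M.y ∉ l) (hS : S ⊆ D.crossings) :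
    M.y ∉ l.toFinset ∪ S := by
  simpa [hl] using fun h => M.y_notMem (hS h)

/-- The coefficient of `y` in `f⁰`. -/
def coeff (ω : Rˣ) (q : QuadData K α) (S : Finset ℕ) : MvPolynomial ℕ K :=
  q.el M.base (↑ω⁻¹ : R) * q.cc ω (M.V S) M.a M.b * q.el M.m (ω : R)

theorem coeff_mem (q : QuadData K α) (S : Finset ℕ) :
    M.coeff ω q S ∈ supp K D'.arcs :=
  mul_mem (mul_mem (q.el_mem (M.sub_arcs M.base_mem_arcs) _)
    (q.cc_mem (M.sub_arcs M.a_mem) (M.sub_arcs M.b_mem) _ _)) (q.el_mem M.m_mem _)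

variable [Coalgebra K R]

theorem map_W {q : QuadData K α} (hω : IsTwisting (K := K) α ω) (hS : S ⊆ D.crossings)
    {b : MvPolynomial ℕ K} (hb : b ∈ supp K D.arcs) :
    M.map (K := K) (R := R) ω (W K α D [] S b) =
      W K α D' [M.x] S b + W K α D' [M.y] S (b * M.coeff ω q S) := by
  have hb' : b * q.el M.base (↑ω⁻¹ : R) ∈ supp K D.arcs :=
    mul_mem hb (q.el_mem M.base_mem_arcs _)
  rw [ReidemeisterII.map, onStates_nil_W hS]
  simp only [LinearMap.comp_apply, LinearMap.add_apply]
  rw [M.isState.slide_ev q M.cut M.state_x M.cut' (by simp) (by simp) (fun _ he => he) le_rfl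
    hS (by simp) rfl hb, wedge_ev, T_ev q M.base_mem_arcs,
    M.isState.surgery_ev q hω M.cut M.state_y M.cut' (by simp) (by simp) (fun _ he => he) M.a_mem
      M.b_mem hS (M.surg hS) (by simp) rfl hb', T_ev q M.m_mem, wedge_ev, coeff]
  simp only [mul_assoc]

theorem inverseMap_W_nil (hS : S ⊆ D.crossings) (b : MvPolynomial ℕ K) :
    M.inverseMap (K := K) (R := R) (W K α D' [] S b) = 0 := by
  rw [ReidemeisterII.inverseMap, onStates_W M.cut'.nodup (List.nil_sublist _)
    (M.notMem_state hS) (M.subset (List.nil_sublist _) hS)]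
  simp only [M.x_notMem_union (l := []) (by simp) hS, M.y_notMem_union (l := []) (by simp) hS,
    decide_false, LinearMap.zero_apply]

theorem inverseMap_W_x (q : QuadData K α) (hS : S ⊆ D.crossings)
    {b : MvPolynomial ℕ K} (hb : b ∈ supp K D.arcs) :
    M.inverseMap (K := K) (R := R) (W K α D' [M.x] S b) = W K α D [] S b := by
  have hx : M.x ∈ [M.x].toFinset ∪ S := by simp
  rw [ReidemeisterII.inverseMap, onStates_W M.cut'.nodup (by simp)
    (M.notMem_state hS) (M.subset (by simp) hS)]
  simp only [hx, M.y_notMem_union (l := [M.x]) (by simpa using M.x_ne_y.symm) hS,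
    decide_false, decide_true, LinearMap.comp_apply]
  rw [M.state_x.slide_ev q M.cut' M.isState M.cut (by simp) (by simp) (M.covered M.a_mem M.r_mem)
    le_rfl hS rfl rfl hb, wedge_ev]

theorem inverseMap_W_y {q : QuadData K α} (hω : IsTwisting (K := K) α ω) (hS : S ⊆ D.crossings)
    {b : MvPolynomial ℕ K} (hb : b ∈ supp K D.arcs) (r : R) :
    M.inverseMap (K := K) (R := R) (W K α D' [M.y] S (b * q.el M.m r)) = W K α D [] S
      (b * (MvPolynomial.C (-Coalgebra.counit (R := K) r) * q.cc ω (M.U S) M.a M.t)) := by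
  have hy : M.y ∈ [M.y].toFinset ∪ S := by simp
  rw [ReidemeisterII.inverseMap, onStates_W M.cut'.nodup (by simp)
    (M.notMem_state hS) (M.subset (by simp) hS)]
  simp only [hy, M.x_notMem_union (l := [M.y]) (by simpa using M.x_ne_y) hS,
    decide_false, decide_true, LinearMap.comp_apply, LinearMap.neg_apply]
  rw [M.state_y.surgery_ev_circle q hω M.cut' M.isState M.cut (by simp) (by simp) M.m_mem
    M.m_notMem (M.send_m _ _) M.covered_circle M.a_mem M.t_mem hS (M.surg hS).symm rfl rfl hb,
    cap_eq, ← (ev α D _).commutes, ← map_mul, wedge_ev, ← map_neg, mul_one,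
    MvPolynomial.algebraMap_eq]
  congr 1
  rw [map_neg MvPolynomial.C]
  ring

theorem inverseMap_W_xy (hS : S ⊆ D.crossings) (b : MvPolynomial ℕ K) :
    M.inverseMap (K := K) (R := R) (W K α D' [M.x, M.y] S b) = 0 := by
  have hx : M.x ∈ [M.x, M.y].toFinset ∪ S := by simp
  have hy : M.y ∈ [M.x, M.y].toFinset ∪ S := by simp
  rw [ReidemeisterII.inverseMap, onStates_W M.cut'.nodup (List.Sublist.refl _)
    (M.notMem_state hS) (M.subset (List.Sublist.refl _) hS)]
  simp only [hx, hy, decide_true, LinearMap.zero_apply]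

/-- The homotopy. -/
def homotopy (ω : Rˣ) : Kh K R D' →ₗ[K] Kh K R D' :=
  onStates [M.x, M.y] fun S₁ S =>
    match decide (M.x ∈ S₁), decide (M.y ∈ S₁) with
    | false, true => -(wedge D' [] S ∘ₗ slide D' S₁ D' _ D.arcs (cap D' _ 1))
    | true, true => -(wedge D' [M.y] S ∘ₗ T D' _ M.m (ω : R) ∘ₗ T D' _ M.b (↑ω⁻¹ : R) ∘ₗ
        slide D' S₁ D' _ D.arcs 0)
    | _, false => 0

theorem homotopy_W_nil (hS : S ⊆ D.crossings) (b : MvPolynomial ℕ K) :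
    M.homotopy (K := K) (R := R) ω (W K α D' [] S b) = 0 := by
  rw [homotopy, onStates_W M.cut'.nodup (List.nil_sublist _)
    (M.notMem_state hS) (M.subset (List.nil_sublist _) hS)]
  simp only [M.x_notMem_union (l := []) (by simp) hS, M.y_notMem_union (l := []) (by simp) hS,
    decide_false, LinearMap.zero_apply]

theorem homotopy_W_x (hS : S ⊆ D.crossings) (b : MvPolynomial ℕ K) :
    M.homotopy (K := K) (R := R) ω (W K α D' [M.x] S b) = 0 := by
  have hx : M.x ∈ [M.x].toFinset ∪ S := by simp
  rw [homotopy, onStates_W M.cut'.nodup (by simp)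
    (M.notMem_state hS) (M.subset (by simp) hS)]
  simp only [hx, M.y_notMem_union (l := [M.x]) (by simpa using M.x_ne_y.symm) hS,
    decide_false, decide_true, LinearMap.zero_apply]

theorem homotopy_W_y (q : QuadData K α) (hS : S ⊆ D.crossings)
    {b : MvPolynomial ℕ K} (hb : b ∈ supp K D.arcs) (r : R) :
    M.homotopy (K := K) (R := R) ω (W K α D' [M.y] S (b * q.el M.m r)) =
      W K α D' [] S (b * MvPolynomial.C (-Coalgebra.counit (R := K) r)) := by
  have hy : M.y ∈ [M.y].toFinset ∪ S := by simp
  rw [homotopy, onStates_W M.cut'.nodup (by simp) (M.notMem_state hS) (M.subset (by simp) hS)]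
  simp only [hy, M.x_notMem_union (l := [M.y]) (by simpa using M.x_ne_y) hS,
    decide_false, decide_true, LinearMap.comp_apply, LinearMap.neg_apply]
  rw [M.state_y.slide_ev_circle q M.cut' M.state_nil M.cut' (by simp) (by simp) M.m_mem
    M.m_notMem (M.send_m _ _) M.covered_circle le_rfl hS rfl rfl hb,
    cap_eq, ← (ev α D' _).commutes, ← map_mul, wedge_ev, ← map_neg, mul_one,
    MvPolynomial.algebraMap_eq, map_neg MvPolynomial.C, mul_neg]

theorem homotopy_W_xy (q : QuadData K α) (hS : S ⊆ D.crossings)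
    {b : MvPolynomial ℕ K} (hb : b ∈ supp K D.arcs) :
    M.homotopy (K := K) (R := R) ω (W K α D' [M.x, M.y] S b) =
      W K α D' [M.y] S (b * -(q.el M.b (↑ω⁻¹ : R) * q.el M.m (ω : R))) := by
  have hx : M.x ∈ [M.x, M.y].toFinset ∪ S := by simp
  have hy : M.y ∈ [M.x, M.y].toFinset ∪ S := by simp
  rw [homotopy, onStates_W M.cut'.nodup (List.Sublist.refl _)
    (M.notMem_state hS) (M.subset (List.Sublist.refl _) hS)]
  simp only [hx, hy, decide_true, LinearMap.neg_apply, LinearMap.comp_apply]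
  rw [(M.state_xy (l := [M.x, M.y]) (by simp) (by simp)).slide_ev q M.cut' M.state_y M.cut'
    (by simp) (by simp) (M.covered M.b_mem M.b_mem) le_rfl hS rfl rfl hb,
    T_ev q (M.sub_arcs M.b_mem), T_ev q M.m_mem, wedge_ev, ← map_neg]
  congr 1
  ring

theorem dOn_W_nil {q : QuadData K α} (hω : IsTwisting (K := K) α ω) (hS : S ⊆ D.crossings)
    {b : MvPolynomial ℕ K} (hb : b ∈ supp K D.arcs) :
    dOn K R D' [M.x, M.y].toFinset (W K α D' [] S b) =
      W K α D' [M.x] S (b * q.cc ω (M.U S) M.r M.a) +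
        (W K α D' [M.y] S (b * (MvPolynomial.X M.a - MvPolynomial.C q.s) * q.el M.m (ω : R)) +
          W K α D' [M.y] S (b * q.el M.m ((ω : R) * α))) := by
  have hx : M.x ∈ D'.crossings := by rw [M.crossings_eq]; simp
  have hy : M.y ∈ D'.crossings := by rw [M.crossings_eq]; simp
  rw [dOn_local_W q hω M.cut'.toFrame (List.nil_sublist _) hS (M.mem_of_mem hb)]
  simp only [List.not_mem_nil, not_false_eq_true, decide_true, List.filter_true, List.map_cons,
    List.map_nil, List.sum_cons, List.sum_nil, add_zero]
  rw [M.state_x.W_cc q M.cut' (by simp) hS (M.mem_of_mem hb) (D'.slot_mem _ hx _)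
    (D'.slot_mem _ hx _), M.state_y.W_cc q M.cut' (by simp) hS (M.mem_of_mem hb)
    (D'.slot_mem _ hy _) (D'.slot_mem _ hy _), M.rename_eq _ _ hb, M.rename_eq _ _ hb, ← map_add]
  congr 1
  · simp [M.slot_x]
  · have h1 : M.send M.m M.m (D'.slot M.y 0) = M.a := by
      simp [M.slot_y, M.send_of_mem _ _ M.a_mem]
    have h2 : M.send M.m M.m (D'.slot M.y 3) = M.m := by simp [M.slot_y]
    rw [h1, h2, q.cc_neg (fun h => fam_isolated M.cut' M.mem_pairsV M.m_notMem
      (M.ne_m M.a_mem).symm (Setoid.symm' _ h))]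
    refine M.state_y.W_congr q M.cut' ⟨_, M.m_mem⟩ (by simp) hS ?_
    intro A _ _ x hx
    simp only [map_mul, map_add, map_sub, QuadData.aeval_cop, hx.aeval_el_mul, q.el_gen,
      MvPolynomial.aeval_X, MvPolynomial.aeval_C]
    ring

theorem dOn_W_x {q : QuadData K α} (hω : IsTwisting (K := K) α ω) (hS : S ⊆ D.crossings)
    {b : MvPolynomial ℕ K} (hb : b ∈ supp K D.arcs) :
    dOn K R D' [M.x, M.y].toFinset (W K α D' [M.x] S b) =
      -W K α D' [M.x, M.y] S (b * q.cc ω (M.V S) M.a M.b) := by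
  have hy : M.y ∈ D'.crossings := by rw [M.crossings_eq]; simp
  rw [dOn_local_W q hω M.cut'.toFrame (by simp) hS (M.mem_of_mem hb)]
  have hf : [M.x, M.y].filter (· ∉ [M.x]) = [M.y] := by simp [M.x_ne_y.symm]
  rw [hf]
  simp only [List.map_cons, List.map_nil, List.sum_cons, List.sum_nil, add_zero]
  rw [(M.state_xy (l := [M.y, M.x]) (by simp) (by simp)).W_cc q M.cut' (by simp) hS
    (M.mem_of_mem hb) (D'.slot_mem _ hy _) (D'.slot_mem _ hy _), M.rename_eq _ _ hb,
    W_swap_nil M.cut'.toFrame (by simp) (by simp) M.x_ne_y hS]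
  simp [M.slot_y, M.send_of_mem _ _ M.a_mem]

theorem dOn_W_y {q : QuadData K α} (hω : IsTwisting (K := K) α ω) (hS : S ⊆ D.crossings)
    {b : MvPolynomial ℕ K} (hb : b ∈ supp K D'.arcs) :
    dOn K R D' [M.x, M.y].toFinset (W K α D' [M.y] S b) =
      W K α D' [M.x, M.y] S (MvPolynomial.rename (M.send M.b M.b) b) := by
  have hx : M.x ∈ D'.crossings := by rw [M.crossings_eq]; simp
  rw [dOn_local_W q hω M.cut'.toFrame (by simp) hS hb]
  have hf : [M.x, M.y].filter (· ∉ [M.y]) = [M.x] := by simp [M.x_ne_y]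
  rw [hf]
  simp only [List.map_cons, List.map_nil, List.sum_cons, List.sum_nil, add_zero]
  rw [(M.state_xy (l := [M.x, M.y]) (by simp) (by simp)).W_cc q M.cut' (by simp) hS
    hb (D'.slot_mem _ hx _) (D'.slot_mem _ hx _)]
  have h1 : M.send M.b M.b (D'.slot M.x 0) = M.b := by simp [M.slot_x]
  have h2 : M.send M.b M.b (D'.slot M.x 3) = M.b := by simp [M.slot_x]
  rw [h1, h2, q.cc_pos (Setoid.refl' _ _), mul_one]

theorem dOn_W_xy {q : QuadData K α} (hω : IsTwisting (K := K) α ω) (hS : S ⊆ D.crossings)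
    {b : MvPolynomial ℕ K} (hb : b ∈ supp K D'.arcs) :
    dOn K R D' [M.x, M.y].toFinset (W K α D' [M.x, M.y] S b) = 0 := by
  rw [dOn_local_W q hω M.cut'.toFrame (List.Sublist.refl _) hS hb]
  simp

theorem hasTables_map {q : QuadData K α} (hω : IsTwisting (K := K) α ω) :
    HasTables ω q D D' [M.x, M.y] D.crossings D.arcs (M.map (K := K) (R := R) ω) (-1) []
      (fun _ => 1) fun _ => [([M.x], fun _ => 1), ([M.y], M.coeff ω q)] := by
  refine M.isState.hasTables M.cut (List.Sublist.refl _) (fun _ he => he) (fun S hS b hb => ?_) ?_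
  · rw [M.map_W (q := q) hω hS hb]; simp [tab]
  · simp only [List.mem_cons, List.not_mem_nil, or_false, forall_eq_or_imp, forall_eq]
    refine ⟨M.state_x.isEntry M.cut' (by simp) (by simp) (fun _ _ => one_mem _)
      (natural_const _), M.state_y.isEntry M.cut' (by simp) (by simp)
      (fun _ _ => M.coeff_mem q _) ?_⟩
    exact ((natural_const _).mul_surg (fun S hS => M.surg hS) M.outSurgU M.outSurgV).mul_const _

theorem isMorphism_map {q : QuadData K α} (hω : IsTwisting (K := K) α ω) :
    IsMorphism (M.map (K := K) (R := R) ω) (-1) := by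
  refine isMorphism_of_tables (q := q) hω M.cut.toFrame M.cut'.toFrame
    (fun w hw => (M.agree w hw).1) fun l hl => ?_
  obtain rfl := List.sublist_nil.1 hl
  refine ⟨_, _, M.hasTables_map hω, fun S hS b hb r => ?_⟩
  rw [List.toFinset_nil, dOn_empty, LinearMap.zero_apply, map_zero, zsmul_zero]
  simp only [tab, List.map_cons, List.map_nil, List.sum_cons, List.sum_nil, add_zero, mul_one]
  rw [map_add, M.dOn_W_x (q := q) hω hS hb, M.dOn_W_y (q := q) hω hS (mul_mem (M.mem_of_mem hb)
    (M.coeff_mem q S)), neg_add_eq_zero, coeff]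
  refine (M.state_xy (l := [M.x, M.y]) (by simp) (by simp)).W_congr q M.cut' ⟨_, M.m_mem⟩
    (by simp) hS ?_
  have hcc : q.cc ω (M.V S) M.a M.b ∈ supp K D.arcs :=
    q.cc_mem M.a_mem M.b_mem _ _
  rw [map_mul, M.rename_eq _ _ hb, map_mul, map_mul, M.rename_eq _ _ hcc]
  intro A _ _ x hx
  simp only [map_mul, rename_el, M.send_m, M.send_of_mem _ _ M.base_mem_arcs]
  have h1 := hx.el_mul_cc ω (M.V_base S) (↑ω⁻¹ : R)
  have h2 := hx.el_mul_inv M.b ω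
  linear_combination (-aeval x b * aeval x (q.el M.b (ω : R))) * h1 -
    (aeval x b * aeval x (q.cc ω (M.V S) M.a M.b)) * h2

theorem isMorphism_inverseMap {q : QuadData K α} (hω : IsTwisting (K := K) α ω) :
    IsMorphism (M.inverseMap (K := K) (R := R)) 1 := by
  refine isMorphism_of_tables (q := q) hω M.cut'.toFrame M.cut.toFrame
    (fun w hw => (M.agree w hw).1.symm) fun l hl => ?_
  rcases sublist_two hl with rfl | rfl | rfl | rfl
  · refine ⟨_, _, M.state_nil.hasTables M.cut' hl (M.covered M.a_mem M.a_mem) (t := [])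
      (fun S hS b hb => by rw [M.inverseMap_W_nil hS]; rfl) (by simp), fun S hS b hb r => ?_⟩
    have h1 : b * (MvPolynomial.X M.a - MvPolynomial.C q.s) ∈
        supp K D.arcs :=
      mul_mem hb (sub_mem (QuadData.X_mem M.a_mem)
        (Subalgebra.algebraMap_mem _ _))
    have h2 : b * q.cc ω (M.U S) M.r M.a ∈ supp K D.arcs :=
      mul_mem hb (q.cc_mem M.r_mem M.a_mem _ _)
    rw [List.toFinset_nil, dOn_empty, LinearMap.zero_apply, mul_one, M.dOn_W_nil (q := q) hω hS hb, map_add,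
      map_add, M.inverseMap_W_x q hS h2, M.inverseMap_W_y (q := q) hω hS h1, M.inverseMap_W_y (q := q) hω hS hb,
      hω.counit_omega, hω.counit_omega_mul, ← map_add, ← map_add]
    have : W K α D [] S (b * q.cc ω (M.U S) M.r M.a +
        (b * (MvPolynomial.X M.a - MvPolynomial.C q.s) *
          (MvPolynomial.C (-0) * q.cc ω (M.U S) M.a M.t) +
        b * (MvPolynomial.C (-1) * q.cc ω (M.U S) M.a M.t))) = W K α D [] S 0 := by
      refine M.isState.W_congr q M.cut ⟨_, M.a_mem⟩ (by simp) hS ?_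
      intro A _ _ x hx
      have h1 := q.cc_congr_swap ω (Setoid.refl' (M.U S) M.a) (Setoid.symm' _ (M.U_rt S))
        (F := M.U S) ⟨fun h => Setoid.trans' _ (M.U_rt S) (Setoid.symm' _ h),
          fun h => Setoid.trans' _ (Setoid.symm' _ h) (M.U_rt S)⟩ A x hx
      simp only [map_mul, map_add, MvPolynomial.aeval_C, map_neg, map_one, neg_zero, map_zero, h1]
      ring
    rw [this, map_zero, zsmul_zero]
  · refine ⟨_, _, M.state_x.hasTables M.cut' hl (M.covered M.a_mem M.r_mem)
      (t := [([], fun _ => 1)])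
      (fun S hS b hb => by rw [M.inverseMap_W_x q hS hb]; simp [tab]) ?_, fun S hS b hb r => ?_⟩
    · simp only [List.mem_singleton]
      rintro _ rfl
      exact M.isState.isEntry M.cut (List.nil_sublist _) (by simp)
        (fun _ _ => one_mem _) (natural_const _)
    · rw [List.toFinset_nil, dOn_empty, LinearMap.zero_apply, mul_one, M.dOn_W_x (q := q) hω hS hb, map_neg,
        M.inverseMap_W_xy hS, neg_zero, zsmul_zero]
  · refine ⟨_, _, M.state_y.hasTables_circle M.cut' hl M.m_mem M.m_notMem (M.send_m _ _)
      M.covered_circle (t := fun r => [([], fun S =>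
        MvPolynomial.C (-Coalgebra.counit (R := K) r) * q.cc ω (M.U S) M.a M.t)])
      (fun S hS b hb r => by rw [M.inverseMap_W_y (q := q) hω hS hb]; simp [tab]) fun r => ?_,
      fun S hS b hb r => ?_⟩
    · simp only [List.mem_singleton]
      rintro _ rfl
      exact M.isState.isEntry M.cut (List.nil_sublist _) (by simp)
        (fun _ _ => mul_mem (Subalgebra.algebraMap_mem _ _)
          (q.cc_mem M.a_mem M.t_mem _ _))
        ((natural_const _).mul_surg (fun S hS => (M.surg hS).symm) M.outSurgV M.outSurgU)
    · rw [List.toFinset_nil, dOn_empty, LinearMap.zero_apply, M.dOn_W_y (q := q) hω hS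
        (mul_mem (M.mem_of_mem hb) (q.el_mem M.m_mem _)), M.inverseMap_W_xy hS,
        zsmul_zero]
  · refine ⟨_, _, (M.state_xy (by simp) (by simp)).hasTables M.cut' hl (M.covered M.b_mem M.b_mem)
      (t := []) (fun S hS b hb => by rw [M.inverseMap_W_xy hS]; rfl) (by simp),
      fun S hS b hb r => ?_⟩
    rw [List.toFinset_nil, dOn_empty, LinearMap.zero_apply, M.dOn_W_xy (q := q) hω hS
      (by simpa using M.mem_of_mem hb), map_zero, zsmul_zero]

theorem inverse_comp {q : QuadData K α} (hω : IsTwisting (K := K) α ω) :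
    M.inverseMap ∘ₗ M.map ω = (LinearMap.id : Kh K R D →ₗ[K] _) := by
  refine kh_hom_ext (α := α) (L := []) (O := D.arcs) fun l hl S hS _ => ?_
  obtain rfl := List.sublist_nil.1 hl
  rw [M.cut.sdiff] at hS
  refine ⟨_, (M.isState.covered M.cut (by simp) hS fun _ he => he).spans q le_rfl, ?_⟩
  rintro b hb _ rfl
  have h1 : b * (q.el M.base (↑ω⁻¹ : R) * q.cc ω (M.V S) M.a M.b) ∈
      supp K D.arcs :=
    mul_mem hb (mul_mem (q.el_mem M.base_mem_arcs _)
      (q.cc_mem M.a_mem M.b_mem _ _))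
  rw [mul_one, LinearMap.comp_apply, M.map_W (q := q) hω hS hb, map_add, M.inverseMap_W_x q hS hb, coeff,
    ← mul_assoc b, M.inverseMap_W_y (q := q) hω hS h1, hω.counit_omega]
  simp

set_option maxHeartbeats 1000000 in
theorem homotopic {q : QuadData K α} (hω : IsTwisting (K := K) α ω) :
    Homotopic (M.map ω ∘ₗ M.inverseMap) (LinearMap.id : Kh K R D' →ₗ[K] _) := by
  have hcoeff : -(q.el M.b (↑ω⁻¹ : R) * q.el M.m (ω : R)) ∈
      supp K D'.arcs :=
    neg_mem (mul_mem (q.el_mem (M.sub_arcs M.b_mem) _)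
      (q.el_mem M.m_mem _))
  refine homotopic_of_tables (q := q) (O := D.arcs) hω M.cut'.toFrame (H := M.homotopy ω)
    fun l hl => ?_
  rcases sublist_two hl with rfl | rfl | rfl | rfl
  · refine ⟨_, _, M.state_nil.hasTables M.cut' hl (M.covered M.a_mem M.a_mem) (t := [])
      (fun S hS b hb => by rw [M.homotopy_W_nil hS]; rfl) (by simp), fun S hS b hb r => ?_⟩
    have h1 : b * (MvPolynomial.X M.a - MvPolynomial.C q.s) ∈
        supp K D.arcs :=
      mul_mem hb (sub_mem (QuadData.X_mem M.a_mem)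
        (Subalgebra.algebraMap_mem _ _))
    rw [LinearMap.comp_apply, LinearMap.id_apply, M.inverseMap_W_nil hS, mul_one,
      M.dOn_W_nil (q := q) hω hS hb, map_add, map_add, M.homotopy_W_x hS, M.homotopy_W_y q hS h1,
      M.homotopy_W_y q hS hb, hω.counit_omega, hω.counit_omega_mul, tab, List.map_nil,
      List.sum_nil, map_zero, map_zero, zero_add, zero_add, zero_sub, ← map_add, ← map_neg]
    congr 1
    simp
  · refine ⟨_, _, M.state_x.hasTables M.cut' hl (M.covered M.a_mem M.r_mem) (t := [])
      (fun S hS b hb => by rw [M.homotopy_W_x hS]; rfl) (by simp), fun S hS b hb r => ?_⟩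
    have h1 : b * q.cc ω (M.V S) M.a M.b ∈ supp K D.arcs :=
      mul_mem hb (q.cc_mem M.a_mem M.b_mem _ _)
    rw [LinearMap.comp_apply, LinearMap.id_apply, mul_one, M.inverseMap_W_x q hS hb,
      M.map_W (q := q) hω hS hb, M.dOn_W_x (q := q) hω hS hb, map_neg, M.homotopy_W_xy q hS h1, tab, List.map_nil,
      List.sum_nil, map_zero, zero_add, add_sub_cancel_left, ← map_neg, coeff]
    refine M.state_y.W_congr q M.cut' ⟨_, M.m_mem⟩ (by simp) hS ?_
    intro A _ _ x hx
    simp only [map_mul, map_neg]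
    linear_combination (aeval x b * aeval x (q.el M.m (ω : R))) *
      hx.el_mul_cc ω (M.V_base S) (↑ω⁻¹ : R)
  · refine ⟨_, _, M.state_y.hasTables_circle M.cut' hl M.m_mem M.m_notMem (M.send_m _ _)
      M.covered_circle (t := fun r => [([], fun S =>
        MvPolynomial.C (-Coalgebra.counit (R := K) r))])
      (fun S hS b hb r => by rw [M.homotopy_W_y q hS hb]; simp [tab]) fun r => ?_,
      fun S hS b hb r => ?_⟩
    · simp only [List.mem_singleton]
      rintro _ rfl
      exact M.state_nil.isEntry M.cut' (List.nil_sublist _) (by simp)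
        (fun _ _ => Subalgebra.algebraMap_mem _ _) (natural_const _)
    · have h1 : b * (MvPolynomial.C (-Coalgebra.counit (R := K) r) * q.cc ω (M.U S) M.a M.t) ∈
          supp K D.arcs :=
        mul_mem hb (mul_mem (Subalgebra.algebraMap_mem _ _)
          (q.cc_mem M.a_mem M.t_mem _ _))
      have h2 : b * q.el M.b r ∈ supp K D.arcs :=
        mul_mem hb (q.el_mem M.b_mem _)
      have h3 : b * MvPolynomial.C (-Coalgebra.counit (R := K) r) ∈
          supp K D.arcs :=
        mul_mem hb (Subalgebra.algebraMap_mem _ _)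
      rw [LinearMap.comp_apply, LinearMap.id_apply, M.inverseMap_W_y (q := q) hω hS hb, M.map_W (q := q) hω hS h1,
        M.dOn_W_y (q := q) hω hS (mul_mem (M.mem_of_mem hb) (q.el_mem M.m_mem _)),
        map_mul (MvPolynomial.rename _), M.rename_eq _ _ hb, rename_el, M.send_m,
        M.homotopy_W_xy q hS h2]
      simp only [tab, List.map_cons, List.map_nil, List.sum_cons, List.sum_nil, add_zero]
      rw [M.dOn_W_nil (q := q) hω hS h3, add_assoc, ← map_add (W K α D' [M.y] S), add_sub_assoc,
        ← map_sub (W K α D' [M.y] S), ← map_add]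
      congr 1
      · refine M.state_x.W_congr q M.cut' ⟨_, M.m_mem⟩ (by simp) hS ?_
        intro A _ _ x hx
        have h1 := q.cc_congr_swap ω (Setoid.refl' (M.U S) M.a) (Setoid.symm' _ (M.U_rt S))
          (F := M.U S) ⟨fun h => Setoid.trans' _ (M.U_rt S) (Setoid.symm' _ h),
            fun h => Setoid.trans' _ (Setoid.symm' _ h) (M.U_rt S)⟩ A x hx
        simp only [map_mul, h1]
        ring
      · refine M.state_y.W_congr q M.cut' ⟨_, M.m_mem⟩ (by simp) hS ?_
        obtain ⟨t, rfl⟩ : ∃ t, r = t * (ω : R) := ⟨r * (↑ω⁻¹ : R), by simp⟩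
        rw [q.counit_mul_omega hω, coeff]
        intro A _ _ x hx
        have h1 := hx.el_mul_cc ω (M.V_base S) (↑ω⁻¹ : R)
        have h2 := hx.el_mul_inv M.b ω
        have h3 := q.cc_back ω (M.surg hS).symm A x hx
        simp only [map_mul, map_neg, map_add, map_sub, hx.aeval_el_mul, q.el_gen,
          QuadData.aeval_cop, MvPolynomial.aeval_X, MvPolynomial.aeval_C] at h3 ⊢
        rw [QuadData.aeval_el x M.m t, QuadData.aeval_el x M.b t]
        set B := aeval x b
        set c := algebraMap K A (q.φ₁ t)
        set wm := aeval x (q.el M.m (ω : R))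
        set wb := aeval x (q.el M.b (ω : R))
        set wb' := aeval x (q.el M.b (↑ω⁻¹ : R))
        set cU := aeval x (q.cc ω (M.U S) M.a M.t)
        linear_combination (-B * c * wm * cU) * h1 - (B * c * wm * wb') * h3 -
          (B * c * wm * (x M.a + x M.b - algebraMap K A q.s) -
            B * wm * (algebraMap K A (q.φ₀ t) + c * x M.b)) * h2
  · refine ⟨_, _, (M.state_xy (by simp) (by simp)).hasTables M.cut' hl (M.covered M.b_mem M.b_mem)
      (t := [([M.y], fun _ => -(q.el M.b (↑ω⁻¹ : R) * q.el M.m (ω : R)))])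
      (fun S hS b hb => by rw [M.homotopy_W_xy q hS hb]; simp [tab]) ?_,
      fun S hS b hb r => ?_⟩
    · simp only [List.mem_singleton]
      rintro _ rfl
      exact M.state_y.isEntry M.cut' (by simp) (by simp) (fun _ _ => hcoeff) (natural_const _)
    · rw [LinearMap.comp_apply, LinearMap.id_apply, mul_one, M.inverseMap_W_xy hS, map_zero,
        M.dOn_W_xy (q := q) hω hS (M.mem_of_mem hb), map_zero, add_zero, zero_sub]
      simp only [tab, List.map_cons, List.map_nil, List.sum_cons, List.sum_nil, add_zero]
      rw [M.dOn_W_y (q := q) hω hS (mul_mem (M.mem_of_mem hb) hcoeff), ← map_neg]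
      refine (M.state_xy (l := [M.x, M.y]) (by simp) (by simp)).W_congr q M.cut' ⟨_, M.m_mem⟩
        (by simp) hS ?_
      rw [map_mul, M.rename_eq _ _ hb]
      intro A _ _ x hx
      simp only [map_mul, map_neg, rename_el, M.send_m, M.send_of_mem _ _ M.b_mem]
      linear_combination (aeval x b) * hx.el_mul_inv M.b ω

end Operators

end ReidemeisterII

section

/-! ### Hexagons -/

theorem Surg.other {E E' : Setoid ℕ} {a b c d : ℕ} (h : Surg E E' a b d) (hE : E c d)
    (hE' : E' c b) : Surg E E' c d b where
  left := hE
  right := hE'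
  sup := by
    have h1 : E ⊔ pr c b = E ⊔ pr a d := by
      refine le_antisymm (sup_le le_sup_left (pr_le.2 ?_)) (sup_le le_sup_left (pr_le.2 ?_))
      · exact (sup_pr_apply ..).2 <| Or.inr (Or.inr ⟨hE, h.left⟩)
      · exact (sup_pr_apply ..).2 <| Or.inr (Or.inr ⟨h.left, hE⟩)
    have h2 : E' ⊔ pr c d = E' ⊔ pr a b := by
      refine le_antisymm (sup_le le_sup_left (pr_le.2 ?_)) (sup_le le_sup_left (pr_le.2 ?_))
      · exact (sup_pr_apply ..).2 <| Or.inr (Or.inr ⟨hE', h.right⟩)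
      · exact (sup_pr_apply ..).2 <| Or.inr (Or.inr ⟨h.right, hE'⟩)
    rw [h1, h2, h.sup]
  xor := by
    have h1 : E c b ↔ E a d := ⟨fun h' => E.trans h.left (E.trans (E.symm h') hE),
      fun h' => E.trans hE (E.trans (E.symm h') h.left)⟩
    have h2 : E' c d ↔ E' a b := ⟨fun h' => E'.trans h.right (E'.trans (E'.symm h') hE'),
      fun h' => E'.trans hE' (E'.trans (E'.symm h') h.right)⟩
    rw [h1, h2, h.xor]

theorem Surg.flip {E E' : Setoid ℕ} {a b c d : ℕ} (h : Surg E E' a b d) (hE : E c d)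
    (hE' : E' b c) : Surg E E' b a c where
  left := E.symm h.left
  right := hE'
  sup := by
    have h1 : E ⊔ pr b c = E ⊔ pr a d := by
      refine le_antisymm (sup_le le_sup_left (pr_le.2 ?_)) (sup_le le_sup_left (pr_le.2 ?_))
      · exact (sup_pr_apply ..).2 <| Or.inr (Or.inl ⟨E.symm h.left, E.symm hE⟩)
      · exact (sup_pr_apply ..).2 <| Or.inr (Or.inl ⟨h.left, hE⟩)
    rw [h1, h.sup, pr_comm]
  xor := by
    have h1 : E b c ↔ E a d := ⟨fun h' => E.trans h.left (E.trans h' hE),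
      fun h' => E.trans (E.symm h.left) (E.trans h' (E.symm hE))⟩
    have h2 : E' b a ↔ E' a b := ⟨fun h' => E'.symm h', fun h' => E'.symm h'⟩
    rw [h1, h2, h.xor]

theorem prs_apply_of_compat {μ : List (ℕ × ℕ)} {a b : ℕ}
    (h : ∀ (T : Type) (φ : ℕ → T), Compat φ μ → φ a = φ b) : prs μ a b :=
  Quotient.exact (h _ _ (compat_mk (E := prs μ) le_rfl))

theorem fam_of_compat {J : Finset (ℕ × ℕ)} {slot : ℕ → Fin 4 → ℕ} {X S : Finset ℕ}
    {μ : List (ℕ × ℕ)} {a b : ℕ} (h : ∀ (T : Type) (φ : ℕ → T), Compat φ μ → φ a = φ b) :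
    fam J slot X μ S a b :=
  (le_sup_right : prs μ ≤ fam J slot X μ S) (prs_apply_of_compat h)

/-- The outside of a disk: crossings, arcs, marked points, and slots at the crossings. -/
structure Outside where
  X : Finset ℕ
  O : Finset ℕ
  J : Finset (ℕ × ℕ)
  slot : ℕ → Fin 4 → ℕ

/-- The gluing relations obtained by connecting arcs in the disk. -/
abbrev Outside.rel (Y : Outside) (μ : List (ℕ × ℕ)) (S : Finset ℕ) : Setoid ℕ :=
  fam Y.J Y.slot Y.X μ S

/-- Six arcs which end on the boundary of a disk, in counterclockwise order. -/
structure Hex where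
  p₁ : ℕ
  p₂ : ℕ
  p₃ : ℕ
  p₄ : ℕ
  p₅ : ℕ
  p₆ : ℕ

namespace Hex

variable (H : Hex)

/-- The rotation by three ends. -/
def rot : Hex := ⟨H.p₄, H.p₅, H.p₆, H.p₁, H.p₂, H.p₃⟩

@[simp] theorem rot_p₁ : H.rot.p₁ = H.p₄ := rfl
@[simp] theorem rot_p₂ : H.rot.p₂ = H.p₅ := rfl
@[simp] theorem rot_p₃ : H.rot.p₃ = H.p₆ := rfl
@[simp] theorem rot_p₄ : H.rot.p₄ = H.p₁ := rfl
@[simp] theorem rot_p₅ : H.rot.p₅ = H.p₂ := rfl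
@[simp] theorem rot_p₆ : H.rot.p₆ = H.p₃ := rfl
@[simp] theorem rot_rot : H.rot.rot = H := rfl

/-- The connections `(16)(23)(45)`. -/
def V : List (ℕ × ℕ) := [(H.p₆, H.p₁), (H.p₂, H.p₃), (H.p₄, H.p₅)]
/-- The connections `(16)(25)(34)`. -/
def A : List (ℕ × ℕ) := [(H.p₆, H.p₁), (H.p₂, H.p₅), (H.p₃, H.p₄)]
/-- The connections `(56)(23)(14)`. -/
def B : List (ℕ × ℕ) := [(H.p₅, H.p₆), (H.p₂, H.p₃), (H.p₁, H.p₄)]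
/-- The connections `(12)(36)(45)`. -/
def C : List (ℕ × ℕ) := [(H.p₁, H.p₂), (H.p₃, H.p₆), (H.p₄, H.p₅)]

theorem prs_rot_A : prs H.rot.A = prs H.A := by
  refine prs_congr fun T f => ?_
  simp only [A, compat_cons, rot_p₁, rot_p₂, rot_p₃, rot_p₄, rot_p₅, rot_p₆]
  grind

theorem prs_rot_B : prs H.rot.B = prs H.B := by
  refine prs_congr fun T f => ?_
  simp only [B, compat_cons, rot_p₁, rot_p₂, rot_p₃, rot_p₄, rot_p₅, rot_p₆]
  grind

theorem prs_rot_C : prs H.rot.C = prs H.C := by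
  refine prs_congr fun T f => ?_
  simp only [C, compat_cons, rot_p₁, rot_p₂, rot_p₃, rot_p₄, rot_p₅, rot_p₆]
  grind

/-- The arcs are outside of the disk. -/
structure Mem (O : Finset ℕ) : Prop where
  p₁ : H.p₁ ∈ O
  p₂ : H.p₂ ∈ O
  p₃ : H.p₃ ∈ O
  p₄ : H.p₄ ∈ O
  p₅ : H.p₅ ∈ O
  p₆ : H.p₆ ∈ O

variable {H} {O : Finset ℕ}

theorem Mem.rot (h : H.Mem O) : H.rot.Mem O := ⟨h.p₄, h.p₅, h.p₆, h.p₁, h.p₂, h.p₃⟩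

theorem Mem.V (h : H.Mem O) : ∀ p ∈ H.V, p.1 ∈ O ∧ p.2 ∈ O := by
  simp [Hex.V, h.p₁, h.p₂, h.p₃, h.p₄, h.p₅, h.p₆]
theorem Mem.A (h : H.Mem O) : ∀ p ∈ H.A, p.1 ∈ O ∧ p.2 ∈ O := by
  simp [Hex.A, h.p₁, h.p₂, h.p₃, h.p₄, h.p₅, h.p₆]
theorem Mem.B (h : H.Mem O) : ∀ p ∈ H.B, p.1 ∈ O ∧ p.2 ∈ O := by
  simp [Hex.B, h.p₁, h.p₂, h.p₃, h.p₄, h.p₅, h.p₆]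
theorem Mem.C (h : H.Mem O) : ∀ p ∈ H.C, p.1 ∈ O ∧ p.2 ∈ O := by
  simp [Hex.C, h.p₁, h.p₂, h.p₃, h.p₄, h.p₅, h.p₆]

end Hex

variable {Y : Outside} {H : Hex} {S : Finset ℕ}

theorem Outside.rel_rot_A : Y.rel H.rot.A = Y.rel H.A := by
  funext S; rw [Outside.rel, fam, H.prs_rot_A, Outside.rel, fam]

theorem Outside.rel_rot_B : Y.rel H.rot.B = Y.rel H.B := by
  funext S; rw [Outside.rel, fam, H.prs_rot_B, Outside.rel, fam]

theorem Outside.rel_rot_C : Y.rel H.rot.C = Y.rel H.C := by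
  funext S; rw [Outside.rel, fam, H.prs_rot_C, Outside.rel, fam]

section Relations

variable (Y H S)

theorem V₆₁ : Y.rel H.V S H.p₆ H.p₁ := fam_apply (p := (_, _)) (by simp [Hex.V])
theorem V₄₅ : Y.rel H.V S H.p₄ H.p₅ := fam_apply (p := (_, _)) (by simp [Hex.V])
theorem B₅₆ : Y.rel H.B S H.p₅ H.p₆ := fam_apply (p := (_, _)) (by simp [Hex.B])
theorem B₁₄ : Y.rel H.B S H.p₁ H.p₄ := fam_apply (p := (_, _)) (by simp [Hex.B])
theorem C₁₂ : Y.rel H.C S H.p₁ H.p₂ := fam_apply (p := (_, _)) (by simp [Hex.C])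
theorem C₃₆ : Y.rel H.C S H.p₃ H.p₆ := fam_apply (p := (_, _)) (by simp [Hex.C])

end Relations

/-- The surgeries between the ways of connecting six ends. -/
structure Surgeries (Y : Outside) (H : Hex) : Prop where
  vc : ∀ S ⊆ Y.X, Surg (Y.rel H.V S) (Y.rel H.C S) H.p₂ H.p₃ H.p₁
  vb : ∀ S ⊆ Y.X, Surg (Y.rel H.V S) (Y.rel H.B S) H.p₄ H.p₅ H.p₁
  outV : OutSurg Y.slot Y.X (Y.rel H.V)
  outC : OutSurg Y.slot Y.X (Y.rel H.C)
  outB : OutSurg Y.slot Y.X (Y.rel H.B)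


namespace Surgeries

theorem vb' (h : Surgeries Y H) (hS : S ⊆ Y.X) : Surg (Y.rel H.V S) (Y.rel H.B S) H.p₆ H.p₁ H.p₅ :=
  (h.vb S hS).other (V₆₁ Y H S) ((Y.rel H.B S).symm (B₅₆ Y H S))

theorem cv (h : Surgeries Y H) (hS : S ⊆ Y.X) : Surg (Y.rel H.C S) (Y.rel H.V S) H.p₁ H.p₂ H.p₆ :=
  (h.vc S hS).symm.flip ((Y.rel H.C S).symm (C₃₆ Y H S)) ((Y.rel H.V S).symm (V₆₁ Y H S))

theorem bv (h : Surgeries Y H) (hS : S ⊆ Y.X) : Surg (Y.rel H.B S) (Y.rel H.V S) H.p₅ H.p₆ H.p₄ :=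
  ((h.vb S hS).symm.other ((Y.rel H.B S).symm (B₅₆ Y H S)) (V₆₁ Y H S)).flip
    ((Y.rel H.B S).symm (B₁₄ Y H S)) ((Y.rel H.V S).symm (V₄₅ Y H S))

theorem bv' (h : Surgeries Y H) (hS : S ⊆ Y.X) : Surg (Y.rel H.B S) (Y.rel H.V S) H.p₁ H.p₄ H.p₆ :=
  (h.vb S hS).symm.flip ((Y.rel H.B S).symm (B₅₆ Y H S)) ((Y.rel H.V S).symm (V₆₁ Y H S))

end Surgeries

section Polynomials

variable {K : Type u} {R : Type v} [CommRing K] [CommRing R] [Algebra K R] {α : R}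
  (ω : Rˣ) (q : QuadData K α) (Y : Outside)

namespace Hex

/-- The surgery from `V` to `C`. -/
def vc (H : Hex) (S : Finset ℕ) : MvPolynomial ℕ K := q.cc ω (Y.rel H.C S) H.p₂ H.p₃
/-- The surgery from `C` to `V`. -/
def cv (H : Hex) (S : Finset ℕ) : MvPolynomial ℕ K := q.cc ω (Y.rel H.V S) H.p₁ H.p₂
/-- The surgery from `V` to `B`. -/
def vb (H : Hex) (S : Finset ℕ) : MvPolynomial ℕ K := q.cc ω (Y.rel H.B S) H.p₄ H.p₅
/-- The surgery from `B` to `V`. -/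
def bv (H : Hex) (S : Finset ℕ) : MvPolynomial ℕ K := q.cc ω (Y.rel H.V S) H.p₅ H.p₆
/-- The surgery from `V` to `A`. -/
def va (H : Hex) (S : Finset ℕ) : MvPolynomial ℕ K := q.cc ω (Y.rel H.A S) H.p₂ H.p₃
/-- The surgery from `A` to `V`. -/
def av (H : Hex) (S : Finset ℕ) : MvPolynomial ℕ K := q.cc ω (Y.rel H.V S) H.p₂ H.p₅

variable {ω q Y} {O : Finset ℕ}

theorem Mem.vc (h : H.Mem O) : H.vc ω q Y S ∈ supp K O :=
  q.cc_mem h.p₂ h.p₃ _ _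
theorem Mem.cv (h : H.Mem O) : H.cv ω q Y S ∈ supp K O :=
  q.cc_mem h.p₁ h.p₂ _ _
theorem Mem.vb (h : H.Mem O) : H.vb ω q Y S ∈ supp K O :=
  q.cc_mem h.p₄ h.p₅ _ _
theorem Mem.bv (h : H.Mem O) : H.bv ω q Y S ∈ supp K O :=
  q.cc_mem h.p₅ h.p₆ _ _
theorem Mem.va (h : H.Mem O) : H.va ω q Y S ∈ supp K O :=
  q.cc_mem h.p₂ h.p₃ _ _
theorem Mem.av (h : H.Mem O) : H.av ω q Y S ∈ supp K O :=
  q.cc_mem h.p₂ h.p₅ _ _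

end Hex

namespace Surgeries

variable {ω q Y}

variable {A : Type (max u v)} [CommRing A] [Algebra K A] {x : ℕ → A}

theorem vc_mul_cv (h : Surgeries Y H) (hS : S ⊆ Y.X) (hx : q.IsModel (Y.rel H.V S) x) :
    aeval x (H.vc ω q Y S) * aeval x (H.cv ω q Y S) =
      aeval x (q.el H.p₁ (ω : R)) * (x H.p₁ + x H.p₂ - algebraMap K A q.s) := by
  have h1 := q.cc_back ω (h.vc S hS) A x hx
  rw [map_mul, q.cc_comm ω _ _ _ A x hx, QuadData.aeval_cop] at h1
  rw [Hex.vc, Hex.cv, h1]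
  ring

theorem vb_mul_bv (h : Surgeries Y H) (hS : S ⊆ Y.X) (hx : q.IsModel (Y.rel H.V S) x) :
    aeval x (H.vb ω q Y S) * aeval x (H.bv ω q Y S) =
      aeval x (q.el H.p₁ (ω : R)) * (x H.p₁ + x H.p₅ - algebraMap K A q.s) := by
  have h1 := q.cc_back ω (h.vb S hS) A x hx
  have h2 : (Y.rel H.V S) H.p₄ H.p₁ ↔ (Y.rel H.V S) H.p₅ H.p₆ :=
    ⟨fun h' => (Y.rel H.V S).trans ((Y.rel H.V S).symm (V₄₅ Y H S))
      ((Y.rel H.V S).trans h' ((Y.rel H.V S).symm (V₆₁ Y H S))),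
    fun h' => (Y.rel H.V S).trans (V₄₅ Y H S) ((Y.rel H.V S).trans h' (V₆₁ Y H S))⟩
  rw [map_mul, q.cc_congr ω (V₄₅ Y H S) ((Y.rel H.V S).symm (V₆₁ Y H S)) h2 A x hx,
    QuadData.aeval_cop, hx.eq_of_rel (V₄₅ Y H S)] at h1
  rw [Hex.vb, Hex.bv, h1]
  ring

theorem square (h : Surgeries Y H) (h' : Surgeries Y H.rot) (hS : S ⊆ Y.X) (hx : q.IsModel (Y.rel H.rot.V S) x) :
    aeval x (H.vb ω q Y S) * aeval x (H.rot.bv ω q Y S) =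
      aeval x (H.vc ω q Y S) * aeval x (H.rot.cv ω q Y S) := by
  have h1 := h'.bv hS
  have h2 := h'.cv hS
  rw [Outside.rel_rot_B] at h1
  rw [Outside.rel_rot_C] at h2
  have := q.cc_square ω (h.vb S hS) h1 (h.vc S hS) h2 A x hx
  rw [map_mul, map_mul] at this
  exact this

end Surgeries

theorem Hex.cc_B (H : Hex) (S : Finset ℕ) :
    q.Cong (Y.rel H.B S) (q.cc ω (Y.rel H.B S) H.p₆ H.p₁) (H.vb ω q Y S) :=
  q.cc_congr_swap ω ((Y.rel H.B S).symm (B₅₆ Y H S)) (B₁₄ Y H S)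
    ⟨fun h => (Y.rel H.B S).trans ((Y.rel H.B S).symm (B₁₄ Y H S))
      ((Y.rel H.B S).trans ((Y.rel H.B S).symm h) ((Y.rel H.B S).symm (B₅₆ Y H S))),
    fun h => (Y.rel H.B S).trans ((Y.rel H.B S).symm (B₅₆ Y H S))
      ((Y.rel H.B S).trans ((Y.rel H.B S).symm h) ((Y.rel H.B S).symm (B₁₄ Y H S)))⟩

theorem Hex.cc_V (H : Hex) (S : Finset ℕ) :
    q.Cong (Y.rel H.V S) (q.cc ω (Y.rel H.V S) H.p₁ H.p₄) (H.bv ω q Y S) :=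
  q.cc_congr_swap ω ((Y.rel H.V S).symm (V₆₁ Y H S)) (V₄₅ Y H S)
    ⟨fun h => (Y.rel H.V S).trans ((Y.rel H.V S).symm (V₄₅ Y H S))
      ((Y.rel H.V S).trans ((Y.rel H.V S).symm h) ((Y.rel H.V S).symm (V₆₁ Y H S))),
    fun h => (Y.rel H.V S).trans ((Y.rel H.V S).symm (V₆₁ Y H S))
      ((Y.rel H.V S).trans ((Y.rel H.V S).symm h) ((Y.rel H.V S).symm (V₄₅ Y H S)))⟩

end Polynomials

end

/-! ### Triangles -/

theorem LinkDiagram.eq_or_eq_of_slot {D : LinkDiagram} {c c' : ℕ × Fin 4} (hne : c ≠ c')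
    (hc : c.1 ∈ D.crossings) (hc' : c'.1 ∈ D.crossings) (h : D.slot c'.1 c'.2 = D.slot c.1 c.2) :
    (∀ j ∈ D.joins, j.1 ≠ D.slot c.1 c.2 ∧ j.2 ≠ D.slot c.1 c.2) ∧
      ∀ w ∈ D.crossings, ∀ i, D.slot w i = D.slot c.1 c.2 → (w, i) = c ∨ (w, i) = c' := by
  have he := D.slot_mem _ hc c.2
  set e := D.slot c.1 c.2 with hedef
  have hh : ∀ l l', D.Head e l → D.Head e l' → l = l' := fun l l' h h' =>
    (LinkDiagram.existsUnique_head he).unique h h'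
  have ht : ∀ l l', D.Tail e l → D.Tail e l' → l = l' := fun l l' h h' =>
    (LinkDiagram.existsUnique_tail he).unique h h'
  have key : ∃ l l' : LinkDiagram.End, D.Head e l ∧ D.Tail e l' ∧
      ((l = .inl c ∧ l' = .inl c') ∨ (l = .inl c' ∧ l' = .inl c)) := by
    by_cases h1 : D.Inward c.1 c.2 <;> by_cases h2 : D.Inward c'.1 c'.2
    · exact absurd (Sum.inl.inj (hh (.inl c) (.inl c') ⟨hc, rfl, h1⟩ ⟨hc', h, h2⟩)) hne
    · exact ⟨.inl c, .inl c', ⟨hc, rfl, h1⟩, ⟨hc', h, h2⟩, Or.inl ⟨rfl, rfl⟩⟩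
    · exact ⟨.inl c', .inl c, ⟨hc', h, h2⟩, ⟨hc, rfl, h1⟩, Or.inr ⟨rfl, rfl⟩⟩
    · exact absurd (Sum.inl.inj (ht (.inl c) (.inl c') ⟨hc, rfl, h1⟩ ⟨hc', h, h2⟩)) hne
  obtain ⟨l, l', hl, hl', hcc⟩ := key
  refine ⟨fun j hj => ⟨fun hje => ?_, fun hje => ?_⟩, fun w hw i hwi => ?_⟩
  · have := hh _ _ hl (show D.Head e (.inr j) from ⟨hj, hje⟩)
    rcases hcc with ⟨rfl, rfl⟩ | ⟨rfl, rfl⟩ <;> cases this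
  · have := ht _ _ hl' (show D.Tail e (.inr j) from ⟨hj, hje⟩)
    rcases hcc with ⟨rfl, rfl⟩ | ⟨rfl, rfl⟩ <;> cases this
  · by_cases h1 : D.Inward w i
    · have := hh _ _ hl (show D.Head e (.inl (w, i)) from ⟨hw, hwi, h1⟩)
      rcases hcc with ⟨rfl, rfl⟩ | ⟨rfl, rfl⟩
      · exact Or.inl (Sum.inl.inj this).symm
      · exact Or.inr (Sum.inl.inj this).symm
    · have := ht _ _ hl' (show D.Tail e (.inl (w, i)) from ⟨hw, hwi, h1⟩)
      rcases hcc with ⟨rfl, rfl⟩ | ⟨rfl, rfl⟩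
      · exact Or.inr (Sum.inl.inj this).symm
      · exact Or.inl (Sum.inl.inj this).symm

/-- The slots of the crossings of a triangle. -/
def Hex.slots (positive : Bool) (H : Hex) (k m n : ℕ) : Fin 3 → Fin 4 → ℕ :=
  if positive then ![![H.p₆, H.p₁, k, m], ![k, H.p₂, H.p₃, n], ![H.p₅, m, n, H.p₄]]
  else ![![H.p₁, k, m, H.p₆], ![H.p₂, H.p₃, n, k], ![m, n, H.p₄, H.p₅]]

/-- The diagram `D` consists of a triangle with vertices `x`, `y`, `z`, edges `k`, `m`, `n` and ends
`H`, and of a diagram `Y` outside of a disk. -/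
structure Triangle (positive : Bool) (D : LinkDiagram) (Y : Outside) (H : Hex)
    (k m n x y z : ℕ) : Prop where
  cut : Cut D [x, y, z] Y.X Y.O Y.J Y.slot []
  slots : ![D.slot x, D.slot y, D.slot z] = H.slots positive k m n
  arcs_eq : D.arcs = insert k (insert m (insert n Y.O))
  mem : H.Mem Y.O
  k_notMem : k ∉ Y.O
  m_notMem : m ∉ Y.O
  n_notMem : n ∉ Y.O
  k_ne_m : k ≠ m
  k_ne_n : k ≠ n
  m_ne_n : m ≠ n

namespace ReidemeisterIII

variable {positive : Bool} {D D' : LinkDiagram} (M : ReidemeisterIII positive D D')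

/-- The six ends. -/
def hex : Hex := ⟨M.p 1, M.p 2, M.p 3, M.p 4, M.p 5, M.p 6⟩


/-- The diagram outside of the triangle. -/
def outside : Outside := ⟨D.crossings \ {M.x, M.y, M.z}, M.outer, D.joins, D.slot⟩

theorem triangle : Triangle positive D M.outside M.hex M.k M.m M.n M.x M.y M.z := by
  have hslots : ![D.slot M.x, D.slot M.y, D.slot M.z] = M.hex.slots positive M.k M.m M.n := M.slots
  have hx := congrFun hslots 0
  have hy := congrFun hslots 1
  have hz := congrFun hslots 2
  simp only [Matrix.cons_val_zero, Matrix.cons_val_one, Matrix.cons_val] at hx hy hz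
  have key : ((∀ j ∈ D.joins, j.1 ≠ M.k ∧ j.2 ≠ M.k) ∧ ∀ w ∈ D.crossings, ∀ i, D.slot w i = M.k →
        (w, i) = (M.x, if positive then 2 else 1) ∨ (w, i) = (M.y, if positive then 0 else 3)) ∧
      ((∀ j ∈ D.joins, j.1 ≠ M.m ∧ j.2 ≠ M.m) ∧ ∀ w ∈ D.crossings, ∀ i, D.slot w i = M.m →
        (w, i) = (M.x, if positive then 3 else 2) ∨ (w, i) = (M.z, if positive then 1 else 0)) ∧
      ((∀ j ∈ D.joins, j.1 ≠ M.n ∧ j.2 ≠ M.n) ∧ ∀ w ∈ D.crossings, ∀ i, D.slot w i = M.n →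
        (w, i) = (M.y, if positive then 3 else 2) ∨ (w, i) = (M.z, if positive then 2 else 1)) := by
    refine ⟨?_, ?_, ?_⟩
    · have := LinkDiagram.eq_or_eq_of_slot (D := D) (c := (M.x, if positive then 2 else 1))
        (c' := (M.y, if positive then 0 else 3)) (by simp [M.x_ne_y]) M.x_mem M.y_mem
        (by cases positive <;> simp [hx, hy, Hex.slots])
      cases positive <;> simpa [hx, Hex.slots] using this
    · have := LinkDiagram.eq_or_eq_of_slot (D := D) (c := (M.x, if positive then 3 else 2))
        (c' := (M.z, if positive then 1 else 0)) (by simp [M.x_ne_z]) M.x_mem M.z_mem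
        (by cases positive <;> simp [hx, hz, Hex.slots])
      cases positive <;> simpa [hx, Hex.slots] using this
    · have := LinkDiagram.eq_or_eq_of_slot (D := D) (c := (M.y, if positive then 3 else 2))
        (c' := (M.z, if positive then 2 else 1)) (by simp [M.y_ne_z]) M.y_mem M.z_mem
        (by cases positive <;> simp [hy, hz, Hex.slots])
      cases positive <;> simpa [hy, Hex.slots] using this
  obtain ⟨⟨hkj, hk⟩, ⟨hmj, hm⟩, ⟨hnj, hn⟩⟩ := key
  have hmemO : ∀ e, e ∈ M.outer ↔ e ∈ D.arcs ∧ e ≠ M.k ∧ e ≠ M.m ∧ e ≠ M.n := by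
    simp [outer]
  have hslotO : ∀ w ∈ D.crossings, ∀ i, (w, i) ≠ (M.x, if positive then 2 else 1) →
      (w, i) ≠ (M.y, if positive then 0 else 3) → (w, i) ≠ (M.x, if positive then 3 else 2) →
      (w, i) ≠ (M.z, if positive then 1 else 0) → (w, i) ≠ (M.y, if positive then 3 else 2) →
      (w, i) ≠ (M.z, if positive then 2 else 1) → D.slot w i ∈ M.outer := by
    intro w hw i h1 h2 h3 h4 h5 h6
    rw [hmemO]
    exact ⟨D.slot_mem w hw i, fun h => (hk w hw i h).elim h1 h2, fun h => (hm w hw i h).elim h3 h4,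
      fun h => (hn w hw i h).elim h5 h6⟩
  have hX : ∀ w ∈ D.crossings \ {M.x, M.y, M.z}, ∀ i, D.slot w i ∈ M.outer := by
    intro w hw i
    simp only [Finset.mem_sdiff, Finset.mem_insert, Finset.mem_singleton, not_or] at hw
    exact hslotO w hw.1 i (by simp [hw.2]) (by simp [hw.2]) (by simp [hw.2]) (by simp [hw.2])
      (by simp [hw.2]) (by simp [hw.2])
  have harc : ∀ e ∈ ({M.k, M.m, M.n} : Finset ℕ), e ∈ D.arcs := by
    simp only [Finset.mem_insert, Finset.mem_singleton, forall_eq_or_imp, forall_eq]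
    have h1 := D.slot_mem M.x M.x_mem
    have h2 := D.slot_mem M.y M.y_mem
    rw [hx] at h1
    rw [hy] at h2
    cases positive
    · exact ⟨h1 1, h1 2, h2 2⟩
    · exact ⟨h1 2, h1 3, h2 3⟩
  have hxy := M.x_ne_y
  have hxz := M.x_ne_z
  have hyz := M.y_ne_z
  refine ⟨⟨⟨?_, ?_, ?_, Finset.sdiff_subset, hX⟩, ?_, ?_, fun _ _ => rfl⟩, hslots, ?_, ?_, ?_, ?_,
    ?_, ?_, ?_, ?_⟩
  · simp [hxy, hxz, hyz]
  · simp [outside]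
  · ext w
    simp only [outside, List.toFinset_cons, List.toFinset_nil, Finset.mem_union, Finset.mem_sdiff,
      Finset.mem_insert, Finset.mem_singleton, Finset.notMem_empty, or_false]
    have h1 := M.x_mem
    have h2 := M.y_mem
    have h3 := M.z_mem
    constructor
    · tauto
    · rintro ((rfl | rfl | rfl) | h) <;> tauto
  · simp [outside]
  · intro j hj
    have := D.join_mem j hj
    exact ⟨(hmemO _).2 ⟨this.1, (hkj j hj).1, (hmj j hj).1, (hnj j hj).1⟩,
      (hmemO _).2 ⟨this.2, (hkj j hj).2, (hmj j hj).2, (hnj j hj).2⟩⟩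
  · ext e
    have := harc e
    simp only [Finset.mem_insert, Finset.mem_singleton] at this
    simp only [outside, Finset.mem_insert, hmemO]
    tauto
  · have h1 := hslotO M.x M.x_mem
    have h2 := hslotO M.y M.y_mem
    have h3 := hslotO M.z M.z_mem
    rw [hx] at h1
    rw [hy] at h2
    rw [hz] at h3
    cases positive
    · refine ⟨h1 0 ?_ ?_ ?_ ?_ ?_ ?_, h2 0 ?_ ?_ ?_ ?_ ?_ ?_, h2 1 ?_ ?_ ?_ ?_ ?_ ?_,
        h3 2 ?_ ?_ ?_ ?_ ?_ ?_, h3 3 ?_ ?_ ?_ ?_ ?_ ?_, h1 3 ?_ ?_ ?_ ?_ ?_ ?_⟩ <;>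
        simp [hxy, hxz, hyz, hxy.symm, hxz.symm, hyz.symm]
    · refine ⟨h1 1 ?_ ?_ ?_ ?_ ?_ ?_, h2 1 ?_ ?_ ?_ ?_ ?_ ?_, h2 2 ?_ ?_ ?_ ?_ ?_ ?_,
        h3 3 ?_ ?_ ?_ ?_ ?_ ?_, h3 0 ?_ ?_ ?_ ?_ ?_ ?_, h1 0 ?_ ?_ ?_ ?_ ?_ ?_⟩ <;>
        simp [hxy, hxz, hyz, hxy.symm, hxz.symm, hyz.symm]
  · simp [outside, hmemO]
  · simp [outside, hmemO]
  · simp [outside, hmemO]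
  · intro h
    have h1 : D.slot M.x (if positive then 3 else 2) = M.m := by
      cases positive <;> simp [hx, Hex.slots]
    have := hk _ M.x_mem _ (h1.trans h.symm)
    cases positive <;> simp [hxy] at this
  · intro h
    have h1 : D.slot M.z (if positive then 2 else 1) = M.n := by
      cases positive <;> simp [hz, Hex.slots]
    have := hk _ M.z_mem _ (h1.trans h.symm)
    cases positive <;> simp [hxz.symm, hyz.symm] at this
  · intro h
    have h1 : D.slot M.y (if positive then 3 else 2) = M.n := by
      cases positive <;> simp [hy, Hex.slots]
    have := hm _ M.y_mem _ (h1.trans h.symm)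
    cases positive <;> simp [hxy.symm, hyz] at this

theorem symm_outer : M.symm.outer = M.outer := by
  rw [outer, outer, M.arcs_eq]; rfl

theorem triangle' : Triangle positive D' M.outside M.hex.rot M.k M.m M.n M.x M.y M.z where
  cut :=
    have h := M.symm.triangle.cut
    have hX : M.symm.outside.X = M.outside.X := by
      change D'.crossings \ _ = D.crossings \ _
      rw [M.crossings_eq]; rfl
    have hO : M.symm.outside.O = M.outside.O := M.symm_outer
    { nodup := h.nodup
      notMem := hX ▸ h.notMem
      crossings_eq := hX ▸ h.crossings_eq
      sub := hO ▸ h.sub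
      slot_mem := hX ▸ hO ▸ h.slot_mem
      joins_iff := fun E => by
        rw [M.joins_eq]; simp [outside]
      join_mem := fun j hj => M.triangle.cut.join_mem j hj
      slot_eq := fun w hw => (M.agree w hw).1 }
  slots := M.symm.triangle.slots
  arcs_eq := M.arcs_eq.trans M.triangle.arcs_eq
  mem := M.triangle.mem.rot
  k_notMem := M.triangle.k_notMem
  m_notMem := M.triangle.m_notMem
  n_notMem := M.triangle.n_notMem
  k_ne_m := M.triangle.k_ne_m
  k_ne_n := M.triangle.k_ne_n
  m_ne_n := M.triangle.m_ne_n

end ReidemeisterIII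

namespace Triangle

section States

variable {positive : Bool} {D : LinkDiagram} {Y : Outside} {H : Hex} {k m n x y z : ℕ}

theorem slot_x (h : Triangle positive D Y H k m n x y z) :
    D.slot x = H.slots positive k m n 0 := congrFun h.slots 0
theorem slot_y (h : Triangle positive D Y H k m n x y z) :
    D.slot y = H.slots positive k m n 1 := congrFun h.slots 1
theorem slot_z (h : Triangle positive D Y H k m n x y z) :
    D.slot z = H.slots positive k m n 2 := congrFun h.slots 2

theorem x_ne_y (h : Triangle positive D Y H k m n x y z) : x ≠ y := by
  have := h.cut.nodup
  simp only [List.nodup_cons, List.mem_cons, not_or] at this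
  exact this.1.1

theorem x_ne_z (h : Triangle positive D Y H k m n x y z) : x ≠ z := by
  have := h.cut.nodup
  simp only [List.nodup_cons, List.mem_cons, not_or] at this
  exact this.1.2.1

theorem y_ne_z (h : Triangle positive D Y H k m n x y z) : y ≠ z := by
  have := h.cut.nodup
  simp only [List.nodup_cons, List.mem_cons, not_or] at this
  exact this.2.1.1

/-- The function which sends the arcs `k`, `m` and `n` to `a`, `b` and `c`. -/
def send (k m n a b c : ℕ) : ℕ → ℕ :=
  Function.update (Function.update (Function.update id k a) m b) n c

theorem send_k (h : Triangle positive D Y H k m n x y z) (a b c : ℕ) :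
    send k m n a b c k = a := by
  simp [send, Function.update_of_ne h.k_ne_n, Function.update_of_ne h.k_ne_m]

theorem send_m (h : Triangle positive D Y H k m n x y z) (a b c : ℕ) :
    send k m n a b c m = b := by
  simp [send, Function.update_of_ne h.m_ne_n]

theorem send_n (a b c : ℕ) : send k m n a b c n = c := by simp [send]

theorem send_of_mem (h : Triangle positive D Y H k m n x y z) (a b c : ℕ) {e : ℕ} (he : e ∈ Y.O) :
    send k m n a b c e = e := by
  rw [send, Function.update_of_ne, Function.update_of_ne, Function.update_of_ne, id]
  · rintro rfl; exact h.k_notMem he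
  · rintro rfl; exact h.m_notMem he
  · rintro rfl; exact h.n_notMem he

theorem forall_arcs (h : Triangle positive D Y H k m n x y z) {P : ℕ → Prop}
    (hO : ∀ e ∈ Y.O, P e) (hk : P k) (hm : P m) (hn : P n) : ∀ e ∈ D.arcs, P e := by
  intro e he
  rw [h.arcs_eq] at he
  simp only [Finset.mem_insert] at he
  rcases he with rfl | rfl | rfl | he
  exacts [hk, hm, hn, hO e he]

theorem covered (h : Triangle positive D Y H k m n x y z) {a b c : ℕ} (ha : a ∈ Y.O)
    (hb : b ∈ Y.O) (hc : c ∈ Y.O) : ∀ e ∈ D.arcs, send k m n a b c e ∈ Y.O :=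
  h.forall_arcs (fun e he => by rwa [h.send_of_mem a b c he]) (by rwa [h.send_k])
    (by rwa [h.send_m]) (by rwa [send_n])

theorem covered_circle (h : Triangle positive D Y H k m n x y z) :
    ∀ e ∈ D.arcs, send k m n k k k e = k ∨ send k m n k k k e ∈ Y.O :=
  h.forall_arcs (fun e he => Or.inr (by rwa [h.send_of_mem _ _ _ he])) (Or.inl (h.send_k _ _ _))
    (Or.inl (h.send_m _ _ _)) (Or.inl (send_n _ _ _))

theorem isState_of (h : Triangle positive D Y H k m n x y z) {l : List ℕ} {μ : List (ℕ × ℕ)}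
    {a b c : ℕ} (hμ : ∀ p ∈ μ, p.1 ∈ Y.O ∧ p.2 ∈ Y.O)
    (h₁ : ∀ (T : Type) (φ : ℕ → T),
      Compat φ (crs (D.slot x) (decide (x ∈ l)) ++ (crs (D.slot y) (decide (y ∈ l)) ++
        crs (D.slot z) (decide (z ∈ l)))) → Compat φ μ ∧ φ a = φ k ∧ φ b = φ m ∧ φ c = φ n)
    (h₂ : ∀ (T : Type) (φ : ℕ → T), Compat φ μ → Compat (φ ∘ send k m n a b c)
      (crs (D.slot x) (decide (x ∈ l)) ++ (crs (D.slot y) (decide (y ∈ l)) ++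
        crs (D.slot z) (decide (z ∈ l))))) :
    IsState D [x, y, z] Y.O [] l μ (send k m n a b c) where
  fix e he := h.send_of_mem a b c he
  mem := hμ
  forth T φ hφ := by
    have := h₁ T φ (by simpa using hφ)
    refine ⟨this.1, h.forall_arcs (fun e he => by rw [h.send_of_mem a b c he]) ?_ ?_ ?_⟩
    · rw [h.send_k]; exact this.2.1
    · rw [h.send_m]; exact this.2.2.1
    · rw [send_n]; exact this.2.2.2
  back T φ hφ := by simpa using h₂ T φ hφ

end States

section LocalStates

variable {D : LinkDiagram} {Y : Outside} {H : Hex} {k m n x y z : ℕ} {l : List ℕ}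

theorem pos_nil (h : Triangle true D Y H k m n x y z) (hx : x ∉ l) (hy : y ∉ l) (hz : z ∉ l) :
    IsState D [x, y, z] Y.O [] l H.V (send k m n H.p₁ H.p₁ H.p₁) := by
  have hs := fun e (he : e ∈ Y.O) => h.send_of_mem H.p₁ H.p₁ H.p₁ he
  refine h.isState_of h.mem.V (fun T φ => ?_) fun T φ => ?_ <;>
    simp [crs, h.slot_x, h.slot_y, h.slot_z, Hex.slots, Hex.V, hx, hy, hz, h.send_k, h.send_m,
      send_n, hs, h.mem.p₁, h.mem.p₂, h.mem.p₃, h.mem.p₄, h.mem.p₅, h.mem.p₆] <;> grind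

theorem pos_x (h : Triangle true D Y H k m n x y z) (hx : x ∈ l) (hy : y ∉ l) (hz : z ∉ l) :
    IsState D [x, y, z] Y.O [] l H.V (send k m n k k k) := by
  have hs := fun e (he : e ∈ Y.O) => h.send_of_mem k k k he
  refine h.isState_of h.mem.V (fun T φ => ?_) fun T φ => ?_ <;>
    simp [crs, h.slot_x, h.slot_y, h.slot_z, Hex.slots, Hex.V, hx, hy, hz, h.send_k, h.send_m,
      send_n, hs, h.mem.p₁, h.mem.p₂, h.mem.p₃, h.mem.p₄, h.mem.p₅, h.mem.p₆] <;> grind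

theorem pos_y (h : Triangle true D Y H k m n x y z) (hx : x ∉ l) (hy : y ∈ l) (hz : z ∉ l) :
    IsState D [x, y, z] Y.O [] l H.C (send k m n H.p₁ H.p₃ H.p₃) := by
  have hs := fun e (he : e ∈ Y.O) => h.send_of_mem H.p₁ H.p₃ H.p₃ he
  refine h.isState_of h.mem.C (fun T φ => ?_) fun T φ => ?_ <;>
    simp [crs, h.slot_x, h.slot_y, h.slot_z, Hex.slots, Hex.C, hx, hy, hz, h.send_k, h.send_m,
      send_n, hs, h.mem.p₁, h.mem.p₂, h.mem.p₃, h.mem.p₄, h.mem.p₅, h.mem.p₆] <;> grind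

theorem pos_z (h : Triangle true D Y H k m n x y z) (hx : x ∉ l) (hy : y ∉ l) (hz : z ∈ l) :
    IsState D [x, y, z] Y.O [] l H.B (send k m n H.p₄ H.p₅ H.p₄) := by
  have hs := fun e (he : e ∈ Y.O) => h.send_of_mem H.p₄ H.p₅ H.p₄ he
  refine h.isState_of h.mem.B (fun T φ => ?_) fun T φ => ?_ <;>
    simp [crs, h.slot_x, h.slot_y, h.slot_z, Hex.slots, Hex.B, hx, hy, hz, h.send_k, h.send_m,
      send_n, hs, h.mem.p₁, h.mem.p₂, h.mem.p₃, h.mem.p₄, h.mem.p₅, h.mem.p₆] <;> grind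

theorem pos_xy (h : Triangle true D Y H k m n x y z) (hx : x ∈ l) (hy : y ∈ l) (hz : z ∉ l) :
    IsState D [x, y, z] Y.O [] l H.V (send k m n H.p₂ H.p₂ H.p₂) := by
  have hs := fun e (he : e ∈ Y.O) => h.send_of_mem H.p₂ H.p₂ H.p₂ he
  refine h.isState_of h.mem.V (fun T φ => ?_) fun T φ => ?_ <;>
    simp [crs, h.slot_x, h.slot_y, h.slot_z, Hex.slots, Hex.V, hx, hy, hz, h.send_k, h.send_m,
      send_n, hs, h.mem.p₁, h.mem.p₂, h.mem.p₃, h.mem.p₄, h.mem.p₅, h.mem.p₆] <;> grind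

theorem pos_xz (h : Triangle true D Y H k m n x y z) (hx : x ∈ l) (hy : y ∉ l) (hz : z ∈ l) :
    IsState D [x, y, z] Y.O [] l H.V (send k m n H.p₅ H.p₅ H.p₅) := by
  have hs := fun e (he : e ∈ Y.O) => h.send_of_mem H.p₅ H.p₅ H.p₅ he
  refine h.isState_of h.mem.V (fun T φ => ?_) fun T φ => ?_ <;>
    simp [crs, h.slot_x, h.slot_y, h.slot_z, Hex.slots, Hex.V, hx, hy, hz, h.send_k, h.send_m,
      send_n, hs, h.mem.p₁, h.mem.p₂, h.mem.p₃, h.mem.p₄, h.mem.p₅, h.mem.p₆] <;> grind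

theorem pos_yz (h : Triangle true D Y H k m n x y z) (hx : x ∉ l) (hy : y ∈ l) (hz : z ∈ l) :
    IsState D [x, y, z] Y.O [] l H.rot.V (send k m n H.p₁ H.p₅ H.p₃) := by
  have hs := fun e (he : e ∈ Y.O) => h.send_of_mem H.p₁ H.p₅ H.p₃ he
  refine h.isState_of h.mem.rot.V (fun T φ => ?_) fun T φ => ?_ <;>
    simp [crs, h.slot_x, h.slot_y, h.slot_z, Hex.slots, Hex.V, hx, hy, hz, h.send_k, h.send_m,
      send_n, hs, h.mem.p₁, h.mem.p₂, h.mem.p₃, h.mem.p₄, h.mem.p₅, h.mem.p₆] <;> grind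

theorem pos_xyz (h : Triangle true D Y H k m n x y z) (hx : x ∈ l) (hy : y ∈ l) (hz : z ∈ l) :
    IsState D [x, y, z] Y.O [] l H.A (send k m n H.p₂ H.p₂ H.p₃) := by
  have hs := fun e (he : e ∈ Y.O) => h.send_of_mem H.p₂ H.p₂ H.p₃ he
  refine h.isState_of h.mem.A (fun T φ => ?_) fun T φ => ?_ <;>
    simp [crs, h.slot_x, h.slot_y, h.slot_z, Hex.slots, Hex.A, hx, hy, hz, h.send_k, h.send_m,
      send_n, hs, h.mem.p₁, h.mem.p₂, h.mem.p₃, h.mem.p₄, h.mem.p₅, h.mem.p₆] <;> grind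

theorem neg_nil (h : Triangle false D Y H k m n x y z) (hx : x ∉ l) (hy : y ∉ l) (hz : z ∉ l) :
    IsState D [x, y, z] Y.O [] l H.A (send k m n H.p₂ H.p₂ H.p₃) := by
  have hs := fun e (he : e ∈ Y.O) => h.send_of_mem H.p₂ H.p₂ H.p₃ he
  refine h.isState_of h.mem.A (fun T φ => ?_) fun T φ => ?_ <;>
    simp [crs, h.slot_x, h.slot_y, h.slot_z, Hex.slots, Hex.A, hx, hy, hz, h.send_k, h.send_m,
      send_n, hs, h.mem.p₁, h.mem.p₂, h.mem.p₃, h.mem.p₄, h.mem.p₅, h.mem.p₆] <;> grind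

theorem neg_x (h : Triangle false D Y H k m n x y z) (hx : x ∈ l) (hy : y ∉ l) (hz : z ∉ l) :
    IsState D [x, y, z] Y.O [] l H.rot.V (send k m n H.p₁ H.p₅ H.p₃) := by
  have hs := fun e (he : e ∈ Y.O) => h.send_of_mem H.p₁ H.p₅ H.p₃ he
  refine h.isState_of h.mem.rot.V (fun T φ => ?_) fun T φ => ?_ <;>
    simp [crs, h.slot_x, h.slot_y, h.slot_z, Hex.slots, Hex.V, hx, hy, hz, h.send_k, h.send_m,
      send_n, hs, h.mem.p₁, h.mem.p₂, h.mem.p₃, h.mem.p₄, h.mem.p₅, h.mem.p₆] <;> grind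

theorem neg_y (h : Triangle false D Y H k m n x y z) (hx : x ∉ l) (hy : y ∈ l) (hz : z ∉ l) :
    IsState D [x, y, z] Y.O [] l H.V (send k m n H.p₅ H.p₅ H.p₅) := by
  have hs := fun e (he : e ∈ Y.O) => h.send_of_mem H.p₅ H.p₅ H.p₅ he
  refine h.isState_of h.mem.V (fun T φ => ?_) fun T φ => ?_ <;>
    simp [crs, h.slot_x, h.slot_y, h.slot_z, Hex.slots, Hex.V, hx, hy, hz, h.send_k, h.send_m,
      send_n, hs, h.mem.p₁, h.mem.p₂, h.mem.p₃, h.mem.p₄, h.mem.p₅, h.mem.p₆] <;> grind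

theorem neg_z (h : Triangle false D Y H k m n x y z) (hx : x ∉ l) (hy : y ∉ l) (hz : z ∈ l) :
    IsState D [x, y, z] Y.O [] l H.V (send k m n H.p₂ H.p₂ H.p₂) := by
  have hs := fun e (he : e ∈ Y.O) => h.send_of_mem H.p₂ H.p₂ H.p₂ he
  refine h.isState_of h.mem.V (fun T φ => ?_) fun T φ => ?_ <;>
    simp [crs, h.slot_x, h.slot_y, h.slot_z, Hex.slots, Hex.V, hx, hy, hz, h.send_k, h.send_m,
      send_n, hs, h.mem.p₁, h.mem.p₂, h.mem.p₃, h.mem.p₄, h.mem.p₅, h.mem.p₆] <;> grind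

theorem neg_xy (h : Triangle false D Y H k m n x y z) (hx : x ∈ l) (hy : y ∈ l) (hz : z ∉ l) :
    IsState D [x, y, z] Y.O [] l H.B (send k m n H.p₁ H.p₅ H.p₁) := by
  have hs := fun e (he : e ∈ Y.O) => h.send_of_mem H.p₁ H.p₅ H.p₁ he
  refine h.isState_of h.mem.B (fun T φ => ?_) fun T φ => ?_ <;>
    simp [crs, h.slot_x, h.slot_y, h.slot_z, Hex.slots, Hex.B, hx, hy, hz, h.send_k, h.send_m,
      send_n, hs, h.mem.p₁, h.mem.p₂, h.mem.p₃, h.mem.p₄, h.mem.p₅, h.mem.p₆] <;> grind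

theorem neg_xz (h : Triangle false D Y H k m n x y z) (hx : x ∈ l) (hy : y ∉ l) (hz : z ∈ l) :
    IsState D [x, y, z] Y.O [] l H.C (send k m n H.p₁ H.p₃ H.p₃) := by
  have hs := fun e (he : e ∈ Y.O) => h.send_of_mem H.p₁ H.p₃ H.p₃ he
  refine h.isState_of h.mem.C (fun T φ => ?_) fun T φ => ?_ <;>
    simp [crs, h.slot_x, h.slot_y, h.slot_z, Hex.slots, Hex.C, hx, hy, hz, h.send_k, h.send_m,
      send_n, hs, h.mem.p₁, h.mem.p₂, h.mem.p₃, h.mem.p₄, h.mem.p₅, h.mem.p₆] <;> grind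

theorem neg_yz (h : Triangle false D Y H k m n x y z) (hx : x ∉ l) (hy : y ∈ l) (hz : z ∈ l) :
    IsState D [x, y, z] Y.O [] l H.V (send k m n k k k) := by
  have hs := fun e (he : e ∈ Y.O) => h.send_of_mem k k k he
  refine h.isState_of h.mem.V (fun T φ => ?_) fun T φ => ?_ <;>
    simp [crs, h.slot_x, h.slot_y, h.slot_z, Hex.slots, Hex.V, hx, hy, hz, h.send_k, h.send_m,
      send_n, hs, h.mem.p₁, h.mem.p₂, h.mem.p₃, h.mem.p₄, h.mem.p₅, h.mem.p₆] <;> grind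

theorem neg_xyz (h : Triangle false D Y H k m n x y z) (hx : x ∈ l) (hy : y ∈ l) (hz : z ∈ l) :
    IsState D [x, y, z] Y.O [] l H.V (send k m n H.p₁ H.p₁ H.p₁) := by
  have hs := fun e (he : e ∈ Y.O) => h.send_of_mem H.p₁ H.p₁ H.p₁ he
  refine h.isState_of h.mem.V (fun T φ => ?_) fun T φ => ?_ <;>
    simp [crs, h.slot_x, h.slot_y, h.slot_z, Hex.slots, Hex.V, hx, hy, hz, h.send_k, h.send_m,
      send_n, hs, h.mem.p₁, h.mem.p₂, h.mem.p₃, h.mem.p₄, h.mem.p₅, h.mem.p₆] <;> grind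

end LocalStates

end Triangle

section Relations

theorem rel_iff {E : Setoid ℕ} {a b a' b' : ℕ} (h : (E a a' ∧ E b b') ∨ (E a b' ∧ E b a')) :
    E a b ↔ E a' b' := by
  rcases h with ⟨h1, h2⟩ | ⟨h1, h2⟩
  · exact ⟨fun h => E.trans (E.symm h1) (E.trans h h2), fun h => E.trans h1 (E.trans h (E.symm h2))⟩
  · exact ⟨fun h => E.trans (E.symm h2) (E.trans (E.symm h) h1),
      fun h => E.trans h1 (E.trans (E.symm h) (E.symm h2))⟩

theorem Cut.xor {D : LinkDiagram} {L l : List ℕ} {X O : Finset ℕ} {J : Finset (ℕ × ℕ)}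
    {slot : ℕ → Fin 4 → ℕ} {Jl μ μ' : List (ℕ × ℕ)} {ρ ρ' : ℕ → ℕ} {S : Finset ℕ} {w : ℕ}
    (h : Cut D L X O J slot Jl) (hst : IsState D L O Jl l μ ρ)
    (hst' : IsState D L O Jl (w :: l) μ' ρ') (hl : ∀ x ∈ w :: l, x ∈ L) (hw : w ∉ l) (hS : S ⊆ X) :
    fam J slot X μ S (ρ (D.slot w 0)) (ρ (D.slot w 1)) ↔
      ¬ fam J slot X μ' S (ρ' (D.slot w 0)) (ρ' (D.slot w 3)) := by
  have hwL := hl w List.mem_cons_self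
  have hwD : w ∈ D.crossings := by
    rw [h.crossings_eq]; exact Finset.mem_union_left _ (List.mem_toFinset.2 hwL)
  have hwS : w ∉ l.toFinset ∪ S := by
    simpa [hw] using fun hwS => h.notMem w hwL (hS hwS)
  have key := LinkDiagram.glue_crossing_xor hwD hwS
  rwa [← Finset.insert_union, ← List.toFinset_cons,
    hst.glue_iff h (fun x hx => hl x (List.mem_cons_of_mem _ hx)) hS (D.slot_mem _ hwD _)
      (D.slot_mem _ hwD _), hst'.glue_iff h hl hS (D.slot_mem _ hwD _) (D.slot_mem _ hwD _)] at key

variable {D : LinkDiagram} {Y : Outside} {H : Hex} {k m n x y z : ℕ}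

theorem surg_VC {S : Finset ℕ}
    (hx : Y.rel H.V S H.p₂ H.p₁ ↔ ¬ Y.rel H.C S H.p₂ H.p₃) :
    Surg (Y.rel H.V S) (Y.rel H.C S) H.p₂ H.p₃ H.p₁ := by
  refine surg_fam (c := H.p₆) (ν := [(H.p₄, H.p₅)]) (prs_congr fun T f => ?_)
    (prs_congr fun T f => ?_) hx <;> simp only [Hex.V, Hex.C, compat_cons] <;> grind

theorem surg_VB {S : Finset ℕ}
    (hx : Y.rel H.V S H.p₄ H.p₁ ↔ ¬ Y.rel H.B S H.p₄ H.p₅) :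
    Surg (Y.rel H.V S) (Y.rel H.B S) H.p₄ H.p₅ H.p₁ := by
  refine surg_fam (c := H.p₆) (ν := [(H.p₂, H.p₃)]) (prs_congr fun T f => ?_)
    (prs_congr fun T f => ?_) hx <;> simp only [Hex.V, Hex.B, compat_cons] <;> grind

theorem Triangle.pos_surgeries (h : Triangle true D Y H k m n x y z) : Surgeries Y H where
  vc S hS := by
    refine surg_VC ?_
    have key := h.cut.xor (h.pos_nil (l := []) (by simp) (by simp) (by simp))
      (h.pos_y (l := [y]) (by simpa using h.x_ne_y) (by simp) (by simpa using h.y_ne_z.symm))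
      (by simp) (by simp) hS
    simp only [h.slot_y, Hex.slots, if_true, Matrix.cons_val_zero, Matrix.cons_val_one,
      Matrix.cons_val, h.send_k, send_n, h.send_of_mem _ _ _ h.mem.p₂] at key
    rwa [rel_iff (Or.inr ⟨Setoid.refl' _ _, Setoid.refl' _ _⟩),
      rel_iff (E := Y.rel H.C S) (Or.inl ⟨C₁₂ Y H S, Setoid.refl' _ _⟩)] at key
  vb S hS := by
    refine surg_VB ?_
    have key := h.cut.xor (h.pos_nil (l := []) (by simp) (by simp) (by simp))
      (h.pos_z (l := [z]) (by simpa using h.x_ne_z) (by simpa using h.y_ne_z) (by simp))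
      (by simp) (by simp) hS
    simp only [h.slot_z, Hex.slots, if_true, Matrix.cons_val_zero, Matrix.cons_val_one,
      Matrix.cons_val, h.send_m, h.send_of_mem _ _ _ h.mem.p₄,
      h.send_of_mem _ _ _ h.mem.p₅] at key
    rwa [rel_iff (Or.inl ⟨Setoid.symm' _ (V₄₅ Y H S), Setoid.refl' _ _⟩),
      rel_iff (E := Y.rel H.B S) (Or.inr ⟨Setoid.refl' _ _, Setoid.refl' _ _⟩)] at key
  outV := (h.pos_nil (l := []) (by simp) (by simp) (by simp)).outSurg h.cut (by simp)
  outC := (h.pos_y (l := [y]) (by simpa using h.x_ne_y) (by simp)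
    (by simpa using h.y_ne_z.symm)).outSurg h.cut (by simp)
  outB := (h.pos_z (l := [z]) (by simpa using h.x_ne_z) (by simpa using h.y_ne_z)
    (by simp)).outSurg h.cut (by simp)

theorem Triangle.neg_surgeries (h : Triangle false D Y H k m n x y z) : Surgeries Y H where
  vc S hS := by
    refine surg_VC ?_
    have key := h.cut.xor (h.neg_z (l := [z]) (by simpa using h.x_ne_z) (by simpa using h.y_ne_z)
      (by simp)) (h.neg_xz (l := [x, z]) (by simp) (by simpa using ⟨h.x_ne_y.symm, h.y_ne_z⟩)
      (by simp)) (by simp) (by simpa using h.x_ne_z) hS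
    simp only [h.slot_x, Hex.slots, Bool.false_eq_true, if_false, Matrix.cons_val_zero,
      Matrix.cons_val_one, Matrix.cons_val, h.send_k, h.send_of_mem _ _ _ h.mem.p₁,
      h.send_of_mem _ _ _ h.mem.p₆] at key
    rwa [rel_iff (Or.inr ⟨Setoid.refl' _ _, Setoid.refl' _ _⟩),
      rel_iff (E := Y.rel H.C S)
        (Or.inl ⟨C₁₂ Y H S, Setoid.symm' _ (C₃₆ Y H S)⟩)] at key
  vb S hS := by
    refine surg_VB ?_
    have key := h.cut.xor (h.neg_y (l := [y]) (by simpa using h.x_ne_y) (by simp)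
      (by simpa using h.y_ne_z.symm)) (h.neg_xy (l := [x, y]) (by simp) (by simp)
      (by simpa using ⟨h.x_ne_z.symm, h.y_ne_z.symm⟩)) (by simp) (by simpa using h.x_ne_y) hS
    simp only [h.slot_x, Hex.slots, Bool.false_eq_true, if_false, Matrix.cons_val_zero,
      Matrix.cons_val_one, Matrix.cons_val, h.send_k, h.send_of_mem _ _ _ h.mem.p₁,
      h.send_of_mem _ _ _ h.mem.p₆] at key
    rwa [rel_iff (Or.inr ⟨Setoid.refl' _ _, Setoid.symm' _ (V₄₅ Y H S)⟩),
      rel_iff (E := Y.rel H.B S)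
        (Or.inl ⟨B₁₄ Y H S, Setoid.symm' _ (B₅₆ Y H S)⟩)] at key
  outV := (h.neg_xyz (l := [x, y, z]) (by simp) (by simp) (by simp)).outSurg h.cut (by simp)
  outC := (h.neg_xz (l := [x, z]) (by simp) (by simpa using ⟨h.x_ne_y.symm, h.y_ne_z⟩)
      (by simp)).outSurg h.cut (by simp)
  outB := (h.neg_xy (l := [x, y]) (by simp) (by simp)
      (by simpa using ⟨h.x_ne_z.symm, h.y_ne_z.symm⟩)).outSurg h.cut (by simp)

end Relations

section Terms

variable {K : Type u} {R : Type v} [CommRing K] [CommRing R] [Algebra K R] {α : R} {ω : Rˣ}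
  {D : LinkDiagram} {L l : List ℕ} {X O : Finset ℕ} {J : Finset (ℕ × ℕ)}
  {slot : ℕ → Fin 4 → ℕ} {Jl μ : List (ℕ × ℕ)} {ρ : ℕ → ℕ} {S : Finset ℕ}

theorem W_rotate (h : Frame D L X O) {x y z : ℕ} (hx : x ∈ L) (hy : y ∈ L) (hz : z ∈ L)
    (hxz : x ≠ z) (hyz : y ≠ z) (hS : S ⊆ X) (hxy : x ≠ y) (b : MvPolynomial ℕ K) :
    W K α D [z, x, y] S b = W K α D [x, y, z] S b := by
  have hn : ∀ w ∈ L, w ∉ S := fun w hw hwS => h.notMem w hw (hS hwS)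
  have h1 : wedgeSign [x, z, y] S = -wedgeSign [x, y, z] S := by
    change _ * wedgeSign [z, y] S = -(_ * wedgeSign [y, z] S)
    rw [wedgeSign_swap hyz.symm (by simpa using hn z hz) (by simpa using hn y hy), mul_neg]
    simp [Finset.insert_comm]
  rw [W_swap hxz.symm (by simpa using ⟨hyz.symm, hn z hz⟩) (by simpa using ⟨hxy, hn x hx⟩),
    W_eq_genE, W_eq_genE, h1, neg_smul, neg_neg]
  simp [Finset.insert_comm]

/-- Normalization of the terms of the differential. -/
theorem IsState.W_term (q : QuadData K α) {w : ℕ} (hst : IsState D L O Jl (w :: l) μ ρ)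
    (h : Cut D L X O J slot Jl) (hl : ∀ x ∈ w :: l, x ∈ L) (hS : S ⊆ X) {b : MvPolynomial ℕ K}
    (hb : b ∈ supp K D.arcs) {e f : ℕ}
    (hr : ∀ (T : Type) (φ : ℕ → T), Compat φ μ →
      φ (ρ (D.slot w 0)) = φ e ∧ φ (ρ (D.slot w 3)) = φ f) :
    W K α D (w :: l) S
      (b * q.cc ω (glue D ((w :: l).toFinset ∪ S)) (D.slot w 0) (D.slot w 3)) =
      W K α D (w :: l) S (MvPolynomial.rename ρ b * q.cc ω (fam J slot X μ S) e f) := by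
  have hwD : w ∈ D.crossings := by
    rw [h.crossings_eq]
    exact Finset.mem_union_left _ (List.mem_toFinset.2 (hl w List.mem_cons_self))
  have h0 : fam J slot X μ S (ρ (D.slot w 0)) e := fam_of_compat fun T φ hφ => (hr T φ hφ).1
  have h3 : fam J slot X μ S (ρ (D.slot w 3)) f := fam_of_compat fun T φ hφ => (hr T φ hφ).2
  rw [hst.W_cc q h hl hS hb (D.slot_mem _ hwD _) (D.slot_mem _ hwD _)]
  exact hst.W_congr q h ⟨_, D.slot_mem _ hwD 0⟩ hl hS ((QuadData.Cong.refl _ _).mul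
    (q.cc_congr ω h0 h3 (rel_iff (Or.inl ⟨h0, h3⟩))))

theorem IsState.W_term_swap (q : QuadData K α) {w : ℕ} (hst : IsState D L O Jl (w :: l) μ ρ)
    (h : Cut D L X O J slot Jl) (hl : ∀ x ∈ w :: l, x ∈ L) (hS : S ⊆ X) {b : MvPolynomial ℕ K}
    (hb : b ∈ supp K D.arcs) {e f : ℕ}
    (hr : ∀ (T : Type) (φ : ℕ → T), Compat φ μ →
      φ (ρ (D.slot w 0)) = φ f ∧ φ (ρ (D.slot w 3)) = φ e) :
    W K α D (w :: l) S
      (b * q.cc ω (glue D ((w :: l).toFinset ∪ S)) (D.slot w 0) (D.slot w 3)) =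
      W K α D (w :: l) S (MvPolynomial.rename ρ b * q.cc ω (fam J slot X μ S) e f) := by
  have hwD : w ∈ D.crossings := by
    rw [h.crossings_eq]
    exact Finset.mem_union_left _ (List.mem_toFinset.2 (hl w List.mem_cons_self))
  rw [hst.W_term q h hl hS hb hr]
  exact hst.W_congr q h ⟨_, D.slot_mem _ hwD 0⟩ hl hS ((QuadData.Cong.refl _ _).mul
    (q.cc_comm ω _ f e))

end Terms

namespace Triangle

section Differential

variable {K : Type u} {R : Type v} [CommRing K] [CommRing R] [Algebra K R] {α : R} {ω : Rˣ}
  {D : LinkDiagram} {Y : Outside} {H : Hex} {k m n x y z : ℕ} {S : Finset ℕ} {positive : Bool}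
  {b : MvPolynomial ℕ K}

theorem mem_of_mem (h : Triangle positive D Y H k m n x y z)
    (hb : b ∈ supp K Y.O) :
    b ∈ supp K D.arcs :=
  MvPolynomial.supported_mono (by exact_mod_cast h.cut.sub) hb

theorem k_mem (h : Triangle positive D Y H k m n x y z) : k ∈ D.arcs := by
  rw [h.arcs_eq]; exact Finset.mem_insert_self _ _

theorem rename_eq (h : Triangle positive D Y H k m n x y z) (e f g : ℕ)
    (hb : b ∈ supp K Y.O) :
    MvPolynomial.rename (send k m n e f g) b = b :=
  rename_of_supported (fun _ ha => h.send_of_mem e f g ha) hb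

theorem rename_mul_el (h : Triangle positive D Y H k m n x y z) (q : QuadData K α) (e f g : ℕ)
    (hb : b ∈ supp K Y.O) (r : R) :
    MvPolynomial.rename (send k m n e f g) (b * q.el k r) = b * q.el e r := by
  rw [map_mul, h.rename_eq _ _ _ hb, rename_el, h.send_k]

theorem swap_xy (h : Triangle positive D Y H k m n x y z) (hS : S ⊆ Y.X) (b : MvPolynomial ℕ K) :
    W K α D [y, x] S b = -W K α D [x, y] S b :=
  W_swap_nil h.cut.toFrame (by simp) (by simp) h.x_ne_y hS b

theorem swap_xz (h : Triangle positive D Y H k m n x y z) (hS : S ⊆ Y.X) (b : MvPolynomial ℕ K) :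
    W K α D [z, x] S b = -W K α D [x, z] S b :=
  W_swap_nil h.cut.toFrame (by simp) (by simp) h.x_ne_z hS b

theorem swap_yz (h : Triangle positive D Y H k m n x y z) (hS : S ⊆ Y.X) (b : MvPolynomial ℕ K) :
    W K α D [z, y] S b = -W K α D [y, z] S b :=
  W_swap_nil h.cut.toFrame (by simp) (by simp) h.y_ne_z hS b

theorem swap_xyz (h : Triangle positive D Y H k m n x y z) (hS : S ⊆ Y.X)
    (b : MvPolynomial ℕ K) : W K α D [y, x, z] S b = -W K α D [x, y, z] S b :=
  W_swap h.x_ne_y.symm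
    (by simpa using ⟨h.y_ne_z, fun hyS => h.cut.notMem y (by simp) (hS hyS)⟩)
    (by simpa using ⟨h.x_ne_z, fun hxS => h.cut.notMem x (by simp) (hS hxS)⟩) b

theorem rotate_xyz (h : Triangle positive D Y H k m n x y z) (hS : S ⊆ Y.X)
    (b : MvPolynomial ℕ K) : W K α D [z, x, y] S b = W K α D [x, y, z] S b :=
  W_rotate h.cut.toFrame (by simp) (by simp) (by simp) h.x_ne_z h.y_ne_z hS h.x_ne_y b

variable [Coalgebra K R] (q : QuadData K α)

theorem pos_dOn_nil (hω : IsTwisting (K := K) α ω) (h : Triangle true D Y H k m n x y z)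
    (hS : S ⊆ Y.X) (hb : b ∈ supp K Y.O) :
    dOn K R D [x, y, z].toFinset (W K α D [] S b) =
      W K α D [x] S (b * q.el H.p₁ (ω : R) * (MvPolynomial.X H.p₁ - MvPolynomial.C q.s) *
        q.el k (1 : R)) + W K α D [x] S (b * q.el H.p₁ (ω : R) * q.el k α) +
      W K α D [y] S (b * H.vc ω q Y S) + W K α D [z] S (b * H.vb ω q Y S) := by
  have hxy := h.x_ne_y
  have hxz := h.x_ne_z
  have hyz := h.y_ne_z
  have hs := fun a b c e (he : e ∈ Y.O) => h.send_of_mem a b c he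
  rw [dOn_local_W q hω h.cut.toFrame (List.nil_sublist _) hS (h.mem_of_mem hb)]
  simp only [List.not_mem_nil, not_false_eq_true, decide_true, List.filter_true, List.map_cons,
    List.map_nil, List.sum_cons, List.sum_nil, add_zero]
  rw [(h.pos_x (l := [x]) (by simp) (by simpa using hxy.symm) (by simpa using hxz.symm)).W_term
      (e := H.p₁) (f := k) q h.cut (by simp) hS (h.mem_of_mem hb) (fun T φ => by
        simp [h.slot_x, Hex.slots, Hex.V, h.send_k, h.send_m, hs, h.mem.p₆]; grind),
    (h.pos_y (l := [y]) (by simpa using hxy) (by simp) (by simpa using hyz.symm)).W_term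
      (e := H.p₂) (f := H.p₃) q h.cut (by simp) hS (h.mem_of_mem hb) (fun T φ => by
        simp [h.slot_y, Hex.slots, Hex.C, h.send_k, send_n]; grind),
    (h.pos_z (l := [z]) (by simpa using hxz) (by simpa using hyz) (by simp)).W_term_swap
      (e := H.p₄) (f := H.p₅) q h.cut (by simp) hS (h.mem_of_mem hb) (fun T φ => by
        simp [h.slot_z, Hex.slots, hs, h.mem.p₄, h.mem.p₅]),
    h.rename_eq _ _ _ hb, h.rename_eq _ _ _ hb, h.rename_eq _ _ _ hb,
    q.cc_neg (fun hk => fam_isolated h.cut h.mem.V h.k_notMem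
      (fun hk => h.k_notMem (hk ▸ h.mem.p₁)) (Setoid.symm' _ hk)), ← map_add, add_assoc]
  congr 1
  refine (h.pos_x (l := [x]) (by simp) (by simpa using hxy.symm)
    (by simpa using hxz.symm)).W_congr q h.cut ⟨_, h.k_mem⟩ (by simp) hS ?_
  intro A _ _ x hx
  rw [map_mul, hx.cop_comm, QuadData.aeval_cop]
  simp only [map_mul, map_add, map_sub, q.el_gen, q.el_one, map_one,
    MvPolynomial.aeval_X, MvPolynomial.algHom_C]
  ring

theorem pos_dOn_x (hω : IsTwisting (K := K) α ω) (h : Triangle true D Y H k m n x y z)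
    (hS : S ⊆ Y.X) (hb : b ∈ supp K Y.O) (r : R) :
    dOn K R D [x, y, z].toFinset (W K α D [x] S (b * q.el k r)) =
      -W K α D [x, y] S (b * q.el H.p₂ r) - W K α D [x, z] S (b * q.el H.p₅ r) := by
  have hxy := h.x_ne_y
  have hxz := h.x_ne_z
  have hyz := h.y_ne_z
  have hs := fun a b c e (he : e ∈ Y.O) => h.send_of_mem a b c he
  have hb' : b * q.el k r ∈ supp K D.arcs :=
    mul_mem (h.mem_of_mem hb) (q.el_mem h.k_mem r)
  have hf : [x, y, z].filter (· ∉ [x]) = [y, z] := by simp [hxy.symm, hxz.symm]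
  rw [dOn_local_W q hω h.cut.toFrame (by simp) hS hb', hf]
  simp only [List.map_cons, List.map_nil, List.sum_cons, List.sum_nil, add_zero]
  rw [(h.pos_xy (l := [y, x]) (by simp) (by simp) (by simpa using ⟨hyz.symm, hxz.symm⟩)).W_term
      (e := H.p₂) (f := H.p₂) q h.cut (by simp) hS hb' (fun T φ => by
        simp [h.slot_y, Hex.slots, Hex.V, h.send_k, send_n]),
    (h.pos_xz (l := [z, x]) (by simp) (by simpa using ⟨hyz, hxy.symm⟩) (by simp)).W_term
      (e := H.p₅) (f := H.p₅) q h.cut (by simp) hS hb' (fun T φ => by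
        simp [h.slot_z, Hex.slots, Hex.V, hs, h.mem.p₅, h.mem.p₄]),
    q.cc_pos (Setoid.refl' _ _), q.cc_pos (Setoid.refl' _ _), mul_one, mul_one,
    h.rename_mul_el q _ _ _ hb, h.rename_mul_el q _ _ _ hb, h.swap_xy hS, h.swap_xz hS,
    sub_eq_add_neg]

theorem pos_dOn_y (hω : IsTwisting (K := K) α ω) (h : Triangle true D Y H k m n x y z)
    (hS : S ⊆ Y.X) (hb : b ∈ supp K Y.O) :
    dOn K R D [x, y, z].toFinset (W K α D [y] S b) =
      W K α D [x, y] S (b * H.cv ω q Y S) - W K α D [y, z] S (b * H.rot.cv ω q Y S) := by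
  have hxy := h.x_ne_y
  have hxz := h.x_ne_z
  have hyz := h.y_ne_z
  have hs := fun a b c e (he : e ∈ Y.O) => h.send_of_mem a b c he
  have hf : [x, y, z].filter (· ∉ [y]) = [x, z] := by simp [hxy, hyz.symm]
  rw [dOn_local_W q hω h.cut.toFrame (by simp) hS (h.mem_of_mem hb), hf]
  simp only [List.map_cons, List.map_nil, List.sum_cons, List.sum_nil, add_zero]
  rw [(h.pos_xy (l := [x, y]) (by simp) (by simp) (by simpa using ⟨hxz.symm, hyz.symm⟩)).W_term
      (e := H.p₁) (f := H.p₂) q h.cut (by simp) hS (h.mem_of_mem hb) (fun T φ => by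
        simp [h.slot_x, Hex.slots, Hex.V, hs, h.mem.p₆, h.send_m]; grind),
    (h.pos_yz (l := [z, y]) (by simpa using ⟨hxz, hxy⟩) (by simp) (by simp)).W_term_swap
      (e := H.p₄) (f := H.p₅) q h.cut (by simp) hS (h.mem_of_mem hb) (fun T φ => by
        simp [h.slot_z, Hex.slots, Hex.V, hs, h.mem.p₅, h.mem.p₄]),
    h.rename_eq _ _ _ hb, h.rename_eq _ _ _ hb, h.swap_yz hS, sub_eq_add_neg]
  rfl

theorem pos_dOn_z (hω : IsTwisting (K := K) α ω) (h : Triangle true D Y H k m n x y z)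
    (hS : S ⊆ Y.X) (hb : b ∈ supp K Y.O) :
    dOn K R D [x, y, z].toFinset (W K α D [z] S b) =
      W K α D [x, z] S (b * H.bv ω q Y S) + W K α D [y, z] S (b * H.rot.bv ω q Y S) := by
  have hxy := h.x_ne_y
  have hxz := h.x_ne_z
  have hyz := h.y_ne_z
  have hs := fun a b c e (he : e ∈ Y.O) => h.send_of_mem a b c he
  have hf : [x, y, z].filter (· ∉ [z]) = [x, y] := by simp [hxz, hyz]
  rw [dOn_local_W q hω h.cut.toFrame (by simp) hS (h.mem_of_mem hb), hf]
  simp only [List.map_cons, List.map_nil, List.sum_cons, List.sum_nil, add_zero]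
  rw [(h.pos_xz (l := [x, z]) (by simp) (by simpa using ⟨hxy.symm, hyz⟩) (by simp)).W_term_swap
      (e := H.p₅) (f := H.p₆) q h.cut (by simp) hS (h.mem_of_mem hb) (fun T φ => by
        simp [h.slot_x, Hex.slots, Hex.V, hs, h.mem.p₆, h.send_m]),
    (h.pos_yz (l := [y, z]) (by simpa using ⟨hxy, hxz⟩) (by simp) (by simp)).W_term
      (e := H.p₂) (f := H.p₃) q h.cut (by simp) hS (h.mem_of_mem hb) (fun T φ => by
        simp [h.slot_y, Hex.slots, Hex.V, h.send_k, send_n]),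
    h.rename_eq _ _ _ hb, h.rename_eq _ _ _ hb]
  rfl

theorem pos_dOn_xy (hω : IsTwisting (K := K) α ω) (h : Triangle true D Y H k m n x y z)
    (hS : S ⊆ Y.X) (hb : b ∈ supp K Y.O) :
    dOn K R D [x, y, z].toFinset (W K α D [x, y] S b) =
      W K α D [x, y, z] S (b * H.va ω q Y S) := by
  have hxy := h.x_ne_y
  have hxz := h.x_ne_z
  have hyz := h.y_ne_z
  have hs := fun a b c e (he : e ∈ Y.O) => h.send_of_mem a b c he
  have hf : [x, y, z].filter (· ∉ [x, y]) = [z] := by simp [hxz.symm, hyz.symm]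
  rw [dOn_local_W q hω h.cut.toFrame (by simp) hS (h.mem_of_mem hb), hf]
  simp only [List.map_cons, List.map_nil, List.sum_cons, List.sum_nil, add_zero]
  rw [(h.pos_xyz (l := [z, x, y]) (by simp) (by simp) (by simp)).W_term
      (e := H.p₂) (f := H.p₃) q h.cut (by simp) hS (h.mem_of_mem hb) (fun T φ => by
        simp [h.slot_z, Hex.slots, Hex.A, hs, h.mem.p₅, h.mem.p₄]; grind),
    h.rename_eq _ _ _ hb, h.rotate_xyz hS]
  rfl

theorem pos_dOn_xz (hω : IsTwisting (K := K) α ω) (h : Triangle true D Y H k m n x y z)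
    (hS : S ⊆ Y.X) (hb : b ∈ supp K Y.O) :
    dOn K R D [x, y, z].toFinset (W K α D [x, z] S b) =
      -W K α D [x, y, z] S (b * H.va ω q Y S) := by
  have hxy := h.x_ne_y
  have hxz := h.x_ne_z
  have hyz := h.y_ne_z
  have hs := fun a b c e (he : e ∈ Y.O) => h.send_of_mem a b c he
  have hf : [x, y, z].filter (· ∉ [x, z]) = [y] := by simp [hxy.symm, hyz]
  rw [dOn_local_W q hω h.cut.toFrame (by simp) hS (h.mem_of_mem hb), hf]
  simp only [List.map_cons, List.map_nil, List.sum_cons, List.sum_nil, add_zero]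
  rw [(h.pos_xyz (l := [y, x, z]) (by simp) (by simp) (by simp)).W_term
      (e := H.p₂) (f := H.p₃) q h.cut (by simp) hS (h.mem_of_mem hb) (fun T φ => by
        simp [h.slot_y, Hex.slots, Hex.A, h.send_k, send_n]),
    h.rename_eq _ _ _ hb, h.swap_xyz hS]
  rfl

theorem pos_dOn_yz (hω : IsTwisting (K := K) α ω) (h : Triangle true D Y H k m n x y z)
    (hS : S ⊆ Y.X) (hb : b ∈ supp K Y.O) :
    dOn K R D [x, y, z].toFinset (W K α D [y, z] S b) =
      W K α D [x, y, z] S (b * H.rot.va ω q Y S) := by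
  have hxy := h.x_ne_y
  have hxz := h.x_ne_z
  have hyz := h.y_ne_z
  have hs := fun a b c e (he : e ∈ Y.O) => h.send_of_mem a b c he
  have hf : [x, y, z].filter (· ∉ [y, z]) = [x] := by simp [hxy, hxz]
  rw [dOn_local_W q hω h.cut.toFrame (by simp) hS (h.mem_of_mem hb), hf]
  simp only [List.map_cons, List.map_nil, List.sum_cons, List.sum_nil, add_zero]
  rw [(h.pos_xyz (l := [x, y, z]) (by simp) (by simp) (by simp)).W_term_swap
      (e := H.p₅) (f := H.p₆) q h.cut (by simp) hS (h.mem_of_mem hb) (fun T φ => by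
        simp [h.slot_x, Hex.slots, Hex.A, hs, h.mem.p₆, h.send_m]; grind),
    h.rename_eq _ _ _ hb, Hex.va, Outside.rel_rot_A]
  rfl

theorem neg_dOn_nil (hω : IsTwisting (K := K) α ω) (h : Triangle false D Y H k m n x y z)
    (hS : S ⊆ Y.X) (hb : b ∈ supp K Y.O) :
    dOn K R D [x, y, z].toFinset (W K α D [] S b) =
      W K α D [x] S (b * H.rot.av ω q Y S) + (W K α D [y] S (b * H.av ω q Y S) +
        W K α D [z] S (b * H.av ω q Y S)) := by
  have hxy := h.x_ne_y
  have hxz := h.x_ne_z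
  have hyz := h.y_ne_z
  have hs := fun a b c e (he : e ∈ Y.O) => h.send_of_mem a b c he
  rw [dOn_local_W q hω h.cut.toFrame (List.nil_sublist _) hS (h.mem_of_mem hb)]
  simp only [List.not_mem_nil, not_false_eq_true, decide_true, List.filter_true, List.map_cons,
    List.map_nil, List.sum_cons, List.sum_nil, add_zero]
  rw [(h.neg_x (l := [x]) (by simp) (by simpa using hxy.symm) (by simpa using hxz.symm)).W_term_swap
      (e := H.p₅) (f := H.p₂) q h.cut (by simp) hS (h.mem_of_mem hb) (fun T φ => by
        simp [h.slot_x, Hex.slots, Hex.V, hs, h.mem.p₁, h.mem.p₆]; grind),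
    (h.neg_y (l := [y]) (by simpa using hxy) (by simp) (by simpa using hyz.symm)).W_term
      (e := H.p₂) (f := H.p₅) q h.cut (by simp) hS (h.mem_of_mem hb) (fun T φ => by
        simp [h.slot_y, Hex.slots, Hex.V, hs, h.mem.p₂, h.send_k]),
    (h.neg_z (l := [z]) (by simpa using hxz) (by simpa using hyz) (by simp)).W_term
      (e := H.p₂) (f := H.p₅) q h.cut (by simp) hS (h.mem_of_mem hb) (fun T φ => by
        simp [h.slot_z, Hex.slots, Hex.V, h.send_m, hs, h.mem.p₅]),
    h.rename_eq _ _ _ hb, h.rename_eq _ _ _ hb, h.rename_eq _ _ _ hb]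
  rfl

theorem neg_dOn_x (hω : IsTwisting (K := K) α ω) (h : Triangle false D Y H k m n x y z)
    (hS : S ⊆ Y.X) (hb : b ∈ supp K Y.O) :
    dOn K R D [x, y, z].toFinset (W K α D [x] S b) =
      -W K α D [x, y] S (b * H.rot.vb ω q Y S) - W K α D [x, z] S (b * H.rot.vc ω q Y S) := by
  have hxy := h.x_ne_y
  have hxz := h.x_ne_z
  have hyz := h.y_ne_z
  have hs := fun a b c e (he : e ∈ Y.O) => h.send_of_mem a b c he
  have hf : [x, y, z].filter (· ∉ [x]) = [y, z] := by simp [hxy.symm, hxz.symm]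
  rw [dOn_local_W q hω h.cut.toFrame (by simp) hS (h.mem_of_mem hb), hf]
  simp only [List.map_cons, List.map_nil, List.sum_cons, List.sum_nil, add_zero]
  rw [(h.neg_xy (l := [y, x]) (by simp) (by simp) (by simpa using ⟨hyz.symm, hxz.symm⟩)).W_term_swap
      (e := H.p₁) (f := H.p₂) q h.cut (by simp) hS (h.mem_of_mem hb) (fun T φ => by
        simp [h.slot_y, Hex.slots, Hex.B, hs, h.mem.p₂, h.send_k]),
    (h.neg_xz (l := [z, x]) (by simp) (by simpa using ⟨hyz, hxy.symm⟩) (by simp)).W_term_swap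
      (e := H.p₅) (f := H.p₆) q h.cut (by simp) hS (h.mem_of_mem hb) (fun T φ => by
        simp [h.slot_z, Hex.slots, Hex.C, h.send_m, hs, h.mem.p₅]; grind),
    h.rename_eq _ _ _ hb, h.rename_eq _ _ _ hb, h.swap_xy hS, h.swap_xz hS, sub_eq_add_neg, Hex.vb, Hex.vc, Outside.rel_rot_B, Outside.rel_rot_C]
  rfl

theorem neg_dOn_y (hω : IsTwisting (K := K) α ω) (h : Triangle false D Y H k m n x y z)
    (hS : S ⊆ Y.X) (hb : b ∈ supp K Y.O) :
    dOn K R D [x, y, z].toFinset (W K α D [y] S b) =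
      W K α D [x, y] S (b * H.vb ω q Y S) -
        (W K α D [y, z] S (b * (MvPolynomial.X H.p₅ - MvPolynomial.C q.s) * q.el k (ω : R)) +
          W K α D [y, z] S (b * q.el k ((ω : R) * α))) := by
  have hxy := h.x_ne_y
  have hxz := h.x_ne_z
  have hyz := h.y_ne_z
  have hs := fun a b c e (he : e ∈ Y.O) => h.send_of_mem a b c he
  have hf : [x, y, z].filter (· ∉ [y]) = [x, z] := by simp [hxy, hyz.symm]
  rw [dOn_local_W q hω h.cut.toFrame (by simp) hS (h.mem_of_mem hb), hf]
  simp only [List.map_cons, List.map_nil, List.sum_cons, List.sum_nil, add_zero]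
  rw [(h.neg_xy (l := [x, y]) (by simp) (by simp) (by simpa using ⟨hxz.symm, hyz.symm⟩)).W_term
      (e := H.p₄) (f := H.p₅) q h.cut (by simp) hS (h.mem_of_mem hb) (fun T φ => by
        simp [h.slot_x, Hex.slots, Hex.B, hs, h.mem.p₁, h.mem.p₆]; grind),
    (h.neg_yz (l := [z, y]) (by simpa using ⟨hxz, hxy⟩) (by simp) (by simp)).W_term_swap
      (e := H.p₅) (f := k) q h.cut (by simp) hS (h.mem_of_mem hb) (fun T φ => by
        simp [h.slot_z, Hex.slots, Hex.V, h.send_m, hs, h.mem.p₅]),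
    h.rename_eq _ _ _ hb, h.rename_eq _ _ _ hb, h.swap_yz hS, ← sub_eq_add_neg, ← map_add,
    q.cc_neg (fun hk => fam_isolated h.cut h.mem.V h.k_notMem
      (fun hk => h.k_notMem (hk ▸ h.mem.p₅)) (Setoid.symm' _ hk)), Hex.vb]
  congr 1
  refine (h.neg_yz (l := [y, z]) (by simpa using ⟨hxy, hxz⟩) (by simp) (by simp)).W_congr q h.cut ⟨_, h.k_mem⟩ (by simp) hS ?_
  intro A _ _ x hx
  simp only [QuadData.cop, map_mul, map_add, map_sub, hx.aeval_el_mul, q.el_gen,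
    MvPolynomial.aeval_X, MvPolynomial.algHom_C]
  ring

theorem neg_dOn_z (hω : IsTwisting (K := K) α ω) (h : Triangle false D Y H k m n x y z)
    (hS : S ⊆ Y.X) (hb : b ∈ supp K Y.O) :
    dOn K R D [x, y, z].toFinset (W K α D [z] S b) =
      W K α D [x, z] S (b * H.vc ω q Y S) +
        (W K α D [y, z] S (b * (MvPolynomial.X H.p₂ - MvPolynomial.C q.s) * q.el k (ω : R)) +
          W K α D [y, z] S (b * q.el k ((ω : R) * α))) := by
  have hxy := h.x_ne_y
  have hxz := h.x_ne_z
  have hyz := h.y_ne_z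
  have hs := fun a b c e (he : e ∈ Y.O) => h.send_of_mem a b c he
  have hf : [x, y, z].filter (· ∉ [z]) = [x, y] := by simp [hxz, hyz]
  rw [dOn_local_W q hω h.cut.toFrame (by simp) hS (h.mem_of_mem hb), hf]
  simp only [List.map_cons, List.map_nil, List.sum_cons, List.sum_nil, add_zero]
  rw [(h.neg_xz (l := [x, z]) (by simp) (by simpa using ⟨hxy.symm, hyz⟩) (by simp)).W_term
      (e := H.p₂) (f := H.p₃) q h.cut (by simp) hS (h.mem_of_mem hb) (fun T φ => by
        simp [h.slot_x, Hex.slots, Hex.C, hs, h.mem.p₁, h.mem.p₆]; grind),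
    (h.neg_yz (l := [y, z]) (by simpa using ⟨hxy, hxz⟩) (by simp) (by simp)).W_term
      (e := H.p₂) (f := k) q h.cut (by simp) hS (h.mem_of_mem hb) (fun T φ => by
        simp [h.slot_y, Hex.slots, Hex.V, hs, h.mem.p₂, h.send_k]),
    h.rename_eq _ _ _ hb, h.rename_eq _ _ _ hb, ← map_add,
    q.cc_neg (fun hk => fam_isolated h.cut h.mem.V h.k_notMem
      (fun hk => h.k_notMem (hk ▸ h.mem.p₂)) (Setoid.symm' _ hk)), Hex.vc]
  congr 1
  refine (h.neg_yz (l := [y, z]) (by simpa using ⟨hxy, hxz⟩) (by simp) (by simp)).W_congr q h.cut ⟨_, h.k_mem⟩ (by simp) hS ?_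
  intro A _ _ x hx
  simp only [QuadData.cop, map_mul, map_add, map_sub, hx.aeval_el_mul, q.el_gen,
    MvPolynomial.aeval_X, MvPolynomial.algHom_C]
  ring

theorem neg_dOn_xy (hω : IsTwisting (K := K) α ω) (h : Triangle false D Y H k m n x y z)
    (hS : S ⊆ Y.X) (hb : b ∈ supp K Y.O) :
    dOn K R D [x, y, z].toFinset (W K α D [x, y] S b) =
      W K α D [x, y, z] S (b * H.bv ω q Y S) := by
  have hxy := h.x_ne_y
  have hxz := h.x_ne_z
  have hyz := h.y_ne_z
  have hs := fun a b c e (he : e ∈ Y.O) => h.send_of_mem a b c he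
  have hf : [x, y, z].filter (· ∉ [x, y]) = [z] := by simp [hxz.symm, hyz.symm]
  rw [dOn_local_W q hω h.cut.toFrame (by simp) hS (h.mem_of_mem hb), hf]
  simp only [List.map_cons, List.map_nil, List.sum_cons, List.sum_nil, add_zero]
  rw [(h.neg_xyz (l := [z, x, y]) (by simp) (by simp) (by simp)).W_term_swap
      (e := H.p₅) (f := H.p₆) q h.cut (by simp) hS (h.mem_of_mem hb) (fun T φ => by
        simp [h.slot_z, Hex.slots, Hex.V, h.send_m, hs, h.mem.p₅]; grind),
    h.rename_eq _ _ _ hb, h.rotate_xyz hS]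
  rfl

theorem neg_dOn_xz (hω : IsTwisting (K := K) α ω) (h : Triangle false D Y H k m n x y z)
    (hS : S ⊆ Y.X) (hb : b ∈ supp K Y.O) :
    dOn K R D [x, y, z].toFinset (W K α D [x, z] S b) =
      -W K α D [x, y, z] S (b * H.cv ω q Y S) := by
  have hxy := h.x_ne_y
  have hxz := h.x_ne_z
  have hyz := h.y_ne_z
  have hs := fun a b c e (he : e ∈ Y.O) => h.send_of_mem a b c he
  have hf : [x, y, z].filter (· ∉ [x, z]) = [y] := by simp [hxy.symm, hyz]
  rw [dOn_local_W q hω h.cut.toFrame (by simp) hS (h.mem_of_mem hb), hf]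
  simp only [List.map_cons, List.map_nil, List.sum_cons, List.sum_nil, add_zero]
  rw [(h.neg_xyz (l := [y, x, z]) (by simp) (by simp) (by simp)).W_term_swap
      (e := H.p₁) (f := H.p₂) q h.cut (by simp) hS (h.mem_of_mem hb) (fun T φ => by
        simp [h.slot_y, Hex.slots, Hex.V, hs, h.mem.p₂, h.send_k]),
    h.rename_eq _ _ _ hb, h.swap_xyz hS]
  rfl

theorem neg_dOn_yz (hω : IsTwisting (K := K) α ω) (h : Triangle false D Y H k m n x y z)
    (hS : S ⊆ Y.X) (hb : b ∈ supp K Y.O) (r : R) :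
    dOn K R D [x, y, z].toFinset (W K α D [y, z] S (b * q.el k r)) =
      W K α D [x, y, z] S (b * q.el H.p₁ r) := by
  have hxy := h.x_ne_y
  have hxz := h.x_ne_z
  have hyz := h.y_ne_z
  have hs := fun a b c e (he : e ∈ Y.O) => h.send_of_mem a b c he
  have hb' : b * q.el k r ∈ supp K D.arcs :=
    mul_mem (h.mem_of_mem hb) (q.el_mem h.k_mem r)
  have hf : [x, y, z].filter (· ∉ [y, z]) = [x] := by simp [hxy, hxz]
  rw [dOn_local_W q hω h.cut.toFrame (by simp) hS hb', hf]
  simp only [List.map_cons, List.map_nil, List.sum_cons, List.sum_nil, add_zero]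
  rw [(h.neg_xyz (l := [x, y, z]) (by simp) (by simp) (by simp)).W_term
      (e := H.p₁) (f := H.p₁) q h.cut (by simp) hS hb' (fun T φ => by
        simp [h.slot_x, Hex.slots, Hex.V, hs, h.mem.p₁, h.mem.p₆]; grind),
    q.cc_pos (Setoid.refl' _ _), mul_one, h.rename_mul_el q _ _ _ hb]

theorem dOn_xyz (q : QuadData K α) (hω : IsTwisting (K := K) α ω)
    (h : Triangle positive D Y H k m n x y z) (hS : S ⊆ Y.X)
    (hb : b ∈ supp K Y.O) :
    dOn K R D [x, y, z].toFinset (W K α D [x, y, z] S b) = 0 := by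
  rw [dOn_local_W q hω h.cut.toFrame (List.Sublist.refl _) hS (h.mem_of_mem hb)]
  simp

end Differential

end Triangle

/-! ### Reidemeister moves of type III -/

theorem sublist_three {x y z : ℕ} {l : List ℕ} (h : l.Sublist [x, y, z]) :
    l = [] ∨ l = [x] ∨ l = [y] ∨ l = [z] ∨ l = [x, y] ∨ l = [x, z] ∨ l = [y, z] ∨
      l = [x, y, z] := by
  rcases List.sublist_cons_iff.1 h with h' | ⟨l, rfl, h'⟩
  · rcases sublist_two h' with rfl | rfl | rfl | rfl <;> simp
  · rcases sublist_two h' with rfl | rfl | rfl | rfl <;> simp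

section General

variable {D : LinkDiagram} {L l : List ℕ} {X O : Finset ℕ} {J : Finset (ℕ × ℕ)}
  {slot : ℕ → Fin 4 → ℕ} {Jl μ μ' : List (ℕ × ℕ)} {ρ : ℕ → ℕ} {S : Finset ℕ}

theorem Frame.mem_union (h : Frame D L X O) {w : ℕ} (hw : w ∈ L) (hS : S ⊆ X) :
    w ∈ l.toFinset ∪ S ↔ w ∈ l := by
  simpa using fun hwS => absurd (hS hwS) (h.notMem w hw)

theorem IsState.congr (h : IsState D L O Jl l μ ρ) (hμ : ∀ p ∈ μ', p.1 ∈ O ∧ p.2 ∈ O)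
    (hc : ∀ (T : Type) (f : ℕ → T), Compat f μ ↔ Compat f μ') : IsState D L O Jl l μ' ρ where
  fix := h.fix
  mem := hμ
  forth T f hf := ⟨(hc T f).1 (h.forth T f hf).1, (h.forth T f hf).2⟩
  back T f hf := h.back T f ((hc T f).2 hf)

theorem IsState.unrot_A {H : Hex} (h : IsState D L O Jl l H.rot.A ρ) (hH : H.Mem O) :
    IsState D L O Jl l H.A ρ :=
  h.congr hH.A fun T f => by simp [Hex.A]; grind

theorem IsState.unrot_B {H : Hex} (h : IsState D L O Jl l H.rot.B ρ) (hH : H.Mem O) :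
    IsState D L O Jl l H.B ρ :=
  h.congr hH.B fun T f => by simp [Hex.B]; grind

theorem IsState.unrot_C {H : Hex} (h : IsState D L O Jl l H.rot.C ρ) (hH : H.Mem O) :
    IsState D L O Jl l H.C ρ :=
  h.congr hH.C fun T f => by simp [Hex.C]; grind

variable {K : Type u} {R : Type v} [CommRing K] [CommRing R] [Algebra K R] {α : R} {ω : Rˣ}

theorem IsState.ev_congr (q : QuadData K α) (hst : IsState D L O Jl l μ ρ)
    (h : Cut D L X O J slot Jl) (hne : D.arcs.Nonempty) (hl : ∀ x ∈ l, x ∈ L) (hS : S ⊆ X)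
    {S₁ : Finset ℕ} (e₁ : S₁ = l.toFinset ∪ S) {b b' : MvPolynomial ℕ K}
    (hb : q.Cong (fam J slot X μ S) b b') : ev α D S₁ b = ev α D S₁ b' := by
  subst e₁
  exact Khovanov.ev_congr q hne (hb.mono (hst.fam_le_glue h hl hS))

theorem Natural.neg {q : QuadData K α} {E E' : Finset ℕ → Setoid ℕ}
    {m : Finset ℕ → MvPolynomial ℕ K} (h : Natural ω q slot X E E' m) :
    Natural ω q slot X E E' fun S => -m S := by
  intro S hS w hw hwS
  have := (h S hS w hw hwS).neg
  rwa [← neg_mul, ← mul_neg] at this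

end General

namespace ReidemeisterIII

variable {positive : Bool} {D D' : LinkDiagram}

theorem p_eq (M : ReidemeisterIII positive D D') : M.p 1 = M.hex.p₁ ∧ M.p 2 = M.hex.p₂ ∧
    M.p 3 = M.hex.p₃ ∧ M.p 4 = M.hex.p₄ ∧ M.p 5 = M.hex.p₅ ∧ M.p 6 = M.hex.p₆ :=
  ⟨rfl, rfl, rfl, rfl, rfl, rfl⟩

theorem ne_eq (M : ReidemeisterIII positive D D') : ¬M.x = M.y ∧ ¬M.y = M.x ∧ ¬M.x = M.z ∧
    ¬M.z = M.x ∧ ¬M.y = M.z ∧ ¬M.z = M.y :=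
  ⟨M.x_ne_y, M.x_ne_y.symm, M.x_ne_z, M.x_ne_z.symm, M.y_ne_z, M.y_ne_z.symm⟩

/-- The two diagrams of the move coincide with `Y` outside of the disk. -/
structure Setting (M : ReidemeisterIII positive D D') (Y : Outside) : Prop where
  outer : M.outer = Y.O
  tri : Triangle positive D Y M.hex M.k M.m M.n M.x M.y M.z
  tri' : Triangle positive D' Y M.hex.rot M.k M.m M.n M.x M.y M.z

theorem setting (M : ReidemeisterIII positive D D') : M.Setting M.outside :=
  ⟨rfl, M.triangle, M.triangle'⟩

theorem Setting.symm {M : ReidemeisterIII positive D D'} {Y : Outside} (T : M.Setting Y) :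
    M.symm.Setting Y :=
  ⟨M.symm_outer.trans T.outer, T.tri', T.tri⟩

namespace Setting

variable {Y : Outside} {S : Finset ℕ} {l : List ℕ}

section Both

variable {M : ReidemeisterIII positive D D'} {K : Type u} {R : Type v} [CommRing K] [CommRing R]
  [Algebra K R] {α : R}

theorem mem_union (T : M.Setting Y) (hS : S ⊆ Y.X) :
    (M.x ∈ l.toFinset ∪ S ↔ M.x ∈ l) ∧ (M.y ∈ l.toFinset ∪ S ↔ M.y ∈ l) ∧
      (M.z ∈ l.toFinset ∪ S ↔ M.z ∈ l) :=
  ⟨T.tri.cut.mem_union (by simp) hS, T.tri.cut.mem_union (by simp) hS,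
    T.tri.cut.mem_union (by simp) hS⟩

theorem onStates_W (T : M.Setting Y) {E : LinkDiagram} (hl : l.Sublist [M.x, M.y, M.z]) (hS : S ⊆ Y.X)
    (φ : (S₁ S : Finset ℕ) → Phi K R D S₁ →ₗ[K] Kh K R E) (b : MvPolynomial ℕ K) :
    onStates [M.x, M.y, M.z] φ (W K α D l S b) =
      φ (l.toFinset ∪ S) S (ev α D (l.toFinset ∪ S) b) :=
  Khovanov.onStates_W T.tri.cut.nodup hl
    (T.tri.cut.notMem_of_sublist (List.Sublist.refl _) hS)
    (T.tri.cut.union_subset hl hS) φ b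

end Both

section Positive

variable {M : ReidemeisterIII true D D'}

theorem pos_y' (T : M.Setting Y) : IsState D' [M.x, M.y, M.z] Y.O [] [M.y] M.hex.C
    (Triangle.send M.k M.m M.n M.hex.p₄ M.hex.p₆ M.hex.p₆) :=
  (T.tri'.pos_y (by simpa using M.x_ne_y) (by simp) (by simpa using M.y_ne_z.symm)).unrot_C
    T.tri.mem

theorem pos_z' (T : M.Setting Y) : IsState D' [M.x, M.y, M.z] Y.O [] [M.z] M.hex.B
    (Triangle.send M.k M.m M.n M.hex.p₁ M.hex.p₂ M.hex.p₁) :=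
  (T.tri'.pos_z (by simpa using M.x_ne_z) (by simpa using M.y_ne_z) (by simp)).unrot_B
    T.tri.mem

theorem pos_x' (T : M.Setting Y) : IsState D' [M.x, M.y, M.z] Y.O [] [M.x] M.hex.rot.V
    (Triangle.send M.k M.m M.n M.k M.k M.k) :=
  T.tri'.pos_x (by simp) (by simpa using M.x_ne_y.symm) (by simpa using M.x_ne_z.symm)

theorem pos_xyz' (T : M.Setting Y) : IsState D' [M.x, M.y, M.z] Y.O [] [M.x, M.y, M.z] M.hex.A
    (Triangle.send M.k M.m M.n M.hex.p₅ M.hex.p₅ M.hex.p₆) :=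
  (T.tri'.pos_xyz (by simp) (by simp) (by simp)).unrot_A T.tri.mem

variable {K : Type u} {R : Type v} [CommRing K] [CommRing R] [Algebra K R] {α : R} {ω : Rˣ}
  {b : MvPolynomial ℕ K} [Coalgebra K R]

theorem mapPos_W_nil (T : M.Setting Y) (hS : S ⊆ Y.X) (b : MvPolynomial ℕ K) :
    M.mapPos (K := K) (R := R) ω (W K α D [] S b) = 0 := by
  rw [ReidemeisterIII.mapPos, T.onStates_W (by simp) hS]
  simp only [T.mem_union hS, List.mem_cons, List.not_mem_nil, or_false, M.ne_eq,
    decide_true, decide_false, LinearMap.zero_apply]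

theorem mapPos_W_x (T : M.Setting Y) (q : QuadData K α) (hω : IsTwisting (K := K) α ω)
    (hS : S ⊆ Y.X) (hb : b ∈ supp K Y.O) (r : R) :
    M.mapPos (K := K) (R := R) ω (W K α D [M.x] S (b * q.el M.k r)) =
      W K α D' [M.x] S (b * (MvPolynomial.C (q.φ₁ r) * M.hex.vb ω q Y S *
        M.hex.rot.bv ω q Y S * q.el M.hex.p₁ (↑ω⁻¹ : R))) +
      W K α D' [M.y] S (b * (MvPolynomial.C (q.φ₁ r) * M.hex.vc ω q Y S *
        q.el M.hex.p₁ (↑ω⁻¹ : R))) +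
      W K α D' [M.z] S (b * (MvPolynomial.C (q.φ₁ r) * M.hex.vb ω q Y S *
        q.el M.hex.p₁ (↑ω⁻¹ : R))) := by
  have hst := T.tri.pos_x (l := [M.x]) (by simp) (by simpa using M.x_ne_y.symm)
    (by simpa using M.x_ne_z.symm)
  have hs := T.tri.pos_surgeries
  have hs' := T.tri'.pos_surgeries
  have hC : MvPolynomial.C (q.φ₁ r) ∈ supp K Y.O :=
    Subalgebra.algebraMap_mem _ _
  have h₁ : M.hex.p₁ ∈ D'.arcs := T.tri'.cut.sub T.tri.mem.p₁
  have e₆₁ : surgery D ([M.x].toFinset ∪ S) D' ([M.z].toFinset ∪ S) Y.O (cap D' _ (ω : R)) M.hex.p₆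
      M.hex.p₁ (ev α D _ (b * q.el M.k r)) =
        ev α D' _ (b * (MvPolynomial.C (q.φ₁ r) * M.hex.vb ω q Y S)) := by
    rw [hst.surgery_ev_circle q hω T.tri.cut T.pos_z' T.tri'.cut (by simp) (by simp) T.tri.k_mem
      T.tri.k_notMem (T.tri.send_k _ _ _) T.tri.covered_circle T.tri.mem.p₆ T.tri.mem.p₁ hS
      (hs.vb' hS) rfl rfl hb, cap_eq, q.counit_mul_omega hω, ← (ev α D' _).commutes, ← map_mul,
      MvPolynomial.algebraMap_eq]
    refine T.pos_z'.ev_congr q T.tri'.cut ⟨_, h₁⟩ (by simp) hS rfl ?_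
    intro A _ _ x hx
    have := M.hex.cc_B (ω := ω) (q := q) (Y := Y) S A x hx
    simp only [map_mul] at this ⊢
    rw [← this]
    simp only [hex]
    ring
  have e₂₃ : surgery D ([M.x].toFinset ∪ S) D' ([M.y].toFinset ∪ S) Y.O (cap D' _ (ω : R)) M.hex.p₂
      M.hex.p₃ (ev α D _ (b * q.el M.k r)) =
        ev α D' _ (b * (MvPolynomial.C (q.φ₁ r) * M.hex.vc ω q Y S)) := by
    rw [hst.surgery_ev_circle q hω T.tri.cut T.pos_y' T.tri'.cut (by simp) (by simp) T.tri.k_mem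
      T.tri.k_notMem (T.tri.send_k _ _ _) T.tri.covered_circle T.tri.mem.p₂ T.tri.mem.p₃ hS
      (hs.vc S hS) rfl rfl hb, cap_eq, q.counit_mul_omega hω, ← (ev α D' _).commutes, ← map_mul,
      MvPolynomial.algebraMap_eq, mul_assoc, mul_comm (q.cc ω _ _ _)]
    rfl
  have hbU := hs'.bv hS
  rw [Outside.rel_rot_B, Hex.rot_p₅, Hex.rot_p₆, Hex.rot_p₄] at hbU
  rw [ReidemeisterIII.mapPos, T.onStates_W (by simp) hS]
  simp only [T.mem_union hS, List.mem_cons, List.not_mem_nil, or_false, M.ne_eq,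
    decide_true, decide_false, LinearMap.add_apply, LinearMap.comp_apply, M.p_eq]
  rw [T.outer, e₆₁, e₂₃, T.pos_z'.surgery_ev q hω T.tri'.cut T.pos_x' T.tri'.cut (by simp) (by simp)
    (T.tri'.covered T.tri.mem.p₁ T.tri.mem.p₂ T.tri.mem.p₁) T.tri.mem.p₂ T.tri.mem.p₃ hS hbU rfl rfl
    (mul_mem hb (mul_mem hC T.tri.mem.vb)), T_ev q h₁, T_ev q h₁,
    T_ev q h₁, wedge_ev, wedge_ev, wedge_ev]
  simp only [mul_assoc]
  rfl

theorem mapPos_W_y (T : M.Setting Y) (q : QuadData K α) (hω : IsTwisting (K := K) α ω)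
    (hS : S ⊆ Y.X) (hb : b ∈ supp K Y.O) :
    M.mapPos (K := K) (R := R) ω (W K α D [M.y] S b) =
      -W K α D' [M.x] S (b * M.hex.rot.cv ω q Y S) - W K α D' [M.y] S b := by
  have hst := T.tri.pos_y (l := [M.y]) (by simpa using M.x_ne_y) (by simp)
    (by simpa using M.y_ne_z.symm)
  have hs' := T.tri'.pos_surgeries.cv hS
  rw [Outside.rel_rot_C, Hex.rot_p₁, Hex.rot_p₂, Hex.rot_p₆] at hs'
  rw [ReidemeisterIII.mapPos, T.onStates_W (by simp) hS]
  simp only [T.mem_union hS, List.mem_cons, List.not_mem_nil, or_false, M.ne_eq,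
    decide_true, decide_false, LinearMap.sub_apply, LinearMap.neg_apply,
    LinearMap.comp_apply, M.p_eq]
  rw [T.outer, hst.surgery_ev q hω T.tri.cut T.pos_x' T.tri'.cut (by simp) (by simp)
    (T.tri.covered T.tri.mem.p₁ T.tri.mem.p₃ T.tri.mem.p₃) T.tri.mem.p₄ T.tri.mem.p₅ hS hs' rfl rfl
    hb, hst.slide_ev q T.tri.cut T.pos_y' T.tri'.cut (by simp) (by simp)
    (T.tri.covered T.tri.mem.p₁ T.tri.mem.p₃ T.tri.mem.p₃) le_rfl hS rfl rfl hb, wedge_ev, wedge_ev]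
  rfl

theorem mapPos_W_z (T : M.Setting Y) (q : QuadData K α) (hS : S ⊆ Y.X)
    (hb : b ∈ supp K Y.O) :
    M.mapPos (K := K) (R := R) ω (W K α D [M.z] S b) = -W K α D' [M.z] S b := by
  have hst := T.tri.pos_z (l := [M.z]) (by simp [M.ne_eq]) (by simp [M.ne_eq]) (by simp)
  have hst' := T.pos_z'
  rw [ReidemeisterIII.mapPos, T.onStates_W (by simp) hS]
  simp only [T.mem_union hS, List.mem_cons, List.not_mem_nil, or_false, or_true, M.ne_eq,
    decide_true, decide_false, LinearMap.neg_apply, LinearMap.comp_apply]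
  rw [T.outer, hst.slide_ev q T.tri.cut hst' T.tri'.cut (by simp) (by simp)
    (T.tri.covered T.tri.mem.p₄ T.tri.mem.p₅ T.tri.mem.p₄) le_rfl hS rfl rfl hb, wedge_ev]

theorem mapPos_W_xy (T : M.Setting Y) (q : QuadData K α) (hS : S ⊆ Y.X)
    (hb : b ∈ supp K Y.O) :
    M.mapPos (K := K) (R := R) ω (W K α D [M.x, M.y] S b) = W K α D' [M.y, M.z] S b := by
  have hst := T.tri.pos_xy (l := [M.x, M.y]) (by simp) (by simp) (by simp [M.ne_eq])
  have hst' := T.tri'.pos_yz (l := [M.y, M.z]) (by simp [M.ne_eq]) (by simp) (by simp)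
  rw [ReidemeisterIII.mapPos, T.onStates_W (by simp) hS]
  simp only [T.mem_union hS, List.mem_cons, List.not_mem_nil, or_false, or_true, M.ne_eq,
    decide_true, decide_false, LinearMap.neg_apply, LinearMap.comp_apply]
  rw [T.outer, hst.slide_ev q T.tri.cut hst' T.tri'.cut (by simp) (by simp)
    (T.tri.covered T.tri.mem.p₂ T.tri.mem.p₂ T.tri.mem.p₂) le_rfl hS rfl rfl hb, wedge_ev]

theorem mapPos_W_xz (T : M.Setting Y) (q : QuadData K α) (hS : S ⊆ Y.X)
    (hb : b ∈ supp K Y.O) :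
    M.mapPos (K := K) (R := R) ω (W K α D [M.x, M.z] S b) = -W K α D' [M.y, M.z] S b := by
  have hst := T.tri.pos_xz (l := [M.x, M.z]) (by simp) (by simp [M.ne_eq]) (by simp)
  have hst' := T.tri'.pos_yz (l := [M.y, M.z]) (by simp [M.ne_eq]) (by simp) (by simp)
  rw [ReidemeisterIII.mapPos, T.onStates_W (by simp) hS]
  simp only [T.mem_union hS, List.mem_cons, List.not_mem_nil, or_false, or_true, M.ne_eq,
    decide_true, decide_false, LinearMap.neg_apply, LinearMap.comp_apply]
  rw [T.outer, hst.slide_ev q T.tri.cut hst' T.tri'.cut (by simp) (by simp)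
    (T.tri.covered T.tri.mem.p₅ T.tri.mem.p₅ T.tri.mem.p₅) le_rfl hS rfl rfl hb, wedge_ev]

theorem mapPos_W_yz (T : M.Setting Y) (q : QuadData K α) (hS : S ⊆ Y.X)
    (hb : b ∈ supp K Y.O) :
    M.mapPos (K := K) (R := R) ω (W K α D [M.y, M.z] S b) = -W K α D' [M.x, M.z] S b := by
  have hst := T.tri.pos_yz (l := [M.y, M.z]) (by simp [M.ne_eq]) (by simp) (by simp)
  have hst' := T.tri'.pos_xz (l := [M.x, M.z]) (by simp) (by simp [M.ne_eq]) (by simp)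
  rw [ReidemeisterIII.mapPos, T.onStates_W (by simp) hS]
  simp only [T.mem_union hS, List.mem_cons, List.not_mem_nil, or_false, or_true, M.ne_eq,
    decide_true, decide_false, LinearMap.neg_apply, LinearMap.comp_apply]
  rw [T.outer, hst.slide_ev q T.tri.cut hst' T.tri'.cut (by simp) (by simp)
    (T.tri.covered T.tri.mem.p₁ T.tri.mem.p₅ T.tri.mem.p₃) le_rfl hS rfl rfl hb, wedge_ev]

theorem mapPos_W_xyz (T : M.Setting Y) (q : QuadData K α) (hS : S ⊆ Y.X)
    (hb : b ∈ supp K Y.O) :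
    M.mapPos (K := K) (R := R) ω (W K α D [M.x, M.y, M.z] S b) = W K α D' [M.x, M.y, M.z] S b := by
  have hst := T.tri.pos_xyz (l := [M.x, M.y, M.z]) (by simp) (by simp) (by simp)
  have hst' := T.pos_xyz'
  rw [ReidemeisterIII.mapPos, T.onStates_W (by simp) hS]
  simp only [T.mem_union hS, List.mem_cons, List.not_mem_nil, or_false, or_true, M.ne_eq,
    decide_true, decide_false, LinearMap.neg_apply, LinearMap.comp_apply]
  rw [T.outer, hst.slide_ev q T.tri.cut hst' T.tri'.cut (by simp) (by simp)
    (T.tri.covered T.tri.mem.p₂ T.tri.mem.p₂ T.tri.mem.p₃) le_rfl hS rfl rfl hb, wedge_ev]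

end Positive

end Setting

end ReidemeisterIII

theorem isMorphism_zero_of_tables {K : Type u} {R : Type v} [CommRing K] [CommRing R] [Algebra K R]
    [Coalgebra K R] {α : R} {ω : Rˣ} {q : QuadData K α} {D D' : LinkDiagram} {L L' : List ℕ}
    {X O : Finset ℕ} (hω : IsTwisting (K := K) α ω) (h : Frame D L X O)
    (h' : Frame D' L' X O) (hslot : ∀ w ∈ X, D'.slot w = D.slot w)
    {F : Kh K R D →ₗ[K] Kh K R D'}
    (hF : ∀ l : List ℕ, l.Sublist L → ∃ β t, HasTables ω q D D' L' X O F 0 l β t ∧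
      ∀ S ⊆ X, ∀ b ∈ supp K O, ∀ r,
        dOn K R D' L'.toFinset (tab α D' (t r) S b) =
          F (dOn K R D L.toFinset (W K α D l S (b * β r)))) :
    IsMorphism F 0 := by
  refine isMorphism_of_tables (q := q) hω h h' hslot fun l hl => ?_
  obtain ⟨β, t, ht, hd⟩ := hF l hl
  refine ⟨β, t, ht, fun S hS b hb r => ?_⟩
  rw [hd S hS b hb r]
  simp

namespace ReidemeisterIII

variable {D D' : LinkDiagram} {Y : Outside} {S : Finset ℕ}

namespace Setting

variable {M : ReidemeisterIII true D D'} {K : Type u} {R : Type v} [CommRing K] [CommRing R]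
  [Algebra K R] {α : R} {ω : Rˣ} {b : MvPolynomial ℕ K} [Coalgebra K R]

theorem mapPos_W_x_one (T : M.Setting Y) (q : QuadData K α) (hω : IsTwisting (K := K) α ω)
    (hS : S ⊆ Y.X) (hb : b ∈ supp K Y.O) :
    M.mapPos (K := K) (R := R) ω (W K α D [M.x] S b) = 0 := by
  have := T.mapPos_W_x q hω hS hb 1
  simpa [q.φ₁_one] using this

theorem pos_chain_nil (T : M.Setting Y) (q : QuadData K α) (hω : IsTwisting (K := K) α ω)
    (hS : S ⊆ Y.X) (hb : b ∈ supp K Y.O) :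
    M.mapPos (K := K) (R := R) ω (dOn K R D [M.x, M.y, M.z].toFinset (W K α D [] S b)) = 0 := by
  have hm := T.tri.mem
  have h₁ : b * q.el M.hex.p₁ (ω : R) ∈ supp K Y.O :=
    mul_mem hb (q.el_mem hm.p₁ _)
  have h₂ : b * q.el M.hex.p₁ (ω : R) * (MvPolynomial.X M.hex.p₁ - MvPolynomial.C q.s) ∈
      supp K Y.O :=
    mul_mem h₁ (sub_mem (QuadData.X_mem hm.p₁)
      (Subalgebra.algebraMap_mem _ _))
  have h₃ : b * M.hex.vc ω q Y S ∈ supp K Y.O :=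
    mul_mem hb hm.vc
  have h₄ : b * M.hex.vb ω q Y S ∈ supp K Y.O :=
    mul_mem hb hm.vb
  rw [T.tri.pos_dOn_nil q hω hS hb, q.el_one, mul_one, map_add, map_add, map_add,
    T.mapPos_W_x_one q hω hS h₂, T.mapPos_W_x q hω hS h₁, T.mapPos_W_y q hω hS h₃,
    T.mapPos_W_z q hS h₄, q.φ₁_gen, map_one, one_mul, one_mul]
  have e₁ : W K α D' [M.x] S (b * q.el M.hex.p₁ (ω : R) * (M.hex.vb ω q Y S *
      M.hex.rot.bv ω q Y S * q.el M.hex.p₁ (↑ω⁻¹ : R))) =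
      W K α D' [M.x] S (b * M.hex.vc ω q Y S * M.hex.rot.cv ω q Y S) := by
    refine T.pos_x'.W_congr q T.tri'.cut ⟨_, T.tri'.k_mem⟩ (by simp) hS ?_
    intro A _ _ x hx
    have h1 := T.tri.pos_surgeries.square (ω := ω) T.tri'.pos_surgeries hS hx
    have h2 := hx.el_mul_inv M.hex.p₁ ω
    simp only [map_mul]
    linear_combination (aeval x b * aeval x (M.hex.vb ω q Y S) *
      aeval x (M.hex.rot.bv ω q Y S)) * h2 + aeval x b * h1
  have e₂ : W K α D' [M.y] S (b * q.el M.hex.p₁ (ω : R) * (M.hex.vc ω q Y S *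
      q.el M.hex.p₁ (↑ω⁻¹ : R))) = W K α D' [M.y] S (b * M.hex.vc ω q Y S) := by
    refine T.pos_y'.W_congr q T.tri'.cut ⟨_, T.tri'.k_mem⟩ (by simp) hS ?_
    intro A _ _ x hx
    have h2 := hx.el_mul_inv M.hex.p₁ ω
    simp only [map_mul]
    linear_combination (aeval x b * aeval x (M.hex.vc ω q Y S)) * h2
  have e₃ : W K α D' [M.z] S (b * q.el M.hex.p₁ (ω : R) * (M.hex.vb ω q Y S *
      q.el M.hex.p₁ (↑ω⁻¹ : R))) = W K α D' [M.z] S (b * M.hex.vb ω q Y S) := by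
    refine T.pos_z'.W_congr q T.tri'.cut ⟨_, T.tri'.k_mem⟩ (by simp) hS ?_
    intro A _ _ x hx
    have h2 := hx.el_mul_inv M.hex.p₁ ω
    simp only [map_mul]
    linear_combination (aeval x b * aeval x (M.hex.vb ω q Y S)) * h2
  rw [e₁, e₂, e₃]
  abel

theorem pos_chain_x (T : M.Setting Y) (q : QuadData K α) (hω : IsTwisting (K := K) α ω)
    (hS : S ⊆ Y.X) (hb : b ∈ supp K Y.O) (r : R) :
    dOn K R D' [M.x, M.y, M.z].toFinset (M.mapPos (K := K) (R := R) ω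
        (W K α D [M.x] S (b * q.el M.k r))) =
      M.mapPos (K := K) (R := R) ω (dOn K R D [M.x, M.y, M.z].toFinset
        (W K α D [M.x] S (b * q.el M.k r))) := by
  have hm := T.tri.mem
  have hC : MvPolynomial.C (q.φ₁ r) ∈ supp K Y.O :=
    Subalgebra.algebraMap_mem _ _
  have hp := q.el_mem (r := (↑ω⁻¹ : R)) hm.p₁
  have h₁ : b * (MvPolynomial.C (q.φ₁ r) * M.hex.vb ω q Y S *
      M.hex.rot.bv ω q Y S * q.el M.hex.p₁ (↑ω⁻¹ : R)) ∈ supp K Y.O :=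
    mul_mem hb (mul_mem (Subalgebra.mul_mem _
      (mul_mem hC hm.vb) hm.rot.bv) hp)
  have h₂ : b * (MvPolynomial.C (q.φ₁ r) * M.hex.vc ω q Y S * q.el M.hex.p₁ (↑ω⁻¹ : R)) ∈
      supp K Y.O :=
    mul_mem hb (mul_mem (mul_mem hC hm.vc) hp)
  have h₃ : b * (MvPolynomial.C (q.φ₁ r) * M.hex.vb ω q Y S * q.el M.hex.p₁ (↑ω⁻¹ : R)) ∈
      supp K Y.O :=
    mul_mem hb (mul_mem (mul_mem hC hm.vb) hp)
  have hx := T.tri'.pos_dOn_x q hω hS h₁ 1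
  rw [q.el_one, q.el_one, q.el_one, mul_one] at hx
  rw [T.mapPos_W_x q hω hS hb, map_add, map_add, hx, T.tri'.pos_dOn_y q hω hS h₂,
    T.tri'.pos_dOn_z q hω hS h₃, T.tri.pos_dOn_x q hω hS hb, map_sub, map_neg,
    T.mapPos_W_xy q hS (mul_mem hb (q.el_mem hm.p₂ _)),
    T.mapPos_W_xz q hS (mul_mem hb (q.el_mem hm.p₅ _))]
  have e₁ : W K α D' [M.x, M.y] S (b * (MvPolynomial.C (q.φ₁ r) * M.hex.vb ω q Y S *
      M.hex.rot.bv ω q Y S * q.el M.hex.p₁ (↑ω⁻¹ : R))) =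
      W K α D' [M.x, M.y] S (b * (MvPolynomial.C (q.φ₁ r) * M.hex.vc ω q Y S *
        q.el M.hex.p₁ (↑ω⁻¹ : R)) * M.hex.rot.cv ω q Y S) := by
    refine (T.tri'.pos_xy (l := [M.x, M.y]) (by simp) (by simp) (by simp [M.ne_eq])).W_congr q
      T.tri'.cut ⟨_, T.tri'.k_mem⟩ (by simp) hS ?_
    intro A _ _ x hx
    have h1 := T.tri.pos_surgeries.square (ω := ω) T.tri'.pos_surgeries hS hx
    simp only [map_mul]
    linear_combination (aeval x b * aeval x (MvPolynomial.C (q.φ₁ r)) *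
      aeval x (q.el M.hex.p₁ (↑ω⁻¹ : R))) * h1
  have e₂ : W K α D' [M.y, M.z] S (b * (MvPolynomial.C (q.φ₁ r) * M.hex.vb ω q Y S *
      q.el M.hex.p₁ (↑ω⁻¹ : R)) * M.hex.bv ω q Y S) =
      W K α D' [M.y, M.z] S (b * (MvPolynomial.C (q.φ₁ r) * M.hex.vc ω q Y S *
        q.el M.hex.p₁ (↑ω⁻¹ : R)) * M.hex.cv ω q Y S) +
      (W K α D' [M.y, M.z] S (b * q.el M.hex.p₅ r) -
        W K α D' [M.y, M.z] S (b * q.el M.hex.p₂ r)) := by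
    rw [← map_sub (W K α D' [M.y, M.z] S), ← map_add (W K α D' [M.y, M.z] S)]
    refine (T.tri'.pos_yz (l := [M.y, M.z]) (by simp [M.ne_eq]) (by simp) (by simp)).W_congr q
      T.tri'.cut ⟨_, T.tri'.k_mem⟩ (by simp) hS ?_
    intro A _ _ x hx
    have h1 := T.tri.pos_surgeries.vb_mul_bv (ω := ω) hS hx
    have h2 := T.tri.pos_surgeries.vc_mul_cv (ω := ω) hS hx
    have h3 := hx.el_mul_inv M.hex.p₁ ω
    simp only [map_mul, map_add, map_sub, MvPolynomial.algHom_C]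
    rw [QuadData.aeval_el x M.hex.p₂ r, QuadData.aeval_el x M.hex.p₅ r]
    set B := aeval x b
    set c := algebraMap K A (q.φ₁ r)
    set e := aeval x (q.el M.hex.p₁ (↑ω⁻¹ : R))
    linear_combination (B * c * e) * (h1 - h2) + (B * c * (x M.hex.p₅ - x M.hex.p₂)) * h3
  have e₃ : b * (MvPolynomial.C (q.φ₁ r) * M.hex.vb ω q Y S * M.hex.rot.bv ω q Y S *
      q.el M.hex.p₁ (↑ω⁻¹ : R)) = b * (MvPolynomial.C (q.φ₁ r) * M.hex.vb ω q Y S *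
        q.el M.hex.p₁ (↑ω⁻¹ : R)) * M.hex.rot.bv ω q Y S := by ring
  rw [e₁, e₃, Hex.rot_rot, e₂]
  abel

theorem pos_chain_y (T : M.Setting Y) (q : QuadData K α) (hω : IsTwisting (K := K) α ω)
    (hS : S ⊆ Y.X) (hb : b ∈ supp K Y.O) :
    dOn K R D' [M.x, M.y, M.z].toFinset (M.mapPos (K := K) (R := R) ω (W K α D [M.y] S b)) =
      M.mapPos (K := K) (R := R) ω (dOn K R D [M.x, M.y, M.z].toFinset (W K α D [M.y] S b)) := by
  have hm := T.tri.mem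
  have h₁ : b * M.hex.rot.cv ω q Y S ∈ supp K Y.O :=
    mul_mem hb hm.rot.cv
  have hx := T.tri'.pos_dOn_x q hω hS h₁ 1
  rw [q.el_one, q.el_one, q.el_one, mul_one] at hx
  rw [T.mapPos_W_y q hω hS hb, map_sub, map_neg, hx, T.tri'.pos_dOn_y q hω hS hb,
    T.tri.pos_dOn_y q hω hS hb, map_sub, T.mapPos_W_xy q hS (mul_mem hb hm.cv),
    T.mapPos_W_yz q hS h₁, Hex.rot_rot]
  abel

theorem pos_chain_z (T : M.Setting Y) (q : QuadData K α) (hω : IsTwisting (K := K) α ω)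
    (hS : S ⊆ Y.X) (hb : b ∈ supp K Y.O) :
    dOn K R D' [M.x, M.y, M.z].toFinset (M.mapPos (K := K) (R := R) ω (W K α D [M.z] S b)) =
      M.mapPos (K := K) (R := R) ω (dOn K R D [M.x, M.y, M.z].toFinset (W K α D [M.z] S b)) := by
  have hm := T.tri.mem
  rw [T.mapPos_W_z q hS hb, map_neg, T.tri'.pos_dOn_z q hω hS hb, T.tri.pos_dOn_z q hω hS hb,
    map_add, T.mapPos_W_xz q hS (mul_mem hb hm.bv),
    T.mapPos_W_yz q hS (mul_mem hb hm.rot.bv), Hex.rot_rot]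
  abel

theorem pos_chain_xy (T : M.Setting Y) (q : QuadData K α) (hω : IsTwisting (K := K) α ω)
    (hS : S ⊆ Y.X) (hb : b ∈ supp K Y.O) :
    dOn K R D' [M.x, M.y, M.z].toFinset (M.mapPos (K := K) (R := R) ω (W K α D [M.x, M.y] S b)) =
      M.mapPos (K := K) (R := R) ω
        (dOn K R D [M.x, M.y, M.z].toFinset (W K α D [M.x, M.y] S b)) := by
  rw [T.mapPos_W_xy q hS hb, T.tri'.pos_dOn_yz q hω hS hb, T.tri.pos_dOn_xy q hω hS hb,
    T.mapPos_W_xyz q hS (mul_mem hb T.tri.mem.va), Hex.rot_rot]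

theorem pos_chain_xz (T : M.Setting Y) (q : QuadData K α) (hω : IsTwisting (K := K) α ω)
    (hS : S ⊆ Y.X) (hb : b ∈ supp K Y.O) :
    dOn K R D' [M.x, M.y, M.z].toFinset (M.mapPos (K := K) (R := R) ω (W K α D [M.x, M.z] S b)) =
      M.mapPos (K := K) (R := R) ω
        (dOn K R D [M.x, M.y, M.z].toFinset (W K α D [M.x, M.z] S b)) := by
  rw [T.mapPos_W_xz q hS hb, map_neg, T.tri'.pos_dOn_yz q hω hS hb, T.tri.pos_dOn_xz q hω hS hb,
    map_neg, T.mapPos_W_xyz q hS (mul_mem hb T.tri.mem.va), Hex.rot_rot]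

theorem pos_chain_yz (T : M.Setting Y) (q : QuadData K α) (hω : IsTwisting (K := K) α ω)
    (hS : S ⊆ Y.X) (hb : b ∈ supp K Y.O) :
    dOn K R D' [M.x, M.y, M.z].toFinset (M.mapPos (K := K) (R := R) ω (W K α D [M.y, M.z] S b)) =
      M.mapPos (K := K) (R := R) ω
        (dOn K R D [M.x, M.y, M.z].toFinset (W K α D [M.y, M.z] S b)) := by
  rw [T.mapPos_W_yz q hS hb, map_neg, T.tri'.pos_dOn_xz q hω hS hb, T.tri.pos_dOn_yz q hω hS hb,
    T.mapPos_W_xyz q hS (mul_mem hb T.tri.mem.rot.va), neg_neg]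

theorem pos_chain_xyz (T : M.Setting Y) (q : QuadData K α) (hω : IsTwisting (K := K) α ω)
    (hS : S ⊆ Y.X) (hb : b ∈ supp K Y.O) :
    dOn K R D' [M.x, M.y, M.z].toFinset
        (M.mapPos (K := K) (R := R) ω (W K α D [M.x, M.y, M.z] S b)) =
      M.mapPos (K := K) (R := R) ω
        (dOn K R D [M.x, M.y, M.z].toFinset (W K α D [M.x, M.y, M.z] S b)) := by
  rw [T.mapPos_W_xyz q hS hb, T.tri'.dOn_xyz q hω hS hb, T.tri.dOn_xyz q hω hS hb, map_zero]


theorem rot_cv (T : M.Setting Y) (hS : S ⊆ Y.X) :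
    Surg (Y.rel M.hex.C S) (Y.rel M.hex.rot.V S) M.hex.p₄ M.hex.p₅ M.hex.p₃ := by
  have := T.tri'.pos_surgeries.cv hS
  rwa [Outside.rel_rot_C] at this

theorem rot_bv (T : M.Setting Y) (hS : S ⊆ Y.X) :
    Surg (Y.rel M.hex.B S) (Y.rel M.hex.rot.V S) M.hex.p₂ M.hex.p₃ M.hex.p₁ := by
  have := T.tri'.pos_surgeries.bv hS
  rwa [Outside.rel_rot_B] at this

theorem pos_entries_x (T : M.Setting Y) (q : QuadData K α) (r : R) :
    ∀ c ∈ [([M.x], fun S => MvPolynomial.C (q.φ₁ r) * M.hex.vb ω q Y S * M.hex.rot.bv ω q Y S *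
        q.el M.hex.p₁ (↑ω⁻¹ : R)),
      ([M.y], fun S => MvPolynomial.C (q.φ₁ r) * M.hex.vc ω q Y S * q.el M.hex.p₁ (↑ω⁻¹ : R)),
      ([M.z], fun S => MvPolynomial.C (q.φ₁ r) * M.hex.vb ω q Y S * q.el M.hex.p₁ (↑ω⁻¹ : R))],
      IsEntry ω q D' [M.x, M.y, M.z] Y.X Y.O (Y.rel M.hex.V) 0 (([M.x].length : ℕ) : ℤ) c := by
  have hm := T.tri.mem
  have hs := T.tri.pos_surgeries
  have hC : MvPolynomial.C (q.φ₁ r) ∈ supp K Y.O :=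
    Subalgebra.algebraMap_mem _ _
  have hp := q.el_mem (r := (↑ω⁻¹ : R)) hm.p₁
  have hB : Natural ω q Y.slot Y.X (Y.rel M.hex.V) (Y.rel M.hex.B) fun S =>
      MvPolynomial.C (q.φ₁ r) * M.hex.vb ω q Y S :=
    (natural_const _).mul_surg (fun S hS => hs.vb S hS) hs.outV hs.outB
  simp only [List.forall_mem_cons, List.not_mem_nil, false_imp_iff, implies_true, and_true]
  refine ⟨T.pos_x'.isEntry T.tri'.cut (by simp) (by simp) (fun S _ => T.tri'.mem_of_mem ?_) ?_,
    T.pos_y'.isEntry T.tri'.cut (by simp) (by simp) (fun S _ => T.tri'.mem_of_mem ?_) ?_,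
    T.pos_z'.isEntry T.tri'.cut (by simp) (by simp) (fun S _ => T.tri'.mem_of_mem ?_) ?_⟩
  · exact mul_mem (mul_mem (mul_mem hC hm.vb) hm.rot.bv) hp
  · exact (hB.mul_surg (fun S hS => T.rot_bv hS) hs.outB T.tri'.pos_surgeries.outV).mul_const _
  · exact mul_mem (mul_mem hC hm.vc) hp
  · exact ((natural_const _).mul_surg (fun S hS => hs.vc S hS) hs.outV hs.outC).mul_const _
  · exact mul_mem (mul_mem hC hm.vb) hp
  · exact hB.mul_const _

theorem pos_isMorphism_map (T : M.Setting Y) (q : QuadData K α) (hω : IsTwisting (K := K) α ω) :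
    IsMorphism (M.mapPos (K := K) (R := R) ω) 0 := by
  refine isMorphism_zero_of_tables (q := q) hω T.tri.cut.toFrame T.tri'.cut.toFrame
    (fun w hw => (T.tri'.cut.slot_eq w hw).trans (T.tri.cut.slot_eq w hw).symm) fun l hl => ?_
  rcases sublist_three hl with rfl | rfl | rfl | rfl | rfl | rfl | rfl | rfl
  · refine ⟨_, _, (T.tri.pos_nil (l := []) (by simp) (by simp) (by simp)).hasTables
      T.tri.cut hl (T.tri.covered T.tri.mem.p₁ T.tri.mem.p₁ T.tri.mem.p₁)
      (t := []) (fun S hS b hb => ?_) ?_, fun S hS b hb r => ?_⟩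
    · rw [T.mapPos_W_nil hS b]; simp [tab]
    · simp
    · rw [mul_one, T.pos_chain_nil q hω hS hb]; simp [tab]
  · refine ⟨_, _, (T.tri.pos_x (l := [M.x]) (by simp) (by simp [M.ne_eq]) (by simp [M.ne_eq])).hasTables_circle
      T.tri.cut hl T.tri.k_mem T.tri.k_notMem (T.tri.send_k _ _ _) T.tri.covered_circle
      (fun S hS b hb r => ?_) (T.pos_entries_x q), fun S hS b hb r => ?_⟩
    · rw [T.mapPos_W_x q hω hS hb]; simp [tab, add_assoc]
    · rw [← T.pos_chain_x q hω hS hb, T.mapPos_W_x q hω hS hb]; simp [tab, add_assoc]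
  · refine ⟨_, _, (T.tri.pos_y (l := [M.y]) (by simp [M.ne_eq]) (by simp) (by simp [M.ne_eq])).hasTables
      T.tri.cut hl (T.tri.covered T.tri.mem.p₁ T.tri.mem.p₃ T.tri.mem.p₃)
      (t := [([M.x], fun S => -M.hex.rot.cv ω q Y S), ([M.y], fun _ => -1)]) (fun S hS b hb => ?_) ?_, fun S hS b hb r => ?_⟩
    · rw [T.mapPos_W_y q hω hS hb]; simp [tab, sub_eq_add_neg]
    · simp only [List.forall_mem_cons, List.not_mem_nil, false_imp_iff, implies_true, and_true]
      exact ⟨T.pos_x'.isEntry T.tri'.cut (by simp) (by simp)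
        (fun S _ => T.tri'.mem_of_mem (neg_mem T.tri.mem.rot.cv)) ((natural_surg (fun S hS => T.rot_cv hS) T.tri.pos_surgeries.outC T.tri'.pos_surgeries.outV).neg),
      T.pos_y'.isEntry T.tri'.cut (by simp) (by simp)
        (fun _ _ => by simp) (natural_const _)⟩
    · rw [mul_one, ← T.pos_chain_y q hω hS hb, T.mapPos_W_y q hω hS hb]; simp [tab, sub_eq_add_neg]
  · refine ⟨_, _, (T.tri.pos_z (l := [M.z]) (by simp [M.ne_eq]) (by simp [M.ne_eq]) (by simp)).hasTables
      T.tri.cut hl (T.tri.covered T.tri.mem.p₄ T.tri.mem.p₅ T.tri.mem.p₄)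
      (t := [([M.z], fun _ => -1)]) (fun S hS b hb => ?_) ?_, fun S hS b hb r => ?_⟩
    · rw [T.mapPos_W_z q hS hb]; simp [tab]
    · simp only [List.forall_mem_cons, List.not_mem_nil, false_imp_iff, implies_true, and_true]
      exact T.pos_z'.isEntry T.tri'.cut (by simp) (by simp)
        (fun _ _ => by simp) (natural_const _)
    · rw [mul_one, ← T.pos_chain_z q hω hS hb, T.mapPos_W_z q hS hb]; simp [tab]
  · refine ⟨_, _, (T.tri.pos_xy (l := [M.x, M.y]) (by simp) (by simp) (by simp [M.ne_eq])).hasTables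
      T.tri.cut hl (T.tri.covered T.tri.mem.p₂ T.tri.mem.p₂ T.tri.mem.p₂)
      (t := [([M.y, M.z], fun _ => 1)]) (fun S hS b hb => ?_) ?_, fun S hS b hb r => ?_⟩
    · rw [T.mapPos_W_xy q hS hb]; simp [tab]
    · simp only [List.forall_mem_cons, List.not_mem_nil, false_imp_iff, implies_true, and_true]
      exact (T.tri'.pos_yz (l := [M.y, M.z]) (by simp [M.ne_eq]) (by simp) (by simp)).isEntry T.tri'.cut (by simp) (by simp)
        (fun _ _ => by simp) (natural_const _)
    · rw [mul_one, ← T.pos_chain_xy q hω hS hb, T.mapPos_W_xy q hS hb]; simp [tab]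
  · refine ⟨_, _, (T.tri.pos_xz (l := [M.x, M.z]) (by simp) (by simp [M.ne_eq]) (by simp)).hasTables
      T.tri.cut hl (T.tri.covered T.tri.mem.p₅ T.tri.mem.p₅ T.tri.mem.p₅)
      (t := [([M.y, M.z], fun _ => -1)]) (fun S hS b hb => ?_) ?_, fun S hS b hb r => ?_⟩
    · rw [T.mapPos_W_xz q hS hb]; simp [tab]
    · simp only [List.forall_mem_cons, List.not_mem_nil, false_imp_iff, implies_true, and_true]
      exact (T.tri'.pos_yz (l := [M.y, M.z]) (by simp [M.ne_eq]) (by simp) (by simp)).isEntry T.tri'.cut (by simp) (by simp)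
        (fun _ _ => by simp) (natural_const _)
    · rw [mul_one, ← T.pos_chain_xz q hω hS hb, T.mapPos_W_xz q hS hb]; simp [tab]
  · refine ⟨_, _, (T.tri.pos_yz (l := [M.y, M.z]) (by simp [M.ne_eq]) (by simp) (by simp)).hasTables
      T.tri.cut hl (T.tri.covered T.tri.mem.p₁ T.tri.mem.p₅ T.tri.mem.p₃)
      (t := [([M.x, M.z], fun _ => -1)]) (fun S hS b hb => ?_) ?_, fun S hS b hb r => ?_⟩
    · rw [T.mapPos_W_yz q hS hb]; simp [tab]
    · simp only [List.forall_mem_cons, List.not_mem_nil, false_imp_iff, implies_true, and_true]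
      exact (T.tri'.pos_xz (l := [M.x, M.z]) (by simp) (by simp [M.ne_eq]) (by simp)).isEntry T.tri'.cut (by simp) (by simp)
        (fun _ _ => by simp) (natural_const _)
    · rw [mul_one, ← T.pos_chain_yz q hω hS hb, T.mapPos_W_yz q hS hb]; simp [tab]
  · refine ⟨_, _, (T.tri.pos_xyz (l := [M.x, M.y, M.z]) (by simp) (by simp) (by simp)).hasTables
      T.tri.cut hl (T.tri.covered T.tri.mem.p₂ T.tri.mem.p₂ T.tri.mem.p₃)
      (t := [([M.x, M.y, M.z], fun _ => 1)]) (fun S hS b hb => ?_) ?_, fun S hS b hb r => ?_⟩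
    · rw [T.mapPos_W_xyz q hS hb]; simp [tab]
    · simp only [List.forall_mem_cons, List.not_mem_nil, false_imp_iff, implies_true, and_true]
      exact T.pos_xyz'.isEntry T.tri'.cut (by simp) (by simp)
        (fun _ _ => by simp) (natural_const _)
    · rw [mul_one, ← T.pos_chain_xyz q hω hS hb, T.mapPos_W_xyz q hS hb]; simp [tab]

end Setting

end ReidemeisterIII

namespace ReidemeisterIII

variable {D D' : LinkDiagram} {Y : Outside} {S : Finset ℕ} {K : Type u} {R : Type v} [CommRing K]
  [CommRing R] [Algebra K R] {α : R} {ω : Rˣ} {b : MvPolynomial ℕ K} [Coalgebra K R]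

/-- The homotopy for a positive move. -/
def homotopyPos (ω : Rˣ) (M : ReidemeisterIII true D D') : Kh K R D →ₗ[K] Kh K R D :=
  onStates [M.x, M.y, M.z] fun S₁ S =>
    match decide (M.x ∈ S₁), decide (M.y ∈ S₁), decide (M.z ∈ S₁) with
    | true, false, false => -(wedge D [] S ∘ₗ T D _ (M.p 1) (↑ω⁻¹ : R) ∘ₗ
        slide D S₁ D _ M.outer (cap D _ (ω : R)))
    | true, true, false => wedge D [M.x] S ∘ₗ slide D S₁ D _ M.outer 0
    | _, _, _ => 0

namespace Setting

variable {M : ReidemeisterIII true D D'}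

theorem homotopyPos_W_x (T : M.Setting Y) (q : QuadData K α) (hω : IsTwisting (K := K) α ω)
    (hS : S ⊆ Y.X) (hb : b ∈ supp K Y.O) (r : R) :
    M.homotopyPos (K := K) (R := R) ω (W K α D [M.x] S (b * q.el M.k r)) =
      W K α D [] S (b * (MvPolynomial.C (-q.φ₁ r) * q.el M.hex.p₁ (↑ω⁻¹ : R))) := by
  have hst := T.tri.pos_x (l := [M.x]) (by simp) (by simp [M.ne_eq]) (by simp [M.ne_eq])
  have hst' := T.tri.pos_nil (l := []) (by simp) (by simp) (by simp)
  rw [homotopyPos, T.onStates_W (by simp) hS]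
  simp only [T.mem_union hS, List.mem_cons, List.not_mem_nil, or_false, M.ne_eq, M.p_eq,
    decide_true, decide_false, LinearMap.neg_apply, LinearMap.comp_apply]
  rw [T.outer, hst.slide_ev_circle q T.tri.cut hst' T.tri.cut (by simp) (by simp) T.tri.k_mem
    T.tri.k_notMem (T.tri.send_k _ _ _) T.tri.covered_circle le_rfl hS rfl rfl hb, cap_eq,
    q.counit_mul_omega hω, ← (ev α D _).commutes, ← map_mul, MvPolynomial.algebraMap_eq,
    T_ev q (T.tri.cut.sub T.tri.mem.p₁), wedge_ev, ← map_neg, map_neg MvPolynomial.C]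
  congr 1
  ring

theorem homotopyPos_W_xy (T : M.Setting Y) (q : QuadData K α) (hS : S ⊆ Y.X)
    (hb : b ∈ supp K Y.O) :
    M.homotopyPos (K := K) (R := R) ω (W K α D [M.x, M.y] S b) = W K α D [M.x] S b := by
  have hst := T.tri.pos_xy (l := [M.x, M.y]) (by simp) (by simp) (by simp [M.ne_eq])
  have hst' := T.tri.pos_x (l := [M.x]) (by simp) (by simp [M.ne_eq]) (by simp [M.ne_eq])
  rw [homotopyPos, T.onStates_W (by simp) hS]
  simp only [T.mem_union hS, List.mem_cons, List.not_mem_nil, or_false, or_true, M.ne_eq,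
    decide_true, decide_false, LinearMap.comp_apply]
  rw [T.outer, hst.slide_ev q T.tri.cut hst' T.tri.cut (by simp) (by simp)
    (T.tri.covered T.tri.mem.p₂ T.tri.mem.p₂ T.tri.mem.p₂) le_rfl hS rfl rfl hb, wedge_ev]

theorem homotopyPos_W_zero (T : M.Setting Y) (hS : S ⊆ Y.X) {l : List ℕ}
    (hl : l.Sublist [M.x, M.y, M.z]) (h : M.x ∉ l ∨ M.z ∈ l) (b : MvPolynomial ℕ K) :
    M.homotopyPos (K := K) (R := R) ω (W K α D l S b) = 0 := by
  rw [homotopyPos, T.onStates_W hl hS]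
  simp only [T.mem_union hS]
  split
  · simp_all
  · simp_all
  · rfl

theorem symm_mapPos_W_x (T : M.Setting Y) (q : QuadData K α) (hω : IsTwisting (K := K) α ω)
    (hS : S ⊆ Y.X) (hb : b ∈ supp K Y.O) :
    M.symm.mapPos (K := K) (R := R) ω (W K α D' [M.x] S b) = 0 :=
  T.symm.mapPos_W_x_one q hω hS hb

theorem symm_mapPos_W_y (T : M.Setting Y) (q : QuadData K α) (hω : IsTwisting (K := K) α ω)
    (hS : S ⊆ Y.X) (hb : b ∈ supp K Y.O) :
    M.symm.mapPos (K := K) (R := R) ω (W K α D' [M.y] S b) =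
      -W K α D [M.x] S (b * M.hex.cv ω q Y S) - W K α D [M.y] S b :=
  T.symm.mapPos_W_y q hω hS hb

theorem symm_mapPos_W_z (T : M.Setting Y) (q : QuadData K α)
    (hS : S ⊆ Y.X) (hb : b ∈ supp K Y.O) :
    M.symm.mapPos (K := K) (R := R) ω (W K α D' [M.z] S b) = -W K α D [M.z] S b :=
  T.symm.mapPos_W_z q hS hb

theorem symm_mapPos_W_xz (T : M.Setting Y) (q : QuadData K α)
    (hS : S ⊆ Y.X) (hb : b ∈ supp K Y.O) :
    M.symm.mapPos (K := K) (R := R) ω (W K α D' [M.x, M.z] S b) = -W K α D [M.y, M.z] S b :=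
  T.symm.mapPos_W_xz q hS hb

theorem symm_mapPos_W_yz (T : M.Setting Y) (q : QuadData K α)
    (hS : S ⊆ Y.X) (hb : b ∈ supp K Y.O) :
    M.symm.mapPos (K := K) (R := R) ω (W K α D' [M.y, M.z] S b) = -W K α D [M.x, M.z] S b :=
  T.symm.mapPos_W_yz q hS hb

theorem symm_mapPos_W_xyz (T : M.Setting Y) (q : QuadData K α)
    (hS : S ⊆ Y.X) (hb : b ∈ supp K Y.O) :
    M.symm.mapPos (K := K) (R := R) ω (W K α D' [M.x, M.y, M.z] S b) =
      W K α D [M.x, M.y, M.z] S b :=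
  T.symm.mapPos_W_xyz q hS hb

theorem pos_homotopy_nil (T : M.Setting Y) (q : QuadData K α) (hω : IsTwisting (K := K) α ω)
    (hS : S ⊆ Y.X) (hb : b ∈ supp K Y.O) :
    M.homotopyPos (K := K) (R := R) ω (dOn K R D [M.x, M.y, M.z].toFinset (W K α D [] S b)) =
      -W K α D [] S b := by
  have h₁ : b * q.el M.hex.p₁ (ω : R) ∈ supp K Y.O :=
    mul_mem hb (q.el_mem T.tri.mem.p₁ _)
  have h₂ : b * q.el M.hex.p₁ (ω : R) * (MvPolynomial.X M.hex.p₁ - MvPolynomial.C q.s) ∈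
      supp K Y.O :=
    mul_mem h₁ (sub_mem (QuadData.X_mem T.tri.mem.p₁)
      (Subalgebra.algebraMap_mem _ _))
  rw [T.tri.pos_dOn_nil q hω hS hb, map_add, map_add, map_add, T.homotopyPos_W_x q hω hS h₂,
    T.homotopyPos_W_x q hω hS h₁, T.homotopyPos_W_zero hS (by simp) (by simp [M.ne_eq]),
    T.homotopyPos_W_zero hS (by simp) (by simp [M.ne_eq]), q.φ₁_one, q.φ₁_gen, neg_zero, map_zero,
    zero_mul, mul_zero, map_zero, zero_add, add_zero, add_zero, ← map_neg]
  refine (T.tri.pos_nil (l := []) (by simp) (by simp) (by simp)).W_congr q T.tri.cut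
    ⟨_, T.tri.k_mem⟩ (by simp) hS ?_
  intro A _ _ x hx
  simp only [map_mul, map_neg, map_one]
  linear_combination (-aeval x b) * hx.el_mul_inv M.hex.p₁ ω

theorem pos_homotopy_x (T : M.Setting Y) (q : QuadData K α) (hω : IsTwisting (K := K) α ω)
    (hS : S ⊆ Y.X) (hb : b ∈ supp K Y.O) (r : R) :
    M.symm.mapPos (K := K) (R := R) ω (M.mapPos (K := K) (R := R) ω (W K α D [M.x] S (b * q.el M.k r))) -
        W K α D [M.x] S (b * q.el M.k r) =
      dOn K R D [M.x, M.y, M.z].toFinset (W K α D [] S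
        (b * (MvPolynomial.C (-q.φ₁ r) * q.el M.hex.p₁ (↑ω⁻¹ : R)))) +
      M.homotopyPos (K := K) (R := R) ω (dOn K R D [M.x, M.y, M.z].toFinset
        (W K α D [M.x] S (b * q.el M.k r))) := by
  have hm := T.tri.mem
  have hC (c : K) : MvPolynomial.C c ∈ supp K Y.O :=
    Subalgebra.algebraMap_mem _ _
  have hp := q.el_mem (r := (↑ω⁻¹ : R)) hm.p₁
  have h₁ : b * (MvPolynomial.C (q.φ₁ r) * M.hex.vb ω q Y S *
      M.hex.rot.bv ω q Y S * q.el M.hex.p₁ (↑ω⁻¹ : R)) ∈ supp K Y.O :=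
    mul_mem hb (mul_mem (Subalgebra.mul_mem _
      (mul_mem (hC _) hm.vb) hm.rot.bv) hp)
  have h₂ : b * (MvPolynomial.C (q.φ₁ r) * M.hex.vc ω q Y S * q.el M.hex.p₁ (↑ω⁻¹ : R)) ∈
      supp K Y.O :=
    mul_mem hb (mul_mem (mul_mem (hC _) hm.vc) hp)
  have h₃ : b * (MvPolynomial.C (q.φ₁ r) * M.hex.vb ω q Y S * q.el M.hex.p₁ (↑ω⁻¹ : R)) ∈
      supp K Y.O :=
    mul_mem hb (mul_mem (mul_mem (hC _) hm.vb) hp)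
  rw [T.mapPos_W_x q hω hS hb, map_add, map_add, T.symm_mapPos_W_x q hω hS h₁,
    T.symm_mapPos_W_y q hω hS h₂, T.symm_mapPos_W_z q hS h₃, T.tri.pos_dOn_nil q hω hS
      (mul_mem hb (mul_mem (hC _) hp)),
    T.tri.pos_dOn_x q hω hS hb, map_sub (M.homotopyPos _), map_neg (M.homotopyPos _),
    T.homotopyPos_W_xy q hS (mul_mem hb (q.el_mem hm.p₂ r)),
    T.homotopyPos_W_zero hS (by simp) (by simp)]
  have e₁ : W K α D [M.y] S (b * (MvPolynomial.C (-q.φ₁ r) * q.el M.hex.p₁ (↑ω⁻¹ : R)) *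
      M.hex.vc ω q Y S) = -W K α D [M.y] S (b * (MvPolynomial.C (q.φ₁ r) * M.hex.vc ω q Y S *
        q.el M.hex.p₁ (↑ω⁻¹ : R))) := by
    rw [← map_neg (W K α D [M.y] S), map_neg MvPolynomial.C]; congr 1; ring
  have e₂ : W K α D [M.z] S (b * (MvPolynomial.C (-q.φ₁ r) * q.el M.hex.p₁ (↑ω⁻¹ : R)) *
      M.hex.vb ω q Y S) = -W K α D [M.z] S (b * (MvPolynomial.C (q.φ₁ r) * M.hex.vb ω q Y S *
        q.el M.hex.p₁ (↑ω⁻¹ : R))) := by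
    rw [← map_neg (W K α D [M.z] S), map_neg MvPolynomial.C]; congr 1; ring
  have e₃ : -W K α D [M.x] S (b * (MvPolynomial.C (q.φ₁ r) * M.hex.vc ω q Y S *
        q.el M.hex.p₁ (↑ω⁻¹ : R)) * M.hex.cv ω q Y S) - W K α D [M.x] S (b * q.el M.k r) =
      W K α D [M.x] S (b * (MvPolynomial.C (-q.φ₁ r) * q.el M.hex.p₁ (↑ω⁻¹ : R)) *
        q.el M.hex.p₁ (ω : R) * (MvPolynomial.X M.hex.p₁ - MvPolynomial.C q.s) *
        q.el M.k (1 : R)) +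
      W K α D [M.x] S (b * (MvPolynomial.C (-q.φ₁ r) * q.el M.hex.p₁ (↑ω⁻¹ : R)) *
        q.el M.hex.p₁ (ω : R) * q.el M.k α) - W K α D [M.x] S (b * q.el M.hex.p₂ r) := by
    rw [← map_neg (W K α D [M.x] S), ← map_sub (W K α D [M.x] S), ← map_add (W K α D [M.x] S),
      ← map_sub (W K α D [M.x] S)]
    refine (T.tri.pos_x (l := [M.x]) (by simp) (by simp [M.ne_eq])
      (by simp [M.ne_eq])).W_congr q T.tri.cut ⟨_, T.tri.k_mem⟩ (by simp) hS ?_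
    intro A _ _ x hx
    have h1 := T.tri.pos_surgeries.vc_mul_cv (ω := ω) hS hx
    have h2 := hx.el_mul_inv M.hex.p₁ ω
    simp only [map_mul, map_add, map_sub, map_neg, MvPolynomial.algHom_C, MvPolynomial.aeval_X,
      q.el_gen, q.el_one, map_one]
    rw [QuadData.aeval_el x M.hex.p₂ r, QuadData.aeval_el x M.k r]
    set B := aeval x b
    set c := algebraMap K A (q.φ₁ r)
    set e := aeval x (q.el M.hex.p₁ (↑ω⁻¹ : R))
    linear_combination (-B * c * e) * h1 +
      (B * c * (x M.k - x M.hex.p₂)) * h2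
  rw [e₁, e₂]
  linear_combination (norm := abel) e₃

theorem pos_homotopic (T : M.Setting Y) (q : QuadData K α) (hω : IsTwisting (K := K) α ω) :
    Homotopic (M.symm.mapPos ω ∘ₗ M.mapPos ω) (LinearMap.id : Kh K R D →ₗ[K] _) := by
  have hm := T.tri.mem
  refine homotopic_of_tables (q := q) (O := Y.O) hω T.tri.cut.toFrame
    (H := M.homotopyPos (K := K) (R := R) ω) fun l hl => ?_
  simp only [LinearMap.comp_apply, LinearMap.id_apply]
  rcases sublist_three hl with rfl | rfl | rfl | rfl | rfl | rfl | rfl | rfl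
  · refine ⟨_, _, (T.tri.pos_nil (l := []) (by simp) (by simp) (by simp)).hasTables T.tri.cut hl
      (T.tri.covered hm.p₁ hm.p₁ hm.p₁) (t := [])
      (fun S hS b hb => by rw [T.homotopyPos_W_zero hS hl (by simp)]; rfl) (by simp),
      fun S hS b hb r => ?_⟩
    rw [mul_one, T.mapPos_W_nil hS, T.pos_homotopy_nil q hω hS hb]
    simp [tab]
  · refine ⟨_, _, (T.tri.pos_x (l := [M.x]) (by simp) (by simp [M.ne_eq])
      (by simp [M.ne_eq])).hasTables_circle T.tri.cut hl T.tri.k_mem T.tri.k_notMem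
      (T.tri.send_k _ _ _) T.tri.covered_circle
      (t := fun r => [([], fun _ => MvPolynomial.C (-q.φ₁ r) * q.el M.hex.p₁ (↑ω⁻¹ : R))])
      (fun S hS b hb r => by rw [T.homotopyPos_W_x q hω hS hb]; simp [tab]) fun r => ?_,
      fun S hS b hb r => ?_⟩
    · simp only [List.mem_singleton]
      rintro _ rfl
      exact (T.tri.pos_nil (l := []) (by simp) (by simp) (by simp)).isEntry T.tri.cut
        (List.nil_sublist _) (by simp) (fun _ _ => T.tri.mem_of_mem (Subalgebra.mul_mem _
          (Subalgebra.algebraMap_mem _ _) (q.el_mem hm.p₁ _))) (natural_const _)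
    · rw [T.pos_homotopy_x q hω hS hb r]; simp [tab]
  · refine ⟨_, _, (T.tri.pos_y (l := [M.y]) (by simp [M.ne_eq]) (by simp)
      (by simp [M.ne_eq])).hasTables T.tri.cut hl (T.tri.covered hm.p₁ hm.p₃ hm.p₃) (t := [])
      (fun S hS b hb => by rw [T.homotopyPos_W_zero hS hl (by simp [M.ne_eq])]; rfl) (by simp),
      fun S hS b hb r => ?_⟩
    rw [mul_one, T.mapPos_W_y q hω hS hb, map_sub, map_neg, T.symm_mapPos_W_y q hω hS hb,
      T.symm_mapPos_W_x q hω hS (mul_mem hb hm.rot.cv), T.tri.pos_dOn_y q hω hS hb,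
      map_sub, T.homotopyPos_W_xy q hS (mul_mem hb hm.cv),
      T.homotopyPos_W_zero hS (by simp) (by simp), tab, List.map_nil, List.sum_nil, map_zero]
    abel
  · refine ⟨_, _, (T.tri.pos_z (l := [M.z]) (by simp [M.ne_eq]) (by simp [M.ne_eq])
      (by simp)).hasTables T.tri.cut hl (T.tri.covered hm.p₄ hm.p₅ hm.p₄) (t := [])
      (fun S hS b hb => by rw [T.homotopyPos_W_zero hS hl (by simp)]; rfl) (by simp),
      fun S hS b hb r => ?_⟩
    rw [mul_one, T.mapPos_W_z q hS hb, map_neg, T.symm_mapPos_W_z q hS hb,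
      T.tri.pos_dOn_z q hω hS hb, map_add, T.homotopyPos_W_zero hS (by simp) (by simp),
      T.homotopyPos_W_zero hS (by simp) (by simp)]
    simp [tab]
  · refine ⟨_, _, (T.tri.pos_xy (l := [M.x, M.y]) (by simp) (by simp)
      (by simp [M.ne_eq])).hasTables T.tri.cut hl (T.tri.covered hm.p₂ hm.p₂ hm.p₂)
      (t := [([M.x], fun _ => 1)])
      (fun S hS b hb => by rw [T.homotopyPos_W_xy q hS hb]; simp [tab]) ?_,
      fun S hS b hb r => ?_⟩
    · simp only [List.mem_singleton]
      rintro _ rfl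
      exact (T.tri.pos_x (l := [M.x]) (by simp) (by simp [M.ne_eq])
        (by simp [M.ne_eq])).isEntry T.tri.cut (by simp) (by simp)
        (fun _ _ => one_mem _) (natural_const _)
    · have hx := T.tri.pos_dOn_x q hω hS hb 1
      rw [q.el_one, q.el_one, q.el_one, mul_one] at hx
      rw [mul_one, T.mapPos_W_xy q hS hb, T.symm_mapPos_W_yz q hS hb, T.tri.pos_dOn_xy q hω hS hb,
        T.homotopyPos_W_zero hS (by simp) (by simp)]
      simp only [tab, List.map_cons, List.map_nil, List.sum_cons, List.sum_nil, add_zero, mul_one]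
      rw [hx]
      abel
  · refine ⟨_, _, (T.tri.pos_xz (l := [M.x, M.z]) (by simp) (by simp [M.ne_eq])
      (by simp)).hasTables T.tri.cut hl (T.tri.covered hm.p₅ hm.p₅ hm.p₅) (t := [])
      (fun S hS b hb => by rw [T.homotopyPos_W_zero hS hl (by simp)]; rfl) (by simp),
      fun S hS b hb r => ?_⟩
    rw [mul_one, T.mapPos_W_xz q hS hb, map_neg, T.symm_mapPos_W_yz q hS hb,
      T.tri.pos_dOn_xz q hω hS hb, map_neg, T.homotopyPos_W_zero hS (by simp) (by simp)]
    simp [tab]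
  · refine ⟨_, _, (T.tri.pos_yz (l := [M.y, M.z]) (by simp [M.ne_eq]) (by simp)
      (by simp)).hasTables T.tri.cut hl (T.tri.covered hm.p₁ hm.p₅ hm.p₃) (t := [])
      (fun S hS b hb => by rw [T.homotopyPos_W_zero hS hl (by simp)]; rfl) (by simp),
      fun S hS b hb r => ?_⟩
    rw [mul_one, T.mapPos_W_yz q hS hb, map_neg, T.symm_mapPos_W_xz q hS hb,
      T.tri.pos_dOn_yz q hω hS hb, T.homotopyPos_W_zero hS (by simp) (by simp)]
    simp [tab]
  · refine ⟨_, _, (T.tri.pos_xyz (l := [M.x, M.y, M.z]) (by simp) (by simp)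
      (by simp)).hasTables T.tri.cut hl (T.tri.covered hm.p₂ hm.p₂ hm.p₃) (t := [])
      (fun S hS b hb => by rw [T.homotopyPos_W_zero hS hl (by simp)]; rfl) (by simp),
      fun S hS b hb r => ?_⟩
    rw [mul_one, T.mapPos_W_xyz q hS hb, T.symm_mapPos_W_xyz q hS hb,
      T.tri.dOn_xyz q hω hS hb, map_zero]
    simp [tab]

end Setting

end ReidemeisterIII

namespace ReidemeisterIII

variable {D D' : LinkDiagram} {Y : Outside} {S : Finset ℕ}

namespace Setting

variable {M : ReidemeisterIII false D D'}

theorem neg_nil' (T : M.Setting Y) : IsState D' [M.x, M.y, M.z] Y.O [] [] M.hex.A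
    (Triangle.send M.k M.m M.n M.hex.p₅ M.hex.p₅ M.hex.p₆) :=
  (T.tri'.neg_nil (by simp) (by simp) (by simp)).unrot_A T.tri.mem

theorem neg_xy' (T : M.Setting Y) : IsState D' [M.x, M.y, M.z] Y.O [] [M.x, M.y] M.hex.B
    (Triangle.send M.k M.m M.n M.hex.p₄ M.hex.p₂ M.hex.p₄) :=
  (T.tri'.neg_xy (by simp) (by simp) (by simp [M.ne_eq])).unrot_B T.tri.mem

theorem neg_xz' (T : M.Setting Y) : IsState D' [M.x, M.y, M.z] Y.O [] [M.x, M.z] M.hex.C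
    (Triangle.send M.k M.m M.n M.hex.p₄ M.hex.p₆ M.hex.p₆) :=
  (T.tri'.neg_xz (by simp) (by simp [M.ne_eq]) (by simp)).unrot_C T.tri.mem

theorem neg_yz' (T : M.Setting Y) : IsState D' [M.x, M.y, M.z] Y.O [] [M.y, M.z] M.hex.rot.V
    (Triangle.send M.k M.m M.n M.k M.k M.k) :=
  T.tri'.neg_yz (by simp [M.ne_eq]) (by simp) (by simp)

theorem neg_rot_cv (T : M.Setting Y) (hS : S ⊆ Y.X) :
    Surg (Y.rel M.hex.C S) (Y.rel M.hex.rot.V S) M.hex.p₄ M.hex.p₅ M.hex.p₃ := by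
  have := T.tri'.neg_surgeries.cv hS
  rwa [Outside.rel_rot_C] at this

theorem neg_rot_bv (T : M.Setting Y) (hS : S ⊆ Y.X) :
    Surg (Y.rel M.hex.B S) (Y.rel M.hex.rot.V S) M.hex.p₂ M.hex.p₃ M.hex.p₁ := by
  have := T.tri'.neg_surgeries.bv hS
  rwa [Outside.rel_rot_B] at this

theorem neg_rot_bv' (T : M.Setting Y) (hS : S ⊆ Y.X) :
    Surg (Y.rel M.hex.B S) (Y.rel M.hex.rot.V S) M.hex.p₄ M.hex.p₁ M.hex.p₃ := by
  have := T.tri'.neg_surgeries.bv' hS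
  rwa [Outside.rel_rot_B] at this

variable {K : Type u} {R : Type v} [CommRing K] [CommRing R]
  [Algebra K R] {α : R} {ω : Rˣ} {b : MvPolynomial ℕ K} [Coalgebra K R]

theorem mapNeg_W_nil (T : M.Setting Y) (q : QuadData K α) (hS : S ⊆ Y.X)
    (hb : b ∈ supp K Y.O) :
    M.mapNeg (K := K) (R := R) ω (W K α D [] S b) = W K α D' [] S b := by
  have hst := T.tri.neg_nil (l := []) (by simp) (by simp) (by simp)
  rw [ReidemeisterIII.mapNeg, T.onStates_W (by simp) hS]
  simp only [T.mem_union hS, List.not_mem_nil, decide_false, LinearMap.comp_apply]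
  rw [T.outer, hst.slide_ev q T.tri.cut T.neg_nil' T.tri'.cut (by simp) (by simp)
    (T.tri.covered T.tri.mem.p₂ T.tri.mem.p₂ T.tri.mem.p₃) le_rfl hS rfl rfl hb, wedge_ev]

theorem mapNeg_W_x (T : M.Setting Y) (q : QuadData K α) (hS : S ⊆ Y.X)
    (hb : b ∈ supp K Y.O) :
    M.mapNeg (K := K) (R := R) ω (W K α D [M.x] S b) =
      W K α D' [M.y] S b + W K α D' [M.z] S b := by
  have hst := T.tri.neg_x (l := [M.x]) (by simp) (by simp [M.ne_eq]) (by simp [M.ne_eq])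
  have hy := T.tri'.neg_y (l := [M.y]) (by simp [M.ne_eq]) (by simp) (by simp [M.ne_eq])
  have hz := T.tri'.neg_z (l := [M.z]) (by simp [M.ne_eq]) (by simp [M.ne_eq]) (by simp)
  rw [ReidemeisterIII.mapNeg, T.onStates_W (by simp) hS]
  simp only [T.mem_union hS, List.mem_cons, List.not_mem_nil, or_false, M.ne_eq,
    decide_true, decide_false, LinearMap.add_apply, LinearMap.comp_apply]
  rw [T.outer, hst.slide_ev q T.tri.cut hy T.tri'.cut (by simp) (by simp)
    (T.tri.covered T.tri.mem.p₁ T.tri.mem.p₅ T.tri.mem.p₃) le_rfl hS rfl rfl hb,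
    hst.slide_ev q T.tri.cut hz T.tri'.cut (by simp) (by simp)
    (T.tri.covered T.tri.mem.p₁ T.tri.mem.p₅ T.tri.mem.p₃) le_rfl hS rfl rfl hb, wedge_ev,
    wedge_ev]

theorem mapNeg_W_y (T : M.Setting Y) (q : QuadData K α) (hS : S ⊆ Y.X)
    (hb : b ∈ supp K Y.O) :
    M.mapNeg (K := K) (R := R) ω (W K α D [M.y] S b) = W K α D' [M.x] S b := by
  have hst := T.tri.neg_y (l := [M.y]) (by simp [M.ne_eq]) (by simp) (by simp [M.ne_eq])
  have hx := T.tri'.neg_x (l := [M.x]) (by simp) (by simp [M.ne_eq]) (by simp [M.ne_eq])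
  rw [ReidemeisterIII.mapNeg, T.onStates_W (by simp) hS]
  simp only [T.mem_union hS, List.mem_cons, List.not_mem_nil, or_false, M.ne_eq,
    decide_true, decide_false, LinearMap.comp_apply]
  rw [T.outer, hst.slide_ev q T.tri.cut hx T.tri'.cut (by simp) (by simp)
    (T.tri.covered T.tri.mem.p₅ T.tri.mem.p₅ T.tri.mem.p₅) le_rfl hS rfl rfl hb, wedge_ev]

theorem mapNeg_W_z (T : M.Setting Y) (hS : S ⊆ Y.X) (b : MvPolynomial ℕ K) :
    M.mapNeg (K := K) (R := R) ω (W K α D [M.z] S b) = 0 := by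
  rw [ReidemeisterIII.mapNeg, T.onStates_W (by simp) hS]
  simp only [T.mem_union hS, List.mem_cons, List.not_mem_nil, or_false, M.ne_eq,
    decide_true, decide_false, LinearMap.zero_apply]

theorem mapNeg_W_xyz (T : M.Setting Y) (hS : S ⊆ Y.X) (b : MvPolynomial ℕ K) :
    M.mapNeg (K := K) (R := R) ω (W K α D [M.x, M.y, M.z] S b) = 0 := by
  rw [ReidemeisterIII.mapNeg, T.onStates_W (by simp) hS]
  simp only [T.mem_union hS, List.mem_cons, true_or, or_true, decide_true, LinearMap.zero_apply]

theorem mapNeg_W_xy (T : M.Setting Y) (q : QuadData K α) (hω : IsTwisting (K := K) α ω)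
    (hS : S ⊆ Y.X) (hb : b ∈ supp K Y.O) :
    M.mapNeg (K := K) (R := R) ω (W K α D [M.x, M.y] S b) = -W K α D' [M.x, M.y] S b +
      W K α D' [M.y, M.z] S (b * (M.hex.rot.bv ω q Y S * q.el M.hex.p₄ (↑ω⁻¹ : R)) *
        q.el M.k (ω : R)) := by
  have hst := T.tri.neg_xy (l := [M.x, M.y]) (by simp) (by simp) (by simp [M.ne_eq])
  have hcov := T.tri.covered T.tri.mem.p₁ T.tri.mem.p₅ T.tri.mem.p₁
  rw [ReidemeisterIII.mapNeg, T.onStates_W (by simp) hS]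
  simp only [T.mem_union hS, List.mem_cons, List.not_mem_nil, or_false, or_true, M.ne_eq, M.p_eq,
    decide_true, decide_false, LinearMap.add_apply, LinearMap.neg_apply, LinearMap.comp_apply]
  rw [T.outer, hst.slide_ev q T.tri.cut T.neg_xy' T.tri'.cut (by simp) (by simp) hcov le_rfl hS
    rfl rfl hb, hst.surgery_ev q hω T.tri.cut T.neg_yz' T.tri'.cut (by simp) (by simp) hcov
    T.tri.mem.p₄ T.tri.mem.p₁ hS (T.neg_rot_bv' hS) rfl rfl hb,
    T_ev q (T.tri'.cut.sub T.tri.mem.p₄), T_ev q T.tri'.k_mem, wedge_ev, wedge_ev]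
  congr 1
  refine T.neg_yz'.W_congr q T.tri'.cut ⟨_, T.tri'.k_mem⟩ (by simp) hS ?_
  intro A _ _ x hx
  have h1 := M.hex.rot.cc_V (ω := ω) (q := q) (Y := Y) S A x hx
  simp only [map_mul]
  rw [← h1, Outside.rel, Hex.rot_p₁, Hex.rot_p₄]
  ring

theorem mapNeg_W_xz (T : M.Setting Y) (q : QuadData K α) (hω : IsTwisting (K := K) α ω)
    (hS : S ⊆ Y.X) (hb : b ∈ supp K Y.O) :
    M.mapNeg (K := K) (R := R) ω (W K α D [M.x, M.z] S b) = -W K α D' [M.x, M.z] S b -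
      W K α D' [M.y, M.z] S (b * (M.hex.rot.cv ω q Y S * q.el M.hex.p₄ (↑ω⁻¹ : R)) *
        q.el M.k (ω : R)) := by
  have hst := T.tri.neg_xz (l := [M.x, M.z]) (by simp) (by simp [M.ne_eq]) (by simp)
  have hcov := T.tri.covered T.tri.mem.p₁ T.tri.mem.p₃ T.tri.mem.p₃
  rw [ReidemeisterIII.mapNeg, T.onStates_W (by simp) hS]
  simp only [T.mem_union hS, List.mem_cons, List.not_mem_nil, or_false, or_true, M.ne_eq, M.p_eq,
    decide_true, decide_false, LinearMap.sub_apply, LinearMap.neg_apply, LinearMap.comp_apply]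
  rw [T.outer, hst.slide_ev q T.tri.cut T.neg_xz' T.tri'.cut (by simp) (by simp) hcov le_rfl hS
    rfl rfl hb, hst.surgery_ev q hω T.tri.cut T.neg_yz' T.tri'.cut (by simp) (by simp) hcov
    T.tri.mem.p₄ T.tri.mem.p₅ hS (T.neg_rot_cv hS) rfl rfl hb,
    T_ev q (T.tri'.cut.sub T.tri.mem.p₄), T_ev q T.tri'.k_mem, wedge_ev, wedge_ev, mul_assoc b]
  rfl

theorem mapNeg_W_yz (T : M.Setting Y) (q : QuadData K α) (hω : IsTwisting (K := K) α ω)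
    (hS : S ⊆ Y.X) (hb : b ∈ supp K Y.O) (r : R) :
    M.mapNeg (K := K) (R := R) ω (W K α D [M.y, M.z] S (b * q.el M.k r)) =
      W K α D' [M.x, M.z] S (b * (MvPolynomial.C (Coalgebra.counit (R := K) r) *
        M.hex.vc ω q Y S)) +
      W K α D' [M.y, M.z] S (b * (MvPolynomial.C (Coalgebra.counit (R := K) r) *
        M.hex.vc ω q Y S * M.hex.rot.cv ω q Y S * q.el M.hex.p₄ (↑ω⁻¹ : R)) *
          q.el M.k (ω : R)) := by
  have hst := T.tri.neg_yz (l := [M.y, M.z]) (by simp [M.ne_eq]) (by simp) (by simp)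
  have hs := T.tri.neg_surgeries
  have hC : MvPolynomial.C (Coalgebra.counit (R := K) r) ∈
      supp K Y.O := Subalgebra.algebraMap_mem _ _
  have e₂₃ : surgery D ([M.y, M.z].toFinset ∪ S) D' ([M.x, M.z].toFinset ∪ S) Y.O
      (cap D' _ (1 : R)) M.hex.p₂ M.hex.p₃ (ev α D _ (b * q.el M.k r)) =
        ev α D' _ (b * (MvPolynomial.C (Coalgebra.counit (R := K) r) * M.hex.vc ω q Y S)) := by
    rw [hst.surgery_ev_circle q hω T.tri.cut T.neg_xz' T.tri'.cut (by simp) (by simp) T.tri.k_mem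
      T.tri.k_notMem (T.tri.send_k _ _ _) T.tri.covered_circle T.tri.mem.p₂ T.tri.mem.p₃ hS
      (hs.vc S hS) rfl rfl hb, cap_eq, mul_one, ← (ev α D' _).commutes, ← map_mul,
      MvPolynomial.algebraMap_eq, mul_assoc, mul_comm (q.cc ω _ _ _)]
    rfl
  rw [ReidemeisterIII.mapNeg, T.onStates_W (by simp) hS]
  simp only [T.mem_union hS, List.mem_cons, List.not_mem_nil, or_false, or_true, M.ne_eq, M.p_eq,
    decide_true, decide_false, LinearMap.add_apply, LinearMap.comp_apply]
  rw [T.outer, e₂₃, T.neg_xz'.surgery_ev q hω T.tri'.cut T.neg_yz' T.tri'.cut (by simp) (by simp)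
    (T.tri'.covered T.tri.mem.p₄ T.tri.mem.p₆ T.tri.mem.p₆) T.tri.mem.p₄ T.tri.mem.p₅ hS
    (T.neg_rot_cv hS) rfl rfl (mul_mem hb (mul_mem hC T.tri.mem.vc)),
    T_ev q (T.tri'.cut.sub T.tri.mem.p₄), T_ev q T.tri'.k_mem, wedge_ev, wedge_ev]
  simp only [mul_assoc]
  rfl

theorem mapNeg_W_yz_omega (T : M.Setting Y) (q : QuadData K α) (hω : IsTwisting (K := K) α ω)
    (hS : S ⊆ Y.X) (hb : b ∈ supp K Y.O) :
    M.mapNeg (K := K) (R := R) ω (W K α D [M.y, M.z] S (b * q.el M.k (ω : R))) = 0 := by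
  rw [T.mapNeg_W_yz q hω hS hb, hω.counit_omega, map_zero]
  simp

end Setting

end ReidemeisterIII

namespace ReidemeisterIII

variable {D D' : LinkDiagram} {Y : Outside} {S : Finset ℕ} {K : Type u} {R : Type v} [CommRing K]
  [CommRing R] [Algebra K R] {α : R} {ω : Rˣ} {b : MvPolynomial ℕ K} [Coalgebra K R]

namespace Setting

variable {M : ReidemeisterIII false D D'}

theorem neg_chain_nil (T : M.Setting Y) (q : QuadData K α) (hω : IsTwisting (K := K) α ω)
    (hS : S ⊆ Y.X) (hb : b ∈ supp K Y.O) :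
    dOn K R D' [M.x, M.y, M.z].toFinset
        (M.mapNeg (K := K) (R := R) ω (W K α D [] S b)) =
      M.mapNeg (K := K) (R := R) ω (dOn K R D [M.x, M.y, M.z].toFinset
        (W K α D [] S b)) := by
  have hm := T.tri.mem
  rw [T.mapNeg_W_nil q hS hb, T.tri'.neg_dOn_nil q hω hS hb, T.tri.neg_dOn_nil q hω hS hb, map_add,
    map_add, T.mapNeg_W_x q hS (mul_mem hb hm.rot.av),
    T.mapNeg_W_y q hS (mul_mem hb hm.av), T.mapNeg_W_z hS, Hex.rot_rot]
  abel

theorem neg_chain_x (T : M.Setting Y) (q : QuadData K α) (hω : IsTwisting (K := K) α ω)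
    (hS : S ⊆ Y.X) (hb : b ∈ supp K Y.O) :
    dOn K R D' [M.x, M.y, M.z].toFinset
        (M.mapNeg (K := K) (R := R) ω (W K α D [M.x] S b)) =
      M.mapNeg (K := K) (R := R) ω (dOn K R D [M.x, M.y, M.z].toFinset
        (W K α D [M.x] S b)) := by
  have hm := T.tri.mem
  rw [T.mapNeg_W_x q hS hb, map_add, T.tri'.neg_dOn_y q hω hS hb, T.tri'.neg_dOn_z q hω hS hb,
    T.tri.neg_dOn_x q hω hS hb, map_sub, map_neg,
    T.mapNeg_W_xy q hω hS (mul_mem hb hm.rot.vb),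
    T.mapNeg_W_xz q hω hS (mul_mem hb hm.rot.vc), Hex.rot_p₅, Hex.rot_p₂]
  have e : W K α D' [M.y, M.z] S (b * (MvPolynomial.X M.hex.p₅ - MvPolynomial.C q.s) *
        q.el M.k (ω : R)) - W K α D' [M.y, M.z] S
        (b * (MvPolynomial.X M.hex.p₂ - MvPolynomial.C q.s) * q.el M.k (ω : R)) =
      W K α D' [M.y, M.z] S (b * M.hex.rot.vc ω q Y S * (M.hex.rot.cv ω q Y S *
        q.el M.hex.p₄ (↑ω⁻¹ : R)) * q.el M.k (ω : R)) -
      W K α D' [M.y, M.z] S (b * M.hex.rot.vb ω q Y S * (M.hex.rot.bv ω q Y S *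
        q.el M.hex.p₄ (↑ω⁻¹ : R)) * q.el M.k (ω : R)) := by
    rw [← map_sub (W K α D' [M.y, M.z] S), ← map_sub (W K α D' [M.y, M.z] S)]
    refine T.neg_yz'.W_congr q T.tri'.cut ⟨_, T.tri'.k_mem⟩ (by simp) hS ?_
    intro A _ _ x hx
    have h1 := T.tri'.neg_surgeries.vb_mul_bv (ω := ω) hS hx
    have h2 := T.tri'.neg_surgeries.vc_mul_cv (ω := ω) hS hx
    have h3 := hx.el_mul_inv M.hex.p₄ ω
    simp only [Hex.rot_p₁, Hex.rot_p₂, Hex.rot_p₅] at h1 h2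
    simp only [map_mul, map_sub, MvPolynomial.aeval_X]
    set B := aeval x b
    set w := aeval x (q.el M.k (ω : R))
    set e := aeval x (q.el M.hex.p₄ (↑ω⁻¹ : R))
    linear_combination (B * w * e) * (h1 - h2) - (B * w * (x M.hex.p₅ - x M.hex.p₂)) * h3
  linear_combination (norm := abel) e

theorem neg_chain_y (T : M.Setting Y) (q : QuadData K α) (hω : IsTwisting (K := K) α ω)
    (hS : S ⊆ Y.X) (hb : b ∈ supp K Y.O) :
    dOn K R D' [M.x, M.y, M.z].toFinset
        (M.mapNeg (K := K) (R := R) ω (W K α D [M.y] S b)) =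
      M.mapNeg (K := K) (R := R) ω (dOn K R D [M.x, M.y, M.z].toFinset
        (W K α D [M.y] S b)) := by
  have hm := T.tri.mem
  have h₁ : b * (MvPolynomial.X M.hex.p₅ - MvPolynomial.C q.s) ∈
      supp K Y.O :=
    mul_mem hb (sub_mem (QuadData.X_mem hm.p₅)
      (Subalgebra.algebraMap_mem _ _))
  rw [T.mapNeg_W_y q hS hb, T.tri'.neg_dOn_x q hω hS hb, T.tri.neg_dOn_y q hω hS hb, map_sub,
    map_add, T.mapNeg_W_xy q hω hS (mul_mem hb hm.vb),
    T.mapNeg_W_yz_omega q hω hS h₁, T.mapNeg_W_yz q hω hS hb, hω.counit_omega_mul, map_one, one_mul,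
    Hex.rot_rot]
  have e : W K α D' [M.y, M.z] S (b * M.hex.vb ω q Y S * (M.hex.rot.bv ω q Y S *
      q.el M.hex.p₄ (↑ω⁻¹ : R)) * q.el M.k (ω : R)) =
      W K α D' [M.y, M.z] S (b * (M.hex.vc ω q Y S * M.hex.rot.cv ω q Y S *
        q.el M.hex.p₄ (↑ω⁻¹ : R)) * q.el M.k (ω : R)) := by
    refine T.neg_yz'.W_congr q T.tri'.cut ⟨_, T.tri'.k_mem⟩ (by simp) hS ?_
    intro A _ _ x hx
    have h1 := T.tri.neg_surgeries.square (ω := ω) T.tri'.neg_surgeries hS hx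
    simp only [map_mul]
    linear_combination (aeval x b * aeval x (q.el M.k (ω : R)) *
      aeval x (q.el M.hex.p₄ (↑ω⁻¹ : R))) * h1
  rw [e]
  abel

theorem neg_chain_z (T : M.Setting Y) (q : QuadData K α) (hω : IsTwisting (K := K) α ω)
    (hS : S ⊆ Y.X) (hb : b ∈ supp K Y.O) :
    dOn K R D' [M.x, M.y, M.z].toFinset
        (M.mapNeg (K := K) (R := R) ω (W K α D [M.z] S b)) =
      M.mapNeg (K := K) (R := R) ω (dOn K R D [M.x, M.y, M.z].toFinset
        (W K α D [M.z] S b)) := by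
  have hm := T.tri.mem
  have h₁ : b * (MvPolynomial.X M.hex.p₂ - MvPolynomial.C q.s) ∈
      supp K Y.O :=
    mul_mem hb (sub_mem (QuadData.X_mem hm.p₂)
      (Subalgebra.algebraMap_mem _ _))
  rw [T.mapNeg_W_z hS, map_zero, T.tri.neg_dOn_z q hω hS hb, map_add, map_add,
    T.mapNeg_W_xz q hω hS (mul_mem hb hm.vc),
    T.mapNeg_W_yz_omega q hω hS h₁, T.mapNeg_W_yz q hω hS hb, hω.counit_omega_mul, map_one, one_mul,
    mul_assoc b (M.hex.vc ω q Y S), mul_assoc (M.hex.vc ω q Y S)]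
  abel

theorem neg_chain_xy (T : M.Setting Y) (q : QuadData K α) (hω : IsTwisting (K := K) α ω)
    (hS : S ⊆ Y.X) (hb : b ∈ supp K Y.O) :
    dOn K R D' [M.x, M.y, M.z].toFinset
        (M.mapNeg (K := K) (R := R) ω (W K α D [M.x, M.y] S b)) =
      M.mapNeg (K := K) (R := R) ω (dOn K R D [M.x, M.y, M.z].toFinset
        (W K α D [M.x, M.y] S b)) := by
  have hm := T.tri.mem
  have h₁ : b * (M.hex.rot.bv ω q Y S * q.el M.hex.p₄ (↑ω⁻¹ : R)) ∈
      supp K Y.O :=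
    mul_mem hb (mul_mem hm.rot.bv (q.el_mem hm.p₄ _))
  have e : W K α D' [M.x, M.y, M.z] S (b * (M.hex.rot.bv ω q Y S *
      q.el M.hex.p₄ (↑ω⁻¹ : R)) * q.el M.hex.rot.p₁ (ω : R)) =
      W K α D' [M.x, M.y, M.z] S (b * M.hex.rot.bv ω q Y S) := by
    refine (T.tri'.neg_xyz (l := [M.x, M.y, M.z]) (by simp) (by simp) (by simp)).W_congr q T.tri'.cut
      ⟨_, T.tri'.k_mem⟩ (by simp) hS ?_
    intro A _ _ x hx
    have h1 := hx.el_mul_inv M.hex.p₄ ω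
    simp only [map_mul, Hex.rot_p₁]
    linear_combination (aeval x b * aeval x (M.hex.rot.bv ω q Y S)) * h1
  rw [T.mapNeg_W_xy q hω hS hb, map_add, map_neg, T.tri'.neg_dOn_xy q hω hS hb,
    T.tri'.neg_dOn_yz q hω hS h₁, T.tri.neg_dOn_xy q hω hS hb, T.mapNeg_W_xyz hS, e]
  abel

theorem neg_chain_xz (T : M.Setting Y) (q : QuadData K α) (hω : IsTwisting (K := K) α ω)
    (hS : S ⊆ Y.X) (hb : b ∈ supp K Y.O) :
    dOn K R D' [M.x, M.y, M.z].toFinset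
        (M.mapNeg (K := K) (R := R) ω (W K α D [M.x, M.z] S b)) =
      M.mapNeg (K := K) (R := R) ω (dOn K R D [M.x, M.y, M.z].toFinset
        (W K α D [M.x, M.z] S b)) := by
  have hm := T.tri.mem
  have h₁ : b * (M.hex.rot.cv ω q Y S * q.el M.hex.p₄ (↑ω⁻¹ : R)) ∈
      supp K Y.O :=
    mul_mem hb (mul_mem hm.rot.cv (q.el_mem hm.p₄ _))
  have e : W K α D' [M.x, M.y, M.z] S (b * (M.hex.rot.cv ω q Y S *
      q.el M.hex.p₄ (↑ω⁻¹ : R)) * q.el M.hex.rot.p₁ (ω : R)) =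
      W K α D' [M.x, M.y, M.z] S (b * M.hex.rot.cv ω q Y S) := by
    refine (T.tri'.neg_xyz (l := [M.x, M.y, M.z]) (by simp) (by simp) (by simp)).W_congr q T.tri'.cut
      ⟨_, T.tri'.k_mem⟩ (by simp) hS ?_
    intro A _ _ x hx
    have h1 := hx.el_mul_inv M.hex.p₄ ω
    simp only [map_mul, Hex.rot_p₁]
    linear_combination (aeval x b * aeval x (M.hex.rot.cv ω q Y S)) * h1
  rw [T.mapNeg_W_xz q hω hS hb, map_sub, map_neg, T.tri'.neg_dOn_xz q hω hS hb,
    T.tri'.neg_dOn_yz q hω hS h₁, T.tri.neg_dOn_xz q hω hS hb, map_neg, T.mapNeg_W_xyz hS, e]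
  abel

theorem neg_chain_yz (T : M.Setting Y) (q : QuadData K α) (hω : IsTwisting (K := K) α ω)
    (hS : S ⊆ Y.X) (hb : b ∈ supp K Y.O) (r : R) :
    dOn K R D' [M.x, M.y, M.z].toFinset
        (M.mapNeg (K := K) (R := R) ω (W K α D [M.y, M.z] S (b * q.el M.k r))) =
      M.mapNeg (K := K) (R := R) ω (dOn K R D [M.x, M.y, M.z].toFinset
        (W K α D [M.y, M.z] S (b * q.el M.k r))) := by
  have hm := T.tri.mem
  have hC : MvPolynomial.C (Coalgebra.counit (R := K) r) ∈
      supp K Y.O := Subalgebra.algebraMap_mem _ _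
  have h₁ : b * (MvPolynomial.C (Coalgebra.counit (R := K) r) * M.hex.vc ω q Y S) ∈
      supp K Y.O :=
    mul_mem hb (mul_mem hC hm.vc)
  have h₂ : b * (MvPolynomial.C (Coalgebra.counit (R := K) r) * M.hex.vc ω q Y S *
      M.hex.rot.cv ω q Y S * q.el M.hex.p₄ (↑ω⁻¹ : R)) ∈ supp K Y.O :=
    mul_mem hb (mul_mem (Subalgebra.mul_mem _
      (mul_mem hC hm.vc) hm.rot.cv) (q.el_mem hm.p₄ _))
  rw [T.mapNeg_W_yz q hω hS hb, map_add, T.tri'.neg_dOn_xz q hω hS h₁,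
    T.tri'.neg_dOn_yz q hω hS h₂, T.tri.neg_dOn_yz q hω hS hb, T.mapNeg_W_xyz hS, ← map_neg,
    ← map_add, ← map_zero (W K α D' [M.x, M.y, M.z] S)]
  refine (T.tri'.neg_xyz (l := [M.x, M.y, M.z]) (by simp) (by simp) (by simp)).W_congr q T.tri'.cut
    ⟨_, T.tri'.k_mem⟩ (by simp) hS ?_
  intro A _ _ x hx
  have h1 := hx.el_mul_inv M.hex.p₄ ω
  simp only [map_mul, map_add, map_neg, map_zero, Hex.rot_p₁]
  linear_combination (aeval x b *
    aeval x (MvPolynomial.C (Coalgebra.counit (R := K) r)) *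
    aeval x (M.hex.vc ω q Y S) * aeval x (M.hex.rot.cv ω q Y S)) * h1

theorem neg_chain_xyz (T : M.Setting Y) (q : QuadData K α) (hω : IsTwisting (K := K) α ω)
    (hS : S ⊆ Y.X) (hb : b ∈ supp K Y.O) :
    dOn K R D' [M.x, M.y, M.z].toFinset
        (M.mapNeg (K := K) (R := R) ω (W K α D [M.x, M.y, M.z] S b)) =
      M.mapNeg (K := K) (R := R) ω (dOn K R D [M.x, M.y, M.z].toFinset
        (W K α D [M.x, M.y, M.z] S b)) := by
  rw [T.mapNeg_W_xyz hS, map_zero, T.tri.dOn_xyz q hω hS hb, map_zero]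

theorem neg_isMorphism_map (T : M.Setting Y) (q : QuadData K α) (hω : IsTwisting (K := K) α ω) :
    IsMorphism (M.mapNeg (K := K) (R := R) ω) 0 := by
  have hm := T.tri.mem
  have hs := T.tri.neg_surgeries
  have hs' := T.tri'.neg_surgeries
  refine isMorphism_zero_of_tables (q := q) hω T.tri.cut.toFrame T.tri'.cut.toFrame
    (fun w hw => (T.tri'.cut.slot_eq w hw).trans (T.tri.cut.slot_eq w hw).symm) fun l hl => ?_
  have hk : q.el M.k (ω : R) ∈ supp K D'.arcs :=
    q.el_mem T.tri'.k_mem _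
  rcases sublist_three hl with rfl | rfl | rfl | rfl | rfl | rfl | rfl | rfl
  · refine ⟨_, _, (T.tri.neg_nil (l := []) (by simp) (by simp) (by simp)).hasTables
      T.tri.cut hl (T.tri.covered hm.p₂ hm.p₂ hm.p₃)
      (t := [([], fun _ => 1)]) (fun S hS b hb => ?_) ?_, fun S hS b hb r => ?_⟩
    · rw [T.mapNeg_W_nil q hS hb]; simp [tab]
    · simp only [List.forall_mem_cons, List.not_mem_nil, false_imp_iff, implies_true, and_true]
      exact T.neg_nil'.isEntry T.tri'.cut (by simp) (by simp)
        (fun _ _ => by simp) (natural_const _)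
    · rw [mul_one, ← T.neg_chain_nil q hω hS hb, T.mapNeg_W_nil q hS hb]; simp [tab]
  · refine ⟨_, _, (T.tri.neg_x (l := [M.x]) (by simp) (by simp [M.ne_eq]) (by simp [M.ne_eq])).hasTables
      T.tri.cut hl (T.tri.covered hm.p₁ hm.p₅ hm.p₃)
      (t := [([M.y], fun _ => 1), ([M.z], fun _ => 1)]) (fun S hS b hb => ?_) ?_, fun S hS b hb r => ?_⟩
    · rw [T.mapNeg_W_x q hS hb]; simp [tab]
    · simp only [List.forall_mem_cons, List.not_mem_nil, false_imp_iff, implies_true, and_true]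
      exact ⟨(T.tri'.neg_y (l := [M.y]) (by simp [M.ne_eq]) (by simp) (by simp [M.ne_eq])).isEntry T.tri'.cut (by simp) (by simp)
        (fun _ _ => by simp) (natural_const _),
      (T.tri'.neg_z (l := [M.z]) (by simp [M.ne_eq]) (by simp [M.ne_eq]) (by simp)).isEntry T.tri'.cut (by simp) (by simp)
        (fun _ _ => by simp) (natural_const _)⟩
    · rw [mul_one, ← T.neg_chain_x q hω hS hb, T.mapNeg_W_x q hS hb]; simp [tab]
  · refine ⟨_, _, (T.tri.neg_y (l := [M.y]) (by simp [M.ne_eq]) (by simp) (by simp [M.ne_eq])).hasTables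
      T.tri.cut hl (T.tri.covered hm.p₅ hm.p₅ hm.p₅)
      (t := [([M.x], fun _ => 1)]) (fun S hS b hb => ?_) ?_, fun S hS b hb r => ?_⟩
    · rw [T.mapNeg_W_y q hS hb]; simp [tab]
    · simp only [List.forall_mem_cons, List.not_mem_nil, false_imp_iff, implies_true, and_true]
      exact (T.tri'.neg_x (l := [M.x]) (by simp) (by simp [M.ne_eq]) (by simp [M.ne_eq])).isEntry T.tri'.cut (by simp) (by simp)
        (fun _ _ => by simp) (natural_const _)
    · rw [mul_one, ← T.neg_chain_y q hω hS hb, T.mapNeg_W_y q hS hb]; simp [tab]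
  · refine ⟨_, _, (T.tri.neg_z (l := [M.z]) (by simp [M.ne_eq]) (by simp [M.ne_eq]) (by simp)).hasTables
      T.tri.cut hl (T.tri.covered hm.p₂ hm.p₂ hm.p₂)
      (t := []) (fun S hS b hb => ?_) ?_, fun S hS b hb r => ?_⟩
    · rw [T.mapNeg_W_z hS]; simp [tab]
    · simp
    · rw [mul_one, ← T.neg_chain_z q hω hS hb, T.mapNeg_W_z hS]; simp [tab]
  · refine ⟨_, _, (T.tri.neg_xy (l := [M.x, M.y]) (by simp) (by simp) (by simp [M.ne_eq])).hasTables
      T.tri.cut hl (T.tri.covered hm.p₁ hm.p₅ hm.p₁)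
      (t := [([M.x, M.y], fun _ => -1), ([M.y, M.z], fun S => M.hex.rot.bv ω q Y S * q.el M.hex.p₄ (↑ω⁻¹ : R) *
        q.el M.k (ω : R))]) (fun S hS b hb => ?_) ?_, fun S hS b hb r => ?_⟩
    · rw [T.mapNeg_W_xy q hω hS hb]; simp [tab, mul_assoc]
    · simp only [List.forall_mem_cons, List.not_mem_nil, false_imp_iff, implies_true, and_true]
      exact ⟨T.neg_xy'.isEntry T.tri'.cut (by simp) (by simp)
        (fun _ _ => by simp) (natural_const _),
      T.neg_yz'.isEntry T.tri'.cut (by simp) (by simp)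
        (fun S _ => mul_mem (T.tri'.mem_of_mem (mul_mem hm.rot.bv
          (q.el_mem hm.p₄ _))) hk) (((natural_surg (fun S hS => T.neg_rot_bv hS) hs.outB hs'.outV).mul_const _).mul_const _)⟩
    · rw [mul_one, ← T.neg_chain_xy q hω hS hb, T.mapNeg_W_xy q hω hS hb]; simp [tab, mul_assoc]
  · refine ⟨_, _, (T.tri.neg_xz (l := [M.x, M.z]) (by simp) (by simp [M.ne_eq]) (by simp)).hasTables
      T.tri.cut hl (T.tri.covered hm.p₁ hm.p₃ hm.p₃)
      (t := [([M.x, M.z], fun _ => -1), ([M.y, M.z], fun S => -(M.hex.rot.cv ω q Y S * q.el M.hex.p₄ (↑ω⁻¹ : R) *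
        q.el M.k (ω : R)))]) (fun S hS b hb => ?_) ?_, fun S hS b hb r => ?_⟩
    · rw [T.mapNeg_W_xz q hω hS hb]; simp [tab, mul_assoc, sub_eq_add_neg]
    · simp only [List.forall_mem_cons, List.not_mem_nil, false_imp_iff, implies_true, and_true]
      exact ⟨T.neg_xz'.isEntry T.tri'.cut (by simp) (by simp)
        (fun _ _ => by simp) (natural_const _),
      T.neg_yz'.isEntry T.tri'.cut (by simp) (by simp)
        (fun S _ => neg_mem (mul_mem (T.tri'.mem_of_mem
          (mul_mem hm.rot.cv (q.el_mem hm.p₄ _))) hk)) ((((natural_surg (fun S hS => T.neg_rot_cv hS) hs.outC hs'.outV).mul_const _).mul_const _).neg)⟩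
    · rw [mul_one, ← T.neg_chain_xz q hω hS hb, T.mapNeg_W_xz q hω hS hb]; simp [tab, mul_assoc, sub_eq_add_neg]
  · refine ⟨_, _, (T.tri.neg_yz (l := [M.y, M.z]) (by simp [M.ne_eq]) (by simp) (by simp)).hasTables_circle
      T.tri.cut hl T.tri.k_mem T.tri.k_notMem (T.tri.send_k _ _ _) T.tri.covered_circle
      (t := fun r => [([M.x, M.z], fun S => MvPolynomial.C (Coalgebra.counit (R := K) r) *
        M.hex.vc ω q Y S), ([M.y, M.z], fun S => MvPolynomial.C (Coalgebra.counit (R := K) r) *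
        M.hex.vc ω q Y S * M.hex.rot.cv ω q Y S * q.el M.hex.p₄ (↑ω⁻¹ : R) * q.el M.k (ω : R))])
      (fun S hS b hb r => ?_) (fun r => ?_), fun S hS b hb r => ?_⟩
    · rw [T.mapNeg_W_yz q hω hS hb]; simp [tab, mul_assoc]
    · have hC : MvPolynomial.C (Coalgebra.counit (R := K) r) ∈
          supp K Y.O := Subalgebra.algebraMap_mem _ _
      have hn : Natural ω q Y.slot Y.X (Y.rel M.hex.V) (Y.rel M.hex.C) fun S =>
          MvPolynomial.C (Coalgebra.counit (R := K) r) * M.hex.vc ω q Y S :=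
        (natural_const _).mul_surg (fun S hS => hs.vc S hS) hs.outV hs.outC
      simp only [List.forall_mem_cons, List.not_mem_nil, false_imp_iff, implies_true, and_true]
      exact ⟨T.neg_xz'.isEntry T.tri'.cut (by simp) (by simp)
        (fun S _ => T.tri'.mem_of_mem (mul_mem hC hm.vc)) hn,
        T.neg_yz'.isEntry T.tri'.cut (by simp) (by simp)
        (fun S _ => mul_mem (T.tri'.mem_of_mem (Subalgebra.mul_mem _
          (mul_mem (mul_mem hC hm.vc) hm.rot.cv)
          (q.el_mem hm.p₄ _))) hk)
        (((hn.mul_surg (fun S hS => T.neg_rot_cv hS) hs.outC hs'.outV).mul_const _).mul_const _)⟩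
    · rw [← T.neg_chain_yz q hω hS hb, T.mapNeg_W_yz q hω hS hb]; simp [tab, mul_assoc]
  · refine ⟨_, _, (T.tri.neg_xyz (l := [M.x, M.y, M.z]) (by simp) (by simp) (by simp)).hasTables
      T.tri.cut hl (T.tri.covered hm.p₁ hm.p₁ hm.p₁)
      (t := []) (fun S hS b hb => ?_) ?_, fun S hS b hb r => ?_⟩
    · rw [T.mapNeg_W_xyz hS]; simp [tab]
    · simp
    · rw [mul_one, ← T.neg_chain_xyz q hω hS hb, T.mapNeg_W_xyz hS]; simp [tab]

end Setting

end ReidemeisterIII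

namespace ReidemeisterIII

variable {D D' : LinkDiagram} {Y : Outside} {S : Finset ℕ} {K : Type u} {R : Type v} [CommRing K]
  [CommRing R] [Algebra K R] {α : R} {ω : Rˣ} {b : MvPolynomial ℕ K} [Coalgebra K R]

/-- The homotopy for a negative move. -/
def homotopyNeg (ω : Rˣ) (M : ReidemeisterIII false D D') : Kh K R D →ₗ[K] Kh K R D :=
  onStates [M.x, M.y, M.z] fun S₁ S =>
    match decide (M.x ∈ S₁), decide (M.y ∈ S₁), decide (M.z ∈ S₁) with
    | false, true, true => -(wedge D [M.z] S ∘ₗ slide D S₁ D _ M.outer (cap D _ (1 : R)))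
    | true, true, true => -(wedge D [M.y, M.z] S ∘ₗ T D _ M.k (ω : R) ∘ₗ
        T D _ (M.p 1) (↑ω⁻¹ : R) ∘ₗ slide D S₁ D _ M.outer 0)
    | _, _, _ => 0

namespace Setting

variable {M : ReidemeisterIII false D D'}

theorem homotopyNeg_W_yz (T : M.Setting Y) (q : QuadData K α) (hS : S ⊆ Y.X)
    (hb : b ∈ supp K Y.O) (r : R) :
    M.homotopyNeg (K := K) (R := R) ω (W K α D [M.y, M.z] S (b * q.el M.k r)) =
      -W K α D [M.z] S (b * MvPolynomial.C (Coalgebra.counit (R := K) r)) := by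
  have hst := T.tri.neg_yz (l := [M.y, M.z]) (by simp [M.ne_eq]) (by simp) (by simp)
  have hst' := T.tri.neg_z (l := [M.z]) (by simp [M.ne_eq]) (by simp [M.ne_eq]) (by simp)
  rw [homotopyNeg, T.onStates_W (by simp) hS]
  simp only [T.mem_union hS, List.mem_cons, List.not_mem_nil, or_false, or_true, M.ne_eq,
    decide_true, decide_false, LinearMap.neg_apply, LinearMap.comp_apply]
  rw [T.outer, hst.slide_ev_circle q T.tri.cut hst' T.tri.cut (by simp) (by simp) T.tri.k_mem
    T.tri.k_notMem (T.tri.send_k _ _ _) T.tri.covered_circle le_rfl hS rfl rfl hb, cap_eq, mul_one,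
    ← (ev α D _).commutes, ← map_mul, MvPolynomial.algebraMap_eq, wedge_ev]

theorem homotopyNeg_W_xyz (T : M.Setting Y) (q : QuadData K α) (hS : S ⊆ Y.X)
    (hb : b ∈ supp K Y.O) :
    M.homotopyNeg (K := K) (R := R) ω (W K α D [M.x, M.y, M.z] S b) =
      -W K α D [M.y, M.z] S (b * q.el M.hex.p₁ (↑ω⁻¹ : R) * q.el M.k (ω : R)) := by
  have hst := T.tri.neg_xyz (l := [M.x, M.y, M.z]) (by simp) (by simp) (by simp)
  have hst' := T.tri.neg_yz (l := [M.y, M.z]) (by simp [M.ne_eq]) (by simp) (by simp)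
  rw [homotopyNeg, T.onStates_W (by simp) hS]
  simp only [T.mem_union hS, List.mem_cons, true_or, or_true, M.p_eq,
    decide_true, LinearMap.neg_apply, LinearMap.comp_apply]
  rw [T.outer, hst.slide_ev q T.tri.cut hst' T.tri.cut (by simp) (by simp)
    (T.tri.covered T.tri.mem.p₁ T.tri.mem.p₁ T.tri.mem.p₁) le_rfl hS rfl rfl hb,
    T_ev q (T.tri.cut.sub T.tri.mem.p₁), T_ev q T.tri.k_mem, wedge_ev]

theorem homotopyNeg_W_zero (T : M.Setting Y) (hS : S ⊆ Y.X) {l : List ℕ}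
    (hl : l.Sublist [M.x, M.y, M.z]) (h : M.y ∉ l ∨ M.z ∉ l) (b : MvPolynomial ℕ K) :
    M.homotopyNeg (K := K) (R := R) ω (W K α D l S b) = 0 := by
  rw [homotopyNeg, T.onStates_W hl hS]
  simp only [T.mem_union hS]
  split
  · simp_all
  · simp_all
  · rfl

theorem symm_mapNeg_W_nil (T : M.Setting Y) (q : QuadData K α) (hS : S ⊆ Y.X)
    (hb : b ∈ supp K Y.O) :
    M.symm.mapNeg (K := K) (R := R) ω (W K α D' [] S b) =
      W K α D [] S b :=
  T.symm.mapNeg_W_nil q hS hb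

theorem symm_mapNeg_W_x (T : M.Setting Y) (q : QuadData K α) (hS : S ⊆ Y.X)
    (hb : b ∈ supp K Y.O) :
    M.symm.mapNeg (K := K) (R := R) ω (W K α D' [M.x] S b) =
      W K α D [M.y] S b + W K α D [M.z] S b :=
  T.symm.mapNeg_W_x q hS hb

theorem symm_mapNeg_W_y (T : M.Setting Y) (q : QuadData K α) (hS : S ⊆ Y.X)
    (hb : b ∈ supp K Y.O) :
    M.symm.mapNeg (K := K) (R := R) ω (W K α D' [M.y] S b) =
      W K α D [M.x] S b :=
  T.symm.mapNeg_W_y q hS hb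

theorem symm_mapNeg_W_z (T : M.Setting Y) (hS : S ⊆ Y.X)
    (b : MvPolynomial ℕ K) :
    M.symm.mapNeg (K := K) (R := R) ω (W K α D' [M.z] S b) =
      0 :=
  T.symm.mapNeg_W_z hS b

theorem symm_mapNeg_W_xy (T : M.Setting Y) (q : QuadData K α) (hω : IsTwisting (K := K) α ω)
    (hS : S ⊆ Y.X)
    (hb : b ∈ supp K Y.O) :
    M.symm.mapNeg (K := K) (R := R) ω (W K α D' [M.x, M.y] S b) =
      -W K α D [M.x, M.y] S b + W K α D [M.y, M.z] S
        (b * (M.hex.bv ω q Y S * q.el M.hex.p₁ (↑ω⁻¹ : R)) * q.el M.k (ω : R)) :=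
  T.symm.mapNeg_W_xy q hω hS hb

theorem symm_mapNeg_W_xz (T : M.Setting Y) (q : QuadData K α) (hω : IsTwisting (K := K) α ω)
    (hS : S ⊆ Y.X)
    (hb : b ∈ supp K Y.O) :
    M.symm.mapNeg (K := K) (R := R) ω (W K α D' [M.x, M.z] S b) =
      -W K α D [M.x, M.z] S b - W K α D [M.y, M.z] S
        (b * (M.hex.cv ω q Y S * q.el M.hex.p₁ (↑ω⁻¹ : R)) * q.el M.k (ω : R)) :=
  T.symm.mapNeg_W_xz q hω hS hb

theorem symm_mapNeg_W_yz (T : M.Setting Y) (q : QuadData K α) (hω : IsTwisting (K := K) α ω)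
    (hS : S ⊆ Y.X)
    (hb : b ∈ supp K Y.O) :
    M.symm.mapNeg (K := K) (R := R) ω (W K α D' [M.y, M.z] S (b * q.el M.k (ω : R))) =
      0 :=
  T.symm.mapNeg_W_yz_omega q hω hS hb

theorem neg_homotopy_nil (T : M.Setting Y) (q : QuadData K α) (hω : IsTwisting (K := K) α ω)
    (hS : S ⊆ Y.X) (hb : b ∈ supp K Y.O) :
    M.symm.mapNeg (K := K) (R := R) ω (M.mapNeg (K := K) (R := R) ω (W K α D [] S b)) -
        W K α D [] S b =
      M.homotopyNeg (K := K) (R := R) ω (dOn K R D [M.x, M.y, M.z].toFinset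
        (W K α D [] S b)) := by
  have hm := T.tri.mem
  rw [T.mapNeg_W_nil q hS hb, T.symm_mapNeg_W_nil q hS hb, T.tri.neg_dOn_nil q hω hS hb, map_add,
    map_add, T.homotopyNeg_W_zero hS (by simp) (by simp [M.ne_eq]),
    T.homotopyNeg_W_zero hS (by simp) (by simp [M.ne_eq]),
    T.homotopyNeg_W_zero hS (by simp) (by simp [M.ne_eq])]
  abel

theorem neg_homotopy_x (T : M.Setting Y) (q : QuadData K α) (hω : IsTwisting (K := K) α ω)
    (hS : S ⊆ Y.X) (hb : b ∈ supp K Y.O) :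
    M.symm.mapNeg (K := K) (R := R) ω (M.mapNeg (K := K) (R := R) ω (W K α D [M.x] S b)) -
        W K α D [M.x] S b =
      M.homotopyNeg (K := K) (R := R) ω (dOn K R D [M.x, M.y, M.z].toFinset
        (W K α D [M.x] S b)) := by
  have hm := T.tri.mem
  rw [T.mapNeg_W_x q hS hb, map_add, T.symm_mapNeg_W_y q hS hb, T.symm_mapNeg_W_z hS,
    T.tri.neg_dOn_x q hω hS hb, map_sub, map_neg,
    T.homotopyNeg_W_zero hS (by simp) (by simp [M.ne_eq]),
    T.homotopyNeg_W_zero hS (by simp) (by simp [M.ne_eq])]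
  abel

theorem neg_homotopy_y (T : M.Setting Y) (q : QuadData K α) (hω : IsTwisting (K := K) α ω)
    (hS : S ⊆ Y.X) (hb : b ∈ supp K Y.O) :
    M.symm.mapNeg (K := K) (R := R) ω (M.mapNeg (K := K) (R := R) ω (W K α D [M.y] S b)) -
        W K α D [M.y] S b =
      M.homotopyNeg (K := K) (R := R) ω (dOn K R D [M.x, M.y, M.z].toFinset
        (W K α D [M.y] S b)) := by
  have hm := T.tri.mem
  have h₁ : b * (MvPolynomial.X M.hex.p₅ - MvPolynomial.C q.s) ∈
      supp K Y.O :=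
    mul_mem hb (sub_mem (QuadData.X_mem hm.p₅)
      (Subalgebra.algebraMap_mem _ _))
  rw [T.mapNeg_W_y q hS hb, T.symm_mapNeg_W_x q hS hb, T.tri.neg_dOn_y q hω hS hb, map_sub,
    map_add, T.homotopyNeg_W_zero hS (by simp) (by simp [M.ne_eq]),
    T.homotopyNeg_W_yz q hS h₁, T.homotopyNeg_W_yz q hS hb, hω.counit_omega, hω.counit_omega_mul,
    map_one, map_zero, mul_zero, map_zero, mul_one]
  abel

theorem neg_homotopy_z (T : M.Setting Y) (q : QuadData K α) (hω : IsTwisting (K := K) α ω)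
    (hS : S ⊆ Y.X) (hb : b ∈ supp K Y.O) :
    M.symm.mapNeg (K := K) (R := R) ω (M.mapNeg (K := K) (R := R) ω (W K α D [M.z] S b)) -
        W K α D [M.z] S b =
      M.homotopyNeg (K := K) (R := R) ω (dOn K R D [M.x, M.y, M.z].toFinset
        (W K α D [M.z] S b)) := by
  have hm := T.tri.mem
  have h₁ : b * (MvPolynomial.X M.hex.p₂ - MvPolynomial.C q.s) ∈
      supp K Y.O :=
    mul_mem hb (sub_mem (QuadData.X_mem hm.p₂)
      (Subalgebra.algebraMap_mem _ _))
  rw [T.mapNeg_W_z hS, map_zero, T.tri.neg_dOn_z q hω hS hb, map_add,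
    map_add, T.homotopyNeg_W_zero hS (by simp) (by simp [M.ne_eq]),
    T.homotopyNeg_W_yz q hS h₁, T.homotopyNeg_W_yz q hS hb, hω.counit_omega, hω.counit_omega_mul,
    map_one, map_zero, mul_zero, map_zero, mul_one]
  abel

theorem neg_homotopy_xy (T : M.Setting Y) (q : QuadData K α) (hω : IsTwisting (K := K) α ω)
    (hS : S ⊆ Y.X) (hb : b ∈ supp K Y.O) :
    M.symm.mapNeg (K := K) (R := R) ω (M.mapNeg (K := K) (R := R) ω (W K α D [M.x, M.y] S b)) -
        W K α D [M.x, M.y] S b =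
      M.homotopyNeg (K := K) (R := R) ω (dOn K R D [M.x, M.y, M.z].toFinset
        (W K α D [M.x, M.y] S b)) := by
  have hm := T.tri.mem
  have h₁ : b * (M.hex.rot.bv ω q Y S * q.el M.hex.p₄ (↑ω⁻¹ : R)) ∈
      supp K Y.O :=
    mul_mem hb (mul_mem hm.rot.bv (q.el_mem hm.p₄ _))
  rw [T.mapNeg_W_xy q hω hS hb, map_add, map_neg, T.symm_mapNeg_W_xy q hω hS hb,
    T.symm_mapNeg_W_yz q hω hS h₁, T.tri.neg_dOn_xy q hω hS hb,
    T.homotopyNeg_W_xyz q hS (mul_mem hb hm.bv), mul_assoc b (M.hex.bv ω q Y S)]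
  abel

theorem neg_homotopy_xz (T : M.Setting Y) (q : QuadData K α) (hω : IsTwisting (K := K) α ω)
    (hS : S ⊆ Y.X) (hb : b ∈ supp K Y.O) :
    M.symm.mapNeg (K := K) (R := R) ω (M.mapNeg (K := K) (R := R) ω (W K α D [M.x, M.z] S b)) -
        W K α D [M.x, M.z] S b =
      M.homotopyNeg (K := K) (R := R) ω (dOn K R D [M.x, M.y, M.z].toFinset
        (W K α D [M.x, M.z] S b)) := by
  have hm := T.tri.mem
  have h₁ : b * (M.hex.rot.cv ω q Y S * q.el M.hex.p₄ (↑ω⁻¹ : R)) ∈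
      supp K Y.O :=
    mul_mem hb (mul_mem hm.rot.cv (q.el_mem hm.p₄ _))
  rw [T.mapNeg_W_xz q hω hS hb, map_sub, map_neg, T.symm_mapNeg_W_xz q hω hS hb,
    T.symm_mapNeg_W_yz q hω hS h₁, T.tri.neg_dOn_xz q hω hS hb, map_neg,
    T.homotopyNeg_W_xyz q hS (mul_mem hb hm.cv), mul_assoc b (M.hex.cv ω q Y S)]
  abel

theorem neg_homotopy_yz (T : M.Setting Y) (q : QuadData K α) (hω : IsTwisting (K := K) α ω)
    (hS : S ⊆ Y.X) (hb : b ∈ supp K Y.O) (r : R) :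
    M.symm.mapNeg (K := K) (R := R) ω (M.mapNeg (K := K) (R := R) ω (W K α D [M.y, M.z] S (b * q.el M.k r))) -
        W K α D [M.y, M.z] S (b * q.el M.k r) =
      -dOn K R D [M.x, M.y, M.z].toFinset (W K α D [M.z] S
        (b * MvPolynomial.C (Coalgebra.counit (R := K) r))) +
      M.homotopyNeg (K := K) (R := R) ω (dOn K R D [M.x, M.y, M.z].toFinset
        (W K α D [M.y, M.z] S (b * q.el M.k r))) := by
  have hm := T.tri.mem
  have hC : MvPolynomial.C (Coalgebra.counit (R := K) r) ∈
      supp K Y.O := Subalgebra.algebraMap_mem _ _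
  have h₁ : b * (MvPolynomial.C (Coalgebra.counit (R := K) r) * M.hex.vc ω q Y S) ∈
      supp K Y.O :=
    mul_mem hb (mul_mem hC hm.vc)
  have h₂ : b * (MvPolynomial.C (Coalgebra.counit (R := K) r) * M.hex.vc ω q Y S *
      M.hex.rot.cv ω q Y S * q.el M.hex.p₄ (↑ω⁻¹ : R)) ∈ supp K Y.O :=
    mul_mem hb (mul_mem (Subalgebra.mul_mem _
      (mul_mem hC hm.vc) hm.rot.cv) (q.el_mem hm.p₄ _))
  rw [T.mapNeg_W_yz q hω hS hb, map_add, T.symm_mapNeg_W_xz q hω hS h₁,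
    T.symm_mapNeg_W_yz q hω hS h₂, T.tri.neg_dOn_z q hω hS (mul_mem hb hC),
    T.tri.neg_dOn_yz q hω hS hb,
    T.homotopyNeg_W_xyz q hS (mul_mem hb (q.el_mem hm.p₁ r)),
    mul_assoc b (MvPolynomial.C _) (M.hex.vc ω q Y S)]
  have e : W K α D [M.y, M.z] S (b * (MvPolynomial.C (Coalgebra.counit (R := K) r) *
        M.hex.vc ω q Y S) * (M.hex.cv ω q Y S * q.el M.hex.p₁ (↑ω⁻¹ : R)) * q.el M.k (ω : R)) +
        W K α D [M.y, M.z] S (b * q.el M.k r) =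
      W K α D [M.y, M.z] S (b * MvPolynomial.C (Coalgebra.counit (R := K) r) *
        (MvPolynomial.X M.hex.p₂ - MvPolynomial.C q.s) * q.el M.k (ω : R)) +
      W K α D [M.y, M.z] S (b * MvPolynomial.C (Coalgebra.counit (R := K) r) *
        q.el M.k ((ω : R) * α)) +
      W K α D [M.y, M.z] S (b * q.el M.hex.p₁ r * q.el M.hex.p₁ (↑ω⁻¹ : R) *
        q.el M.k (ω : R)) := by
    obtain ⟨t, rfl⟩ : ∃ t, r = t * (ω : R) := ⟨r * (↑ω⁻¹ : R), by simp⟩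
    rw [q.counit_mul_omega hω, ← map_add (W K α D [M.y, M.z] S), ← map_add (W K α D [M.y, M.z] S),
      ← map_add (W K α D [M.y, M.z] S)]
    refine (T.tri.neg_yz (l := [M.y, M.z]) (by simp [M.ne_eq]) (by simp) (by simp)).W_congr q T.tri.cut
      ⟨_, T.tri.k_mem⟩ (by simp) hS ?_
    intro A _ _ x hx
    have h1 := T.tri.neg_surgeries.vc_mul_cv (ω := ω) hS hx
    have h2 := hx.el_mul_inv M.hex.p₁ ω
    simp only [map_mul, map_add, map_sub, hx.aeval_el_mul, q.el_gen, MvPolynomial.aeval_X,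
      MvPolynomial.algHom_C]
    rw [QuadData.aeval_el x M.k t, QuadData.aeval_el x M.hex.p₁ t]
    set B := aeval x b
    set c := algebraMap K A (q.φ₁ t)
    set wk := aeval x (q.el M.k (ω : R))
    set e := aeval x (q.el M.hex.p₁ (↑ω⁻¹ : R))
    linear_combination (B * c * e * wk) * h1 + (B * wk * (c * (x M.hex.p₁ + x M.hex.p₂ -
      algebraMap K A q.s) - (algebraMap K A (q.φ₀ t) + c * x M.hex.p₁))) * h2
  linear_combination (norm := abel) -e

theorem neg_homotopy_xyz (T : M.Setting Y) (q : QuadData K α) (hω : IsTwisting (K := K) α ω)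
    (hS : S ⊆ Y.X) (hb : b ∈ supp K Y.O) :
    M.symm.mapNeg (K := K) (R := R) ω (M.mapNeg (K := K) (R := R) ω (W K α D [M.x, M.y, M.z] S b)) -
        W K α D [M.x, M.y, M.z] S b =
      -dOn K R D [M.x, M.y, M.z].toFinset (W K α D [M.y, M.z] S
        (b * q.el M.hex.p₁ (↑ω⁻¹ : R) * q.el M.k (ω : R))) +
      M.homotopyNeg (K := K) (R := R) ω (dOn K R D [M.x, M.y, M.z].toFinset
        (W K α D [M.x, M.y, M.z] S b)) := by
  have hm := T.tri.mem
  have h₁ : b * q.el M.hex.p₁ (↑ω⁻¹ : R) ∈ supp K Y.O :=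
    mul_mem hb (q.el_mem hm.p₁ _)
  rw [T.mapNeg_W_xyz hS, map_zero, T.tri.dOn_xyz q hω hS hb, map_zero,
    T.tri.neg_dOn_yz q hω hS h₁, zero_sub, add_zero]
  congr 1
  refine (T.tri.neg_xyz (l := [M.x, M.y, M.z]) (by simp) (by simp) (by simp)).W_congr q T.tri.cut
    ⟨_, T.tri.k_mem⟩ (by simp) hS ?_
  intro A _ _ x hx
  have h2 := hx.el_mul_inv M.hex.p₁ ω
  simp only [map_mul]
  linear_combination (-aeval x b) * h2

theorem neg_homotopic (T : M.Setting Y) (q : QuadData K α) (hω : IsTwisting (K := K) α ω) :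
    Homotopic (M.symm.mapNeg ω ∘ₗ M.mapNeg ω) (LinearMap.id : Kh K R D →ₗ[K] _) := by
  have hm := T.tri.mem
  refine homotopic_of_tables (q := q) (O := Y.O) hω T.tri.cut.toFrame
    (H := M.homotopyNeg (K := K) (R := R) ω) fun l hl => ?_
  simp only [LinearMap.comp_apply, LinearMap.id_apply]
  rcases sublist_three hl with rfl | rfl | rfl | rfl | rfl | rfl | rfl | rfl
  · refine ⟨_, _, (T.tri.neg_nil (l := []) (by simp) (by simp) (by simp)).hasTables
      T.tri.cut hl (T.tri.covered hm.p₂ hm.p₂ hm.p₃) (t := [])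
      (fun S hS b hb => by
        rw [T.homotopyNeg_W_zero hS hl (by simp)]; rfl) (by simp),
      fun S hS b hb r => ?_⟩
    rw [mul_one, T.neg_homotopy_nil q hω hS hb]
    simp [tab]
  · refine ⟨_, _, (T.tri.neg_x (l := [M.x]) (by simp) (by simp [M.ne_eq]) (by simp [M.ne_eq])).hasTables
      T.tri.cut hl (T.tri.covered hm.p₁ hm.p₅ hm.p₃) (t := [])
      (fun S hS b hb => by
        rw [T.homotopyNeg_W_zero hS hl (by simp [M.ne_eq])]; rfl) (by simp),
      fun S hS b hb r => ?_⟩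
    rw [mul_one, T.neg_homotopy_x q hω hS hb]
    simp [tab]
  · refine ⟨_, _, (T.tri.neg_y (l := [M.y]) (by simp [M.ne_eq]) (by simp) (by simp [M.ne_eq])).hasTables
      T.tri.cut hl (T.tri.covered hm.p₅ hm.p₅ hm.p₅) (t := [])
      (fun S hS b hb => by
        rw [T.homotopyNeg_W_zero hS hl (by simp [M.ne_eq])]; rfl) (by simp),
      fun S hS b hb r => ?_⟩
    rw [mul_one, T.neg_homotopy_y q hω hS hb]
    simp [tab]
  · refine ⟨_, _, (T.tri.neg_z (l := [M.z]) (by simp [M.ne_eq]) (by simp [M.ne_eq]) (by simp)).hasTables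
      T.tri.cut hl (T.tri.covered hm.p₂ hm.p₂ hm.p₂) (t := [])
      (fun S hS b hb => by
        rw [T.homotopyNeg_W_zero hS hl (by simp [M.ne_eq])]; rfl) (by simp),
      fun S hS b hb r => ?_⟩
    rw [mul_one, T.neg_homotopy_z q hω hS hb]
    simp [tab]
  · refine ⟨_, _, (T.tri.neg_xy (l := [M.x, M.y]) (by simp) (by simp) (by simp [M.ne_eq])).hasTables
      T.tri.cut hl (T.tri.covered hm.p₁ hm.p₅ hm.p₁) (t := [])
      (fun S hS b hb => by
        rw [T.homotopyNeg_W_zero hS hl (by simp [M.ne_eq])]; rfl) (by simp),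
      fun S hS b hb r => ?_⟩
    rw [mul_one, T.neg_homotopy_xy q hω hS hb]
    simp [tab]
  · refine ⟨_, _, (T.tri.neg_xz (l := [M.x, M.z]) (by simp) (by simp [M.ne_eq]) (by simp)).hasTables
      T.tri.cut hl (T.tri.covered hm.p₁ hm.p₃ hm.p₃) (t := [])
      (fun S hS b hb => by
        rw [T.homotopyNeg_W_zero hS hl (by simp [M.ne_eq])]; rfl) (by simp),
      fun S hS b hb r => ?_⟩
    rw [mul_one, T.neg_homotopy_xz q hω hS hb]
    simp [tab]
  · refine ⟨_, _, (T.tri.neg_yz (l := [M.y, M.z]) (by simp [M.ne_eq]) (by simp) (by simp)).hasTables_circle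
      T.tri.cut hl T.tri.k_mem T.tri.k_notMem (T.tri.send_k _ _ _) T.tri.covered_circle
      (t := fun r => [([M.z], fun _ => -MvPolynomial.C (Coalgebra.counit (R := K) r))])
      (fun S hS b hb r => by rw [T.homotopyNeg_W_yz q hS hb]; simp [tab]) fun r => ?_,
      fun S hS b hb r => ?_⟩
    · simp only [List.mem_singleton]
      rintro _ rfl
      exact (T.tri.neg_z (l := [M.z]) (by simp [M.ne_eq]) (by simp [M.ne_eq]) (by simp)).isEntry T.tri.cut (by simp) (by simp)
        (fun _ _ => neg_mem (Subalgebra.algebraMap_mem _ _)) (natural_const _)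
    · rw [T.neg_homotopy_yz q hω hS hb]; simp [tab]
  · refine ⟨_, _, (T.tri.neg_xyz (l := [M.x, M.y, M.z]) (by simp) (by simp) (by simp)).hasTables
      T.tri.cut hl (T.tri.covered hm.p₁ hm.p₁ hm.p₁)
      (t := [([M.y, M.z], fun _ => -(q.el M.hex.p₁ (↑ω⁻¹ : R) * q.el M.k (ω : R)))])
      (fun S hS b hb => by rw [T.homotopyNeg_W_xyz q hS hb]; simp [tab, mul_assoc]) ?_,
      fun S hS b hb r => ?_⟩
    · simp only [List.mem_singleton]
      rintro _ rfl
      exact (T.tri.neg_yz (l := [M.y, M.z]) (by simp [M.ne_eq]) (by simp) (by simp)).isEntry T.tri.cut (by simp) (by simp)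
        (fun _ _ => neg_mem (Subalgebra.mul_mem _
          (T.tri.mem_of_mem (q.el_mem hm.p₁ _)) (q.el_mem T.tri.k_mem _))) (natural_const _)
    · rw [mul_one, T.neg_homotopy_xyz q hω hS hb]; simp [tab, mul_assoc]

end Setting

end ReidemeisterIII

section

theorem ReidemeisterIII.symm_symm {positive : Bool} {D D' : LinkDiagram}
    (M : ReidemeisterIII positive D D') : M.symm.symm = M := by
  have h : (fun i : ZMod 6 => M.p (i + 3 + 3)) = M.p := by
    funext i
    rw [add_assoc, show (3 + 3 : ZMod 6) = 0 by decide, add_zero]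
  cases M
  simpa [ReidemeisterIII.symm] using h

variable {K : Type u} {R : Type v} [CommRing K] [CommRing R] [Algebra K R] [Coalgebra K R] {α : R}
  {ω : Rˣ} {D D' : LinkDiagram}

theorem ElementaryMove.isMorphism_map (q : QuadData K α) (hω : IsTwisting (K := K) α ω)
    (f : ElementaryMove D D') : IsMorphism (f.map (K := K) α ω) f.degree := by
  cases f with
  | reidemeister f =>
    cases f with
    | createI positive M =>
      cases positive
      · exact M.neg_isMorphism_map q hω
      · exact M.pos_isMorphism_map q hω
    | removeI positive M =>
      cases positive
      · exact M.neg_isMorphism_inverseMap q hω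
      · exact M.pos_isMorphism_inverseMap q hω
    | createII M => exact M.isMorphism_map (q := q) hω
    | removeII M => exact M.isMorphism_inverseMap (q := q) hω
    | moveIII positive M =>
      cases positive
      · exact M.setting.neg_isMorphism_map q hω
      · exact M.setting.pos_isMorphism_map q hω
  | surgery0 M => exact M.isMorphism_map q hω
  | surgery1 M => exact M.isMorphism_map q hω
  | surgery2 M => exact M.isMorphism_inverseMap q hω

theorem ReidemeisterMove.homotopic_inverse (q : QuadData K α) (hω : IsTwisting (K := K) α ω)
    (f : ReidemeisterMove D D') :
    Homotopic (f.inverse.map (K := K) α ω ∘ₗ f.map α ω) LinearMap.id := by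
  cases f with
  | createI positive M =>
    cases positive
    · exact homotopic_of_eq (M.neg_inverse_comp (ω := ω) q)
    · exact homotopic_of_eq (M.pos_inverse_comp q hω)
  | removeI positive M =>
    cases positive
    · exact M.neg_homotopic q hω
    · exact M.pos_homotopic q hω
  | createII M => exact homotopic_of_eq (M.inverse_comp (q := q) hω)
  | removeII M => exact M.homotopic (q := q) hω
  | moveIII positive M =>
    cases positive
    · exact M.setting.neg_homotopic q hω
    · exact M.setting.pos_homotopic q hω

theorem ReidemeisterMove.inverse_inverse (f : ReidemeisterMove D D') : f.inverse.inverse = f := by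
  cases f with
  | moveIII positive M => rw [inverse, inverse, M.symm_symm]
  | _ => rfl

end

end Khovanov

end

theorem mainTheorem7 {K R : Type*} [CommRing K] [CommRing R] [Algebra K R] [Coalgebra K R]
    [IsFrobenius K R] (α : R) (hα : IsGenerator K α) :
    -- the modules `kh(D)` are complexes
    (∀ D : LinkDiagram, HasDegree (Kh.d (K := K) (R := R) D) (-1) ∧
      Kh.d (K := K) (R := R) D ∘ₗ Kh.d D = 0) ∧
    -- each elementary move `f` induces a morphism of complexes `f⁰`
    (∀ (D D' : LinkDiagram) (f : ElementaryMove D D'),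
      IsMorphism (f.map (K := K) α (twist hα)) f.degree) ∧
    -- if `f` is a Reidemeister move with inverse `g`, then `g⁰` is a homotopy inverse of `f⁰`
    (∀ (D D' : LinkDiagram) (f : ReidemeisterMove D D'),
      Homotopic (f.inverse.map (K := K) α (twist hα) ∘ₗ f.map α (twist hα)) LinearMap.id ∧
      Homotopic (f.map (K := K) α (twist hα) ∘ₗ f.inverse.map α (twist hα)) LinearMap.id) := by
  obtain ⟨q⟩ := hα.nonempty_quadData
  have hω : IsTwisting (K := K) α (twist hα) := (existsUnique_isTwisting hα).choose_spec.1
  refine ⟨fun D => ⟨hasDegree_d q hω D, d_comp_d q hω D⟩,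
    fun D D' f => f.isMorphism_map q hω, fun D D' f => ⟨f.homotopic_inverse q hω, ?_⟩⟩
  have h := f.inverse.homotopic_inverse (K := K) q hω
  rwa [f.inverse_inverse] at h
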